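/- Let $r,n$ be positive integers with $r\mid n$, and let $s\in\mathbb{Z}$ with $\gcd(s,r)=1$. Let $\mu_r$ be the group of complex $r$th roots of unity and, for $m\ge 1$, let $W(r,m)=\mu_r^m\rtimes S_m$ be the wreath product, with its standard representation on $\mathbb{C}^m$ (permutation matrices and diagonal matrices with entries in $\mu_r$). Write $\varepsilon_m$ for the sign character of $S_m$, extended to $W(r,m)$ by $\varepsilon_m(\zeta w)=\varepsilon_m(w)$, and $\mathrm{det}_m(\zeta w)=\varepsilon_m(w)\zeta_1\cdots\zeta_m$. Embed $W(r,n/r)$ in $S_n$ by identifying $\{1,\dots,n\}$ with $\mu_r\times\{1,\dots,n/r\}$, on which $\zeta w$ acts by $(\eta,i)\mapsto(\zeta_{w(i)}\eta,w(i))$; this is the centralizer of a product of $n/r$ disjoint $r$-cycles, and any identification may be used. Let $T(r,m)=\{z\in\mathbb{C}^m : z_i\ne 0\ \forall i,\ z_i^r\ne z_j^r\ \forall i\ne j\}$, on whose differential forms $g\in W(r,m)$ acts by pull-back along $g^{-1}$. Put $\omega_i=\frac{dz_i}{z_i}$ and $\omega_{i,j,\eta}=\frac{dz_i-\eta\,dz_j}{z_i-\eta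 z_j}$ for $i\ne j$, $\eta\in\mu_r$. A decorated directed forest $F$ on $\{1,\dots,m\}$ is an acyclic directed graph in which each vertex has out-degree at most $1$, with edges labelled by elements of $\mu_r$ and with each root (vertex of out-degree $0$) declared open or closed. Put $\alpha(F)=\alpha_1(F)\wedge\cdots\wedge\alpha_m(F)$, where $\alpha_i(F)$ is $(-1)^{i-1-|\{\text{open roots}<i\}|}$ if $i$ is an open root, $\omega_i$ if $i$ is a closed root, and $\omega_{i,j,\eta}$ if there is an edge from $i$ to $j$ with label $\eta$. For integers $p,q$ let $A^p(T(r,m))_q$ be the span of all $\alpha(F)$ where $F$ has $p$ edges and closed roots in total, at least $q$ of them closed roots; this is $W(r,m)$-stable. For integers $k,l$ let $$A^{k,l}(T(r,m))=A^{k+l}(T(r,m))_l\,/\,A^{k+l}(T(r,m))_{l+1},$$ a representation of $W(r,m)$ which is zero if $k<0$ or $l<0$. Finally, for a representation $V$ of $W(r,n)$ let $V_{(s/r)}=\{v\in V : \zeta v=\zeta_1^{-s}\cdots\zeta_n^{-s}v\ \ \forall\zeta\in\mu_r^n\}$, a representation of $S_n$. Then, for all integers $k,l$, there is an isomorphism of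 representations of $S_n$ $$\varepsilon_n\otimes A^{k,l}(T(r,n))_{(s/r)}\;\cong\;\mathrm{Ind}_{W(r,n/r)}^{S_n}\bigl(\mathrm{det}_{n/r}\otimes A^{k-n+n/r,\,l}(T(r,n/r))\bigr).$$ -/

import Mathlib

noncomputable section

namespace WreathOS

/-! ### The wreath product `W(r,n) = μ_r ≀ S_n` and its characters -/

/-- The group `μ_r` of complex `r`-th roots of unity. -/
abbrev Mu (r : ℕ) : Type := rootsOfUnity r ℂ

/-- The wreath product `W(r,n) = μ_r^n ⋊ S_n`, where `S_n` permutes the factors. The element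
`⟨ζ, w⟩` is the product `ζ w`; multiplication is
`(ζ w)(ζ' w') = (i ↦ ζ_i ζ'_{w⁻¹ i}) (w w')`. -/
abbrev W (r n : ℕ) : Type :=
  SemidirectProduct (Fin n → Mu r) (Equiv.Perm (Fin n)) mulAutArrow

theorem aut_apply {r n : ℕ} (w : Equiv.Perm (Fin n)) (ζ : Fin n → Mu r) (i : Fin n) :
    mulAutArrow w ζ i = ζ (w⁻¹ i) := rfl

/-- The sign character of `S_n`, with complex values. -/
def signChar (n : ℕ) : Equiv.Perm (Fin n) →* ℂ :=
  ((Int.castRingHom ℂ : ℤ →* ℂ).comp (Units.coeHom ℤ)).comp Equiv.Perm.sign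

/-- The character `det_n(ζ w) = ε_n(w) ζ_1 ⋯ ζ_n` of `W(r,n)`, the determinant of its standard
representation. -/
def detChar (r n : ℕ) : W r n →* ℂ where
  toFun g := signChar n g.right * ∏ i, ((g.left i : ℂˣ) : ℂ)
  map_one' := by simp
  map_mul' g h := by
    have : ∏ i, (((h.left (g.right⁻¹ i) : Mu r) : ℂˣ) : ℂ) = ∏ i, ((h.left i : ℂˣ) : ℂ) :=
      Equiv.prod_comp g.right⁻¹ (fun i => (((h.left i : Mu r) : ℂˣ) : ℂ))
    simp only [SemidirectProduct.mul_right, SemidirectProduct.mul_left, map_mul, Pi.mul_apply,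
      aut_apply, Subgroup.coe_mul, Units.val_mul, Finset.prod_mul_distrib]
    rw [this]
    ring

/-- The one-dimensional representation on `ℂ` given by a character. -/
def charRep {G : Type*} [Group G] (χ : G →* ℂ) : Representation ℂ G ℂ :=
  (Algebra.lmul ℂ ℂ : ℂ →* Module.End ℂ ℂ).comp χ

/-- The action of `W(r,m)` on `μ_r × {1,…,m}`: `(ζ w)(η, i) = (ζ_{w i} η, w i)`. -/
def wreathPerm (r m : ℕ) : W r m →* Equiv.Perm (Mu r × Fin m) where
  toFun g :=
    { toFun := fun x => (g.left (g.right x.2) * x.1, g.right x.2)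
      invFun := fun x => ((g.left x.2)⁻¹ * x.1, g.right⁻¹ x.2)
      left_inv := fun x => by simp
      right_inv := fun x => by simp }
  map_one' := by ext x <;> simp
  map_mul' g h := by
    ext x <;> simp [-mulAutArrow_apply_apply, aut_apply, mul_assoc]

/-- The embedding of `W(r,m)` in `S_n`, `n = r m`, determined by an identification `e` of
`μ_r × {1,…,m}` with `{1,…,n}`. A generator `ζ₀` of the `i`-th factor `μ_r` goes to the `r`-cycle
`e(1,i) ↦ e(ζ₀,i) ↦ e(ζ₀²,i) ↦ ⋯`, and the image is the centralizer of the product of these `m`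
disjoint `r`-cycles. Another choice of `e` changes the embedding by an inner automorphism of
`S_n`. -/
def wreathEmb {r m n : ℕ} (e : Mu r × Fin m ≃ Fin n) : W r m →* Equiv.Perm (Fin n) :=
  (e.permCongrHom : Equiv.Perm (Mu r × Fin m) →* Equiv.Perm (Fin n)).comp (wreathPerm r m)

/-! ### Differential forms on `T(r,n)` -/

/-- The standard representation of `W(r,n)` on `ℂ^n`: `(ζ w) z = (i ↦ ζ_i z_{w⁻¹ i})`. -/
def stdRep (r n : ℕ) : Representation ℂ (W r n) (Fin n → ℂ) where
  toFun g :=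
    { toFun := fun z i => ((g.left i : ℂˣ) : ℂ) * z (g.right⁻¹ i)
      map_add' := fun x y => by ext i; simp [mul_add]
      map_smul' := fun c x => by ext i; simp; ring }
  map_one' := by ext; simp
  map_mul' g h := by
    refine LinearMap.ext fun z => funext fun i => ?_
    simp [-mulAutArrow_apply_apply, aut_apply, mul_assoc]

/-- `T(r,n)`, the set of `z ∈ ℂ^n` with `z_i ≠ 0` for all `i` and `z_i^r ≠ z_j^r` for all
`i ≠ j`. -/
def T (r n : ℕ) : Set (Fin n → ℂ) :=
  {z | (∀ i, z i ≠ 0) ∧ ∀ i j, i ≠ j → z i ^ r ≠ z j ^ r}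

theorem root_pow (r : ℕ) (ζ : Mu r) : ((ζ : ℂˣ) : ℂ) ^ r = 1 := by
  have h := congrArg Units.val ((mem_rootsOfUnity r (ζ : ℂˣ)).1 ζ.2)
  simpa using h

theorem stdRep_mem_T {r n : ℕ} (g : W r n) {z : Fin n → ℂ} (hz : z ∈ T r n) :
    stdRep r n g z ∈ T r n := by
  refine ⟨fun i => mul_ne_zero (Units.ne_zero _) (hz.1 _), fun i j hij => ?_⟩
  have := hz.2 (g.right⁻¹ i) (g.right⁻¹ j) (by simpa using hij)
  simpa [stdRep, mul_pow, root_pow] using this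

/-- The exterior algebra on the dual space of `ℂ^n`. -/
abbrev Ext (n : ℕ) : Type := ExteriorAlgebra ℂ (Module.Dual ℂ (Fin n → ℂ))

/-- The algebra of (not necessarily regular) complex differential forms on `T(r,n)`: functions on
`T(r,n)` with values in the exterior algebra on the dual of `ℂ^n`, with the pointwise wedge product.
It contains the algebra of regular differential forms. -/
abbrev Form (r n : ℕ) : Type := T r n → Ext n

/-- The action of `g ∈ W(r,n)` on differential forms, by pull-back along `g⁻¹`. -/
def formAct (r n : ℕ) (g : W r n) : Form r n →ₐ[ℂ] Form r n where
  toFun α z := ExteriorAlgebra.map ((stdRep r n).dual g)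
    (α ⟨stdRep r n g⁻¹ z, stdRep_mem_T g⁻¹ z.2⟩)
  map_one' := by ext; simp
  map_mul' α β := by ext; simp
  map_zero' := by ext; simp
  map_add' α β := by ext; simp
  commutes' c := by ext; simp [Pi.algebraMap_apply]

/-- The representation of `W(r,n)` on differential forms on `T(r,n)`. -/
def formRep (r n : ℕ) : Representation ℂ (W r n) (Form r n) where
  toFun g := (formAct r n g).toLinearMap
  map_one' := by
    refine LinearMap.ext fun α => funext fun z => ?_
    have h : (stdRep r n).dual 1 = LinearMap.id := by rw [map_one]; rfl
    simp only [formAct, AlgHom.toLinearMap_apply, AlgHom.coe_mk, RingHom.coe_mk, MonoidHom.coe_mk,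
      OneHom.coe_mk, h, ExteriorAlgebra.map_id, inv_one, map_one, Module.End.one_apply]
    rfl
  map_mul' g h := by
    refine LinearMap.ext fun α => funext fun z => ?_
    simp only [formAct, AlgHom.toLinearMap_apply, AlgHom.coe_mk, RingHom.coe_mk, MonoidHom.coe_mk,
      OneHom.coe_mk, Module.End.mul_apply, map_mul, mul_inv_rev]
    rw [Module.End.mul_eq_comp, ← ExteriorAlgebra.map_comp_map]
    rfl

/-- The coordinate covector `dz_i`. -/
def dz {n : ℕ} (i : Fin n) : Module.Dual ℂ (Fin n → ℂ) := LinearMap.proj i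

/-- The 1-form `ω_i = dz_i / z_i`. -/
def omega (r : ℕ) {n : ℕ} (i : Fin n) : Form r n := fun z =>
  (z.1 i)⁻¹ • ExteriorAlgebra.ι ℂ (dz i)

/-- The 1-form `ω_{i,j,η} = (dz_i - η dz_j) / (z_i - η z_j)`. -/
def omegaEdge {r n : ℕ} (i j : Fin n) (η : Mu r) : Form r n := fun z =>
  (z.1 i - ((η : ℂˣ) : ℂ) * z.1 j)⁻¹ •
    ExteriorAlgebra.ι ℂ (dz i - ((η : ℂˣ) : ℂ) • dz j)

/-! ### Decorated directed forests -/

/-- What a vertex of a decorated directed forest can be: an open root, a closed root, or the source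
of exactly one edge, which ends at `j` and is labelled by `η`. -/
inductive Vertex (r n : ℕ) : Type
  | openRoot : Vertex r n
  | closedRoot : Vertex r n
  | edge (j : Fin n) (η : Mu r) : Vertex r n

/-- Is the vertex an open root? -/
def Vertex.isOpen {r n : ℕ} : Vertex r n → Bool
  | openRoot => true
  | closedRoot => false
  | edge _ _ => false

/-- Is the vertex a closed root? -/
def Vertex.isClosed {r n : ℕ} : Vertex r n → Bool
  | openRoot => false
  | closedRoot => true
  | edge _ _ => false

/-- Is the vertex the source of an edge? -/
def Vertex.isEdge {r n : ℕ} : Vertex r n → Bool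
  | openRoot => false
  | closedRoot => false
  | edge _ _ => true

/-- A decorated directed forest on `{1,…,n}`: every vertex has out-degree at most one, and there are
no loops or cycles; edges are labelled by `μ_r`, and each root (vertex of out-degree zero) is open
or closed. -/
structure Forest (r n : ℕ) where
  /-- The type of each vertex, with the edge that leaves it. -/
  vertex : Fin n → Vertex r n
  /-- There are no directed cycles; as out-degrees are at most one, there are no undirected cycles
  either. -/
  acyclic : ∀ i, ¬ Relation.TransGen (fun a b => ∃ η, vertex a = .edge b η) i i

namespace Forest

variable {r n : ℕ}

/-- The number of edges of a forest. -/
def numEdges (F : Forest r n) : ℕ := (Finset.univ.filter fun i => (F.vertex i).isEdge).card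

/-- The number of closed roots of a forest. -/
def numClosed (F : Forest r n) : ℕ := (Finset.univ.filter fun i => (F.vertex i).isClosed).card

/-- The sign `ε_i(F) = (-1)^(i - 1 - |{open roots < i}|)` for `i ∈ {1,…,n}`; here vertices are
numbered from `0`, so that `i - 1` is the number of vertices before the given one. -/
def eps (F : Forest r n) (i : Fin n) : ℂ :=
  (-1) ^ ((i : ℕ) - (Finset.univ.filter fun j => (F.vertex j).isOpen ∧ j < i).card)

/-- The factor `α_i(F)`: the sign `ε_i(F)` if `i` is an open root, `ω_i` if it is a closed root, and
`ω_{i,j,η}` if there is an edge from `i` to `j` labelled by `η`. -/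
def alphaFactor (F : Forest r n) (i : Fin n) : Form r n :=
  match F.vertex i with
  | .openRoot => algebraMap ℂ (Form r n) (F.eps i)
  | .closedRoot => omega r i
  | .edge j η => omegaEdge i j η

/-- The form `α(F) = α_1(F) ∧ α_2(F) ∧ ⋯ ∧ α_n(F)`. -/
def alpha (F : Forest r n) : Form r n := (List.ofFn F.alphaFactor).prod

end Forest

/-! ### The filtration and its graded pieces -/

/-- `A^p(T(r,n))_m`, the span of the forms `α(F)` with `F` a forest with `k` edges and `l` closed
roots, over all `k + l = p`, `l ≥ m`. It is zero for `p < 0`. -/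
def filt (r n : ℕ) (p m : ℤ) : Submodule ℂ (Form r n) :=
  Submodule.span ℂ (Forest.alpha ''
    {F | (F.numEdges : ℤ) + F.numClosed = p ∧ m ≤ F.numClosed})

/-- Equality up to sign. -/
def SignEq {A : Type*} [Ring A] (a b : A) : Prop := a = b ∨ a = -b

theorem SignEq.mul {A : Type*} [Ring A] {a b c d : A} (h : SignEq a b) (h' : SignEq c d) :
    SignEq (a * c) (b * d) := by
  rcases h with rfl | rfl <;> rcases h' with rfl | rfl <;> simp [SignEq]

theorem SignEq.trans {A : Type*} [Ring A] {a b c : A} (h : SignEq a b) (h' : SignEq b c) :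
    SignEq a c := by
  rcases h with rfl | rfl <;> rcases h' with rfl | rfl <;> simp [SignEq]

theorem signEq_prod {A : Type*} [Ring A] {l l' : List A} (h : List.Forall₂ SignEq l l') :
    SignEq l.prod l'.prod := by
  induction h with
  | nil => exact Or.inl rfl
  | cons h _ ih => simpa using h.mul ih

theorem signEq_prod_perm {A : Type*} [Ring A] {l l' : List A} (h : l.Perm l')
    (hl : ∀ a ∈ l, ∀ b ∈ l, SignEq (a * b) (b * a)) : SignEq l.prod l'.prod := by
  induction h with
  | nil => exact Or.inl rfl
  | cons x _ ih =>
    have := ih fun a ha b hb => hl a (List.mem_cons_of_mem _ ha) b (List.mem_cons_of_mem _ hb)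
    simpa using SignEq.mul (Or.inl rfl) this
  | swap x y l =>
    have := SignEq.mul (hl y (by simp) x (by simp)) (Or.inl rfl : SignEq l.prod l.prod)
    simpa [mul_assoc] using this
  | trans h₁ _ ih₁ ih₂ =>
    exact (ih₁ hl).trans (ih₂ fun a ha b hb => hl a (h₁.mem_iff.2 ha) b (h₁.mem_iff.2 hb))

theorem eps_signEq {r n : ℕ} (F : Forest r n) (i : Fin n) :
    SignEq (algebraMap ℂ (Form r n) (F.eps i)) 1 := by
  rcases neg_one_pow_eq_or ℂ
    ((i : ℕ) - (Finset.univ.filter fun j => (F.vertex j).isOpen ∧ j < i).card) with h | h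
  · left; rw [Forest.eps, h, map_one]
  · right; rw [Forest.eps, h, map_neg, map_one]

theorem alphaFactor_cases {r n : ℕ} (F : Forest r n) (i : Fin n) :
    SignEq (F.alphaFactor i) 1 ∨ ∀ z, ∃ v, F.alphaFactor i z = ExteriorAlgebra.ι ℂ v := by
  unfold Forest.alphaFactor
  cases F.vertex i with
  | openRoot => exact Or.inl (eps_signEq F i)
  | closedRoot => exact Or.inr fun z => ⟨_, (map_smul _ _ _).symm⟩
  | edge j η => exact Or.inr fun z => ⟨_, (map_smul _ _ _).symm⟩

theorem alphaFactor_comm {r n : ℕ} (F : Forest r n) (i j : Fin n) :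
    SignEq (F.alphaFactor i * F.alphaFactor j) (F.alphaFactor j * F.alphaFactor i) := by
  rcases alphaFactor_cases F i with (h | h) | h
  · rw [h]; left; simp
  · rw [h]; left; simp
  rcases alphaFactor_cases F j with (h' | h') | h'
  · rw [h']; left; simp
  · rw [h']; left; simp
  right
  funext z
  obtain ⟨v, hv⟩ := h z
  obtain ⟨u, hu⟩ := h' z
  simp only [Pi.mul_apply, Pi.neg_apply, hv, hu]
  exact eq_neg_of_add_eq_zero_left (ExteriorAlgebra.ι_add_mul_swap v u)

/-- The action of `ζ w` on the type of a vertex: an edge to `j` labelled by `η`, starting at `i`,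
becomes an edge from `w i` to `w j` labelled by `η ζ_{w i} ζ_{w j}⁻¹`. -/
def Vertex.act {r n : ℕ} (g : W r n) (i : Fin n) : Vertex r n → Vertex r n
  | openRoot => openRoot
  | closedRoot => closedRoot
  | edge j η => edge (g.right j) (η * g.left (g.right i) * (g.left (g.right j))⁻¹)

/-- The action of `W(r,n)` on forests. -/
def Forest.act {r n : ℕ} (g : W r n) (F : Forest r n) : Forest r n where
  vertex i := (F.vertex (g.right⁻¹ i)).act g (g.right⁻¹ i)
  acyclic i hi := by
    refine F.acyclic (g.right⁻¹ i) (Relation.TransGen.lift (fun a => g.right⁻¹ a) ?_ _ _ hi)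
    rintro a b ⟨η, h⟩
    change ∃ θ, F.vertex (g.right⁻¹ a) = .edge (g.right⁻¹ b) θ
    cases hv : F.vertex (g.right⁻¹ a) with
    | openRoot => rw [hv] at h; simp [Vertex.act] at h
    | closedRoot => rw [hv] at h; simp [Vertex.act] at h
    | edge j θ =>
      rw [hv] at h
      simp only [Vertex.act, Vertex.edge.injEq] at h
      exact ⟨θ, by rw [← h.1]; simp⟩

theorem Forest.act_vertex {r n : ℕ} (g : W r n) (F : Forest r n) (i : Fin n) :
    (F.act g).vertex (g.right i) = (F.vertex i).act g i := by
  simp [Forest.act]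

theorem Forest.act_numEdges {r n : ℕ} (g : W r n) (F : Forest r n) :
    (F.act g).numEdges = F.numEdges := by
  refine (Finset.card_equiv g.right fun i => ?_).symm
  simp only [Finset.mem_filter, Finset.mem_univ, true_and, Forest.act_vertex]
  cases F.vertex i <;> rfl

theorem Forest.act_numClosed {r n : ℕ} (g : W r n) (F : Forest r n) :
    (F.act g).numClosed = F.numClosed := by
  refine (Finset.card_equiv g.right fun i => ?_).symm
  simp only [Finset.mem_filter, Finset.mem_univ, true_and, Forest.act_vertex]
  cases F.vertex i <;> rfl

theorem stdRep_inv_apply {r n : ℕ} (g : W r n) (z : Fin n → ℂ) (i : Fin n) :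
    stdRep r n g⁻¹ z i = (((g.left (g.right i) : ℂˣ) : ℂ))⁻¹ * z (g.right i) := by
  change (((mulAutArrow g.right⁻¹ g.left⁻¹ i : Mu r) : ℂˣ) : ℂ) * z (g.right⁻¹⁻¹ i) = _
  rw [aut_apply]
  simp

theorem dual_dz {r n : ℕ} (g : W r n) (i : Fin n) :
    (stdRep r n).dual g (dz i) = (((g.left (g.right i) : ℂˣ) : ℂ))⁻¹ • dz (g.right i) :=
  LinearMap.ext fun z => stdRep_inv_apply g z i

theorem formAct_alphaFactor {r n : ℕ} (g : W r n) (F : Forest r n) (i : Fin n) :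
    SignEq (formAct r n g (F.alphaFactor i)) ((F.act g).alphaFactor (g.right i)) := by
  have hv := Forest.act_vertex g F i
  cases h : F.vertex i with
  | openRoot =>
    rw [h] at hv
    have h1 : F.alphaFactor i = algebraMap ℂ (Form r n) (F.eps i) := by
      simp only [Forest.alphaFactor, h]
    have h2 : (F.act g).alphaFactor (g.right i)
        = algebraMap ℂ (Form r n) ((F.act g).eps (g.right i)) := by
      simp only [Forest.alphaFactor, hv, Vertex.act]
    rw [h1, h2, AlgHom.commutes]
    have h3 := eps_signEq (F.act g) (g.right i)
    refine (eps_signEq F i).trans ?_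
    rcases h3 with h3 | h3 <;> rw [h3] <;> simp [SignEq]
  | closedRoot =>
    rw [h] at hv
    have h1 : F.alphaFactor i = omega r i := by simp only [Forest.alphaFactor, h]
    have h2 : (F.act g).alphaFactor (g.right i) = omega r (g.right i) := by
      simp only [Forest.alphaFactor, hv, Vertex.act]
    rw [h1, h2]
    left
    funext z
    simp only [formAct, omega, AlgHom.coe_mk, RingHom.coe_mk, MonoidHom.coe_mk, OneHom.coe_mk,
      map_smul, ExteriorAlgebra.map_apply_ι, dual_dz, stdRep_inv_apply, smul_smul]
    congr 1
    field_simp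
  | edge j η =>
    rw [h] at hv
    have h1 : F.alphaFactor i = omegaEdge i j η := by simp only [Forest.alphaFactor, h]
    have h2 : (F.act g).alphaFactor (g.right i) = omegaEdge (g.right i) (g.right j)
        (η * g.left (g.right i) * (g.left (g.right j))⁻¹) := by
      simp only [Forest.alphaFactor, hv, Vertex.act]
    rw [h1, h2]
    left
    funext z
    simp only [formAct, omegaEdge, AlgHom.coe_mk, RingHom.coe_mk, MonoidHom.coe_mk, OneHom.coe_mk,
      map_smul, ExteriorAlgebra.map_apply_ι, map_sub, dual_dz, stdRep_inv_apply, smul_smul,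
      Subgroup.coe_mul, Units.val_mul, Subgroup.coe_inv, Units.val_inv_eq_inv_val]
    generalize hx : ((g.left (g.right i) : ℂˣ) : ℂ) = x
    generalize hy : ((g.left (g.right j) : ℂˣ) : ℂ) = y
    have hx0 : x ≠ 0 := hx ▸ Units.ne_zero _
    have e1 : x⁻¹ * z.1 (g.right i) - ((η : ℂˣ) : ℂ) * (y⁻¹ * z.1 (g.right j))
        = x⁻¹ * (z.1 (g.right i) - ((η : ℂˣ) : ℂ) * x * y⁻¹ * z.1 (g.right j)) := by
      field_simp
    rw [e1, mul_inv, inv_inv, mul_comm x, mul_smul, smul_sub x, smul_smul, smul_smul,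
      mul_inv_cancel₀ hx0, one_smul]
    rw [show x * (((η : ℂˣ) : ℂ) * y⁻¹) = ((η : ℂˣ) : ℂ) * x * y⁻¹ by ring]

theorem formRep_alpha {r n : ℕ} (g : W r n) (F : Forest r n) :
    SignEq (formRep r n g F.alpha) (F.act g).alpha := by
  have h1 : formRep r n g F.alpha
      = (List.ofFn fun i => formAct r n g (F.alphaFactor i)).prod := by
    change formAct r n g (List.ofFn F.alphaFactor).prod = _
    rw [map_list_prod, List.map_ofFn]
    rfl
  have h2 : SignEq (List.ofFn fun i => formAct r n g (F.alphaFactor i)).prod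
      (List.ofFn fun i => (F.act g).alphaFactor (g.right i)).prod := by
    refine signEq_prod (List.forall₂_iff_get.2 ⟨by simp, fun i _ _ => ?_⟩)
    simpa using formAct_alphaFactor g F _
  rw [h1]
  refine h2.trans (signEq_prod_perm (Equiv.Perm.ofFn_comp_perm g.right (F.act g).alphaFactor) ?_)
  intro a ha b hb
  obtain ⟨i, rfl⟩ := List.mem_ofFn.1 ha
  obtain ⟨j, rfl⟩ := List.mem_ofFn.1 hb
  exact alphaFactor_comm _ _ _

theorem filt_stable {r n : ℕ} (p m : ℤ) (g : W r n) :
    filt r n p m ≤ (filt r n p m).comap (formRep r n g) := by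
  rw [filt, Submodule.span_le]
  rintro _ ⟨F, hF, rfl⟩
  have hmem : (F.act g).alpha ∈ filt r n p m := Submodule.subset_span
    ⟨F.act g, by simpa [Forest.act_numEdges, Forest.act_numClosed] using hF, rfl⟩
  change formRep r n g F.alpha ∈ filt r n p m
  rcases formRep_alpha g F with h | h <;> rw [h]
  · exact hmem
  · exact neg_mem hmem

/-- The representation of `W(r,n)` on `A^p(T(r,n))_m`. -/
def filtRep (r n : ℕ) (p m : ℤ) : Representation ℂ (W r n) (filt r n p m) :=
  (formRep r n).subrepresentation (filt r n p m) (filt_stable p m)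

/-- `A^{k,l}(T(r,n)) = A^{k+l}(T(r,n))_l / A^{k+l}(T(r,n))_{l+1}`. It is zero if `k < 0` or
`l < 0`. -/
abbrev Gr (r n : ℕ) (k l : ℤ) : Type :=
  filt r n (k + l) l ⧸ (filt r n (k + l) (l + 1)).submoduleOf (filt r n (k + l) l)

/-- The representation of `W(r,n)` on `A^{k,l}(T(r,n))`. -/
def grRep (r n : ℕ) (k l : ℤ) : Representation ℂ (W r n) (Gr r n k l) :=
  (filtRep r n (k + l) l).quotient _ fun g _ hx => filt_stable (k + l) (l + 1) g hx

/-! ### Isotypic components for `μ_r^n` -/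

/-- For a representation `V` of `W(r,n)` and an integer `s`, the subspace `V_{(s/r)}` of all `v`
with `ζ v = ζ_1^{-s} ⋯ ζ_n^{-s} v` for all `ζ ∈ μ_r^n`. -/
def isotypic {r n : ℕ} {V : Type*} [AddCommGroup V] [Module ℂ V]
    (ρ : Representation ℂ (W r n) V) (s : ℤ) : Submodule ℂ V where
  carrier := {v | ∀ ζ : Fin n → Mu r,
    ρ (SemidirectProduct.inl ζ) v = (∏ i, ((ζ i : ℂˣ) : ℂ) ^ (-s)) • v}
  add_mem' ha hb ζ := by rw [map_add, ha ζ, hb ζ, smul_add]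
  zero_mem' ζ := by simp
  smul_mem' c v hv ζ := by rw [map_smul, hv ζ, smul_comm]

theorem isotypic_stable {r n : ℕ} {V : Type*} [AddCommGroup V] [Module ℂ V]
    (ρ : Representation ℂ (W r n) V) (s : ℤ) (w : Equiv.Perm (Fin n)) :
    isotypic ρ s ≤ (isotypic ρ s).comap (ρ.comp SemidirectProduct.inr w) := by
  intro v hv ζ
  have h1 : (SemidirectProduct.inl ζ : W r n) * SemidirectProduct.inr w
      = SemidirectProduct.inr w * SemidirectProduct.inl (mulAutArrow w⁻¹ ζ) := by
    ext i
    · simp [-mulAutArrow_apply_apply]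
    · simp
  change ρ (SemidirectProduct.inl ζ) (ρ (SemidirectProduct.inr w) v)
    = _ • ρ (SemidirectProduct.inr w) v
  rw [← Module.End.mul_apply, ← map_mul, h1, map_mul, Module.End.mul_apply, hv, map_smul]
  congr 1
  exact Equiv.prod_comp (w⁻¹)⁻¹ fun i => (((ζ i : Mu r) : ℂˣ) : ℂ) ^ (-s)

/-- The representation of `S_n` on `V_{(s/r)}`. -/
def isotypicRep {r n : ℕ} {V : Type*} [AddCommGroup V] [Module ℂ V]
    (ρ : Representation ℂ (W r n) V) (s : ℤ) :
    Representation ℂ (Equiv.Perm (Fin n)) (isotypic ρ s) :=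
  Representation.subrepresentation (ρ.comp SemidirectProduct.inr) (isotypic ρ s)
    (isotypic_stable ρ s)

end WreathOS

end

noncomputable section

namespace WreathOS

/-! ### Products along paths in a commutative algebra -/

section Path

variable {X Z : Type*} [CommRing Z] (link : X → X → Z)

/-! Multiply every form by the product θ_1 ⋯ θ_n of auxiliary odd variables. This costs the sign
character (`bigAct_thetaTop`) and loses nothing (`thetaMul_injective`). An edge then becomes an even
element ω_{c,a} θ_a, and the Arnold relation becomes the identity `forkRel_link`, by which trees of
edges turn into combinations of paths with the same start. Modulo forms with more closed roots,
A^{k,l} is therefore spanned by products over a = n - k - l open and l closed blocks, a block being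
a word in labelled points of μ_r × {1,…,n} (`thetaMul_mem_span_blockProd`). In each block the word
may moreover be symmetrized over its rotations with a faithful character of the cyclic group
(`path_mem_span_cutSum`). This is the analogue of Klyachko's theorem that the multilinear part of
the free Lie algebra is induced from a faithful character of a long cycle.

So, up to the sign character, A^{k,l} is a quotient of a space `blockFun` of functions on
arrangements of the labelled points into blocks. These functions are equivariant under rotations,
insensitive to labels, alternating in the open blocks and symmetric in the closed ones. The quotient
map is an isomorphism by a count over all a and l at once. Increasing forests give independent forms
(`linearIndependent_incProd`), there are ∏ (2 + r k) of them over 0 ≤ k < n, and the dimensions of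
the function spaces add up to at most this number (`sum_coeff_logSeries_le`). The outcome is
`exists_gr_equiv`.

Apply this to both sides, with m = n / r. On the left, a common label acts trivially on a block, so
gcd(s, r) = 1 forces all block sizes to be multiples of r. Restriction to trivial labels then leaves
functions on arrangements of n points into blocks of r b points, equivariant for a faithful
character of a cyclic group of order r b (`nonempty_isotypic_equiv`). On the right, induction from
W(r,m) replaces arrangements of labelled points by arrangements of n points, in blocks of shape μ_r
× ℤ/b. The sign in det cancels the sign in `exists_gr_equiv`, and the factor ζ_1 ⋯ ζ_m adds the
character ξ ↦ ξ^{-b} on labels (`nonempty_ind_det_equiv`). The number of open blocks is the same on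
both sides.

It remains to compare, for one block of r b points, the groups ℤ/rb and μ_r × ℤ/b. Both act simply
transitively, and both characters are nontrivial on the p-torsion for every prime p dividing r b.
The trace of the corresponding idempotent on a representation of the symmetric group depends only on
r b: permutations of the same order in free actions are conjugate, and the sum of the character over
the elements of a given order is determined (`sum_orderOf_eq`). Hence the idempotents are equivalent
in the group algebra (`exists_rotIdem_equiv`), and applying the equivalence in every block gives the
isomorphism (`nonempty_equiv_of_rotIdem`). -/

/-- The product of the links along the path that starts at `c` and visits the given list. -/
def path : X → List X → Z
  | _, [] => 1
  | c, a :: w => link c a * path a w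

@[simp] theorem path_nil (c : X) : path link c [] = 1 := rfl

@[simp] theorem path_cons (c a : X) (w : List X) :
    path link c (a :: w) = link c a * path link a w := rfl

theorem path_append (c a : X) (A B : List X) :
    path link c (A ++ a :: B) = path link c (A ++ [a]) * path link a B := by
  induction A generalizing c with
  | nil => simp
  | cons x A ih => simp [ih, mul_assoc]

/-- Two links with the same start can be replaced by a path, in two ways. -/
def ForkRel (d : X → X → Prop) : Prop :=
  ∀ c a b, d c a → d c b → d a b →
    link c a * link c b = link c a * link a b + link c b * link b a

variable {link} {d : X → X → Prop}

/-- The fork relation is applied to the two first links only. Iterated, it would expand the product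
of two paths into the sum over all shuffles. -/
theorem path_mul_path (h : ForkRel link d) {c a b : X} (hca : d c a) (hcb : d c b) (hab : d a b)
    (A B : List X) :
    path link c (a :: A) * path link c (b :: B) =
      link c a * (path link a A * path link a (b :: B)) +
        link c b * (path link b (a :: A) * path link b B) := by
  simp only [path_cons]
  linear_combination (path link a A * path link b B) * h c a b hca hcb hab

variable [Algebra ℂ Z]

/-- The fork relation either puts `i` before the next letter or pushes the link to `i` one step down
the path, so in the end `i` is inserted at every place after the start. -/
theorem path_mul_link_start (h : ForkRel link d) (c i : X)
    (w : List X) (hw : (c :: w).Pairwise d) (hi : ∀ x ∈ c :: w, d x i) :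
    path link c w * link c i ∈
      Submodule.span ℂ {z | ∃ w', w'.Perm (i :: w) ∧ z = path link c w'} := by
  induction w generalizing c with
  | nil => exact Submodule.subset_span ⟨[i], List.Perm.refl _, by simp⟩
  | cons a w ih =>
    have hca : d c a := (List.pairwise_cons.1 hw).1 a (by simp)
    have e : path link c (a :: w) * link c i =
        link c a * (path link a w * link a i) + path link c (i :: a :: w) := by
      simp only [path_cons]
      linear_combination path link a w * h c a i hca (hi c (by simp)) (hi a (by simp))
    rw [e]
    refine add_mem ?_ (Submodule.subset_span ⟨_, List.Perm.refl _, rfl⟩)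
    have := Submodule.mem_map_of_mem (f := LinearMap.mulLeft ℂ (link c a))
      (ih a (List.pairwise_cons.1 hw).2 fun x hx => hi x (List.mem_cons_of_mem _ hx))
    rw [Submodule.map_span] at this
    refine Submodule.span_mono ?_ this
    rintro _ ⟨_, ⟨w', hw', rfl⟩, rfl⟩
    exact ⟨a :: w', (hw'.cons a).trans (List.Perm.swap _ _ _), rfl⟩

/-- The part of the path before `j` is a common factor, so `j` may be taken as the start. Attaching
vertices one at a time in this way turns any tree into paths with the same start. -/
theorem path_mul_link (h : ForkRel link d) (c i j : X)
    (w : List X) (hw : (c :: w).Pairwise d) (hi : ∀ x ∈ c :: w, d x i) (hj : j ∈ c :: w) :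
    path link c w * link j i ∈
      Submodule.span ℂ {z | ∃ w', w'.Perm (i :: w) ∧ z = path link c w'} := by
  induction w generalizing c with
  | nil =>
    obtain rfl : j = c := by simpa using hj
    exact path_mul_link_start h j i _ hw hi
  | cons a w ih =>
    rcases List.mem_cons.1 hj with rfl | hj
    · exact path_mul_link_start h j i _ hw hi
    have := Submodule.mem_map_of_mem (f := LinearMap.mulLeft ℂ (link c a))
      (ih a (List.pairwise_cons.1 hw).2 (fun x hx => hi x (List.mem_cons_of_mem _ hx)) hj)
    rw [Submodule.map_span] at this
    rw [path_cons, mul_assoc]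
    refine Submodule.span_mono ?_ this
    rintro _ ⟨_, ⟨w', hw', rfl⟩, rfl⟩
    exact ⟨a :: w', (hw'.cons a).trans (List.Perm.swap _ _ _), rfl⟩

variable (link) in
/-- The sum over all ways to cut a word `w = B A` of `(-q)^|A|` times the product of the path from
`c` along `B` and the path from `c` along the reversed word `A`. -/
def cutSum (q : ℂ) (c : X) (w : List X) : Z :=
  ∑ k ∈ Finset.range (w.length + 1),
    (-q) ^ (w.length - k) • (path link c (w.drop k).reverse * path link c (w.take k))

variable (link) in
/-- The part of `cutSum` whose first link leads to the first letter. -/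
def cutSumHead (q : ℂ) (c : X) : List X → Z
  | [] => 0
  | a :: w => link c a * cutSum link q a w

@[simp] theorem cutSum_nil (q : ℂ) (c : X) : cutSum link q c [] = 1 := by
  simp [cutSum]

/-- In a cut with both parts nonempty, one path begins with the first letter and the reversed one
with the last letter `a`. The fork relation sorts these terms by which of the two links comes first.
If it is the link to `a`, the part `A` loses a letter, which accounts for the factor `-q`. -/
theorem cutSum_snoc (h : ForkRel link d) (q : ℂ) (c a : X) (t : List X)
    (hw : (c :: (t ++ [a])).Pairwise d) (hs : ∀ x y, d x y → d y x) :
    cutSum link q c (t ++ [a]) =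
      cutSumHead link q c (t ++ [a]) - q • cutSumHead link q c (a :: t) := by
  cases t with
  | nil => simp [cutSum, cutSumHead, Finset.sum_range_succ]; ring
  | cons b t =>
    have hcb : d c b := (List.pairwise_cons.1 hw).1 b (by simp)
    have hca : d c a := (List.pairwise_cons.1 hw).1 a (by simp)
    have hba : d b a := (List.pairwise_cons.1 (List.pairwise_cons.1 hw).2).1 a (by simp)
    -- The two cuts with an empty part are single paths and are split off; the remaining ones are
    -- indexed by the number of letters of `t` in the first part.
    have e1 : cutSum link q c (b :: t ++ [a]) =
        path link c (b :: t ++ [a]) + (-q) ^ (t.length + 2) • path link c (b :: t ++ [a]).reverse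
        + ∑ k ∈ Finset.range (t.length + 1), (-q) ^ (t.length + 1 - k) •
          (path link c (a :: (t.drop k).reverse) * path link c (b :: t.take k)) := by
      have hl : (b :: t ++ [a]).length + 1 = (t.length + 1) + 1 + 1 := by simp
      rw [cutSum, hl, Finset.sum_range_succ, Finset.sum_range_succ']
      have h1 : ∀ k ∈ Finset.range (t.length + 1),
          (-q) ^ ((b :: t ++ [a]).length - (k + 1)) •
            (path link c ((b :: t ++ [a]).drop (k + 1)).reverse *
              path link c ((b :: t ++ [a]).take (k + 1))) =
          (-q) ^ (t.length + 1 - k) •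
          (path link c (a :: (t.drop k).reverse) * path link c (b :: t.take k)) := by
        intro k hk
        have hk' : k ≤ t.length := by simpa [Nat.lt_succ_iff] using hk
        have hd : (b :: t ++ [a]).drop (k + 1) = t.drop k ++ [a] := by
          simp [List.drop_append_of_le_length hk']
        have ht : (b :: t ++ [a]).take (k + 1) = b :: t.take k := by
          simp [List.take_append_of_le_length hk']
        rw [hd, ht, List.reverse_append]
        congr 2
        simp
      rw [Finset.sum_congr rfl h1]
      have h2 : (b :: t ++ [a]).length = t.length + 1 + 1 := by simp
      have h3 : (b :: t ++ [a]).drop (t.length + 1 + 1) = [] := by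
        apply List.drop_of_length_le; simp
      have h4 : (b :: t ++ [a]).take (t.length + 1 + 1) = b :: t ++ [a] := by
        apply List.take_of_length_le; simp
      rw [h2, h3, h4]
      simp
      ring
    have e2 : cutSumHead link q c (b :: t ++ [a]) = path link c (b :: t ++ [a]) +
        ∑ k ∈ Finset.range (t.length + 1), (-q) ^ (t.length + 1 - k) •
          (link c b * (path link b (a :: (t.drop k).reverse) * path link b (t.take k))) := by
      change link c b * cutSum link q b (t ++ [a]) = _
      have hl : (t ++ [a]).length + 1 = (t.length + 1) + 1 := by simp
      rw [cutSum, hl, Finset.sum_range_succ, mul_add, Finset.mul_sum, add_comm]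
      have h3 : (t ++ [a]).drop (t.length + 1) = [] := by
        apply List.drop_of_length_le; simp
      have h4 : (t ++ [a]).take (t.length + 1) = t ++ [a] := by
        apply List.take_of_length_le; simp
      rw [h3, h4]
      congr 1
      · simp
      · refine Finset.sum_congr rfl fun k hk => ?_
        have hk' : k ≤ t.length := by simpa [Nat.lt_succ_iff] using hk
        rw [List.drop_append_of_le_length hk', List.take_append_of_le_length hk',
          List.reverse_append, mul_smul_comm]
        simp
    have e3 : -q • cutSumHead link q c (a :: b :: t) =
        (-q) ^ (t.length + 2) • path link c (b :: t ++ [a]).reverse +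
        ∑ k ∈ Finset.range (t.length + 1), (-q) ^ (t.length + 1 - k) •
          (link c a * (path link a (t.drop k).reverse * path link a (b :: t.take k))) := by
      change -q • (link c a * cutSum link q a (b :: t)) = _
      have hl : (b :: t).length + 1 = (t.length + 1) + 1 := by simp
      rw [cutSum, hl, Finset.sum_range_succ', mul_add, Finset.mul_sum, add_comm, smul_add,
        Finset.smul_sum]
      congr 1
      · simp [pow_succ, smul_smul]; ring_nf
      · refine Finset.sum_congr rfl fun k hk => ?_
        have hk' : k ≤ t.length := by simpa [Nat.lt_succ_iff] using hk
        rw [mul_smul_comm, smul_smul]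
        have : t.length + 1 - k = (b :: t).length - (k + 1) + 1 := by simp; omega
        rw [this, pow_succ]
        simp [mul_comm]
    have e4 : ∀ k, path link c (a :: (t.drop k).reverse) * path link c (b :: t.take k) =
        link c a * (path link a (t.drop k).reverse * path link a (b :: t.take k)) +
        link c b * (path link b (a :: (t.drop k).reverse) * path link b (t.take k)) :=
      fun k => path_mul_path h hca hcb (hs _ _ hba) _ _
    rw [sub_eq_add_neg, ← neg_smul]
    change _ = _ + -q • cutSumHead link q c (a :: b :: t)
    rw [e1, e2, e3]
    simp only [e4, smul_add, Finset.sum_add_distrib]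
    ring

/-- By `cutSum_snoc`, the cut sum of a rotated word is the difference of its own head and `q` times
the head of the previous rotation. The sum over one full turn, weighted by powers of `q`, telescopes
to `1 - q ^ w.length` times the head of `w`, and this factor is invertible. -/
theorem cutSumHead_mem (h : ForkRel link d) (hs : ∀ x y, d x y → d y x) (q : ℂ) (c : X)
    (w : List X) (hw : (c :: w).Pairwise d) (hw0 : w ≠ []) (hq : q ^ w.length ≠ 1) :
    cutSumHead link q c w ∈
      Submodule.span ℂ {z | ∃ w', w'.Perm w ∧ z = cutSum link q c w'} := by
  have hstep : ∀ j, cutSum link q c (w.rotate (j + 1)) =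
      cutSumHead link q c (w.rotate (j + 1)) - q • cutSumHead link q c (w.rotate j) := by
    intro j
    have hne : w.rotate j ≠ [] := by simpa using hw0
    obtain ⟨a, t, hat⟩ := List.exists_cons_of_ne_nil hne
    have e : w.rotate (j + 1) = t ++ [a] := by
      rw [← List.rotate_rotate, hat]; simp
    rw [e, hat]
    refine cutSum_snoc h q c a t ?_ hs
    have hp : (t ++ [a]).Perm w := e ▸ List.rotate_perm w (j + 1)
    exact (hp.cons c).symm.pairwise hw (fun {x y} => hs x y)
  have hsum : ∀ m, ∑ j ∈ Finset.range m, q ^ (m - 1 - j) • cutSum link q c (w.rotate (j + 1)) =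
      cutSumHead link q c (w.rotate m) - q ^ m • cutSumHead link q c w := by
    intro m
    induction m with
    | zero => simp
    | succ m ih =>
      rw [Finset.sum_range_succ, hstep m]
      have : ∑ j ∈ Finset.range m, q ^ (m + 1 - 1 - j) • cutSum link q c (w.rotate (j + 1)) =
          q • ∑ j ∈ Finset.range m, q ^ (m - 1 - j) • cutSum link q c (w.rotate (j + 1)) := by
        rw [Finset.smul_sum]
        refine Finset.sum_congr rfl fun j hj => ?_
        have hj' := Finset.mem_range.1 hj
        rw [smul_smul, ← pow_succ']
        congr 2
        omega
      rw [this, ih]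
      simp [pow_succ', smul_sub, smul_smul]
  have h1 := hsum w.length
  rw [List.rotate_length] at h1
  have h2 : cutSumHead link q c w = (1 - q ^ w.length)⁻¹ •
      ∑ j ∈ Finset.range w.length,
        q ^ (w.length - 1 - j) • cutSum link q c (w.rotate (j + 1)) := by
    have h0 : (1 - q ^ w.length) ≠ 0 := sub_ne_zero.2 (Ne.symm hq)
    rw [h1, eq_inv_smul_iff₀ h0, sub_smul, one_smul]
  rw [h2]
  exact Submodule.smul_mem _ _ (Submodule.sum_mem _ fun j _ => Submodule.smul_mem _ _
    (Submodule.subset_span ⟨_, List.rotate_perm w _, rfl⟩))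

/-- If `q^m ≠ 1` for `1 ≤ m ≤ |w|`, then the path product along `w` is a combination of the cut sums
of the rearrangements of `w`. -/
theorem path_mem_span_cutSum (h : ForkRel link d) (hs : ∀ x y, d x y → d y x) (q : ℂ) (c : X)
    (w : List X) (hw : (c :: w).Pairwise d) (hq : ∀ m, 1 ≤ m → m ≤ w.length → q ^ m ≠ 1) :
    path link c w ∈ Submodule.span ℂ {z | ∃ w', w'.Perm w ∧ z = cutSum link q c w'} := by
  induction w generalizing c with
  | nil => exact Submodule.subset_span ⟨[], List.Perm.refl _, by simp⟩
  | cons a w ih =>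
    -- By induction the path from `a` is a combination of cut sums from `a`. Multiplied by `link c
    -- a`, these are heads of words of full length, which `cutSumHead_mem` expresses by cut sums
    -- from `c`.
    have := Submodule.mem_map_of_mem (f := LinearMap.mulLeft ℂ (link c a))
      (ih a (List.pairwise_cons.1 hw).2 fun m h1 h2 => hq m h1 (by simp; omega))
    rw [Submodule.map_span] at this
    refine Submodule.span_le.2 ?_ this
    rintro _ ⟨_, ⟨w', hw', rfl⟩, rfl⟩
    have hp : (a :: w').Perm (a :: w) := hw'.cons a
    have := cutSumHead_mem h hs q c (a :: w') ((hp.cons c).symm.pairwise hw fun {x y} => hs x y)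
      (by simp) (hq _ (by simp) (by rw [hp.length_eq]))
    refine Submodule.span_mono ?_ this
    rintro _ ⟨w'', hw'', rfl⟩
    exact ⟨w'', hw''.trans hp, rfl⟩

end Path

end WreathOS

end

noncomputable section

namespace WreathOS

/-! ### Odd elements and logarithmic forms -/

section Odd

variable {S V : Type*} [AddCommGroup V] [Module ℂ V]

/-- A function with values in the degree one part of an exterior algebra. -/
def IsOdd (a : S → ExteriorAlgebra ℂ V) : Prop := ∀ z, ∃ v, a z = ExteriorAlgebra.ι ℂ v

theorem IsOdd.mul_swap {a b : S → ExteriorAlgebra ℂ V} (ha : IsOdd a) (hb : IsOdd b) :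
    a * b = -(b * a) := by
  funext z
  obtain ⟨u, hu⟩ := ha z
  obtain ⟨v, hv⟩ := hb z
  simp only [Pi.mul_apply, Pi.neg_apply, hu, hv]
  exact eq_neg_of_add_eq_zero_left (ExteriorAlgebra.ι_add_mul_swap u v)

theorem IsOdd.mul_self {a : S → ExteriorAlgebra ℂ V} (ha : IsOdd a) : a * a = 0 := by
  funext z
  obtain ⟨u, hu⟩ := ha z
  simp [hu]

theorem IsOdd.add {a b : S → ExteriorAlgebra ℂ V} (ha : IsOdd a) (hb : IsOdd b) :
    IsOdd (a + b) := by
  intro z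
  obtain ⟨u, hu⟩ := ha z
  obtain ⟨v, hv⟩ := hb z
  exact ⟨u + v, by simp [hu, hv]⟩

theorem isOdd_zero : IsOdd (0 : S → ExteriorAlgebra ℂ V) := fun _ => ⟨0, by simp⟩

theorem isOdd_list_sum {l : List (S → ExteriorAlgebra ℂ V)} (hl : ∀ a ∈ l, IsOdd a) :
    IsOdd l.sum := by
  induction l with
  | nil => exact isOdd_zero
  | cons a l ih =>
    rw [List.sum_cons]
    exact (hl a (by simp)).add (ih fun b hb => hl b (by simp [hb]))

theorem ι_mul_ι_comm (u v : V) (x : ExteriorAlgebra ℂ V) :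
    Commute (ExteriorAlgebra.ι ℂ u * ExteriorAlgebra.ι ℂ v) x := by
  have hsw : ∀ a b : V, ExteriorAlgebra.ι ℂ a * ExteriorAlgebra.ι ℂ b
      = -(ExteriorAlgebra.ι ℂ b * ExteriorAlgebra.ι ℂ a) := fun a b =>
    eq_neg_of_add_eq_zero_left (ExteriorAlgebra.ι_add_mul_swap a b)
  induction x using ExteriorAlgebra.induction with
  | algebraMap c => exact (Algebra.commutes c _).symm
  | ι w =>
    change _ * _ * _ = _ * (_ * _)
    rw [mul_assoc, hsw v w, mul_neg, ← mul_assoc, hsw u w, neg_mul, neg_neg, mul_assoc]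
  | mul a b ha hb => exact ha.mul_right hb
  | add a b ha hb => exact ha.add_right hb

theorem IsOdd.mul_mem_center {a b : S → ExteriorAlgebra ℂ V} (ha : IsOdd a) (hb : IsOdd b) :
    a * b ∈ Subalgebra.center ℂ (S → ExteriorAlgebra ℂ V) := by
  rw [Subalgebra.mem_center_iff]
  intro x
  funext z
  obtain ⟨u, hu⟩ := ha z
  obtain ⟨v, hv⟩ := hb z
  simp only [Pi.mul_apply, hu, hv]
  exact ((ι_mul_ι_comm u v (x z)).eq).symm

/-- The logarithmic form of a function `a` with differential `u`. -/
def dlog (a : S → ℂ) (u : S → V) : S → ExteriorAlgebra ℂ V :=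
  fun z => (a z)⁻¹ • ExteriorAlgebra.ι ℂ (u z)

theorem isOdd_dlog (a : S → ℂ) (u : S → V) : IsOdd (dlog a u) :=
  fun _ => ⟨_, (map_smul _ _ _).symm⟩

theorem dlog_smul {c : ℂ} (hc : c ≠ 0) (a : S → ℂ) (u : S → V) :
    dlog (c • a) (c • u) = dlog a u := by
  funext z
  simp only [dlog, Pi.smul_apply, smul_eq_mul, map_smul, smul_smul]
  congr 1
  field_simp

theorem dlog_neg (a : S → ℂ) (u : S → V) : dlog (-a) (-u) = dlog a u := by
  simpa using dlog_smul (c := -1) (by simp) a u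

/-- Both sides are multiples of `u ∧ v`, and the coefficients agree because 1/(ab) = (1/a + 1/b)/(a
+ b). All Orlik–Solomon relations used below are instances of this identity. -/
theorem dlog_mul_dlog {a b : S → ℂ} (u v : S → V) (ha : ∀ z, a z ≠ 0) (hb : ∀ z, b z ≠ 0)
    (hab : ∀ z, a z + b z ≠ 0) :
    dlog a u * dlog b v = dlog (a + b) (u + v) * (dlog b v - dlog a u) := by
  funext z
  have hsw : ExteriorAlgebra.ι ℂ (v z) * ExteriorAlgebra.ι ℂ (u z)
      = -(ExteriorAlgebra.ι ℂ (u z) * ExteriorAlgebra.ι ℂ (v z)) :=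
    eq_neg_of_add_eq_zero_left (ExteriorAlgebra.ι_add_mul_swap _ _)
  simp only [dlog, Pi.mul_apply, Pi.sub_apply, Pi.add_apply, map_add, mul_sub, smul_mul_assoc,
    mul_smul_comm, add_mul, ExteriorAlgebra.ι_sq_zero, zero_add, add_zero, hsw, smul_neg,
    smul_smul, sub_neg_eq_add, ← add_smul]
  congr 1
  have h1 := ha z
  have h2 := hb z
  have h3 := hab z
  field_simp

end Odd

/-! ### Contractions -/

section Contraction

variable {V : Type*} [AddCommGroup V] [Module ℂ V]

/-- The right contraction of the exterior algebra by a covector. -/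
def contr (d : Module.Dual ℂ V) : ExteriorAlgebra ℂ V →ₗ[ℂ] ExteriorAlgebra ℂ V :=
  CliffordAlgebra.contractRight.flip d

theorem contr_mul_ι (d : Module.Dual ℂ V) (x : ExteriorAlgebra ℂ V) (v : V) :
    contr d (x * ExteriorAlgebra.ι ℂ v) = d v • x - contr d x * ExteriorAlgebra.ι ℂ v :=
  CliffordAlgebra.contractRight_mul_ι d v x

theorem contr_algebraMap (d : Module.Dual ℂ V) (c : ℂ) :
    contr d (algebraMap ℂ (ExteriorAlgebra ℂ V) c) = 0 :=
  CliffordAlgebra.contractRight_algebraMap _ d c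

theorem contr_one (d : Module.Dual ℂ V) : contr d (1 : ExteriorAlgebra ℂ V) = 0 :=
  CliffordAlgebra.contractRight_one _ d

end Contraction

/-! ### Logarithmic forms of hyperplanes -/

section Hyperplane

variable {r n : ℕ}

/-- The function `ξ⁻¹ z_i` on `T(r,n)` for `x = (ξ, i)`. -/
def coordFn (x : Mu r × Fin n) : T r n → ℂ := fun z => (((x.1 : ℂˣ) : ℂ))⁻¹ * z.1 x.2

/-- The differential of `coordFn x`. -/
def coordD (x : Mu r × Fin n) : T r n → Module.Dual ℂ (Fin n → ℂ) :=
  fun _ => (((x.1 : ℂˣ) : ℂ))⁻¹ • dz x.2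

/-- The form `d log (ξ⁻¹ z_i - η⁻¹ z_j)` for `x = (ξ, i)` and `y = (η, j)`. -/
def ed (x y : Mu r × Fin n) : Form r n := omegaEdge x.2 y.2 (x.1 * y.1⁻¹)

theorem omega_eq (x : Mu r × Fin n) : omega r x.2 = dlog (coordFn x) (coordD x) := by
  have h : (((x.1 : ℂˣ) : ℂ))⁻¹ ≠ 0 := inv_ne_zero (Units.ne_zero _)
  exact (dlog_smul h (fun z : T r n => z.1 x.2) (fun _ => dz x.2)).symm

/-- A logarithmic form is unchanged when its function is scaled, here by ξ⁻¹. In this shape an edge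
belongs to a difference of two functions attached to labelled points, which makes the symmetry and
the three-term relations evident. -/
theorem ed_eq (x y : Mu r × Fin n) :
    ed x y = dlog (coordFn x - coordFn y) (coordD x - coordD y) := by
  have h : (((x.1 : ℂˣ) : ℂ))⁻¹ ≠ 0 := inv_ne_zero (Units.ne_zero _)
  have e := dlog_smul h (fun z : T r n => z.1 x.2 - (((x.1 * y.1⁻¹ : Mu r) : ℂˣ) : ℂ) * z.1 y.2)
    (fun _ => dz x.2 - (((x.1 * y.1⁻¹ : Mu r) : ℂˣ) : ℂ) • dz y.2)
  refine e.symm.trans ?_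
  have hx : ((x.1 : ℂˣ) : ℂ) ≠ 0 := Units.ne_zero _
  congr 1
  · funext z
    simp [coordFn]
    field_simp
  · funext z
    simp only [coordD, Pi.smul_apply, Pi.sub_apply, smul_sub, smul_smul, Subgroup.coe_mul,
      Units.val_mul, Subgroup.coe_inv, Units.val_inv_eq_inv_val]
    rw [inv_mul_cancel_left₀ hx]

theorem coordFn_ne_zero (x : Mu r × Fin n) (z : T r n) : coordFn x z ≠ 0 :=
  mul_ne_zero (inv_ne_zero (Units.ne_zero _)) (z.2.1 _)

theorem coordFn_sub_ne_zero {x y : Mu r × Fin n} (h : x.2 ≠ y.2) (z : T r n) :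
    coordFn x z - coordFn y z ≠ 0 := by
  intro h0
  refine z.2.2 _ _ h ?_
  have e := congrArg (· ^ r) (sub_eq_zero.1 h0)
  simpa [coordFn, mul_pow, root_pow] using e

theorem isOdd_omega (i : Fin n) : IsOdd (omega r i) := isOdd_dlog _ _

theorem isOdd_omegaEdge (i j : Fin n) (η : Mu r) : IsOdd (omegaEdge i j η) := isOdd_dlog _ _

theorem isOdd_ed (x y : Mu r × Fin n) : IsOdd (ed x y) := isOdd_dlog _ _

theorem ed_symm (x y : Mu r × Fin n) : ed x y = ed y x := by
  rw [ed_eq, ed_eq, ← dlog_neg, neg_sub, neg_sub]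

theorem ed_mul_ed {c a b : Mu r × Fin n} (hca : c.2 ≠ a.2) (hcb : c.2 ≠ b.2) (hab : a.2 ≠ b.2) :
    ed c a * ed a b = ed c b * (ed a b - ed c a) := by
  have := dlog_mul_dlog (a := coordFn c - coordFn a) (b := coordFn a - coordFn b)
    (coordD c - coordD a) (coordD a - coordD b)
    (coordFn_sub_ne_zero hca) (coordFn_sub_ne_zero hab)
    (fun z => by simpa using coordFn_sub_ne_zero hcb z)
  rw [sub_add_sub_cancel, sub_add_sub_cancel, ← ed_eq, ← ed_eq, ← ed_eq] at this
  exact this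

theorem ed_mul_omega {c a : Mu r × Fin n} (hca : c.2 ≠ a.2) :
    ed c a * omega r a.2 = omega r c.2 * (omega r a.2 - ed c a) := by
  have := dlog_mul_dlog (a := coordFn c - coordFn a) (b := coordFn a)
    (coordD c - coordD a) (coordD a)
    (coordFn_sub_ne_zero hca) (coordFn_ne_zero a)
    (fun z => by simpa using coordFn_ne_zero c z)
  rw [sub_add_cancel, sub_add_cancel, ← ed_eq, ← omega_eq, ← omega_eq] at this
  exact this

/-- The difference of the two linear functions is a constant multiple of z_j. Thus parallel edges
with different labels create a closed root; relations such as this one are why closed roots give a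
filtration and not a grading. -/
theorem ed_mul_ed_same {i j : Fin n} (hij : i ≠ j) {η θ : Mu r} (h : η ≠ θ) :
    (omegaEdge i j η * omegaEdge i j θ : Form r n) =
      omega r j * (omegaEdge i j θ - omegaEdge i j η) := by
  have hsub : ((θ : ℂˣ) : ℂ) - ((η : ℂˣ) : ℂ) ≠ 0 := by
    rw [sub_ne_zero]
    intro h'
    exact h (Subtype.ext (Units.ext h'.symm))
  have ha : ∀ η : Mu r, ∀ z : T r n, z.1 i - ((η : ℂˣ) : ℂ) * z.1 j ≠ 0 := by
    intro η z
    have := coordFn_sub_ne_zero (x := ((1 : Mu r), i)) (y := (η⁻¹, j)) hij z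
    simpa [coordFn] using this
  have := dlog_mul_dlog (S := T r n) (a := fun z => z.1 i - ((η : ℂˣ) : ℂ) * z.1 j)
    (b := -fun z => z.1 i - ((θ : ℂˣ) : ℂ) * z.1 j)
    (fun _ => dz i - ((η : ℂˣ) : ℂ) • dz j) (-fun _ => dz i - ((θ : ℂˣ) : ℂ) • dz j)
    (ha η) (fun z => neg_ne_zero.2 (ha θ z)) (fun z => by
      have : z.1 i - ((η : ℂˣ) : ℂ) * z.1 j + (-fun z : T r n => z.1 i - ((θ : ℂˣ) : ℂ) * z.1 j) z
        = (((θ : ℂˣ) : ℂ) - ((η : ℂˣ) : ℂ)) * z.1 j := by simp; ring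
      rw [this]
      exact mul_ne_zero hsub (z.2.1 j))
  rw [dlog_neg] at this
  refine this.trans ?_
  congr 1
  have e := dlog_smul hsub (fun z : T r n => z.1 j) (fun _ => dz j)
  refine Eq.trans ?_ e
  congr 1
  · funext z; simp; ring
  · funext z
    simp only [Pi.add_apply, Pi.neg_apply, Pi.smul_apply, sub_smul]
    abel

end Hyperplane

end WreathOS

end

noncomputable section

namespace WreathOS

/-! ### Forms with auxiliary odd variables -/

section Big

variable {r n : ℕ}

/-- The exterior algebra on the covectors and on `n` auxiliary odd variables. -/
abbrev BigExt (n : ℕ) : Type := ExteriorAlgebra ℂ (Module.Dual ℂ (Fin n → ℂ) × (Fin n → ℂ))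

/-- Differential forms on `T(r,n)` with coefficients involving `n` auxiliary odd variables. -/
abbrev BigForm (r n : ℕ) : Type := T r n → BigExt n

/-- The inclusion of differential forms. -/
def big : Form r n →ₐ[ℂ] BigForm r n :=
  (ExteriorAlgebra.map (LinearMap.inl ℂ (Module.Dual ℂ (Fin n → ℂ)) (Fin n → ℂ))).compLeft (T r n)

theorem big_apply (α : Form r n) (z : T r n) :
    big α z = ExteriorAlgebra.map (LinearMap.inl ℂ _ _) (α z) := rfl

theorem isOdd_big {a : Form r n} (ha : IsOdd a) : IsOdd (big a) := by
  intro z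
  obtain ⟨v, hv⟩ := ha z
  exact ⟨(v, 0), by rw [big_apply, hv, ExteriorAlgebra.map_apply_ι]; rfl⟩

/-- The auxiliary odd variables. -/
def theta (r : ℕ) {n : ℕ} (i : Fin n) : BigForm r n :=
  fun _ => ExteriorAlgebra.ι ℂ (0, Pi.single i 1)

theorem isOdd_theta (i : Fin n) : IsOdd (theta r i) := fun _ => ⟨_, rfl⟩

/-- The product of all auxiliary odd variables. -/
def thetaTop (r n : ℕ) : BigForm r n := (List.ofFn (theta r)).prod

/-- Multiplication of forms by the product of all auxiliary variables. -/
def thetaMul (r n : ℕ) : Form r n →ₗ[ℂ] BigForm r n :=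
  (LinearMap.mulRight ℂ (thetaTop r n)).comp big.toLinearMap

theorem thetaMul_apply (α : Form r n) : thetaMul r n α = big α * thetaTop r n := rfl

theorem contr_map_inl (c : Module.Dual ℂ (Fin n → ℂ)) (x : Ext n) :
    contr (c.comp (LinearMap.snd ℂ (Module.Dual ℂ (Fin n → ℂ)) _))
      (ExteriorAlgebra.map (LinearMap.inl ℂ _ _) x) = 0 := by
  induction x using CliffordAlgebra.right_induction with
  | algebraMap a => rw [AlgHom.commutes]; exact contr_algebraMap _ _
  | add a b ha hb => rw [map_add, map_add, ha, hb, add_zero]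
  | mul_ι v x ih =>
    have : ExteriorAlgebra.map (LinearMap.inl ℂ (Module.Dual ℂ (Fin n → ℂ)) (Fin n → ℂ))
        (x * ExteriorAlgebra.ι ℂ v) =
        ExteriorAlgebra.map (LinearMap.inl ℂ _ _) x * ExteriorAlgebra.ι ℂ (v, 0) := by
      rw [map_mul, ExteriorAlgebra.map_apply_ι]; rfl
    refine (congrArg _ this).trans ?_
    rw [contr_mul_ι, ih]
    simp

theorem prod_pi_apply {S A ι : Type*} [Monoid A] (l : List ι) (f : ι → S → A) (z : S) :
    (l.map f).prod z = (l.map fun i => f i z).prod := by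
  have := map_list_prod (Pi.evalMonoidHom (fun _ : S => A) z) (l.map f)
  rw [List.map_map] at this
  exact this

/-- If `x` is killed by the contraction dual to θ_i, the contraction of x θ_i is x. The variables
can therefore be removed one at a time. -/
theorem eq_zero_of_mul_theta (l : List (Fin n)) (hl : l.Nodup) (x : BigExt n)
    (hx : ∀ i ∈ l, contr ((LinearMap.proj i).comp
      (LinearMap.snd ℂ (Module.Dual ℂ (Fin n → ℂ)) (Fin n → ℂ))) x = 0)
    (h : x * (l.map fun i => ExteriorAlgebra.ι ℂ
      ((0, Pi.single i 1) : Module.Dual ℂ (Fin n → ℂ) × (Fin n → ℂ))).prod = 0) : x = 0 := by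
  induction l generalizing x with
  | nil => simpa using h
  | cons i l ih =>
    have hil : i ∉ l := (List.nodup_cons.1 hl).1
    set y := x * ExteriorAlgebra.ι ℂ
      ((0, Pi.single i 1) : Module.Dual ℂ (Fin n → ℂ) × (Fin n → ℂ)) with hy
    have hy0 : y = 0 := by
      refine ih (List.nodup_cons.1 hl).2 y (fun j hj => ?_) ?_
      · have hji : j ≠ i := fun e => hil (e ▸ hj)
        rw [hy, contr_mul_ι, hx j (by simp [hj])]
        simp [hji]
      · rw [hy, mul_assoc]
        simpa using h
    have := congrArg (contr ((LinearMap.proj i).comp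
      (LinearMap.snd ℂ (Module.Dual ℂ (Fin n → ℂ)) (Fin n → ℂ)))) hy0
    rw [hy, contr_mul_ι, hx i (by simp)] at this
    simpa using this

/-- Identities between forms, and membership in spans, can thus be checked after multiplication by
all θ_i, where edges are even elements. -/
theorem thetaMul_injective : Function.Injective (thetaMul r n) := by
  rw [injective_iff_map_eq_zero]
  intro α hα
  funext z
  have hz := congrFun hα z
  rw [thetaMul_apply, Pi.mul_apply, thetaTop, List.ofFn_eq_map, prod_pi_apply] at hz
  have h0 := eq_zero_of_mul_theta (List.finRange n) (List.nodup_finRange n) (big α z)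
    (fun i _ => contr_map_inl _ _) hz
  have hleft : Function.LeftInverse (ExteriorAlgebra.map (LinearMap.fst ℂ _ _))
      (ExteriorAlgebra.map (LinearMap.inl ℂ (Module.Dual ℂ (Fin n → ℂ)) (Fin n → ℂ))) := by
    intro x
    rw [← AlgHom.comp_apply, ExteriorAlgebra.map_comp_map, LinearMap.fst_comp_inl,
      ExteriorAlgebra.map_id]
    rfl
  exact (map_eq_zero_iff _ hleft.injective).1 h0

/-! ### The action on forms with auxiliary variables -/

/-- The action of `g` on covectors and auxiliary variables. -/
def bigLin (g : W r n) : (Module.Dual ℂ (Fin n → ℂ) × (Fin n → ℂ)) →ₗ[ℂ]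
    (Module.Dual ℂ (Fin n → ℂ) × (Fin n → ℂ)) :=
  LinearMap.prodMap ((stdRep r n).dual g) (LinearMap.funLeft ℂ ℂ (g.right⁻¹ : Equiv.Perm (Fin n)))

/-- The action of `g` on forms with auxiliary variables. -/
def bigAct (g : W r n) : BigForm r n →ₐ[ℂ] BigForm r n where
  toFun α z := ExteriorAlgebra.map (bigLin g) (α ⟨stdRep r n g⁻¹ z, stdRep_mem_T g⁻¹ z.2⟩)
  map_one' := by ext; simp
  map_mul' α β := by ext; simp
  map_zero' := by ext; simp
  map_add' α β := by ext; simp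
  commutes' c := by ext; simp [Pi.algebraMap_apply]

theorem bigAct_apply (g : W r n) (α : BigForm r n) (z : T r n) : bigAct g α z =
    ExteriorAlgebra.map (bigLin g) (α ⟨stdRep r n g⁻¹ z, stdRep_mem_T g⁻¹ z.2⟩) := rfl

theorem formRep_apply (g : W r n) (α : Form r n) (z : T r n) : formRep r n g α z =
    ExteriorAlgebra.map ((stdRep r n).dual g) (α ⟨stdRep r n g⁻¹ z, stdRep_mem_T g⁻¹ z.2⟩) := rfl

theorem bigLin_comp_inl (g : W r n) : (bigLin g).comp (LinearMap.inl ℂ _ _) =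
    (LinearMap.inl ℂ (Module.Dual ℂ (Fin n → ℂ)) (Fin n → ℂ)).comp ((stdRep r n).dual g) :=
  LinearMap.ext fun _ => Prod.ext rfl
    (map_zero (LinearMap.funLeft ℂ ℂ (g.right⁻¹ : Equiv.Perm (Fin n))))

theorem bigAct_big (g : W r n) (α : Form r n) : bigAct g (big α) = big (formRep r n g α) := by
  funext z
  rw [bigAct_apply, big_apply, big_apply, formRep_apply]
  generalize α ⟨stdRep r n g⁻¹ z, stdRep_mem_T g⁻¹ z.2⟩ = x
  rw [← AlgHom.comp_apply, ← AlgHom.comp_apply, ExteriorAlgebra.map_comp_map,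
    ExteriorAlgebra.map_comp_map, bigLin_comp_inl]

theorem bigAct_theta (g : W r n) (i : Fin n) : bigAct g (theta r i) = theta r (g.right i) := by
  funext z
  rw [bigAct_apply, theta, ExteriorAlgebra.map_apply_ι, theta]
  congr 1
  ext j
  · simp [bigLin]
  · simp only [bigLin, LinearMap.prodMap_apply, LinearMap.funLeft_apply, Pi.single_apply]
    simp only [Equiv.Perm.inv_eq_iff_eq]

/-- The top exterior power of the permutation representation on the θ_i is the sign; this is where
ε_n enters. -/
theorem bigAct_thetaTop (g : W r n) :
    bigAct g (thetaTop r n) = signChar n g.right • thetaTop r n := by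
  have h1 : bigAct g (thetaTop r n) = (List.ofFn fun i => theta r (g.right i)).prod := by
    rw [thetaTop, map_list_prod, List.map_ofFn]
    congr 2
    funext i
    exact bigAct_theta g i
  rw [h1, thetaTop]
  funext z
  rw [Pi.smul_apply, List.ofFn_eq_map, List.ofFn_eq_map, prod_pi_apply, prod_pi_apply,
    ← List.ofFn_eq_map, ← List.ofFn_eq_map]
  have := (ExteriorAlgebra.ιMulti ℂ n (M := Module.Dual ℂ (Fin n → ℂ) × (Fin n → ℂ))).map_perm
    (fun i => (0, Pi.single i 1)) g.right
  rw [ExteriorAlgebra.ιMulti_apply, ExteriorAlgebra.ιMulti_apply] at this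
  refine Eq.trans this ?_
  simp only [signChar, MonoidHom.comp_apply, Units.smul_def, Units.coeHom_apply]
  exact (Int.cast_smul_eq_zsmul ℂ _ _).symm

theorem bigAct_thetaMul (g : W r n) (α : Form r n) :
    bigAct g (thetaMul r n α) = signChar n g.right • thetaMul r n (formRep r n g α) := by
  rw [thetaMul_apply, map_mul, bigAct_big, bigAct_thetaTop, mul_smul_comm, thetaMul_apply]

theorem formRep_omega (g : W r n) (i : Fin n) :
    formRep r n g (omega r i) = omega r (g.right i) := by
  funext z
  rw [formRep_apply]
  simp only [omega, map_smul, ExteriorAlgebra.map_apply_ι, dual_dz, stdRep_inv_apply, smul_smul]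
  congr 1
  field_simp

/-- With edges indexed by pairs of labelled points, the action of the wreath product is the
permutation action on labelled points, without correction factors. -/
theorem formRep_ed (g : W r n) (x y : Mu r × Fin n) :
    formRep r n g (ed x y) = ed (wreathPerm r n g x) (wreathPerm r n g y) := by
  have hc : ∀ (x : Mu r × Fin n) (z : T r n),
      coordFn x ⟨stdRep r n g⁻¹ z, stdRep_mem_T g⁻¹ z.2⟩ = coordFn (wreathPerm r n g x) z := by
    intro x z
    simp [coordFn, stdRep_inv_apply, wreathPerm]
    ring
  have hd : ∀ (x : Mu r × Fin n) (z z' : T r n),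
      (stdRep r n).dual g (coordD x z) = coordD (wreathPerm r n g x) z' := by
    intro x z z'
    rw [coordD, map_smul, dual_dz, smul_smul]
    simp [coordD, wreathPerm, mul_comm]
  rw [ed_eq, ed_eq]
  funext z
  rw [formRep_apply]
  simp only [dlog, map_smul, ExteriorAlgebra.map_apply_ι, Pi.sub_apply, hc, map_sub]
  rw [hd x _ z, hd y _ z]

theorem ed_diag (ξ : Mu r) (x y : Mu r × Fin n) :
    ed (ξ * x.1, x.2) (ξ * y.1, y.2) = ed x y := by
  simp only [ed]
  congr 1
  rw [mul_inv, mul_mul_mul_comm, mul_inv_cancel, one_mul]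

/-! ### Links -/

/-- The even element `ω_{c,a} θ_a`. -/
def link (c a : Mu r × Fin n) : Subalgebra.center ℂ (BigForm r n) :=
  ⟨big (ed c a) * theta r a.2, (isOdd_big (isOdd_ed c a)).mul_mem_center (isOdd_theta _)⟩

theorem link_coe (c a : Mu r × Fin n) :
    (link c a : BigForm r n) = big (ed c a) * theta r a.2 := rfl

/-- This is the Arnold relation `ed_mul_ed`. Giving each edge the odd variable of its endpoint makes
the links commute and absorbs all the signs. -/
theorem forkRel_link :
    ForkRel (link : Mu r × Fin n → _ → Subalgebra.center ℂ (BigForm r n))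
      (fun x y => x.2 ≠ y.2) := by
  intro c a b hca hcb hab
  refine Subtype.ext ?_
  simp only [Subalgebra.coe_mul, Subalgebra.coe_add, link_coe]
  have hodd : ∀ x y : Mu r × Fin n, ∀ k : Fin n,
      theta r k * big (ed x y) = -(big (ed x y) * theta r k) := fun x y k =>
    (isOdd_theta k).mul_swap (isOdd_big (isOdd_ed x y))
  have hE : ∀ x y x' y' : Mu r × Fin n, ∀ k k' : Fin n,
      big (ed x y) * theta r k * (big (ed x' y') * theta r k') =
      -(big (ed x y * ed x' y') * (theta r k * theta r k')) := by
    intro x y x' y' k k'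
    rw [mul_assoc, ← mul_assoc (theta r k), hodd, map_mul]
    noncomm_ring
  rw [hE, hE, hE, (isOdd_theta b.2).mul_swap (isOdd_theta a.2), ed_mul_ed hca hcb hab,
    ed_symm b a, (isOdd_ed c a).mul_swap (isOdd_ed c b), mul_sub, map_sub, map_neg]
  noncomm_ring

end Big

end WreathOS

end

noncomputable section

namespace WreathOS

/-! ### Increasing products -/

section Increasing

variable {r n : ℕ}

/-- `IncProd i q l α` says that `α` is a product over the vertices before `i`, in order, of factors
`1`, `ω_k` or `ω_{k,j,η}` with `j < k`, in which `q` factors are not `1` and `l` are of the form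
`ω_k`. -/
inductive IncProd : ℕ → ℕ → ℕ → Form r n → Prop
  | one : IncProd 0 0 0 1
  | openRoot {i q l : ℕ} {α : Form r n} (hi : i < n) (h : IncProd i q l α) : IncProd (i + 1) q l α
  | closedRoot {i q l : ℕ} {α : Form r n} (hi : i < n) (h : IncProd i q l α) :
      IncProd (i + 1) (q + 1) (l + 1) (α * omega r ⟨i, hi⟩)
  | edge {i q l : ℕ} {α : Form r n} (hi : i < n) (j : Fin n) (hj : (j : ℕ) < i) (η : Mu r)
      (h : IncProd i q l α) : IncProd (i + 1) (q + 1) l (α * omegaEdge ⟨i, hi⟩ j η)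

/-- The span of the increasing products on the vertices before `i` with `q` nontrivial factors, at
least `l` of which are closed roots. -/
def incSpan (r n i q l : ℕ) : Submodule ℂ (Form r n) :=
  Submodule.span ℂ {α | ∃ l', l ≤ l' ∧ IncProd i q l' α}

theorem IncProd.mem {i q l : ℕ} {α : Form r n} (h : IncProd i q l α) : α ∈ incSpan r n i q l :=
  Submodule.subset_span ⟨l, le_rfl, h⟩

theorem incSpan_anti {i q l l' : ℕ} (h : l ≤ l') : incSpan r n i q l' ≤ incSpan r n i q l :=
  Submodule.span_mono fun _ ⟨m, hm, hα⟩ => ⟨m, h.trans hm, hα⟩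

theorem incSpan_mul {i q l i' q' l' : ℕ} (g : Form r n)
    (hg : ∀ m α, l ≤ m → IncProd i q m α → α * g ∈ incSpan r n i' q' l') {α : Form r n}
    (hα : α ∈ incSpan r n i q l) : α * g ∈ incSpan r n i' q' l' := by
  have : incSpan r n i q l ≤ (incSpan r n i' q' l').comap (LinearMap.mulRight ℂ g) := by
    rw [incSpan, Submodule.span_le]
    rintro α ⟨m, hm, h⟩
    exact hg m α hm h
  exact this hα

theorem incSpan_succ {i q l : ℕ} (hi : i < n) : incSpan r n i q l ≤ incSpan r n (i + 1) q l :=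
  Submodule.span_mono fun _ ⟨m, hm, hα⟩ => ⟨m, hm, hα.openRoot hi⟩

theorem incSpan_mul_omega_last {i q l : ℕ} (hi : i < n) {α : Form r n}
    (hα : α ∈ incSpan r n i q l) :
    α * omega r ⟨i, hi⟩ ∈ incSpan r n (i + 1) (q + 1) (l + 1) :=
  incSpan_mul _ (fun _ _ hm h => incSpan_anti (by omega) (h.closedRoot hi).mem) hα

theorem incSpan_mul_edge_last {i q l : ℕ} (hi : i < n) (j : Fin n) (hj : (j : ℕ) < i) (η : Mu r)
    {α : Form r n} (hα : α ∈ incSpan r n i q l) :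
    α * omegaEdge ⟨i, hi⟩ j η ∈ incSpan r n (i + 1) (q + 1) l :=
  incSpan_mul _ (fun _ _ hm h => incSpan_anti hm (h.edge hi j hj η).mem) hα

theorem omegaEdge_eq_ed (i j : Fin n) (η : Mu r) :
    (omegaEdge i j η : Form r n) = ed (1, i) (η⁻¹, j) := by
  simp [ed]

theorem omegaEdge_symm (i j : Fin n) (η : Mu r) :
    (omegaEdge i j η : Form r n) = omegaEdge j i η⁻¹ := by
  rw [omegaEdge_eq_ed, ed_symm, ed]
  simp

theorem omega_mul_omegaEdge {i j : Fin n} (hij : i ≠ j) (η : Mu r) :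
    (omega r i * omegaEdge i j η : Form r n) =
      omega r j * omegaEdge i j η - omega r j * omega r i := by
  have h := ed_mul_omega (r := r) (c := (1, i)) (a := (η⁻¹, j)) hij
  rw [← omegaEdge_eq_ed, mul_sub] at h
  simp only at h
  rw [(isOdd_omega j).mul_swap (isOdd_omegaEdge i j η), h, (isOdd_omega j).mul_swap (isOdd_omega i)]
  abel

theorem omegaEdge_mul_omegaEdge {i j k : Fin n} (hij : i ≠ j) (hik : i ≠ k) (hjk : j ≠ k)
    (η θ : Mu r) :
    (omegaEdge i j η * omegaEdge i k θ : Form r n) =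
      omegaEdge j k (η⁻¹ * θ) * omegaEdge i k θ - omegaEdge j k (η⁻¹ * θ) * omegaEdge i j η := by
  have h := ed_mul_ed (r := r) (c := (1, i)) (a := (η⁻¹, j)) (b := (θ⁻¹, k)) hij hik hjk
  have e : ed (η⁻¹, j) (θ⁻¹, k) = (omegaEdge j k (η⁻¹ * θ) : Form r n) := by simp [ed]
  rw [← omegaEdge_eq_ed, ← omegaEdge_eq_ed, e, mul_sub,
    (isOdd_omegaEdge i k θ).mul_swap (isOdd_omegaEdge i j η), sub_neg_eq_add] at h
  rw [(isOdd_omegaEdge j k (η⁻¹ * θ)).mul_swap (isOdd_omegaEdge i k θ),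
    (isOdd_omegaEdge j k (η⁻¹ * θ)).mul_swap (isOdd_omegaEdge i j η), h]
  abel

theorem mul_mul_swap {a g h : Form r n} (hg : IsOdd g) (hh : IsOdd h) :
    a * g * h = -(a * h * g) := by
  rw [mul_assoc, hg.mul_swap hh, mul_neg, mul_assoc]

/-- Straightening, by induction on the number of vertices. Only a second factor at the last vertex
causes trouble. Each relation for two such factors leaves one factor at the last vertex and moves
the other to earlier vertices, which are covered by induction; no relation lowers the number of
closed roots. -/
theorem incSpan_closed (i : ℕ) : ∀ q l : ℕ, ∀ α : Form r n, IncProd i q l α →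
    (∀ k : Fin n, (k : ℕ) < i → α * omega r k ∈ incSpan r n i (q + 1) (l + 1)) ∧
    (∀ k j : Fin n, ∀ η : Mu r, (k : ℕ) < i → (j : ℕ) < i → k ≠ j →
      α * omegaEdge k j η ∈ incSpan r n i (q + 1) l) := by
  induction i with
  | zero => exact fun q l α _ => ⟨fun k hk => absurd hk (Nat.not_lt_zero _),
      fun k j η hk => absurd hk (Nat.not_lt_zero _)⟩
  | succ i ih =>
    have ihO : ∀ {q l : ℕ} {α : Form r n}, α ∈ incSpan r n i q l → ∀ k : Fin n, (k : ℕ) < i →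
        α * omega r k ∈ incSpan r n i (q + 1) (l + 1) := fun hα k hk =>
      incSpan_mul _ (fun m β hm hβ => incSpan_anti (by omega) ((ih _ _ _ hβ).1 k hk)) hα
    have ihE : ∀ {q l : ℕ} {α : Form r n}, α ∈ incSpan r n i q l → ∀ k j : Fin n, ∀ η : Mu r,
        (k : ℕ) < i → (j : ℕ) < i → k ≠ j →
        α * omegaEdge k j η ∈ incSpan r n i (q + 1) l := fun hα k j η hk hj hkj =>
      incSpan_mul _ (fun m β hm hβ => incSpan_anti hm ((ih _ _ _ hβ).2 k j η hk hj hkj)) hα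
    -- it suffices to treat generators that involve the last vertex in first position
    suffices H : ∀ q l : ℕ, ∀ α : Form r n, IncProd (i + 1) q l α → ∀ hi : i < n,
        (α * omega r ⟨i, hi⟩ ∈ incSpan r n (i + 1) (q + 1) (l + 1)) ∧
        (∀ j : Fin n, ∀ η : Mu r, (j : ℕ) < i →
          α * omegaEdge ⟨i, hi⟩ j η ∈ incSpan r n (i + 1) (q + 1) l) ∧
        (∀ k : Fin n, (k : ℕ) < i → α * omega r k ∈ incSpan r n (i + 1) (q + 1) (l + 1)) ∧
        (∀ k j : Fin n, ∀ η : Mu r, (k : ℕ) < i → (j : ℕ) < i → k ≠ j →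
          α * omegaEdge k j η ∈ incSpan r n (i + 1) (q + 1) l) by
      intro q l α h
      have hi : i < n := by cases h <;> assumption
      refine ⟨fun k hk => ?_, fun k j η hk hj hkj => ?_⟩
      · rcases Nat.lt_succ_iff_lt_or_eq.1 hk with hk' | hk'
        · exact (H q l α h hi).2.2.1 k hk'
        · subst hk'
          exact (H q l α h k.2).1
      · rcases Nat.lt_succ_iff_lt_or_eq.1 hk with hk' | hk'
        · rcases Nat.lt_succ_iff_lt_or_eq.1 hj with hj' | hj'
          · exact (H q l α h hi).2.2.2 k j η hk' hj' hkj
          · subst hj'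
            rw [omegaEdge_symm]
            exact (H q l α h j.2).2.1 k _ hk'
        · subst hk'
          exact (H q l α h k.2).2.1 j η (lt_of_le_of_ne (Nat.lt_succ_iff.1 hj)
            fun e => hkj (Fin.ext e.symm))
    intro q l α h hi
    cases h with
    | openRoot _ h =>
      exact ⟨incSpan_mul_omega_last hi h.mem, fun j η hj => incSpan_mul_edge_last hi j hj η h.mem,
        fun k hk => incSpan_succ hi (ihO h.mem k hk),
        fun k j η hk hj hkj => incSpan_succ hi (ihE h.mem k j η hk hj hkj)⟩
    | @closedRoot _ q l α _ h =>
      refine ⟨?_, fun j η hj => ?_, fun k hk => ?_, fun k j η hk hj hkj => ?_⟩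
      · rw [mul_assoc, (isOdd_omega _).mul_self, mul_zero]
        exact zero_mem _
      -- The last vertex is a closed root and receives an edge: the root moves to `j`, and the
      -- second term even gains a closed root.
      · rw [mul_assoc, omega_mul_omegaEdge (fun e => hj.ne (congrArg Fin.val e).symm), mul_sub,
          ← mul_assoc, ← mul_assoc]
        exact sub_mem (incSpan_mul_edge_last hi j hj η (ihO h.mem j hj))
          (incSpan_anti (by omega) (incSpan_mul_omega_last hi (ihO h.mem j hj)))
      · rw [mul_mul_swap (isOdd_omega _) (isOdd_omega _)]
        exact neg_mem (incSpan_mul_omega_last hi (ihO h.mem k hk))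
      · rw [mul_mul_swap (isOdd_omega _) (isOdd_omegaEdge _ _ _)]
        exact neg_mem (incSpan_mul_omega_last hi (ihE h.mem k j η hk hj hkj))
    | @edge _ q l α _ j' hj' θ h =>
      have hne : ∀ j : Fin n, (j : ℕ) < i → (⟨i, hi⟩ : Fin n) ≠ j :=
        fun j hj e => hj.ne (congrArg Fin.val e).symm
      refine ⟨?_, fun j η hj => ?_, fun k hk => ?_, fun k j η hk hj hkj => ?_⟩
      · rw [mul_mul_swap (isOdd_omegaEdge _ _ _) (isOdd_omega _), mul_assoc,
          omega_mul_omegaEdge (hne j' hj'), mul_sub, ← mul_assoc, ← mul_assoc]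
        exact neg_mem (sub_mem (incSpan_mul_edge_last hi j' hj' θ (ihO h.mem j' hj'))
          (incSpan_anti (by omega) (incSpan_mul_omega_last hi (ihO h.mem j' hj'))))
      -- Two edges leave the last vertex. Equal ones square to zero, parallel ones with different
      -- labels trade an edge for a closed root, and otherwise the Arnold relation moves one of them
      -- to an edge between `j'` and `j`.
      · by_cases hjj : j' = j
        · subst hjj
          by_cases hηθ : θ = η
          · rw [hηθ, mul_assoc, (isOdd_omegaEdge _ _ _).mul_self, mul_zero]
            exact zero_mem _
          · rw [mul_assoc, ed_mul_ed_same (hne j' hj') hηθ, mul_sub, mul_sub, ← mul_assoc,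
              ← mul_assoc]
            exact sub_mem
              (incSpan_anti (by omega) (incSpan_mul_edge_last hi j' hj' η (ihO h.mem j' hj')))
              (incSpan_anti (by omega) (incSpan_mul_edge_last hi j' hj' θ (ihO h.mem j' hj')))
        · rw [mul_assoc, omegaEdge_mul_omegaEdge (hne j' hj') (hne j hj) hjj, mul_sub, ← mul_assoc,
            ← mul_assoc]
          exact sub_mem (incSpan_mul_edge_last hi j hj η (ihE h.mem _ _ _ hj' hj hjj))
            (incSpan_mul_edge_last hi j' hj' θ (ihE h.mem _ _ _ hj' hj hjj))
      · rw [mul_mul_swap (isOdd_omegaEdge _ _ _) (isOdd_omega _)]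
        exact neg_mem (incSpan_anti (by omega) (incSpan_mul_edge_last hi j' hj' θ (ihO h.mem k hk)))
      · rw [mul_mul_swap (isOdd_omegaEdge _ _ _) (isOdd_omegaEdge _ _ _)]
        exact neg_mem (incSpan_mul_edge_last hi j' hj' θ (ihE h.mem k j η hk hj hkj))

theorem incSpan_mul_omega {q l : ℕ} {α : Form r n} (hα : α ∈ incSpan r n n q l) (k : Fin n) :
    α * omega r k ∈ incSpan r n n (q + 1) (l + 1) :=
  incSpan_mul _ (fun _ _ hm hβ => incSpan_anti (by omega) ((incSpan_closed n _ _ _ hβ).1 k k.2)) hα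

theorem incSpan_mul_omegaEdge {q l : ℕ} {α : Form r n} (hα : α ∈ incSpan r n n q l) {k j : Fin n}
    (hkj : k ≠ j) (η : Mu r) : α * omegaEdge k j η ∈ incSpan r n n (q + 1) l :=
  incSpan_mul _ (fun _ _ hm hβ => incSpan_anti hm
    ((incSpan_closed n _ _ _ hβ).2 k j η k.2 j.2 hkj)) hα

theorem incProd_one (i : ℕ) (hi : i ≤ n) : IncProd i 0 0 (1 : Form r n) := by
  induction i with
  | zero => exact .one
  | succ i ih => exact (ih (by omega)).openRoot (by omega)

/-! ### Increasing forests -/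

/-- The factor of a vertex `i` of the given type. -/
def Vertex.factor (i : Fin n) : Vertex r n → Form r n
  | openRoot => 1
  | closedRoot => omega r i
  | edge j η => omegaEdge i j η

/-- All edges lead to smaller vertices. -/
def IsInc (v : Fin n → Vertex r n) : Prop := ∀ k j η, v k = .edge j η → j < k

/-- The product of the factors of the vertices before `i`. -/
def incProd (v : Fin n → Vertex r n) (i : ℕ) : Form r n :=
  ((List.ofFn fun k => (v k).factor k).take i).prod

/-- The number of vertices before `i` that satisfy a condition. -/
def countBefore (f : Vertex r n → Bool) (v : Fin n → Vertex r n) (i : ℕ) : ℕ :=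
  (Finset.univ.filter fun k : Fin n => (k : ℕ) < i ∧ f (v k)).card

theorem incProd_succ (v : Fin n → Vertex r n) {i : ℕ} (hi : i < n) :
    incProd v (i + 1) = incProd v i * (v ⟨i, hi⟩).factor ⟨i, hi⟩ := by
  rw [incProd, List.prod_take_succ _ _ (by simpa using hi), incProd]
  simp

theorem countBefore_zero (f : Vertex r n → Bool) (v : Fin n → Vertex r n) :
    countBefore f v 0 = 0 := by
  simp [countBefore]

theorem countBefore_succ (f : Vertex r n → Bool) (v : Fin n → Vertex r n) {i : ℕ} (hi : i < n) :
    countBefore f v (i + 1) = countBefore f v i + (f (v ⟨i, hi⟩)).toNat := by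
  have h : ∀ k : Fin n, ((k : ℕ) < i + 1 ∧ f (v k)) ↔
      ((k : ℕ) < i ∧ f (v k)) ∨ (k = ⟨i, hi⟩ ∧ f (v ⟨i, hi⟩)) := by
    intro k
    rw [Nat.lt_succ_iff_lt_or_eq, or_and_right]
    refine or_congr Iff.rfl ⟨fun h => ?_, fun h => ?_⟩
    · obtain rfl : k = ⟨i, hi⟩ := Fin.ext h.1
      exact ⟨rfl, h.2⟩
    · obtain ⟨rfl, h⟩ := h
      exact ⟨rfl, h⟩
  rw [countBefore, Finset.filter_congr fun k _ => h k, Finset.filter_or,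
    Finset.card_union_of_disjoint, countBefore]
  · congr 1
    cases hf : f (v ⟨i, hi⟩) <;> simp [Finset.filter_eq']
  · rw [Finset.disjoint_filter]
    rintro k - ⟨h1, -⟩ ⟨rfl, -⟩
    exact lt_irrefl _ h1

theorem countBefore_congr (f : Vertex r n → Bool) {v v' : Fin n → Vertex r n} {i : ℕ}
    (h : ∀ k : Fin n, (k : ℕ) < i → v k = v' k) : countBefore f v i = countBefore f v' i := by
  rw [countBefore, countBefore]
  congr 1
  refine Finset.filter_congr fun k _ => and_congr_right fun hk => by rw [h k hk]

theorem incProd_congr {v v' : Fin n → Vertex r n} {i : ℕ} (hi : i ≤ n)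
    (h : ∀ k : Fin n, (k : ℕ) < i → v k = v' k) : incProd v i = incProd v' i := by
  induction i with
  | zero => simp [incProd]
  | succ i ih =>
    rw [incProd_succ v (by omega), incProd_succ v' (by omega),
      ih (by omega) fun k hk => h k (by omega), h ⟨i, by omega⟩ (Nat.lt_succ_self i)]

/-- Is the vertex not an open root? -/
def Vertex.isNonOpen (v : Vertex r n) : Bool := !v.isOpen

theorem IsInc.incProd {v : Fin n → Vertex r n} (hv : IsInc v) (i : ℕ) (hi : i ≤ n) :
    IncProd i (countBefore Vertex.isNonOpen v i) (countBefore Vertex.isClosed v i)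
      (incProd v i) := by
  induction i with
  | zero => simpa [WreathOS.incProd, countBefore_zero] using IncProd.one
  | succ i ih =>
    have hi' : i < n := by omega
    rw [incProd_succ v hi', countBefore_succ _ v hi', countBefore_succ _ v hi']
    cases h : v ⟨i, hi'⟩ with
    | openRoot => simpa [Vertex.factor, Vertex.isNonOpen, Vertex.isOpen, Vertex.isClosed]
        using (ih hi'.le).openRoot hi'
    | closedRoot => exact (ih hi'.le).closedRoot hi'
    | edge j η => exact (ih hi'.le).edge hi' j (hv _ _ _ h) η

theorem IncProd.exists_isInc {i q l : ℕ} {α : Form r n} (h : IncProd i q l α) (hi : i ≤ n) :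
    ∃ v : Fin n → Vertex r n, IsInc v ∧ (∀ k : Fin n, i ≤ k → v k = .openRoot) ∧
      countBefore Vertex.isNonOpen v i = q ∧ countBefore Vertex.isClosed v i = l ∧
      WreathOS.incProd v i = α := by
  have step : ∀ {i : ℕ} (hi : i < n) (v : Fin n → Vertex r n) (t : Vertex r n), IsInc v →
      (∀ k : Fin n, i ≤ k → v k = .openRoot) → (∀ j η, t = .edge j η → (j : ℕ) < i) →
      ∃ v' : Fin n → Vertex r n, IsInc v' ∧ (∀ k : Fin n, i + 1 ≤ k → v' k = .openRoot) ∧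
        (∀ f, countBefore f v' (i + 1) = countBefore f v i + (f t).toNat) ∧
        WreathOS.incProd v' (i + 1) = WreathOS.incProd v i * t.factor ⟨i, hi⟩ := by
    intro i hi v t hv ho ht
    have hc : ∀ k : Fin n, (k : ℕ) < i → Function.update v ⟨i, hi⟩ t k = v k := fun k hk =>
      Function.update_of_ne (fun e => hk.ne (congrArg Fin.val e)) _ _
    refine ⟨Function.update v ⟨i, hi⟩ t, fun k j η hk => ?_, fun k hk => ?_, fun f => ?_, ?_⟩
    · by_cases hki : k = ⟨i, hi⟩
      · subst hki
        rw [Function.update_self] at hk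
        exact ht j η hk
      · rw [Function.update_of_ne hki] at hk
        exact hv k j η hk
    · rw [Function.update_of_ne (fun e => by rw [e] at hk; exact absurd hk (by simp))]
      exact ho k (by omega)
    · rw [countBefore_succ _ _ hi, Function.update_self, countBefore_congr f hc]
    · rw [incProd_succ _ hi, Function.update_self, incProd_congr hi.le hc]
  induction h with
  | one => exact ⟨fun _ => .openRoot, fun k j η h => by simp at h, fun _ _ => rfl,
      countBefore_zero _ _, countBefore_zero _ _, by simp [WreathOS.incProd]⟩
  | openRoot hi _ ih =>
    obtain ⟨v, hv, ho, rfl, rfl, rfl⟩ := ih (by omega)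
    obtain ⟨v', h1, h2, h3, h4⟩ := step hi v .openRoot hv ho (by simp)
    exact ⟨v', h1, h2, h3 _, h3 _, by rw [h4]; exact mul_one _⟩
  | closedRoot hi _ ih =>
    obtain ⟨v, hv, ho, rfl, rfl, rfl⟩ := ih (by omega)
    obtain ⟨v', h1, h2, h3, h4⟩ := step hi v .closedRoot hv ho (by simp)
    exact ⟨v', h1, h2, h3 _, h3 _, h4⟩
  | edge hi j hj η _ ih =>
    obtain ⟨v, hv, ho, rfl, rfl, rfl⟩ := ih (by omega)
    obtain ⟨v', h1, h2, h3, h4⟩ := step hi v (.edge j η) hv ho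
      (fun j' η' e => by cases e; exact hj)
    exact ⟨v', h1, h2, h3 _, h3 _, h4⟩

/-! ### Comparison with the filtration -/

/-- The factors of α(F) are multiplied on one after another, and `incSpan_closed` keeps each partial
product in the span with the right counts. -/
theorem Forest.alpha_mem_incSpan (F : Forest r n) :
    F.alpha ∈ incSpan r n n (F.numEdges + F.numClosed) F.numClosed := by
  -- Of acyclicity only the absence of loops is used.
  have hne : ∀ i j η, F.vertex i = .edge j η → i ≠ j := by
    rintro i j η h rfl
    exact F.acyclic i (Relation.TransGen.single ⟨η, h⟩)
  have key : ∀ L : List (Fin n), ∀ q l : ℕ, ∀ x ∈ incSpan r n n q l,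
      x * (L.map F.alphaFactor).prod ∈ incSpan r n n
        (q + (L.map fun i => (F.vertex i).isEdge.toNat + (F.vertex i).isClosed.toNat).sum)
        (l + (L.map fun i => (F.vertex i).isClosed.toNat).sum) := by
    intro L
    induction L with
    | nil => intro q l x hx; simpa using hx
    | cons i L ih =>
      intro q l x hx
      simp only [List.map_cons, List.prod_cons, List.sum_cons, ← mul_assoc, ← add_assoc]
      have hcase : x * F.alphaFactor i ∈ incSpan r n n
          (q + (F.vertex i).isEdge.toNat + (F.vertex i).isClosed.toNat)
          (l + (F.vertex i).isClosed.toNat) := by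
        cases h : F.vertex i with
        | openRoot =>
          have e : F.alphaFactor i = algebraMap ℂ _ (F.eps i) := by
            simp only [Forest.alphaFactor, h]
          rw [e, ← Algebra.commutes, ← Algebra.smul_def]
          exact Submodule.smul_mem _ _ hx
        | closedRoot =>
          have e : F.alphaFactor i = omega r i := by simp only [Forest.alphaFactor, h]
          rw [e]
          exact incSpan_mul_omega hx i
        | edge j η =>
          have e : F.alphaFactor i = omegaEdge i j η := by simp only [Forest.alphaFactor, h]
          rw [e]
          exact incSpan_mul_omegaEdge hx (hne i j η h) η
      exact ih _ _ _ hcase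
  have := key (List.finRange n) 0 0 1 (incProd_one n le_rfl).mem
  rw [Forest.alpha, List.ofFn_eq_map]
  rw [one_mul, ← Fin.sum_univ_def, ← Fin.sum_univ_def, zero_add, zero_add,
    Finset.sum_add_distrib] at this
  have hcard : ∀ f : Fin n → Bool, ∑ i, (f i).toNat = (Finset.univ.filter fun i => f i).card := by
    intro f
    rw [Finset.card_filter]
    exact Finset.sum_congr rfl fun i _ => by cases f i <;> rfl
  rw [hcard, hcard] at this
  exact this

theorem IsInc.exists_forest {v : Fin n → Vertex r n} (hv : IsInc v) :
    ∃ F : Forest r n, F.numEdges + F.numClosed = countBefore Vertex.isNonOpen v n ∧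
      F.numClosed = countBefore Vertex.isClosed v n ∧
      SignEq F.alpha (WreathOS.incProd v n) := by
  have hac : ∀ i, ¬ Relation.TransGen (fun a b => ∃ η, v a = .edge b η) i i := by
    intro i hi
    have : ∀ j, Relation.TransGen (fun a b => ∃ η, v a = .edge b η) i j → j < i := by
      intro j hj
      induction hj with
      | single h => obtain ⟨η, h⟩ := h; exact hv _ _ _ h
      | tail _ h ih => obtain ⟨η, h⟩ := h; exact (hv _ _ _ h).trans ih
    exact lt_irrefl _ (this i hi)
  refine ⟨⟨v, hac⟩, ?_, ?_, ?_⟩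
  · rw [Forest.numEdges, Forest.numClosed, ← Finset.card_union_of_disjoint, countBefore]
    · congr 1
      ext i
      simp only [Finset.mem_union, Finset.mem_filter, Finset.mem_univ, true_and, i.2]
      cases v i <;> simp [Vertex.isEdge, Vertex.isClosed, Vertex.isNonOpen, Vertex.isOpen]
    · rw [Finset.disjoint_filter]
      intro i _
      simp only
      cases v i <;> simp [Vertex.isEdge, Vertex.isClosed]
  · rw [Forest.numClosed, countBefore]
    congr 1
    ext i
    simp
  · rw [WreathOS.incProd, List.take_of_length_le (by simp)]
    refine signEq_prod (List.forall₂_iff_get.2 ⟨by simp, fun i h1 h2 => ?_⟩)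
    simp only [List.get_eq_getElem, List.getElem_ofFn]
    generalize (⟨i, _⟩ : Fin n) = k
    cases h : v k with
    | openRoot =>
      have e : (⟨v, hac⟩ : Forest r n).alphaFactor k = algebraMap ℂ _
          ((⟨v, hac⟩ : Forest r n).eps k) := by simp only [Forest.alphaFactor, h]
      rw [e]
      exact eps_signEq _ _
    | closedRoot =>
      exact Or.inl (by simp only [Forest.alphaFactor, h, Vertex.factor])
    | edge j η =>
      exact Or.inl (by simp only [Forest.alphaFactor, h, Vertex.factor])

/-- One inclusion is straightening; the other holds because a graph whose edges all lead to smaller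
vertices is acyclic, hence a forest. -/
theorem filt_eq_incSpan (q : ℕ) (m : ℤ) : filt r n q m = incSpan r n n q m.toNat := by
  apply le_antisymm
  · rw [filt, Submodule.span_le]
    rintro _ ⟨F, ⟨h1, h2⟩, rfl⟩
    have := F.alpha_mem_incSpan
    have e : F.numEdges + F.numClosed = q := by exact_mod_cast h1
    rw [e] at this
    exact incSpan_anti (by omega) this
  · rw [incSpan, Submodule.span_le]
    rintro _ ⟨l, hl, h⟩
    obtain ⟨v, hv, -, rfl, rfl, rfl⟩ := h.exists_isInc le_rfl
    obtain ⟨F, h1, h2, h3⟩ := hv.exists_forest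
    have hF : F.alpha ∈ filt r n (countBefore Vertex.isNonOpen v n : ℕ) m :=
      Submodule.subset_span ⟨F, ⟨by exact_mod_cast h1, by omega⟩, rfl⟩
    rcases h3 with h3 | h3
    · exact h3 ▸ hF
    · rw [h3] at hF
      simpa using neg_mem hF

theorem filt_of_neg {p : ℤ} (hp : p < 0) (m : ℤ) : filt r n p m = ⊥ := by
  rw [filt, Submodule.span_eq_bot]
  rintro _ ⟨F, ⟨h1, -⟩, rfl⟩
  omega

end Increasing

end WreathOS

end

noncomputable section

namespace WreathOS

/-! ### Linear independence of increasing products -/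

section Indep

variable {r n : ℕ}

/-- Uniqueness of partial fractions: clearing denominators gives a polynomial with infinitely many
zeros, and evaluating it at one root isolates one coefficient. -/
theorem eq_zero_of_sum_inv_mul {β : Type*} [DecidableEq β] (s : Finset β) (root g : β → ℂ)
    (hroot : Set.InjOn root s) (bad : Set ℂ) (hbad : bad.Finite)
    (h : ∀ x ∉ bad, ∑ t ∈ s, (x - root t)⁻¹ * g t = 0) : ∀ t ∈ s, g t = 0 := by
  open Polynomial in
  let P : ℂ[X] := ∑ t ∈ s, C (g t) * ∏ u ∈ s.erase t, (X - C (root u))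
  have hP : P = 0 := by
    refine P.eq_zero_of_infinite_isRoot ?_
    refine ((hbad.union (s.finite_toSet.image root)).infinite_compl).mono fun x hx => ?_
    have hx1 : x ∉ bad := fun hb => hx (Or.inl hb)
    have hx2 : ∀ u ∈ s, x - root u ≠ 0 := fun u hu e =>
      hx (Or.inr ⟨u, hu, (sub_eq_zero.1 e).symm⟩)
    have := congrArg (fun y => (∏ u ∈ s, (x - root u)) * y) (h x hx1)
    simp only [mul_zero, Finset.mul_sum] at this
    change P.eval x = 0
    rw [← this]
    simp only [P, Polynomial.eval_finsetSum, Polynomial.eval_mul, Polynomial.eval_C,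
      Polynomial.eval_prod, Polynomial.eval_sub, Polynomial.eval_X]
    refine Finset.sum_congr rfl fun t ht => ?_
    rw [← Finset.mul_prod_erase s (fun u => x - root u) ht]
    field_simp [hx2 t ht]
  intro t ht
  have he := congrArg (Polynomial.eval (root t)) hP
  simp only [P, Polynomial.eval_finsetSum, Polynomial.eval_mul, Polynomial.eval_C,
    Polynomial.eval_prod, Polynomial.eval_sub, Polynomial.eval_X, Polynomial.eval_zero] at he
  rw [Finset.sum_eq_single_of_mem t ht] at he
  · refine (mul_eq_zero.1 he).resolve_right (Finset.prod_ne_zero_iff.2 fun u hu => ?_)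
    have := Finset.mem_erase.1 hu
    exact sub_ne_zero.2 fun e => this.1 (hroot this.2 ht e.symm)
  · intro u hu hut
    rw [Finset.prod_eq_zero (i := t) (by simp [ht, Ne.symm hut]), mul_zero]
    simp

theorem eq_zero_of_sum_inv_smul {β V : Type*} [DecidableEq β] [AddCommGroup V] [Module ℂ V]
    (s : Finset β) (root : β → ℂ) (g : β → V) (hroot : Set.InjOn root s) (bad : Set ℂ)
    (hbad : bad.Finite) (h : ∀ x ∉ bad, ∑ t ∈ s, (x - root t)⁻¹ • g t = 0) :
    ∀ t ∈ s, g t = 0 := by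
  intro t ht
  rw [← Module.forall_dual_apply_eq_zero_iff ℂ]
  intro f
  refine eq_zero_of_sum_inv_mul s root (fun u => f (g u)) hroot bad hbad (fun x hx => ?_) t ht
  simpa using congrArg f (h x hx)

theorem update_mem_T {z : Fin n → ℂ} (hz : z ∈ T r n) (i : Fin n) (x : ℂ) (hx : x ≠ 0)
    (hxz : ∀ j, x ^ r ≠ z j ^ r) : Function.update z i x ∈ T r n := by
  refine ⟨fun k => ?_, fun k j hkj => ?_⟩
  · by_cases hk : k = i
    · subst hk; simpa using hx
    · rw [Function.update_of_ne hk]; exact hz.1 k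
  · by_cases hk : k = i
    · subst hk
      rw [Function.update_self, Function.update_of_ne (Ne.symm hkj)]
      exact hxz j
    · by_cases hj : j = i
      · subst hj
        rw [Function.update_self, Function.update_of_ne hk]
        exact (hxz k).symm
      · rw [Function.update_of_ne hk, Function.update_of_ne hj]
        exact hz.2 k j hkj

/-- The pole, as a function of `z_i`, of the factor of the vertex `i`. -/
def Vertex.pole (z : Fin n → ℂ) : Vertex r n → ℂ
  | openRoot => 0
  | closedRoot => 0
  | edge j η => ((η : ℂˣ) : ℂ) * z j

/-- The contraction that pairs with `dz_i`. -/
def contrCoord (i : Fin n) : Ext n →ₗ[ℂ] Ext n :=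
  contr (Module.Dual.eval ℂ (Fin n → ℂ) (Pi.single i 1))

/-- Among the edges that lead to smaller vertices, dz_i occurs in the factor of `i` with coefficient
one, so contraction leaves only the scalar denominator. -/
theorem contrCoord_mul_factor (i : Fin n) (t : Vertex r n) (ht : ∀ j η, t = .edge j η → j < i)
    (z : T r n) (x : Ext n) (hx : contrCoord i x = 0) :
    contrCoord i (x * t.factor i z) =
      if t.isOpen then 0 else (z.1 i - t.pole z.1)⁻¹ • x := by
  have hdz : ∀ k : Fin n, (Module.Dual.eval ℂ (Fin n → ℂ) (Pi.single i 1)) (dz k) =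
      if k = i then 1 else 0 := by
    intro k
    change (Pi.single i (1 : ℂ) : Fin n → ℂ) k = _
    rw [Pi.single_apply]
  rw [contrCoord] at hx ⊢
  cases t with
  | openRoot =>
    simp only [Vertex.factor, Pi.one_apply, mul_one, hx, Vertex.isOpen, if_true]
  | closedRoot =>
    simp only [Vertex.factor, omega, mul_smul_comm, map_smul, contr_mul_ι, hx, hdz, if_true,
      zero_mul, sub_zero, one_smul, Vertex.isOpen, Vertex.pole]
    simp
  | edge j η =>
    have hj : j ≠ i := (ht j η rfl).ne
    have hd : (Module.Dual.eval ℂ (Fin n → ℂ) (Pi.single i 1)) (dz i - ((η : ℂˣ) : ℂ) • dz j)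
        = 1 := by rw [map_sub, map_smul, hdz, hdz, if_pos rfl, if_neg hj]; simp
    simp only [Vertex.factor, omegaEdge, mul_smul_comm, map_smul, contr_mul_ι, hx, hd,
      zero_mul, sub_zero, one_smul, Vertex.isOpen, Vertex.pole]
    simp

theorem contrCoord_mul_factor_of_lt {i k : Fin n} (hki : k < i) (t : Vertex r n)
    (ht : ∀ j η, t = .edge j η → j < k) (z : T r n) (x : Ext n) (hx : contrCoord i x = 0) :
    contrCoord i (x * t.factor k z) = 0 := by
  have hdz : ∀ k : Fin n, (Module.Dual.eval ℂ (Fin n → ℂ) (Pi.single i 1)) (dz k) =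
      if k = i then 1 else 0 := by
    intro k
    change (Pi.single i (1 : ℂ) : Fin n → ℂ) k = _
    rw [Pi.single_apply]
  rw [contrCoord] at hx ⊢
  cases t with
  | openRoot => simp only [Vertex.factor, Pi.one_apply, mul_one, hx]
  | closedRoot =>
    simp only [Vertex.factor, omega, mul_smul_comm, map_smul, contr_mul_ι, hx, hdz, hki.ne,
      if_false, zero_mul, sub_zero, zero_smul, smul_zero]
  | edge j η =>
    have hj : j ≠ i := ((ht j η rfl).trans hki).ne
    have hd : (Module.Dual.eval ℂ (Fin n → ℂ) (Pi.single i 1)) (dz k - ((η : ℂˣ) : ℂ) • dz j)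
        = 0 := by rw [map_sub, map_smul, hdz, hdz, if_neg hj, if_neg hki.ne]; simp
    simp only [Vertex.factor, omegaEdge, mul_smul_comm, map_smul, contr_mul_ι, hx, hd,
      zero_mul, sub_zero, zero_smul, smul_zero]

theorem contrCoord_incProd {v : Fin n → Vertex r n} (hv : IsInc v) (i : Fin n) (m : ℕ)
    (hm : m ≤ i) (z : T r n) : contrCoord i (incProd v m z) = 0 := by
  induction m with
  | zero => simp only [incProd, List.take_zero, List.prod_nil, Pi.one_apply]; exact contr_one _
  | succ m ih =>
    rw [incProd_succ v (by omega)]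
    exact contrCoord_mul_factor_of_lt (by rw [Fin.lt_def]; exact hm) _ (fun j η h => hv _ _ _ h) z _
      (ih (by omega))

theorem factor_congr {k : Fin n} (t : Vertex r n) (z z' : T r n) (hk : z.1 k = z'.1 k)
    (ht : ∀ j η, t = .edge j η → z.1 j = z'.1 j) : t.factor k z = t.factor k z' := by
  cases t with
  | openRoot => rfl
  | closedRoot => simp only [Vertex.factor, omega, hk]
  | edge j η => simp only [Vertex.factor, omegaEdge, hk, ht j η rfl]

theorem incProd_apply_congr {v : Fin n → Vertex r n} (hv : IsInc v) (m : ℕ) (hm : m ≤ n)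
    (z z' : T r n) (h : ∀ k : Fin n, (k : ℕ) < m → z.1 k = z'.1 k) :
    incProd v m z = incProd v m z' := by
  induction m with
  | zero => simp [incProd]
  | succ m ih =>
    rw [incProd_succ v (by omega), Pi.mul_apply, Pi.mul_apply,
      ih (by omega) fun k hk => h k (by omega)]
    congr 1
    exact factor_congr _ _ _ (h _ (Nat.lt_succ_self m))
      fun j η e => h j (by have := Fin.lt_def.1 (hv _ _ _ e); simp at this; omega)

/-- Vertex types are the same as elements of `Option (Option (Fin n × Mu r))`. -/
def Vertex.equivOption : Vertex r n ≃ Option (Option (Fin n × Mu r)) where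
  toFun
    | openRoot => none
    | closedRoot => some none
    | edge j η => some (some (j, η))
  invFun
    | none => openRoot
    | some none => closedRoot
    | some (some (j, η)) => edge j η
  left_inv t := by cases t <;> rfl
  right_inv t := by rcases t with _ | _ | _ <;> rfl

variable [NeZero r]

instance : Fintype (Mu r) := Fintype.ofFinite _

instance : Fintype (Vertex r n) := Fintype.ofEquiv _ Vertex.equivOption.symm

instance : DecidableEq (Vertex r n) := Classical.decEq _

-- The coefficients contain neither dz_i nor z_i. Contraction with dz_i removes the open root and
-- leaves a sum of simple fractions in z_i with distinct poles, so the other coefficients vanish;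
-- then the open root is the only term left.
open scoped Classical in
theorem eq_zero_of_sum_mul_factor (i : Fin n) (G : Vertex r n → Form r n)
    (hcontr : ∀ t z, contrCoord i (G t z) = 0)
    (hdep : ∀ t (z z' : T r n), (∀ k, k ≠ i → z.1 k = z'.1 k) → G t z = G t z')
    (hval : ∀ t, (¬ ∀ j η, t = .edge j η → j < i) → G t = 0)
    (h : ∑ t, G t * t.factor i = 0) (t : Vertex r n) : G t = 0 := by
  have main : ∀ t : Vertex r n, t.isOpen = false → G t = 0 := by
    intro t ht
    by_cases htv : ∀ j η, t = .edge j η → j < i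
    swap
    · exact hval t htv
    funext z
    let s : Finset (Vertex r n) :=
      Finset.univ.filter fun t => t.isOpen = false ∧ ∀ j η, t = .edge j η → j < i
    let bad : Set ℂ := {x | x = 0 ∨ ∃ j, x ^ r = z.1 j ^ r}
    have hbad : bad.Finite := by
      have h1 : ∀ j, {x : ℂ | x ^ r = z.1 j ^ r}.Finite := by
        intro j
        refine Set.Finite.subset (Polynomial.nthRoots r (z.1 j ^ r)).toFinset.finite_toSet ?_
        intro x hx
        simpa [Polynomial.mem_nthRoots (NeZero.pos r)] using hx
      refine Set.Finite.subset ((Set.finite_singleton 0).union (Set.finite_iUnion h1)) ?_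
      rintro x (hx | ⟨j, hj⟩)
      · exact Or.inl hx
      · exact Or.inr (Set.mem_iUnion.2 ⟨j, hj⟩)
    refine eq_zero_of_sum_inv_smul s (fun t => t.pole z.1) (fun t => G t z) ?_ bad hbad ?_ t
      (by simp only [s, Finset.mem_filter, Finset.mem_univ, true_and]; exact ⟨ht, htv⟩)
    -- Distinctness of the poles is exactly what `z ∈ T r n` provides: the coordinates are nonzero
    -- and their `r`-th powers are distinct.
    · intro a ha b hb hab
      have hη : ∀ η : Mu r, ((η : ℂˣ) : ℂ) ≠ 0 := fun η => Units.ne_zero _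
      cases a with
      | openRoot => simp [s, Vertex.isOpen] at ha
      | closedRoot =>
        cases b with
        | openRoot => simp [s, Vertex.isOpen] at hb
        | closedRoot => rfl
        | edge j η =>
          exact absurd hab.symm (mul_ne_zero (hη η) (z.2.1 j))
      | edge j η =>
        cases b with
        | openRoot => simp [s, Vertex.isOpen] at hb
        | closedRoot => exact absurd hab (mul_ne_zero (hη η) (z.2.1 j))
        | edge j' η' =>
          simp only [Vertex.pole] at hab
          have hjj : j = j' := by
            by_contra hne
            refine z.2.2 j j' hne ?_
            have := congrArg (· ^ r) hab
            simpa [mul_pow, root_pow] using this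
          subst hjj
          have := mul_right_cancel₀ (z.2.1 j) hab
          rw [Subtype.ext (Units.ext this)]
    · intro x hx
      have hx' : x ≠ 0 ∧ ∀ j, x ^ r ≠ z.1 j ^ r := by
        simpa [bad, not_or] using hx
      let z' : T r n := ⟨Function.update z.1 i x, update_mem_T z.2 i x hx'.1 hx'.2⟩
      have hz' : ∀ k, k ≠ i → z'.1 k = z.1 k := fun k hk => Function.update_of_ne hk _ _
      -- Only the `i`-th coordinate is moved, so the coefficients keep their values at `z` while the
      -- denominators become functions of `x`.
      have h0 := congrArg (contrCoord i) (congrFun h z')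
      rw [Finset.sum_apply, map_sum] at h0
      simp only [Pi.zero_apply, map_zero] at h0
      rw [← h0, ← Finset.sum_filter_add_sum_filter_not Finset.univ
        (fun t : Vertex r n => t.isOpen = false ∧ ∀ j η, t = .edge j η → j < i)]
      rw [Finset.sum_eq_zero (s := Finset.univ.filter fun t : Vertex r n =>
        ¬ (t.isOpen = false ∧ ∀ j η, t = .edge j η → j < i)), add_zero]
      · refine Finset.sum_congr rfl fun t ht => ?_
        have ht' := (Finset.mem_filter.1 ht).2
        rw [Pi.mul_apply, contrCoord_mul_factor i t ht'.2 z' _ (hcontr t z'), ht'.1,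
          if_neg (by simp), hdep t z' z hz']
        congr 3
        · exact (Function.update_self i x z.1).symm
        · cases t with
          | openRoot => rfl
          | closedRoot => rfl
          | edge j η => simp only [Vertex.pole]; rw [hz' j (ht'.2 j η rfl).ne]
      · intro t ht
        have ht' := (Finset.mem_filter.1 ht).2
        by_cases htv : ∀ j η, t = .edge j η → j < i
        · have hto : t.isOpen = true := by
            by_contra hc
            exact ht' ⟨by simpa using hc, htv⟩
          rw [Pi.mul_apply, contrCoord_mul_factor i t htv z' _ (hcontr t z'), hto, if_pos rfl]
        · rw [hval t htv, zero_mul]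
          exact map_zero _
  by_cases ht : t.isOpen = false
  · exact main t ht
  · have : t = .openRoot := by cases t <;> simp [Vertex.isOpen] at ht ⊢
    subst this
    rw [Finset.sum_eq_single .openRoot] at h
    · simpa [Vertex.factor] using h
    · intro u _ hu
      rw [main u (by cases u <;> simp [Vertex.isOpen] at hu ⊢), zero_mul]
    · simp

-- The factors of the vertices are stripped off from the last one downwards. Each step separates the
-- forests by the type of the current last vertex, by `eq_zero_of_sum_mul_factor`.
open scoped Classical in
theorem linearIndependent_incProd :
    LinearIndependent ℂ fun v : {v : Fin n → Vertex r n // IsInc v} => incProd v.1 n := by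
  rw [Fintype.linearIndependent_iff]
  intro c hc
  -- Among the forests that agree with `t` on the last `m` vertices, the relation still holds with
  -- those `m` factors removed. For `m = n` a single forest and the product `1` remain.
  have key : ∀ m ≤ n, ∀ t : Fin n → Vertex r n,
      ∑ v : {v : Fin n → Vertex r n // IsInc v} with (∀ k : Fin n, n - m ≤ (k : ℕ) → v.1 k = t k),
        c v • incProd v.1 (n - m) = 0 := by
    intro m
    induction m with
    | zero =>
      intro _ t
      rw [Finset.filter_true_of_mem (fun v _ k hk => absurd k.2 (by omega))]
      simpa using hc
    | succ m ih =>
      intro hm t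
      let i : Fin n := ⟨n - (m + 1), by omega⟩
      have hi : n - m = (i : ℕ) + 1 := by simp [i]; omega
      let G : Vertex r n → Form r n := fun τ =>
        ∑ v : {v : Fin n → Vertex r n // IsInc v}
          with (∀ k : Fin n, (i : ℕ) ≤ k → v.1 k = Function.update t i τ k), c v • incProd v.1 i
      have hG : ∀ τ, G τ = 0 := by
        refine eq_zero_of_sum_mul_factor i G (fun τ z => ?_) (fun τ z z' hz => ?_)
          (fun τ hτ => ?_) ?_
        · simp only [G, Finset.sum_apply, Pi.smul_apply, map_sum, map_smul,
            contrCoord_incProd (Subtype.prop _) i i le_rfl, smul_zero, Finset.sum_const_zero]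
        · simp only [G, Finset.sum_apply, Pi.smul_apply]
          refine Finset.sum_congr rfl fun v _ => ?_
          rw [incProd_apply_congr v.2 i i.2.le z z' fun k hk =>
            hz k fun e => hk.ne (congrArg Fin.val e)]
        · refine Finset.sum_eq_zero fun v hv => ?_
          exfalso
          refine hτ fun j η e => v.2 i j η ?_
          rw [(Finset.mem_filter.1 hv).2 i le_rfl, Function.update_self, e]
        · have h1 := ih (by omega) t
          rw [← h1, hi]
          simp only [G, Finset.sum_mul]
          rw [Finset.sum_comm' (s' := fun v => {v.1 i})
            (t' := Finset.univ.filter fun v : {v : Fin n → Vertex r n // IsInc v} =>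
              ∀ k : Fin n, (i : ℕ) + 1 ≤ (k : ℕ) → v.1 k = t k)]
          rotate_left
          · intro τ v
            simp only [Finset.mem_univ, Finset.mem_filter, true_and, Finset.mem_singleton]
            constructor
            · intro h
              refine ⟨by rw [h i le_rfl, Function.update_self], fun k hk => ?_⟩
              rw [h k (by omega), Function.update_of_ne (fun e => by rw [e] at hk; omega)]
            · rintro ⟨rfl, h⟩ k hk
              by_cases hki : k = i
              · rw [hki, Function.update_self]
              · rw [Function.update_of_ne hki]
                exact h k (Nat.lt_of_le_of_ne hk fun e => hki (Fin.ext e.symm))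
          · refine Finset.sum_congr rfl fun v _ => ?_
            rw [Finset.sum_singleton, incProd_succ v.1 i.2, smul_mul_assoc]
      have := hG (t i)
      simp only [G, Function.update_eq_self] at this
      exact this
  intro v
  have := key n le_rfl v.1
  rw [Nat.sub_self] at this
  rw [Finset.sum_eq_single_of_mem v (by simp)] at this
  · simp only [incProd, List.take_zero, List.prod_nil] at this
    have h1 : (1 : Form r n) ≠ 0 := by
      intro h
      -- The point (1, 2, …, n) shows that T(r,n) is not empty, so that `1 ≠ 0` among the forms:
      -- distinct positive integers have distinct `r`-th powers.
      have z : T r n := ⟨fun k => (k : ℂ) + 1, fun k =>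
        Nat.cast_add_one_ne_zero (k : ℕ), fun k j hkj h => hkj ?_⟩
      · exact one_ne_zero (congrFun h z)
      · simp only at h
        have h' : ((k : ℕ) + 1) ^ r = ((j : ℕ) + 1) ^ r := by exact_mod_cast h
        have := Nat.pow_left_injective (NeZero.ne r) h'
        exact Fin.ext (by simpa using this)
    exact (smul_eq_zero.1 this).resolve_right h1
  · intro w hw hwv
    exact absurd (Subtype.ext (funext fun k => (Finset.mem_filter.1 hw).2 k (Nat.zero_le _))) hwv

end Indep

end WreathOS

end

noncomputable section

namespace WreathOS

/-! ### Dimensions of the graded pieces -/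

section GrDim

variable {r n : ℕ}

theorem mk_gr_eq_zero {k l : ℤ} (x : filt r n (k + l) l) :
    (Submodule.Quotient.mk x : Gr r n k l) = 0 ↔ (x : Form r n) ∈ filt r n (k + l) (l + 1) := by
  rw [Submodule.Quotient.mk_eq_zero]
  rfl

theorem IsInc.mem_filt {v : Fin n → Vertex r n} (hv : IsInc v) {q : ℤ} {l : ℤ}
    (hq : (countBefore Vertex.isNonOpen v n : ℤ) = q)
    (hl : l ≤ countBefore Vertex.isClosed v n) : WreathOS.incProd v n ∈ filt r n q l := by
  rw [← hq, filt_eq_incSpan]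
  exact incSpan_anti (by omega) (hv.incProd n le_rfl).mem

theorem filt_le_span (q m : ℤ) : filt r n q m ≤ Submodule.span ℂ
    ((fun v : {v : Fin n → Vertex r n // IsInc v} => incProd v.1 n) ''
      {v | m ≤ countBefore Vertex.isClosed v.1 n}) := by
  rcases lt_or_ge q 0 with hq | hq
  · rw [filt_of_neg hq]
    exact bot_le
  · obtain ⟨q, rfl⟩ := Int.eq_ofNat_of_zero_le hq
    rw [filt_eq_incSpan, incSpan, Submodule.span_le]
    rintro _ ⟨l, hl, h⟩
    obtain ⟨v, hv, -, -, rfl, rfl⟩ := h.exists_isInc le_rfl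
    exact Submodule.subset_span ⟨⟨v, hv⟩, by simp only [Set.mem_ofPred_eq]; omega, rfl⟩

variable [NeZero r]

instance (q m : ℤ) : Module.Finite ℂ (filt r n q m) := by
  classical
  have : Module.Finite ℂ (Submodule.span ℂ
    ((fun v : {v : Fin n → Vertex r n // IsInc v} => incProd v.1 n) ''
      {v | m ≤ countBefore Vertex.isClosed v.1 n})) :=
    Module.Finite.span_of_finite ℂ (Set.toFinite _)
  exact Submodule.finiteDimensional_of_le (filt_le_span q m)

/-- The increasing forests with `q` vertices that are not open roots and `l` closed roots. -/
abbrev IncForest (r n q l : ℕ) : Type :=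
  {v : Fin n → Vertex r n // IsInc v ∧ countBefore Vertex.isNonOpen v n = q ∧
    countBefore Vertex.isClosed v n = l}

-- All increasing products are independent at once, so those with exactly `m` closed roots remain
-- independent modulo the span of those with more.
open scoped Classical in
theorem card_incForest_le_finrank {k l : ℤ} {q m : ℕ} (hq : k + l = q) (hl : l = m) :
    Fintype.card (IncForest r n q m) ≤ Module.finrank ℂ (Gr r n k l) := by
  let b : IncForest r n q m → Gr r n k l := fun v => Submodule.Quotient.mk
    ⟨incProd v.1 n, IsInc.mem_filt v.2.1 (by rw [hq, v.2.2.1]) (by rw [hl, v.2.2.2])⟩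
  have hb : LinearIndependent ℂ b := by
    rw [Fintype.linearIndependent_iff]
    intro c hc
    let ι : IncForest r n q m → {v : Fin n → Vertex r n // IsInc v} := fun v => ⟨v.1, v.2.1⟩
    have hι : Function.Injective ι := fun v w h => Subtype.ext (congrArg (fun x : {v : Fin n → Vertex r n // IsInc v} => x.1) h)
    have hli := linearIndependent_incProd (r := r) (n := n)
    have h1 : ∑ v, c v • incProd v.1 n ∈ filt r n (k + l) (l + 1) := by
      let x : filt r n (k + l) l := ∑ v : IncForest r n q m, c v •
        ⟨incProd v.1 n, IsInc.mem_filt v.2.1 (by rw [hq, v.2.2.1]) (by rw [hl, v.2.2.2])⟩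
      have hx : (Submodule.Quotient.mk x : Gr r n k l) = 0 := by
        rw [← hc]
        change Submodule.mkQ _ x = _
        simp only [x, map_sum, map_smul]
        rfl
      have := (mk_gr_eq_zero x).1 hx
      simpa [x] using this
    have h2 := hli.disjoint_span_image (s := {v | (l + 1 : ℤ) ≤ countBefore Vertex.isClosed v.1 n})
      (t := Set.range ι) (by
        rw [Set.disjoint_left]
        rintro _ hv ⟨w, rfl⟩
        have := w.2.2.2
        simp only [Set.mem_ofPred_eq, ι] at hv
        omega)
    have h3 : ∑ v, c v • incProd v.1 n = 0 := by
      refine Submodule.disjoint_def.1 h2 _ (filt_le_span _ _ h1)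
        (Submodule.sum_mem _ fun v _ => Submodule.smul_mem _ _
          (Submodule.subset_span ⟨ι v, ⟨v, rfl⟩, rfl⟩))
    exact Fintype.linearIndependent_iff.1 (hli.comp ι hι) c h3
  exact hb.fintype_card_le_finrank

end GrDim

end WreathOS

end

noncomputable section

namespace WreathOS

/-! ### Products of generators and of the odd variables `θ` -/

section Mixed

variable {r n : ℕ}

/-- The product of the odd variables `θ_i` with `i` in a list. -/
def thetaProd (L : List (Fin n)) : BigForm r n := (L.map (theta r)).prod

theorem big_mul_theta_swap {g : Form r n} (hg : IsOdd g) (i : Fin n) :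
    theta r i * big g = -(big g * theta r i) :=
  (isOdd_theta i).mul_swap (isOdd_big hg)

theorem thetaProd_mul_big (L : List (Fin n)) {g : Form r n} (hg : IsOdd g) :
    thetaProd L * big g = (-1 : ℂ) ^ L.length • (big g * thetaProd L) := by
  induction L with
  | nil => simp [thetaProd]
  | cons i L ih =>
    have e : (thetaProd (i :: L) : BigForm r n) = theta r i * thetaProd L := by simp [thetaProd]
    rw [e, mul_assoc, ih, mul_smul_comm, ← mul_assoc, big_mul_theta_swap hg, List.length_cons,
      pow_succ, mul_neg_one, neg_smul, neg_mul, smul_neg, mul_assoc]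

/-- The span of the products of forms in `incSpan r n n q l` with the odd variables in a list. -/
def mixed (L : List (Fin n)) (q l : ℕ) : Submodule ℂ (BigForm r n) :=
  (incSpan r n n q l).map ((LinearMap.mulRight ℂ (thetaProd L)).comp big.toLinearMap)

theorem mem_mixed {L : List (Fin n)} {q l : ℕ} {x : BigForm r n} :
    x ∈ mixed L q l ↔ ∃ α ∈ incSpan r n n q l, big α * thetaProd L = x := Iff.rfl

theorem mixed_anti {L : List (Fin n)} {q l l' : ℕ} (h : l ≤ l') :
    (mixed L q l' : Submodule ℂ (BigForm r n)) ≤ mixed L q l :=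
  Submodule.map_mono (incSpan_anti h)

theorem one_mem_mixed : (1 : BigForm r n) ∈ mixed [] 0 0 :=
  ⟨1, (incProd_one n le_rfl).mem, by simp [thetaProd]⟩

theorem mixed_mul_theta {L : List (Fin n)} {q l : ℕ} {x : BigForm r n} (hx : x ∈ mixed L q l)
    (i : Fin n) : x * theta r i ∈ mixed (L ++ [i]) q l := by
  obtain ⟨α, hα, rfl⟩ := mem_mixed.1 hx
  exact ⟨α, hα, by simp [thetaProd, mul_assoc]⟩

theorem mixed_mul_big {L : List (Fin n)} {q l q' l' : ℕ} {x : BigForm r n} (hx : x ∈ mixed L q l)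
    {g : Form r n} (hg : IsOdd g)
    (h : ∀ α ∈ incSpan r n n q l, α * g ∈ incSpan r n n q' l') : x * big g ∈ mixed L q' l' := by
  obtain ⟨α, hα, rfl⟩ := mem_mixed.1 hx
  refine ⟨(-1 : ℂ) ^ L.length • (α * g), Submodule.smul_mem _ _ (h α hα), ?_⟩
  rw [mul_assoc, thetaProd_mul_big L hg, mul_smul_comm, ← mul_assoc, ← map_mul]
  simp

theorem mixed_mul_omega {L : List (Fin n)} {q l : ℕ} {x : BigForm r n} (hx : x ∈ mixed L q l)
    (i : Fin n) : x * big (omega r i) ∈ mixed L (q + 1) (l + 1) :=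
  mixed_mul_big hx (isOdd_omega i) fun _ hα => incSpan_mul_omega hα i

theorem mixed_mul_ed {L : List (Fin n)} {q l : ℕ} {x : BigForm r n} (hx : x ∈ mixed L q l)
    {c a : Mu r × Fin n} (h : c.2 ≠ a.2) : x * big (ed c a) ∈ mixed L (q + 1) l :=
  mixed_mul_big hx (isOdd_ed c a) fun _ hα => incSpan_mul_omegaEdge hα h _

theorem mixed_le_of_perm {L L' : List (Fin n)} (h : L.Perm L') (q l : ℕ) :
    (mixed L q l : Submodule ℂ (BigForm r n)) ≤ mixed L' q l := by
  rintro _ ⟨α, hα, rfl⟩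
  have hs : SignEq (thetaProd L : BigForm r n) (thetaProd L') := by
    refine signEq_prod_perm (h.map _) ?_
    intro a ha b hb
    obtain ⟨i, -, rfl⟩ := List.mem_map.1 ha
    obtain ⟨j, -, rfl⟩ := List.mem_map.1 hb
    exact Or.inr ((isOdd_theta i).mul_swap (isOdd_theta j))
  rcases hs with h | h
  · exact ⟨α, hα, by simp [h]⟩
  · exact ⟨-α, neg_mem hα, by simp [h]⟩

theorem mixed_le_of_perm_finRange {L : List (Fin n)} (h : L.Perm (List.finRange n)) (q l : ℕ) :
    mixed L q l ≤ (incSpan r n n q l).map (thetaMul r n) := by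
  refine (mixed_le_of_perm h q l).trans ?_
  rintro _ ⟨α, hα, rfl⟩
  refine ⟨α, hα, ?_⟩
  simp [thetaMul_apply, thetaProd, thetaTop, List.ofFn_eq_map]

theorem link_mul (c a : Mu r × Fin n) (x : BigForm r n) :
    x * (link c a : BigForm r n) = x * big (ed c a) * theta r a.2 := by
  rw [link_coe, mul_assoc]

theorem center_comm (z : Subalgebra.center ℂ (BigForm r n)) (x : BigForm r n) :
    x * (z : BigForm r n) = z * x :=
  Subalgebra.mem_center_iff.1 z.2 x

/-- The letters of a word are above distinct points. -/
abbrev Distinct (w : List (Mu r × Fin n)) : Prop := w.Pairwise fun x y => x.2 ≠ y.2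

theorem mixed_mul_path (w : List (Mu r × Fin n)) :
    ∀ (c : Mu r × Fin n) {L : List (Fin n)} {q l : ℕ} {x : BigForm r n}, Distinct (c :: w) →
      x ∈ mixed L q l →
      x * (path link c w : Subalgebra.center ℂ (BigForm r n)) ∈
        mixed (L ++ w.map Prod.snd) (q + w.length) l := by
  induction w with
  | nil => intro c L q l x _ hx; simpa using hx
  | cons a w ih =>
    intro c L q l x hw hx
    have hca : c.2 ≠ a.2 := (List.pairwise_cons.1 hw).1 a (by simp)
    have h1 := ih a (List.pairwise_cons.1 hw).2 (mixed_mul_theta (mixed_mul_ed hx hca) a.2)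
    rw [path_cons, Subalgebra.coe_mul, ← mul_assoc, link_mul]
    convert h1 using 2
    · simp
    · simp; omega

/-- The element attached to an open block: `θ_c` times the product of links along the word. -/
def openWord : List (Mu r × Fin n) → BigForm r n
  | [] => 0
  | c :: w => theta r c.2 * (path link c w : Subalgebra.center ℂ (BigForm r n))

/-- The sum of the forms `ω_i` over the letters of a word. -/
def omegaSum (w : List (Mu r × Fin n)) : Form r n := (w.map fun x => omega r x.2).sum

/-- The element attached to a closed block. -/
def closedWord (w : List (Mu r × Fin n)) : BigForm r n := big (omegaSum w) * openWord w

/-- The element attached to a closed root at the first letter of a word. -/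
def rootedWord : List (Mu r × Fin n) → BigForm r n
  | [] => 0
  | c :: w => big (omega r c.2) * openWord (c :: w)

theorem isOdd_omegaSum (w : List (Mu r × Fin n)) : IsOdd (omegaSum w) := by
  refine isOdd_list_sum fun a ha => ?_
  obtain ⟨x, -, rfl⟩ := List.mem_map.1 ha
  exact isOdd_omega _

theorem mixed_mul_openWord {L : List (Fin n)} {q l : ℕ} {x : BigForm r n} (hx : x ∈ mixed L q l)
    {w : List (Mu r × Fin n)} (hw : Distinct w) :
    x * openWord w ∈ mixed (L ++ w.map Prod.snd) (q + (w.length - 1)) l := by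
  cases w with
  | nil => simp [openWord]
  | cons c w =>
    rw [openWord, ← mul_assoc]
    have := mixed_mul_path w c hw (mixed_mul_theta hx c.2)
    convert this using 2
    · simp
    · simp

theorem mixed_mul_omegaSum {L : List (Fin n)} {q l : ℕ} {x : BigForm r n} (hx : x ∈ mixed L q l)
    (w : List (Mu r × Fin n)) : x * big (omegaSum w) ∈ mixed L (q + 1) (l + 1) := by
  rw [omegaSum]
  induction w with
  | nil => simp
  | cons c w ih =>
    rw [List.map_cons, List.sum_cons, map_add, mul_add]
    exact add_mem (mixed_mul_omega hx _) ih

theorem mixed_mul_closedWord {L : List (Fin n)} {q l : ℕ} {x : BigForm r n} (hx : x ∈ mixed L q l)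
    {w : List (Mu r × Fin n)} (hw : Distinct w) (h0 : w ≠ []) :
    x * closedWord w ∈ mixed (L ++ w.map Prod.snd) (q + w.length) (l + 1) := by
  rw [closedWord, ← mul_assoc]
  have := mixed_mul_openWord (mixed_mul_omegaSum hx w) hw
  have h1 : 0 < w.length := List.length_pos_of_ne_nil h0
  convert this using 2
  omega

theorem omega_sub_mul_ed {c a : Mu r × Fin n} (h : c.2 ≠ a.2) :
    (omega r c.2 - omega r a.2) * ed c a = omega r c.2 * omega r a.2 := by
  have h1 := ed_mul_omega h
  rw [(isOdd_ed c a).mul_swap (isOdd_omega _), mul_sub] at h1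
  rw [sub_mul]
  have := congrArg (omega r c.2 * ed c a + ·) h1
  simpa [sub_eq_add_neg, add_comm, add_left_comm] using this

/-- Moving the closed root of a block changes the product by terms with more closed roots. -/
theorem mixed_mul_sub_openWord (w : List (Mu r × Fin n)) :
    ∀ (c : Mu r × Fin n) {L : List (Fin n)} {q l : ℕ} {x : BigForm r n}, Distinct (c :: w) →
      x ∈ mixed L q l → ∀ y ∈ c :: w,
      x * (big (omega r c.2 - omega r y.2) * openWord (c :: w)) ∈
        mixed (L ++ (c :: w).map Prod.snd) (q + (w.length + 1)) (l + 2) := by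
  induction w with
  | nil =>
    intro c L q l x _ hx y hy
    obtain rfl : y = c := by simpa using hy
    simp
  | cons a w ih =>
    intro c L q l x hw hx y hy
    rcases List.mem_cons.1 hy with rfl | hy
    · simp
    have hca : c.2 ≠ a.2 := (List.pairwise_cons.1 hw).1 a (by simp)
    have hw' := (List.pairwise_cons.1 hw).2
    have h1 := ih a hw' (mixed_mul_ed (mixed_mul_theta hx c.2) hca) y hy
    have h2 := mixed_mul_path w a hw'
      (mixed_mul_theta (mixed_mul_theta (mixed_mul_omega (mixed_mul_omega hx c.2) a.2) c.2) a.2)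
    -- Write ω_c - ω_y as (ω_c - ω_a) + (ω_a - ω_y). The first difference times the edge from `c` to
    -- `a` is ω_c ω_a, which has two closed roots; the second commutes with θ_c ω_{c,a} and is
    -- handled by induction on the tail.
    have e : x * (big (omega r c.2 - omega r y.2) * openWord (c :: a :: w)) =
        x * theta r c.2 * big (ed c a) *
          (big (omega r a.2 - omega r y.2) * openWord (a :: w)) -
        x * big (omega r c.2) * big (omega r a.2) * theta r c.2 * theta r a.2 *
          (path link a w : Subalgebra.center ℂ (BigForm r n)) := by
      have o1 : IsOdd (omega r a.2 - omega r y.2) := by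
        rw [sub_eq_add_neg, ← neg_one_smul ℂ (omega r y.2)]
        refine (isOdd_omega _).add fun z => ?_
        obtain ⟨v, hv⟩ := isOdd_omega y.2 z
        exact ⟨(-1 : ℂ) • v, by rw [map_smul, ← hv]; rfl⟩
      have e1 : big (omega r c.2 - omega r y.2) =
          big (omega r c.2 - omega r a.2) + big (omega r a.2 - omega r y.2) := by
        rw [← map_add, sub_add_sub_cancel]
      have e2 : openWord (c :: a :: w) = theta r c.2 * big (ed c a) * theta r a.2 *
          (path link a w : Subalgebra.center ℂ (BigForm r n)) := by
        rw [openWord, path_cons, Subalgebra.coe_mul, link_coe]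
        noncomm_ring
      have e3 : big (omega r a.2 - omega r y.2) * (theta r c.2 * big (ed c a)) =
          theta r c.2 * big (ed c a) * big (omega r a.2 - omega r y.2) := by
        rw [← mul_assoc, ← neg_eq_iff_eq_neg.2 (big_mul_theta_swap o1 c.2), neg_mul, mul_assoc,
          mul_assoc, ← map_mul, ← map_mul, (isOdd_ed c a).mul_swap o1, map_neg, mul_neg]
      have e4 : big (omega r c.2 - omega r a.2) * (theta r c.2 * big (ed c a)) =
          -(big (omega r c.2) * big (omega r a.2) * theta r c.2) := by
        rw [big_mul_theta_swap (isOdd_ed c a), mul_neg, ← mul_assoc, ← map_mul,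
          omega_sub_mul_ed hca, map_mul]
      rw [e1, e2, add_mul, mul_add, openWord]
      rw [show big (omega r c.2 - omega r a.2) * (theta r c.2 * big (ed c a) * theta r a.2 *
          (path link a w : Subalgebra.center ℂ (BigForm r n))) =
          big (omega r c.2 - omega r a.2) * (theta r c.2 * big (ed c a)) * theta r a.2 *
          (path link a w : Subalgebra.center ℂ (BigForm r n)) by noncomm_ring, e4]
      rw [show big (omega r a.2 - omega r y.2) * (theta r c.2 * big (ed c a) * theta r a.2 *
          (path link a w : Subalgebra.center ℂ (BigForm r n))) =
          big (omega r a.2 - omega r y.2) * (theta r c.2 * big (ed c a)) * theta r a.2 *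
          (path link a w : Subalgebra.center ℂ (BigForm r n)) by noncomm_ring, e3]
      noncomm_ring
    rw [e]
    refine sub_mem ?_ ?_
    · convert h1 using 2
      · simp
      · simp; omega
    · convert h2 using 2
      · simp
      · simp; omega

/-- A closed block carries the sum of ω over its letters, so |w| ω_c differs from it by the sum of
the differences ω_c - ω_y, and these are negligible by `mixed_mul_sub_openWord`. -/
theorem rootedWord_eq {w : List (Mu r × Fin n)} (h0 : w ≠ []) :
    ∃ c ∈ w, ∃ t, w = c :: t ∧ rootedWord w = (w.length : ℂ)⁻¹ • (closedWord w +
      (w.map fun y => big (omega r c.2 - omega r y.2) * openWord w).sum) := by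
  obtain ⟨c, t, rfl⟩ := List.exists_cons_of_ne_nil h0
  refine ⟨c, by simp, t, rfl, ?_⟩
  have hl : (((c :: t).length : ℕ) : ℂ) ≠ 0 :=
    Nat.cast_ne_zero.2 (Nat.succ_ne_zero _)
  rw [eq_inv_smul_iff₀ hl, rootedWord, closedWord, omegaSum, map_list_sum, List.sum_map_mul_right,
    ← add_mul, ← smul_mul_assoc]
  congr 1
  generalize (c :: t) = L
  induction L with
  | nil => simp
  | cons y L ih =>
    simp only [List.length_cons, List.map_cons, List.sum_cons, Nat.cast_add, Nat.cast_one, add_smul,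
      one_smul, map_sub] at ih ⊢
    rw [ih]
    abel

/-- Modulo more closed roots, a root at the first letter may be replaced by the average over the
block, which no longer depends on the order of the letters. Both claims are proved together because
the error of one block is multiplied by the rooted words of the remaining ones. -/
theorem mixed_mul_rooted_prod (C : List (List (Mu r × Fin n))) :
    ∀ {L : List (Fin n)} {q l : ℕ} {x : BigForm r n}, x ∈ mixed L q l →
      (∀ w ∈ C, w ≠ [] ∧ Distinct w) →
      x * (C.map closedWord).prod ∈
        mixed (L ++ C.flatten.map Prod.snd) (q + C.flatten.length) (l + C.length) ∧
      x * (C.map rootedWord).prod - (C.map fun w => (w.length : ℂ)⁻¹).prod •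
        (x * (C.map closedWord).prod) ∈
        mixed (L ++ C.flatten.map Prod.snd) (q + C.flatten.length) (l + C.length + 1) := by
  induction C with
  | nil => intro L q l x hx _; simpa using hx
  | cons w C ih =>
    intro L q l x hx hC
    obtain ⟨h0, hw⟩ := hC w (by simp)
    have hC' : ∀ w ∈ C, w ≠ [] ∧ Distinct w := fun v hv => hC v (by simp [hv])
    have hcl := mixed_mul_closedWord hx hw h0
    have h1 := ih hcl hC'
    have hL : L ++ (w :: C).flatten.map Prod.snd =
      L ++ w.map Prod.snd ++ C.flatten.map Prod.snd := by simp
    have hq : q + (w :: C).flatten.length = q + w.length + C.flatten.length := by simp; omega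
    have hl : l + (w :: C).length = l + 1 + C.length := by simp; omega
    rw [hL, hq, hl]
    simp only [List.map_cons, List.prod_cons, ← mul_assoc]
    refine ⟨h1.1, ?_⟩
    obtain ⟨c, -, t, hct, hr⟩ := rootedWord_eq h0
    set D := (w.map fun y => big (omega r c.2 - omega r y.2) * openWord w).sum with hD
    have hxD : x * D ∈ mixed (L ++ w.map Prod.snd) (q + w.length) (l + 2) := by
      rw [hD, ← List.sum_map_mul_left]
      refine list_sum_mem ?_
      intro z hz
      obtain ⟨y, hy, rfl⟩ := List.mem_map.1 hz
      subst hct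
      simpa using mixed_mul_sub_openWord t c hw hx y hy
    have h2 := ih hxD hC'
    have h2' : x * D * (C.map rootedWord).prod ∈ mixed (L ++ w.map Prod.snd ++
        C.flatten.map Prod.snd) (q + w.length + C.flatten.length) (l + 1 + C.length + 1) := by
      have := add_mem (mixed_anti (by omega) h2.2)
        (Submodule.smul_mem _ (C.map fun w => (w.length : ℂ)⁻¹).prod h2.1)
      rw [sub_add_cancel] at this
      exact mixed_anti (by omega) this
    have := add_mem (Submodule.smul_mem _ (w.length : ℂ)⁻¹ h1.2)
      (Submodule.smul_mem _ (w.length : ℂ)⁻¹ h2')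
    convert this using 1
    rw [hr, mul_smul_comm, mul_add, smul_mul_assoc, add_mul, smul_sub, smul_add, mul_smul]
    abel

end Mixed

end WreathOS

end

noncomputable section

namespace WreathOS

/-! ### Increasing products as combinations of products over blocks -/

section Build

variable {r n : ℕ}

/-- The product over open blocks and closed blocks, the latter with a root at the first letter. -/
def rootedProd (O C : List (List (Mu r × Fin n))) : BigForm r n :=
  (O.map openWord).prod * (C.map rootedWord).prod

/-- The blocks in two lists partition the points before `i`. -/
structure Covers (i : ℕ) (O C : List (List (Mu r × Fin n))) : Prop where
  perm : ((O.flatten ++ C.flatten).map fun x => (x.2 : ℕ)).Perm (List.range i)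
  ne_nil_left : ∀ w ∈ O, w ≠ []
  ne_nil_right : ∀ w ∈ C, w ≠ []

/-- The span of the products over blocks that partition the points before `i`. -/
def rootedSpan (r n i q l : ℕ) : Submodule ℂ (BigForm r n) :=
  Submodule.span ℂ {x | ∃ O C, Covers i O C ∧ C.length = l ∧ q + O.length = i ∧ x = rootedProd O C}

theorem Covers.distinct {i : ℕ} {O C : List (List (Mu r × Fin n))} (h : Covers i O C) :
    Distinct (O.flatten ++ C.flatten) := by
  have := h.perm.nodup_iff.2 List.nodup_range
  refine (List.pairwise_map.1 this).imp ?_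
  intro x y hxy h
  exact hxy (congrArg _ h)

theorem distinct_of_mem_flatten {L : List (List (Mu r × Fin n))} (h : Distinct L.flatten)
    {w : List (Mu r × Fin n)} (hw : w ∈ L) : Distinct w :=
  (List.pairwise_flatten.1 h).1 w hw

theorem Covers.distinct_left {i : ℕ} {O C : List (List (Mu r × Fin n))} (h : Covers i O C)
    {w : List (Mu r × Fin n)} (hw : w ∈ O) : Distinct w :=
  distinct_of_mem_flatten (List.pairwise_append.1 h.distinct).1 hw

theorem Covers.distinct_right {i : ℕ} {O C : List (List (Mu r × Fin n))} (h : Covers i O C)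
    {w : List (Mu r × Fin n)} (hw : w ∈ C) : Distinct w :=
  distinct_of_mem_flatten (List.pairwise_append.1 h.distinct).2.1 hw

theorem Covers.lt {i : ℕ} {O C : List (List (Mu r × Fin n))} (h : Covers i O C)
    {x : Mu r × Fin n} (hx : x ∈ O.flatten ++ C.flatten) : (x.2 : ℕ) < i :=
  List.mem_range.1 (h.perm.mem_iff.1 (List.mem_map_of_mem (f := fun x => (x.2 : ℕ)) hx))

theorem Covers.exists_mem {i : ℕ} {O C : List (List (Mu r × Fin n))} (h : Covers i O C)
    {j : Fin n} (hj : (j : ℕ) < i) : ∃ x ∈ O.flatten ++ C.flatten, x.2 = j := by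
  obtain ⟨x, hx, e⟩ := List.mem_map.1 (h.perm.mem_iff.2 (List.mem_range.2 hj))
  exact ⟨x, hx, Fin.ext e⟩

theorem rootedWord_mem_center (w : List (Mu r × Fin n)) :
    rootedWord w ∈ Subalgebra.center ℂ (BigForm r n) := by
  cases w with
  | nil => exact zero_mem _
  | cons c w =>
    rw [rootedWord, openWord, ← mul_assoc]
    exact mul_mem ((isOdd_big (isOdd_omega _)).mul_mem_center (isOdd_theta _)) (path link c w).2

theorem rootedProd_mem_center (C : List (List (Mu r × Fin n))) :
    (C.map rootedWord).prod ∈ Subalgebra.center ℂ (BigForm r n) := by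
  refine list_prod_mem fun x hx => ?_
  obtain ⟨w, -, rfl⟩ := List.mem_map.1 hx
  exact rootedWord_mem_center w

/-- The first letter is kept. This matters for closed blocks, whose root sits there. -/
theorem openWord_mul_link {w : List (Mu r × Fin n)} {y z : Mu r × Fin n} (hw : Distinct w)
    (hy : y ∈ w) (hz : ∀ x ∈ w, x.2 ≠ z.2) :
    openWord w * (link y z : BigForm r n) ∈
      Submodule.span ℂ {x | ∃ w', w'.Perm (z :: w) ∧ w' ≠ [] ∧ w'.head? = w.head? ∧
        x = openWord w'} := by
  cases w with
  | nil => simp at hy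
  | cons c w =>
    have h := path_mul_link (Z := Subalgebra.center ℂ (BigForm r n)) forkRel_link c z y w hw hz hy
    have := Submodule.mem_map_of_mem
      (f := (LinearMap.mulLeft ℂ (theta r c.2)).comp (Subalgebra.center ℂ (BigForm r n)).val.toLinearMap) h
    rw [Submodule.map_span] at this
    rw [openWord, mul_assoc, ← Subalgebra.coe_mul]
    refine Submodule.span_mono ?_ this
    rintro _ ⟨_, ⟨w', hw', rfl⟩, rfl⟩
    exact ⟨c :: w', (hw'.cons c).trans (List.Perm.swap _ _ _), by simp, by simp, rfl⟩

theorem rootedWord_mul_link {w : List (Mu r × Fin n)} {y z : Mu r × Fin n} (hw : Distinct w)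
    (hy : y ∈ w) (hz : ∀ x ∈ w, x.2 ≠ z.2) :
    rootedWord w * (link y z : BigForm r n) ∈
      Submodule.span ℂ {x | ∃ w', w'.Perm (z :: w) ∧ w' ≠ [] ∧ x = rootedWord w'} := by
  have h := openWord_mul_link hw hy hz
  cases w with
  | nil => simp at hy
  | cons c w =>
    have := Submodule.mem_map_of_mem (f := LinearMap.mulLeft ℂ (big (omega r c.2))) h
    rw [Submodule.map_span] at this
    rw [rootedWord, mul_assoc]
    refine Submodule.span_mono ?_ this
    rintro _ ⟨_, ⟨w', hw', h0, h1, rfl⟩, rfl⟩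
    obtain ⟨c', t, rfl⟩ := List.exists_cons_of_ne_nil h0
    obtain rfl : c' = c := by simpa using h1
    exact ⟨_, hw', h0, rfl⟩

theorem perm_flatten_insert {α : Type*} (O₁ O₂ : List (List α)) {w w' : List α} {z : α}
    (h : w'.Perm (z :: w)) : (O₁ ++ w' :: O₂).flatten.Perm (z :: (O₁ ++ w :: O₂).flatten) := by
  simp only [List.flatten_append, List.flatten_cons]
  refine ((h.append_right _).append_left _).trans ?_
  simp

theorem Covers.insert {i : ℕ} {O C O' C' : List (List (Mu r × Fin n))} (h : Covers i O C)
    {z : Mu r × Fin n} (hz : (z.2 : ℕ) = i)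
    (hp : (O'.flatten ++ C'.flatten).Perm (z :: (O.flatten ++ C.flatten)))
    (hO : ∀ w ∈ O', w ≠ []) (hC : ∀ w ∈ C', w ≠ []) : Covers (i + 1) O' C' := by
  refine ⟨(hp.map _).trans ?_, hO, hC⟩
  rw [List.map_cons, hz, List.range_succ]
  exact (h.perm.cons i).trans (List.perm_append_singleton i _).symm

/-- The vertex `j` lies in exactly one block, and `path_mul_link` inserts the new vertex into the
word of that block. Links are central, so the new one can be moved next to it. -/
theorem rootedSpan_mul_link {i q l : ℕ} (hi : i < n) {j : Fin n} (hj : (j : ℕ) < i) (η : Mu r)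
    {x : BigForm r n} (hx : x ∈ rootedSpan r n i q l) :
    x * (big (omegaEdge ⟨i, hi⟩ j η) * theta r ⟨i, hi⟩) ∈ rootedSpan r n (i + 1) (q + 1) l := by
  suffices h : rootedSpan r n i q l ≤ (rootedSpan r n (i + 1) (q + 1) l).comap
      (LinearMap.mulRight ℂ (big (omegaEdge ⟨i, hi⟩ j η) * theta r ⟨i, hi⟩)) from h hx
  rw [rootedSpan, Submodule.span_le]
  rintro _ ⟨O, C, hcov, rfl, hq, rfl⟩
  obtain ⟨y, hy, hyj⟩ := hcov.exists_mem hj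
  -- The letter above `j` may carry a label already; the new label makes the ratio of the two equal
  -- to `η`.
  let z : Mu r × Fin n := (y.1 * η, ⟨i, hi⟩)
  have hlink : big (omegaEdge ⟨i, hi⟩ j η) * theta r ⟨i, hi⟩ = (link y z : BigForm r n) := by
    rw [link_coe, ed_symm, ed]
    simp [z, hyj]
  have hne : ∀ x ∈ O.flatten ++ C.flatten, x.2 ≠ z.2 := by
    intro x hx h
    have := hcov.lt hx
    simp [h, z] at this
  change rootedProd O C * _ ∈ rootedSpan r n (i + 1) (q + 1) C.length
  rw [hlink, rootedProd]
  rcases List.mem_append.1 hy with hy | hy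
  · obtain ⟨w, hwO, hyw⟩ := List.mem_flatten.1 hy
    obtain ⟨O₁, O₂, rfl⟩ := List.append_of_mem hwO
    have h := openWord_mul_link (hcov.distinct_left hwO) hyw fun x hx => hne x
      (List.mem_append_left _ (List.mem_flatten.2 ⟨w, hwO, hx⟩))
    have := Submodule.mem_map_of_mem (f := (LinearMap.mulLeft ℂ (O₁.map openWord).prod).comp
      (LinearMap.mulRight ℂ ((O₂.map openWord).prod * (C.map rootedWord).prod))) h
    rw [Submodule.map_span] at this
    have e : ((O₁ ++ w :: O₂).map openWord).prod * (C.map rootedWord).prod *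
        (link y z : BigForm r n) = (O₁.map openWord).prod * (openWord w * (link y z : BigForm r n) *
          ((O₂.map openWord).prod * (C.map rootedWord).prod)) := by
      rw [mul_assoc (openWord w), ← center_comm]
      simp only [List.map_append, List.map_cons, List.prod_append, List.prod_cons]
      noncomm_ring
    rw [e]
    refine Submodule.span_mono ?_ this
    rintro _ ⟨_, ⟨w', hw', h0, -, rfl⟩, rfl⟩
    refine ⟨O₁ ++ w' :: O₂, C, hcov.insert (z := z) rfl ?_ ?_ hcov.ne_nil_right, rfl, ?_, ?_⟩
    · exact (perm_flatten_insert O₁ O₂ hw').append_right _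
    · intro v hv
      rcases List.mem_append.1 hv with hv | hv
      · exact hcov.ne_nil_left v (by simp [hv])
      · rcases List.mem_cons.1 hv with rfl | hv
        · exact h0
        · exact hcov.ne_nil_left v (by simp [hv])
    · simp at hq ⊢; omega
    · simp [rootedProd, mul_assoc]
  · obtain ⟨w, hwC, hyw⟩ := List.mem_flatten.1 hy
    obtain ⟨C₁, C₂, rfl⟩ := List.append_of_mem hwC
    have h := rootedWord_mul_link (hcov.distinct_right hwC) hyw fun x hx => hne x
      (List.mem_append_right _ (List.mem_flatten.2 ⟨w, hwC, hx⟩))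
    have := Submodule.mem_map_of_mem (f := (LinearMap.mulLeft ℂ ((O.map openWord).prod *
      (C₁.map rootedWord).prod)).comp (LinearMap.mulRight ℂ (C₂.map rootedWord).prod)) h
    rw [Submodule.map_span] at this
    have e : (O.map openWord).prod * ((C₁ ++ w :: C₂).map rootedWord).prod *
        (link y z : BigForm r n) = (O.map openWord).prod * (C₁.map rootedWord).prod *
          (rootedWord w * (link y z : BigForm r n) * (C₂.map rootedWord).prod) := by
      rw [mul_assoc (rootedWord w), ← center_comm]
      simp only [List.map_append, List.map_cons, List.prod_append, List.prod_cons]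
      noncomm_ring
    rw [e]
    refine Submodule.span_mono ?_ this
    rintro _ ⟨_, ⟨w', hw', h0, rfl⟩, rfl⟩
    refine ⟨O, C₁ ++ w' :: C₂, hcov.insert (z := z) rfl ?_ hcov.ne_nil_left ?_, by simp, ?_, ?_⟩
    · exact ((perm_flatten_insert C₁ C₂ hw').append_left _).trans List.perm_middle
    · intro v hv
      rcases List.mem_append.1 hv with hv | hv
      · exact hcov.ne_nil_right v (by simp [hv])
      · rcases List.mem_cons.1 hv with rfl | hv
        · exact h0
        · exact hcov.ne_nil_right v (by simp [hv])
    · omega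
    · simp [rootedProd]

theorem rootedSpan_mul_theta {i q l : ℕ} (hi : i < n) {x : BigForm r n}
    (hx : x ∈ rootedSpan r n i q l) : x * theta r ⟨i, hi⟩ ∈ rootedSpan r n (i + 1) q l := by
  suffices h : rootedSpan r n i q l ≤ (rootedSpan r n (i + 1) q l).comap
      (LinearMap.mulRight ℂ (theta r ⟨i, hi⟩)) from h hx
  rw [rootedSpan, Submodule.span_le]
  rintro _ ⟨O, C, hcov, rfl, hq, rfl⟩
  refine Submodule.subset_span ⟨O ++ [[(1, ⟨i, hi⟩)]], C,
    hcov.insert (z := (1, ⟨i, hi⟩)) rfl ?_ ?_ hcov.ne_nil_right, rfl, ?_, ?_⟩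
  · simp
  · intro v hv
    rcases List.mem_append.1 hv with hv | hv
    · exact hcov.ne_nil_left v hv
    · simp at hv; simp [hv]
  · simp; omega
  · have := Subalgebra.mem_center_iff.1 (rootedProd_mem_center C) (theta r ⟨i, hi⟩)
    simp [rootedProd, openWord, mul_assoc, this]

theorem rootedSpan_mul_omega {i q l : ℕ} (hi : i < n) {x : BigForm r n}
    (hx : x ∈ rootedSpan r n i q l) : x * (big (omega r ⟨i, hi⟩) * theta r ⟨i, hi⟩) ∈
      rootedSpan r n (i + 1) (q + 1) (l + 1) := by
  suffices h : rootedSpan r n i q l ≤ (rootedSpan r n (i + 1) (q + 1) (l + 1)).comap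
      (LinearMap.mulRight ℂ (big (omega r ⟨i, hi⟩) * theta r ⟨i, hi⟩)) from h hx
  rw [rootedSpan, Submodule.span_le]
  rintro _ ⟨O, C, hcov, rfl, hq, rfl⟩
  refine Submodule.subset_span ⟨O, C ++ [[(1, ⟨i, hi⟩)]],
    hcov.insert (z := (1, ⟨i, hi⟩)) rfl ?_ hcov.ne_nil_left ?_, by simp, by omega, ?_⟩
  · rw [List.flatten_append, ← List.append_assoc]
    exact List.perm_append_singleton _ _
  · intro v hv
    rcases List.mem_append.1 hv with hv | hv
    · exact hcov.ne_nil_right v hv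
    · simp at hv; simp [hv]
  · simp [rootedProd, rootedWord, openWord, mul_assoc]

/-- The product of the first odd variables. -/
def thetaBefore (r n i : ℕ) : BigForm r n := thetaProd ((List.finRange n).take i)

theorem thetaBefore_succ {i : ℕ} (hi : i < n) :
    thetaBefore r n (i + 1) = thetaBefore r n i * theta r ⟨i, hi⟩ := by
  rw [thetaBefore, thetaProd, ← List.take_concat_get' _ i (by simpa using hi)]
  simp [thetaBefore, thetaProd]

/-- An increasing product adds one vertex at a time: an open root starts an open block, a closed
root a closed block, and an edge enlarges an existing block. -/
theorem IncProd.big_mul_mem_rootedSpan {i q l : ℕ} {α : Form r n} (h : IncProd i q l α) :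
    big α * thetaBefore r n i ∈ rootedSpan r n i q l := by
  -- The new factor moves past the earlier odd variables to stand beside its own; this costs only a
  -- sign.
  have key : ∀ (i : ℕ) (hi : i < n) (α g : Form r n), IsOdd g →
      big (α * g) * thetaBefore r n (i + 1) = (-1 : ℂ) ^ ((List.finRange n).take i).length •
        (big α * thetaBefore r n i * (big g * theta r ⟨i, hi⟩)) := by
    intro i hi α g hg
    have := congrArg (fun x => (-1 : ℂ) ^ ((List.finRange n).take i).length • x)
      (thetaProd_mul_big ((List.finRange n).take i) hg)
    simp only [smul_smul, ← mul_pow, neg_one_mul, neg_neg, one_pow, one_smul] at this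
    rw [thetaBefore_succ hi, map_mul, thetaBefore]
    rw [show big α * big g * (thetaProd ((List.finRange n).take i) * theta r ⟨i, hi⟩) =
      big α * (big g * thetaProd ((List.finRange n).take i)) * theta r ⟨i, hi⟩ by noncomm_ring,
      ← this, mul_smul_comm, smul_mul_assoc]
    congr 1
    noncomm_ring
  induction h with
  | one =>
    refine Submodule.subset_span ⟨[], [], ⟨by simp, by simp, by simp⟩, rfl, rfl, ?_⟩
    simp [thetaBefore, thetaProd, rootedProd]
  | openRoot hi _ ih =>
    rw [thetaBefore_succ hi, ← mul_assoc]
    exact rootedSpan_mul_theta hi ih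
  | closedRoot hi _ ih =>
    rw [key _ hi _ _ (isOdd_omega _)]
    exact Submodule.smul_mem _ _ (rootedSpan_mul_omega hi ih)
  | edge hi j hj η _ ih =>
    rw [key _ hi _ _ (isOdd_omegaEdge _ _ _)]
    exact Submodule.smul_mem _ _ (rootedSpan_mul_link hi hj η ih)

/-- The product over open blocks and closed blocks. -/
def blockProd (O C : List (List (Mu r × Fin n))) : BigForm r n :=
  (O.map openWord).prod * (C.map closedWord).prod

/-- An open block has one edge less than it has letters. Stating the degree by an equation for `q'`
avoids truncated subtraction. -/
theorem mixed_mul_open_prod (O : List (List (Mu r × Fin n))) :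
    ∀ {L : List (Fin n)} {q l : ℕ} {x : BigForm r n}, x ∈ mixed L q l →
      (∀ w ∈ O, w ≠ [] ∧ Distinct w) →
      ∃ q', q' + O.length = q + O.flatten.length ∧
      x * (O.map openWord).prod ∈ mixed (L ++ O.flatten.map Prod.snd) q' l := by
  induction O with
  | nil => intro L q l x hx _; exact ⟨q, by simp, by simpa using hx⟩
  | cons w O ih =>
    intro L q l x hx hO
    obtain ⟨h0, hw⟩ := hO w (by simp)
    obtain ⟨q', h1, h2⟩ := ih (mixed_mul_openWord hx hw) fun v hv => hO v (by simp [hv])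
    have hp := List.length_pos_of_ne_nil h0
    refine ⟨q', by simp only [List.flatten_cons, List.length_append, List.length_cons]; omega, ?_⟩
    convert h2 using 1
    · simp
    · simp [mul_assoc]

theorem Covers.perm_finRange {O C : List (List (Mu r × Fin n))} (h : Covers n O C) :
    ((O.flatten ++ C.flatten).map Prod.snd).Perm (List.finRange n) := by
  rw [← List.map_perm_map_iff Fin.val_injective]
  simpa [List.map_map, Function.comp_def] using h.perm

theorem Covers.blockProd_mem {q : ℕ} {O C : List (List (Mu r × Fin n))} (h : Covers n O C)
    (hq : q + O.length = n) :
    blockProd O C ∈ (incSpan r n n q C.length).map (thetaMul r n) ∧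
    rootedProd O C - (C.map fun w => (w.length : ℂ)⁻¹).prod • blockProd O C ∈
      (incSpan r n n q (C.length + 1)).map (thetaMul r n) := by
  obtain ⟨q', hq', hO⟩ := mixed_mul_open_prod O one_mem_mixed fun w hw =>
    ⟨h.ne_nil_left w hw, h.distinct_left hw⟩
  rw [one_mul] at hO
  have hC := mixed_mul_rooted_prod C hO fun w hw => ⟨h.ne_nil_right w hw, h.distinct_right hw⟩
  have hlen : O.flatten.length + C.flatten.length = n := by
    have := h.perm.length_eq
    rwa [List.length_map, List.length_append, List.length_range] at this
  have e : q' + C.flatten.length = q := by omega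
  rw [e] at hC
  have hp := h.perm_finRange
  rw [List.map_append] at hp
  have h1 := hC.1
  have h2 := hC.2
  rw [zero_add] at h1 h2
  exact ⟨mixed_le_of_perm_finRange (by simpa using hp) _ _ h1,
    mixed_le_of_perm_finRange (by simpa using hp) _ _ h2⟩

/-- Modulo terms with more closed roots, all forms are combinations of products over blocks. -/
theorem thetaMul_mem_span_blockProd {q l : ℕ} {α : Form r n} (hα : α ∈ incSpan r n n q l) :
    thetaMul r n α ∈ Submodule.span ℂ {x | ∃ O C, Covers n O C ∧ C.length = l ∧
      q + O.length = n ∧ x = blockProd O C} ⊔ (incSpan r n n q (l + 1)).map (thetaMul r n) := by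
  suffices h : incSpan r n n q l ≤ Submodule.comap (thetaMul r n) (Submodule.span ℂ
      {x | ∃ O C, Covers n O C ∧ C.length = l ∧ q + O.length = n ∧ x = blockProd O C} ⊔
        (incSpan r n n q (l + 1)).map (thetaMul r n)) from h hα
  rw [incSpan, Submodule.span_le]
  rintro α ⟨l', hl', h⟩
  rcases hl'.eq_or_lt with rfl | hl'
  · have h1 := h.big_mul_mem_rootedSpan
    have e : thetaBefore r n n = thetaTop r n := by
      rw [thetaBefore, List.take_of_length_le (by simp), thetaProd, thetaTop, List.ofFn_eq_map]
    rw [e] at h1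
    rw [← thetaMul_apply] at h1
    rw [SetLike.mem_coe, Submodule.mem_comap]
    refine (?_ : rootedSpan r n n q l ≤ _) h1
    rw [rootedSpan, Submodule.span_le]
    rintro _ ⟨O, C, hcov, rfl, hq, rfl⟩
    have h2 := (hcov.blockProd_mem hq).2
    rw [SetLike.mem_coe, ← sub_add_cancel (rootedProd O C)
      ((C.map fun w => (w.length : ℂ)⁻¹).prod • blockProd O C)]
    exact Submodule.add_mem _ (Submodule.mem_sup_right h2) (Submodule.mem_sup_left
      (Submodule.smul_mem _ _ (Submodule.subset_span ⟨O, C, hcov, rfl, hq, rfl⟩)))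
  · exact Submodule.mem_sup_right ⟨α, incSpan_anti (by omega) h.mem, rfl⟩

end Build

end WreathOS

end

noncomputable section

namespace WreathOS

/-! ### Symmetrization over rotations of words -/

section Rotation

variable {r n : ℕ}

/-- The form of an edge is symmetric in its ends, so exchanging the ends only exchanges two odd
variables. -/
theorem theta_mul_link_swap (a c : Mu r × Fin n) :
    theta r a.2 * (link a c : BigForm r n) = -(theta r c.2 * (link c a : BigForm r n)) := by
  rw [link_coe, link_coe, ed_symm c a, ← mul_assoc, ← mul_assoc,
    big_mul_theta_swap (isOdd_ed a c), big_mul_theta_swap (isOdd_ed a c), neg_mul, neg_mul, mul_assoc,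
    (isOdd_theta a.2).mul_swap (isOdd_theta c.2), mul_assoc]
  simp

theorem theta_mul_path_reverse (A : List (Mu r × Fin n)) : ∀ a c : Mu r × Fin n,
    theta r a.2 * (path link a (A ++ [c]) : Subalgebra.center ℂ (BigForm r n)) =
      (-1 : ℂ) ^ (A.length + 1) • (theta r c.2 *
        (path link c (a :: A).reverse : Subalgebra.center ℂ (BigForm r n))) := by
  induction A with
  | nil => intro a c; simpa using theta_mul_link_swap a c
  | cons b A ih =>
    intro a c
    have e : path link c (a :: b :: A).reverse =
        path link c (b :: A).reverse * link b a := by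
      simp only [List.reverse_cons, List.append_assoc, List.cons_append, List.nil_append]
      rw [path_append]
      simp
    rw [e, List.cons_append, path_cons, Subalgebra.coe_mul, ← mul_assoc, theta_mul_link_swap a b,
      neg_mul, mul_assoc, ← Subalgebra.coe_mul, mul_comm (link b a), Subalgebra.coe_mul, ← mul_assoc,
      ih b c, smul_mul_assoc, Subalgebra.coe_mul, mul_assoc, List.length_cons, pow_succ _ (_ + 1),
      mul_neg_one, neg_smul]

/-- Any letter can serve as the start of an open word: the part before it is reversed, with one sign
per link. Thus the rotations of a word are all written with the same start, as products of two
paths. -/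
theorem openWord_append (A : List (Mu r × Fin n)) (c : Mu r × Fin n) (B : List (Mu r × Fin n)) :
    openWord (A ++ c :: B) = (-1 : ℂ) ^ A.length • (theta r c.2 *
      (path link c A.reverse * path link c B : Subalgebra.center ℂ (BigForm r n))) := by
  cases A with
  | nil => simp [openWord]
  | cons a A =>
    rw [List.cons_append, openWord, path_append, Subalgebra.coe_mul, ← mul_assoc,
      theta_mul_path_reverse, Subalgebra.coe_mul, smul_mul_assoc, mul_assoc, List.length_cons]

/-- The root of unity `exp(2πi/N)`. -/
def zetaRoot (N : ℕ) : ℂ := Complex.exp (2 * Real.pi * Complex.I / N)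

theorem zetaRoot_isPrimitive {N : ℕ} (hN : N ≠ 0) : IsPrimitiveRoot (zetaRoot N) N :=
  Complex.isPrimitiveRoot_exp N hN

/-- The sum of the open block products over the rotations of a word, weighted by a character. -/
def rotSum (w : List (Mu r × Fin n)) : BigForm r n :=
  ∑ k ∈ Finset.range w.length, zetaRoot w.length ^ k • openWord (w.rotate k)

/-- Rotating `c :: w` past the letter `c` and `k` letters of `w` puts the rest of `w` before `c`. By
`openWord_append` this is the cut of `w` after `k` letters. -/
theorem theta_mul_cutSum (c : Mu r × Fin n) (w : List (Mu r × Fin n)) :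
    theta r c.2 * (cutSum link (zetaRoot (w.length + 1))⁻¹ c w :
      Subalgebra.center ℂ (BigForm r n)) = rotSum (c :: w) := by
  set q := zetaRoot (w.length + 1) with hq
  have hp : q ^ (w.length + 1) = 1 := (zetaRoot_isPrimitive (Nat.succ_ne_zero _)).pow_eq_one
  have hq0 : q ≠ 0 := (zetaRoot_isPrimitive (Nat.succ_ne_zero _)).ne_zero (Nat.succ_ne_zero _)
  have h1 : ∀ k ∈ Finset.range (w.length + 1), theta r c.2 *
      (((-q⁻¹) ^ (w.length - k) • (path link c (w.drop k).reverse * path link c (w.take k)) :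
        Subalgebra.center ℂ (BigForm r n)) : BigForm r n) =
      q ^ (k + 1) • openWord ((c :: w).rotate (k + 1)) := by
    intro k hk
    have hk' : k ≤ w.length := by simpa [Nat.lt_succ_iff] using hk
    have e1 : (c :: w).rotate (k + 1) = w.drop k ++ c :: w.take k := by
      rw [List.rotate_eq_drop_append_take (by simpa using hk')]
      simp
    rw [e1, openWord_append, Subalgebra.coe_smul, mul_smul_comm, smul_smul, List.length_drop]
    congr 1
    -- The sign in `-q⁻¹` is the sign of the reversal, and the remaining powers agree because `q ^
    -- (w.length + 1) = 1`.
    rw [neg_pow, mul_comm]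
    congr 1
    rw [inv_pow, inv_eq_of_mul_eq_one_left]
    rw [← pow_add, ← hp]
    congr 1
    omega
  rw [cutSum, AddSubmonoidClass.coe_finsetSum, Finset.mul_sum, Finset.sum_congr rfl h1, rotSum,
    List.length_cons, ← hq, Finset.sum_range_succ, Finset.sum_range_succ', hp]
  have e2 : (c :: w).rotate (w.length + 1) = c :: w := by
    rw [← List.length_cons (a := c), List.rotate_length]
  rw [e2]
  simp

/-- The root of unity has order exactly |w|, one more than the length of the path after the first
letter, so none of the powers excluded in `path_mem_span_cutSum` is 1. -/
theorem openWord_mem_span_rotSum {w : List (Mu r × Fin n)} (hw : Distinct w) (h0 : w ≠ []) :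
    openWord w ∈ Submodule.span ℂ {x | ∃ w', w'.Perm w ∧ x = rotSum w'} := by
  obtain ⟨c, w, rfl⟩ := List.exists_cons_of_ne_nil h0
  have hz := zetaRoot_isPrimitive (Nat.succ_ne_zero w.length)
  have h := path_mem_span_cutSum (Z := Subalgebra.center ℂ (BigForm r n)) forkRel_link
    (fun x y h => Ne.symm h) (zetaRoot (w.length + 1))⁻¹ c w hw (by
      intro m h1 h2 h3
      rw [inv_pow, inv_eq_one] at h3
      have := Nat.le_of_dvd h1 (hz.dvd_of_pow_eq_one m h3)
      omega)
  have := Submodule.mem_map_of_mem (f := (LinearMap.mulLeft ℂ (theta r c.2)).comp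
    (Subalgebra.center ℂ (BigForm r n)).val.toLinearMap) h
  rw [Submodule.map_span] at this
  rw [openWord]
  refine Submodule.span_mono ?_ this
  rintro _ ⟨_, ⟨w', hw', rfl⟩, rfl⟩
  refine ⟨c :: w', hw'.cons c, ?_⟩
  rw [← theta_mul_cutSum, hw'.length_eq]
  rfl

/-- The sum of the closed block products over the rotations of a word, weighted by a character. -/
def closedRotSum (w : List (Mu r × Fin n)) : BigForm r n :=
  ∑ k ∈ Finset.range w.length, zetaRoot w.length ^ k • closedWord (w.rotate k)

theorem omegaSum_perm {w w' : List (Mu r × Fin n)} (h : w.Perm w') : omegaSum w = omegaSum w' :=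
  (h.map _).sum_eq

theorem closedRotSum_eq (w : List (Mu r × Fin n)) :
    closedRotSum w = big (omegaSum w) * rotSum w := by
  rw [closedRotSum, rotSum, Finset.mul_sum]
  refine Finset.sum_congr rfl fun k _ => ?_
  rw [closedWord, omegaSum_perm (w.rotate_perm k), mul_smul_comm]

theorem closedWord_mem_span_rotSum {w : List (Mu r × Fin n)} (hw : Distinct w) (h0 : w ≠ []) :
    closedWord w ∈ Submodule.span ℂ {x | ∃ w', w'.Perm w ∧ x = closedRotSum w'} := by
  have := Submodule.mem_map_of_mem (f := LinearMap.mulLeft ℂ (big (omegaSum w)))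
    (openWord_mem_span_rotSum hw h0)
  rw [Submodule.map_span] at this
  refine Submodule.span_mono ?_ this
  rintro _ ⟨_, ⟨w', hw', rfl⟩, rfl⟩
  exact ⟨w', hw', by rw [closedRotSum_eq, omegaSum_perm hw']; rfl⟩

theorem list_prod_mem_span {X A : Type*} [Ring A] [Algebra ℂ A] (f g : List X → A)
    (L : List (List X)) (h : ∀ w ∈ L, f w ∈ Submodule.span ℂ {x | ∃ w', w'.Perm w ∧ x = g w'}) :
    (L.map f).prod ∈ Submodule.span ℂ
      {x | ∃ L', List.Forall₂ List.Perm L' L ∧ x = (L'.map g).prod} := by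
  induction L with
  | nil => exact Submodule.subset_span ⟨[], List.Forall₂.nil, rfl⟩
  | cons w L ih =>
    have := Submodule.mul_mem_mul (h w (by simp)) (ih fun v hv => h v (by simp [hv]))
    rw [Submodule.span_mul_span] at this
    rw [List.map_cons, List.prod_cons]
    refine Submodule.span_mono ?_ this
    rintro _ ⟨_, ⟨w', hw', rfl⟩, _, ⟨L', hL', rfl⟩, rfl⟩
    exact ⟨w' :: L', List.Forall₂.cons hw' hL', by simp⟩

/-- The product of the symmetrized open and closed blocks. -/
def rotProd (O C : List (List (Mu r × Fin n))) : BigForm r n :=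
  (O.map rotSum).prod * (C.map closedRotSum).prod

theorem perm_flatten_of_forall₂ {X : Type*} {L L' : List (List X)}
    (h : List.Forall₂ List.Perm L L') : L.flatten.Perm L'.flatten := by
  induction h with
  | nil => exact List.Perm.refl _
  | cons h _ ih => simpa using h.append ih

theorem ne_nil_of_forall₂ {X : Type*} {L L' : List (List X)} (h : List.Forall₂ List.Perm L L')
    (h' : ∀ w ∈ L', w ≠ []) : ∀ w ∈ L, w ≠ [] := by
  induction h with
  | nil => simp
  | cons h _ ih =>
    intro w hw
    rcases List.mem_cons.1 hw with rfl | hw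
    · intro h0
      subst h0
      exact h' _ (by simp) h.nil_eq.symm
    · exact ih (fun v hv => h' v (by simp [hv])) w hw

theorem Covers.blockProd_mem_span_rotProd {O C : List (List (Mu r × Fin n))} (h : Covers n O C) :
    blockProd O C ∈ Submodule.span ℂ {x | ∃ O' C', Covers n O' C' ∧ O'.length = O.length ∧
      C'.length = C.length ∧ x = rotProd O' C'} := by
  have := Submodule.mul_mem_mul
    (list_prod_mem_span openWord rotSum O fun w hw =>
      openWord_mem_span_rotSum (h.distinct_left hw) (h.ne_nil_left w hw))
    (list_prod_mem_span closedWord closedRotSum C fun w hw =>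
      closedWord_mem_span_rotSum (h.distinct_right hw) (h.ne_nil_right w hw))
  rw [Submodule.span_mul_span] at this
  refine Submodule.span_mono ?_ this
  rintro _ ⟨_, ⟨O', hO', rfl⟩, _, ⟨C', hC', rfl⟩, rfl⟩
  refine ⟨O', C', ⟨?_, ne_nil_of_forall₂ hO' h.ne_nil_left, ne_nil_of_forall₂ hC' h.ne_nil_right⟩,
    hO'.length_eq, hC'.length_eq, rfl⟩
  exact (((perm_flatten_of_forall₂ hO').append (perm_flatten_of_forall₂ hC')).map _).trans h.perm

/-- Modulo terms with more closed roots, all forms are combinations of symmetrized products over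
blocks. -/
theorem thetaMul_mem_span_rotProd {q l : ℕ} {α : Form r n} (hα : α ∈ incSpan r n n q l) :
    thetaMul r n α ∈ Submodule.span ℂ {x | ∃ O C, Covers n O C ∧ C.length = l ∧
      q + O.length = n ∧ x = rotProd O C} ⊔ (incSpan r n n q (l + 1)).map (thetaMul r n) := by
  refine (?_ : _ ≤ (_ : Submodule ℂ (BigForm r n))) (thetaMul_mem_span_blockProd hα)
  refine sup_le_sup_right (Submodule.span_le.2 ?_) _
  rintro _ ⟨O, C, h, hl, hq, rfl⟩
  refine Submodule.span_mono ?_ h.blockProd_mem_span_rotProd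
  rintro _ ⟨O', C', h', hO, hC, rfl⟩
  exact ⟨O', C', h', hC.trans hl, by rw [hO, hq], rfl⟩

end Rotation

end WreathOS

end

noncomputable section

namespace WreathOS

/-! ### Functions on arrangements into blocks -/

section Arr

variable {S : Type} {Y : S → Type} {β N : Type}

/-- An arrangement of the points of `N` into blocks: for every `i : β` a block of shape `Y (b i)`. -/
abbrev Arr (Y : S → Type) (β N : Type) : Type := Σ b : β → S, (Σ i, Y (b i)) ≃ N

/-- Permute the positions in every block. -/
abbrev Arr.loc (x : Arr Y β N) (t : ∀ i, Equiv.Perm (Y (x.1 i))) : Arr Y β N :=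
  ⟨x.1, (Equiv.sigmaCongrRight t).trans x.2⟩

/-- Permute the blocks. -/
abbrev Arr.shuf (x : Arr Y β N) (π : Equiv.Perm β) : Arr Y β N :=
  ⟨fun i => x.1 (π i), (Equiv.sigmaCongrLeft (β := fun i => Y (x.1 i)) π).trans x.2⟩

/-- Permute the points. -/
abbrev Arr.act (x : Arr Y β N) (σ : Equiv.Perm N) : Arr Y β N := ⟨x.1, x.2.trans σ⟩

theorem Arr.ext_of_fst {b : β → S} {u v : (Σ i, Y (b i)) ≃ N} (h : ∀ i y, u ⟨i, y⟩ = v ⟨i, y⟩) :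
    (⟨b, u⟩ : Arr Y β N) = ⟨b, v⟩ :=
  congrArg (Sigma.mk b) (Equiv.ext fun ⟨i, y⟩ => h i y)

theorem Arr.loc_loc (x : Arr Y β N) (t t' : ∀ i, Equiv.Perm (Y (x.1 i))) :
    (x.loc t).loc t' = x.loc (t * t') := Arr.ext_of_fst fun _ _ => rfl

theorem Arr.shuf_one (x : Arr Y β N) : x.shuf 1 = x := Arr.ext_of_fst fun _ _ => rfl

theorem Arr.shuf_shuf (x : Arr Y β N) (π π' : Equiv.Perm β) :
    (x.shuf π).shuf π' = x.shuf (π * π') := Arr.ext_of_fst fun _ _ => rfl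

theorem Arr.loc_shuf (x : Arr Y β N) (t : ∀ i, Equiv.Perm (Y (x.1 i))) (π : Equiv.Perm β) :
    (x.loc t).shuf π = (x.shuf π).loc fun i => t (π i) := Arr.ext_of_fst fun _ _ => rfl

theorem Arr.act_one (x : Arr Y β N) : x.act 1 = x := rfl

theorem Arr.act_act (x : Arr Y β N) (σ τ : Equiv.Perm N) : (x.act σ).act τ = x.act (τ * σ) := rfl

/-- Groups that act on the shapes of blocks, with characters. -/
structure BlockData (Y : S → Type) where
  /-- The group for a shape. -/
  C : S → Type
  [group : ∀ s, Group (C s)]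
  [fintype : ∀ s, Fintype (C s)]
  /-- The action on positions. -/
  ρ : ∀ s, C s →* Equiv.Perm (Y s)
  /-- The character. -/
  ψ : ∀ s, C s →* ℂ

attribute [instance] BlockData.group BlockData.fintype

variable (D : BlockData Y) {a l : ℕ}

/-- Let the groups of a block datum act on an arrangement. -/
abbrev Arr.rot (x : Arr Y β N) (c : ∀ i, D.C (x.1 i)) : Arr Y β N := x.loc fun i => D.ρ _ (c i)

theorem Arr.rot_rot (x : Arr Y β N) (c c' : ∀ i, D.C (x.1 i)) :
    Arr.rot D (x.rot D c) c' = x.rot D (c * c') := by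
  refine Arr.ext_of_fst fun i y => ?_
  change x.2 ⟨i, D.ρ _ (c i) (D.ρ _ (c' i) y)⟩ = x.2 ⟨i, D.ρ _ (c i * c' i) y⟩
  rw [map_mul]
  rfl

theorem Arr.rot_one (x : Arr Y β N) : x.rot D 1 = x := by
  refine Arr.ext_of_fst fun i y => ?_
  simp

/-- The permutations of open blocks and of closed blocks. -/
abbrev BlockPerm (a l : ℕ) : Type := Equiv.Perm (Fin a) × Equiv.Perm (Fin l)

/-- Permute the open blocks and the closed blocks. -/
abbrev Arr.mix (x : Arr Y (Fin a ⊕ Fin l) N) (π : BlockPerm a l) : Arr Y (Fin a ⊕ Fin l) N :=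
  x.shuf (Equiv.Perm.sumCongrHom (Fin a) (Fin l) π)

/-- The sign of the permutation of the open blocks. -/
def mixSign (a l : ℕ) : BlockPerm a l →* ℂ := (signChar a).comp (MonoidHom.fst _ _)

theorem Arr.mix_mix (x : Arr Y (Fin a ⊕ Fin l) N) (π π' : BlockPerm a l) :
    (x.mix π).mix π' = x.mix (π * π') := by
  rw [Arr.mix, Arr.mix, Arr.shuf_shuf, Arr.mix, map_mul]

theorem Arr.mix_one (x : Arr Y (Fin a ⊕ Fin l) N) : x.mix 1 = x := by
  rw [Arr.mix, map_one, Arr.shuf_one]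

/-- Permute group elements together with the blocks. -/
def Arr.mixRot (x : Arr Y (Fin a ⊕ Fin l) N) (c : ∀ i, D.C (x.1 i)) (π : BlockPerm a l) :
    ∀ i, D.C ((x.mix π).1 i) :=
  fun i => c (Equiv.Perm.sumCongrHom (Fin a) (Fin l) π i)

theorem Arr.rot_mix (x : Arr Y (Fin a ⊕ Fin l) N) (c : ∀ i, D.C (x.1 i)) (π : BlockPerm a l) :
    (x.rot D c).mix π = (x.mix π).rot D (x.mixRot D c π) :=
  Arr.loc_shuf _ _ _

/-- Functions on arrangements, supported on those that satisfy `P`, that are equivariant for a block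
datum and change by the sign under permutations of the open blocks. -/
def blockFun (P : Arr Y (Fin a ⊕ Fin l) N → Prop) : Submodule ℂ (Arr Y (Fin a ⊕ Fin l) N → ℂ) where
  carrier := {f | (∀ x (c : ∀ i, D.C (x.1 i)), f (x.rot D c) = (∏ i, D.ψ _ (c i)) * f x) ∧
    (∀ x π, f (x.mix π) = mixSign a l π * f x) ∧ ∀ x, ¬ P x → f x = 0}
  zero_mem' := by simp
  add_mem' := by
    rintro f g ⟨h1, h2, h3⟩ ⟨h1', h2', h3'⟩
    refine ⟨fun x c => ?_, fun x π => ?_, fun x hx => ?_⟩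
    · rw [Pi.add_apply, h1, h1', Pi.add_apply, mul_add]
    · rw [Pi.add_apply, h2, h2', Pi.add_apply, mul_add]
    · rw [Pi.add_apply, h3 x hx, h3' x hx, add_zero]
  smul_mem' := by
    rintro z f ⟨h1, h2, h3⟩
    refine ⟨fun x c => ?_, fun x π => ?_, fun x hx => ?_⟩
    · rw [Pi.smul_apply, h1, Pi.smul_apply, smul_eq_mul, smul_eq_mul]; ring
    · rw [Pi.smul_apply, h2, Pi.smul_apply, smul_eq_mul, smul_eq_mul]; ring
    · rw [Pi.smul_apply, h3 x hx, smul_zero]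

/-- A condition on arrangements is compatible with a block datum if it is invariant. -/
structure Invariant (P : Arr Y (Fin a ⊕ Fin l) N → Prop) : Prop where
  rot : ∀ x (c : ∀ i, D.C (x.1 i)), P x → P (x.rot D c)
  mix : ∀ x π, P x → P (x.mix π)

variable {D} in
theorem Invariant.rot_iff {P : Arr Y (Fin a ⊕ Fin l) N → Prop} (h : Invariant D P) (x)
    (c : ∀ i, D.C (x.1 i)) : P (x.rot D c) ↔ P x := by
  refine ⟨fun hx => ?_, h.rot x c⟩
  have := h.rot (x.rot D c) (c⁻¹ : ∀ i, D.C (x.1 i)) hx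
  rwa [Arr.rot_rot, mul_inv_cancel, Arr.rot_one] at this

variable {D} in
theorem Invariant.mix_iff {P : Arr Y (Fin a ⊕ Fin l) N → Prop} (h : Invariant D P) (x)
    (π : BlockPerm a l) : P (x.mix π) ↔ P x := by
  refine ⟨fun hx => ?_, h.mix x π⟩
  have := h.mix _ π⁻¹ hx
  rwa [Arr.mix_mix, mul_inv_cancel, Arr.mix_one] at this

/-! ### The averaging projection onto equivariant functions and its trace -/

/-- Average over the groups of a block datum. -/
def avgRot : (Arr Y (Fin a ⊕ Fin l) N → ℂ) →ₗ[ℂ] (Arr Y (Fin a ⊕ Fin l) N → ℂ) where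
  toFun f x := (∏ i, (Fintype.card (D.C (x.1 i)) : ℂ))⁻¹ *
    ∑ c : ∀ i, D.C (x.1 i), (∏ i, D.ψ _ (c i)⁻¹) * f (x.rot D c)
  map_add' f g := by
    funext x
    simp only [Pi.add_apply, mul_add, Finset.sum_add_distrib]
  map_smul' z f := by
    funext x
    simp only [Pi.smul_apply, smul_eq_mul, RingHom.id_apply, Finset.mul_sum]
    exact Finset.sum_congr rfl fun c _ => by ring

/-- Average over the permutations of blocks. -/
def avgMix : (Arr Y (Fin a ⊕ Fin l) N → ℂ) →ₗ[ℂ] (Arr Y (Fin a ⊕ Fin l) N → ℂ) where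
  toFun f x := (Fintype.card (BlockPerm a l) : ℂ)⁻¹ *
    ∑ π : BlockPerm a l, mixSign a l π⁻¹ * f (x.mix π)
  map_add' f g := by
    funext x
    simp only [Pi.add_apply, mul_add, Finset.sum_add_distrib]
  map_smul' z f := by
    funext x
    simp only [Pi.smul_apply, smul_eq_mul, RingHom.id_apply, Finset.mul_sum]
    exact Finset.sum_congr rfl fun c _ => by ring

open scoped Classical in
/-- Restrict the support of a function. -/
def cutOff (P : Arr Y (Fin a ⊕ Fin l) N → Prop) :
    (Arr Y (Fin a ⊕ Fin l) N → ℂ) →ₗ[ℂ] (Arr Y (Fin a ⊕ Fin l) N → ℂ) where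
  toFun f x := if P x then f x else 0
  map_add' f g := by
    funext x
    by_cases h : P x <;> simp [h]
  map_smul' z f := by
    funext x
    by_cases h : P x <;> simp [h]

theorem avgRot_apply (f : Arr Y (Fin a ⊕ Fin l) N → ℂ) (x) : avgRot D f x =
    (∏ i, (Fintype.card (D.C (x.1 i)) : ℂ))⁻¹ *
    ∑ c : ∀ i, D.C (x.1 i), (∏ i, D.ψ _ (c i)⁻¹) * f (x.rot D c) := rfl

theorem avgMix_apply (f : Arr Y (Fin a ⊕ Fin l) N → ℂ) (x) : avgMix f x =
    (Fintype.card (BlockPerm a l) : ℂ)⁻¹ *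
    ∑ π : BlockPerm a l, mixSign a l π⁻¹ * f (x.mix π) := rfl

theorem char_mul_inv {G : Type*} [Group G] (χ : G →* ℂ) (g : G) : χ g * χ g⁻¹ = 1 := by
  rw [← map_mul, mul_inv_cancel, map_one]

theorem avgRot_rot (f : Arr Y (Fin a ⊕ Fin l) N → ℂ) (x) (c : ∀ i, D.C (x.1 i)) :
    avgRot D f (x.rot D c) = (∏ i, D.ψ _ (c i)) * avgRot D f x := by
  have h : ∑ c' : ∀ i, D.C (x.1 i), (∏ i, D.ψ _ (c' i)⁻¹) * f ((x.rot D c).rot D c') =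
      (∏ i, D.ψ _ (c i)) * ∑ c' : ∀ i, D.C (x.1 i), (∏ i, D.ψ _ (c' i)⁻¹) * f (x.rot D c') := by
    rw [← Equiv.sum_comp (Equiv.mulLeft c) (fun c' : ∀ i, D.C (x.1 i) =>
      (∏ i, D.ψ _ (c' i)⁻¹) * f (x.rot D c')), Finset.mul_sum]
    refine Finset.sum_congr rfl fun c' _ => ?_
    rw [Arr.rot_rot, Equiv.coe_mulLeft]
    have : ∏ i, D.ψ _ (c' i)⁻¹ = (∏ i, D.ψ _ (c i)) * ∏ i, D.ψ _ ((c * c') i)⁻¹ := by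
      rw [← Finset.prod_mul_distrib]
      refine Finset.prod_congr rfl fun i _ => ?_
      rw [Pi.mul_apply, mul_inv_rev, map_mul, mul_left_comm, char_mul_inv, mul_one]
    rw [this, mul_assoc]
  rw [avgRot_apply, avgRot_apply, mul_left_comm, ← h]

theorem avgMix_mix (f : Arr Y (Fin a ⊕ Fin l) N → ℂ) (x) (π : BlockPerm a l) :
    avgMix f (x.mix π) = mixSign a l π * avgMix f x := by
  rw [avgMix_apply, avgMix_apply, mul_left_comm]
  congr 1
  rw [← Equiv.sum_comp (Equiv.mulLeft π) (fun π' : BlockPerm a l =>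
      mixSign a l π'⁻¹ * f (x.mix π')), Finset.mul_sum]
  refine Finset.sum_congr rfl fun π' _ => ?_
  rw [Arr.mix_mix, Equiv.coe_mulLeft, mul_inv_rev, map_mul, ← mul_assoc, mul_left_comm,
    char_mul_inv, mul_one]

theorem prod_rot_mix (x : Arr Y (Fin a ⊕ Fin l) N) (c : ∀ i, D.C (x.1 i)) (π : BlockPerm a l) :
    ∏ i, D.ψ _ (x.mixRot D c π i) = ∏ i, D.ψ _ (c i) :=
  Equiv.prod_comp (M := ℂ) (Equiv.Perm.sumCongrHom (Fin a) (Fin l) π) fun i => D.ψ _ (c i)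

/-- Permuting blocks carries rotations to rotations (`Arr.rot_mix`), so averaging over block
permutations last does not spoil the equivariance under rotations. -/
theorem avgMix_mem {P : Arr Y (Fin a ⊕ Fin l) N → Prop} (hP : Invariant D P)
    (f : Arr Y (Fin a ⊕ Fin l) N → ℂ) :
    avgMix (avgRot D (cutOff P f)) ∈ blockFun D P := by
  refine ⟨fun x c => ?_, fun x π => avgMix_mix _ _ _, fun x hx => ?_⟩
  · rw [avgMix_apply, avgMix_apply, mul_left_comm]
    congr 1
    rw [Finset.mul_sum]
    refine Finset.sum_congr rfl fun π _ => ?_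
    rw [Arr.rot_mix, avgRot_rot, mul_left_comm]
    rw [prod_rot_mix]
  · rw [avgMix_apply]
    have : ∀ y, ¬ P y → avgRot D (cutOff P f) y = 0 := by
      intro y hy
      rw [avgRot_apply]
      simp [cutOff, hP.rot_iff, hy]
    simp [this _ (mt (hP.mix_iff x _).1 hx)]

variable {D} in
theorem avgRot_of_mem {f : Arr Y (Fin a ⊕ Fin l) N → ℂ} {P : Arr Y (Fin a ⊕ Fin l) N → Prop}
    (hf : f ∈ blockFun D P) : avgRot D f = f := by
  funext x
  rw [avgRot_apply]
  have : ∀ c : ∀ i, D.C (x.1 i), (∏ i, D.ψ _ (c i)⁻¹) * f (x.rot D c) = f x := by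
    intro c
    have e : (∏ i, D.ψ _ (c i)⁻¹) * ∏ i, D.ψ _ (c i) = 1 := by
      rw [← Finset.prod_mul_distrib]
      exact Finset.prod_eq_one fun i _ => by rw [mul_comm, char_mul_inv]
    rw [hf.1, ← mul_assoc, e, one_mul]
  rw [Finset.sum_congr rfl fun c _ => this c, Finset.sum_const, Finset.card_univ,
    Fintype.card_pi, nsmul_eq_mul, Nat.cast_prod, ← mul_assoc, inv_mul_cancel₀, one_mul]
  exact Finset.prod_ne_zero_iff.2 fun i _ => Nat.cast_ne_zero.2 Fintype.card_ne_zero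

theorem avgMix_eq {P : Arr Y (Fin a ⊕ Fin l) N → Prop} {f : Arr Y (Fin a ⊕ Fin l) N → ℂ}
    (hf : f ∈ blockFun D P) : avgMix (avgRot D (cutOff P f)) = f := by
  have h1 : cutOff P f = f := by
    funext x
    by_cases hx : P x
    · simp [cutOff, hx]
    · simp [cutOff, hx, hf.2.2 x hx]
  rw [h1, avgRot_of_mem hf]
  funext x
  rw [avgMix_apply]
  have : ∀ π, mixSign a l π⁻¹ * f (x.mix π) = f x := by
    intro π
    rw [hf.2.1, ← mul_assoc, mul_comm (mixSign a l π⁻¹), char_mul_inv, one_mul]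
  rw [Finset.sum_congr rfl fun c _ => this c, Finset.sum_const, Finset.card_univ, nsmul_eq_mul,
    ← mul_assoc, inv_mul_cancel₀ (Nat.cast_ne_zero.2 Fintype.card_ne_zero), one_mul]

/-- The groups of a block datum act freely. -/
def BlockData.IsFree : Prop := ∀ s (c : D.C s) (y : Y s), D.ρ s c y = y → c = 1

variable {D} in
theorem BlockData.IsFree.rot_eq (hD : D.IsFree) [∀ s, Nonempty (Y s)] {x : Arr Y β N}
    {c : ∀ i, D.C (x.1 i)} (h : x.rot D c = x) (i : β) : c i = 1 := by
  have key : (⟨i, D.ρ _ (c i) (Classical.arbitrary _)⟩ : Σ i, Y (x.1 i)) =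
      ⟨i, Classical.arbitrary _⟩ :=
    x.2.injective (congrArg (fun z : Arr Y β N => z.2 ⟨i, Classical.arbitrary _⟩) h)
  exact hD _ _ _ (eq_of_heq (Sigma.mk.inj key).2)

-- Blocks are nonempty and keep their points under rotations, so any permutation of the blocks can
-- be seen on the points.
variable {D} in
theorem eq_one_of_mix_rot_eq [∀ s, Nonempty (Y s)]
    {x : Arr Y (Fin a ⊕ Fin l) N} {π : BlockPerm a l} {c : ∀ i, D.C ((x.mix π).1 i)}
    (h : (x.mix π).rot D c = x) : π = 1 := by
  refine (Equiv.Perm.sumCongrHom_injective (α := Fin a) (β := Fin l)) ?_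
  rw [map_one]
  refine Equiv.ext fun i => ?_
  have key : (⟨Equiv.Perm.sumCongrHom (Fin a) (Fin l) π i, D.ρ _ (c i)
      (Classical.arbitrary _)⟩ : Σ i, Y (x.1 i)) = ⟨i, Classical.arbitrary _⟩ :=
    x.2.injective
      (congrArg (fun z : Arr Y (Fin a ⊕ Fin l) N => z.2 ⟨i, Classical.arbitrary _⟩) h)
  exact congrArg Sigma.fst key

-- The dimension is the trace of the averaging projection in the basis of delta functions. Since
-- rotations and block permutations act freely, only the identity contributes to each diagonal
-- entry.
open scoped Classical in
variable {D} in
theorem finrank_blockFun [Finite S] [∀ s, Finite (Y s)] [Fintype (Arr Y (Fin a ⊕ Fin l) N)]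
    [∀ s, Nonempty (Y s)]
    (hD : D.IsFree) {P : Arr Y (Fin a ⊕ Fin l) N → Prop} (hP : Invariant D P) :
    (Module.finrank ℂ (blockFun D P) : ℂ) = ∑ x : Arr Y (Fin a ⊕ Fin l) N,
      if P x then ((a.factorial * l.factorial : ℕ) : ℂ)⁻¹ *
        (∏ i, (Fintype.card (D.C (x.1 i)) : ℂ))⁻¹ else 0 := by
  have hproj : LinearMap.IsProj (blockFun D P) (avgMix ∘ₗ avgRot D ∘ₗ cutOff P) :=
    ⟨fun f => avgMix_mem D hP f, fun f hf => avgMix_eq D hf⟩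
  rw [← hproj.trace, LinearMap.trace_eq_matrix_trace ℂ (Pi.basisFun ℂ _), Matrix.trace]
  refine Finset.sum_congr rfl fun x _ => ?_
  rw [Matrix.diag_apply, LinearMap.toMatrix_apply, Pi.basisFun_repr, Pi.basisFun_apply]
  by_cases hx : P x
  · have h0 : cutOff P (Pi.single x 1 : Arr Y (Fin a ⊕ Fin l) N → ℂ) = Pi.single x 1 := by
      funext y
      by_cases hy : P y
      · simp [cutOff, hy]
      · have : y ≠ x := fun h => hy (h ▸ hx)
        simp [cutOff, hy, this]
    rw [if_pos hx, LinearMap.comp_apply, LinearMap.comp_apply, h0, avgMix_apply,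
      Finset.sum_eq_single 1]
    · rw [Arr.mix_one, inv_one, map_one, one_mul, avgRot_apply, Finset.sum_eq_single 1]
      · rw [Arr.rot_one]
        simp [Fintype.card_perm]
      · intro c _ hc
        rw [Pi.single_eq_of_ne, mul_zero]
        intro h
        exact hc (funext fun i => hD.rot_eq h i)
      · simp
    · intro π _ hπ
      have : avgRot D (Pi.single x 1) (x.mix π) = 0 := by
        rw [avgRot_apply, Finset.sum_eq_zero, mul_zero]
        intro c _
        rw [Pi.single_eq_of_ne, mul_zero]
        exact fun h => hπ (eq_one_of_mix_rot_eq h)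
      rw [this, mul_zero]
    · simp
  · have h0 : cutOff P (Pi.single x 1 : Arr Y (Fin a ⊕ Fin l) N → ℂ) = 0 := by
      funext y
      by_cases hy : P y
      · have : y ≠ x := fun h => hx (h ▸ hy)
        simp [cutOff, hy, this]
      · simp [cutOff, hy]
    rw [if_neg hx, LinearMap.comp_apply, LinearMap.comp_apply, h0]
    simp

/-- The action of permutations of the points on functions on arrangements. -/
def arrRep (Y : S → Type) (β N : Type) :
    Representation ℂ (Equiv.Perm N) (Arr Y β N → ℂ) where
  toFun σ := LinearMap.funLeft ℂ ℂ fun x => x.act σ⁻¹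
  map_one' := rfl
  map_mul' σ τ := by
    refine LinearMap.ext fun f => funext fun x => ?_
    simp [LinearMap.funLeft_apply, Arr.act_act]

theorem arrRep_apply (σ : Equiv.Perm N) (f : Arr Y β N → ℂ) (x) :
    arrRep Y β N σ f x = f (x.act σ⁻¹) := rfl

/-- The representation on equivariant functions of a group that preserves a condition. -/
def blockRep {H : Type*} [Group H] (h : H →* Equiv.Perm N) (P : Arr Y (Fin a ⊕ Fin l) N → Prop)
    (hP : ∀ g x, P x → P (x.act (h g))) : Representation ℂ H (blockFun D P) :=
  Representation.subrepresentation ((arrRep Y _ N).comp h) (blockFun D P) (by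
    rintro g f ⟨h1, h2, h3⟩
    refine ⟨fun x c => ?_, fun x π => ?_, fun x hx => ?_⟩
    · exact h1 (x.act (h g)⁻¹) c
    · exact h2 (x.act (h g)⁻¹) π
    · refine h3 _ fun h' => hx ?_
      have := hP g _ h'
      rwa [Arr.act_act, mul_inv_cancel, Arr.act_one] at this)

theorem blockRep_apply {H : Type*} [Group H] (h : H →* Equiv.Perm N)
    (P : Arr Y (Fin a ⊕ Fin l) N → Prop) (hP : ∀ g x, P x → P (x.act (h g))) (g : H)
    (f : blockFun D P) (x) : (blockRep D h P hP g f : Arr Y (Fin a ⊕ Fin l) N → ℂ) x =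
      (f : Arr Y (Fin a ⊕ Fin l) N → ℂ) (x.act (h g)⁻¹) := rfl

end Arr

end WreathOS

end

noncomputable section

namespace WreathOS

/-! ### Arrangements of the points `μ_r × {1,…,n}` -/

section WreathArr

/-- The shape of a block of size `b + 1`, with labels in `μ_r`. -/
abbrev Shape (r n : ℕ) (b : Fin n) : Type := Mu r × Multiplicative (ZMod (b + 1))

variable {r n a l : ℕ}

/-- The character of the cyclic part. -/
def shapeChar (r : ℕ) {n : ℕ} (b : Fin n) : Shape r n b →* ℂ :=
  (AddChar.toMonoidHom (ZMod.stdAddChar (N := b + 1))).comp (MonoidHom.snd _ _)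

/-- Labels act trivially, cyclic rotations by a faithful character. -/
abbrev shapeData (r n : ℕ) [NeZero r] : BlockData (Shape r n) where
  C := Shape r n
  ρ b := MulAction.toPermHom (Shape r n b) (Shape r n b)
  ψ := shapeChar r

/-- Arrangements of the labelled points into blocks. -/
abbrev WArr (r n a l : ℕ) : Type := Arr (Shape r n) (Fin a ⊕ Fin l) (Mu r × Fin n)

/-- The arrangement commutes with the action of `μ_r` on labels. -/
def IsEquivariant (x : WArr r n a l) : Prop := ∀ i (ξ : Mu r) (y : Shape r n (x.1 i)),
  x.2 ⟨i, (ξ * y.1, y.2)⟩ = (ξ * (x.2 ⟨i, y⟩).1, (x.2 ⟨i, y⟩).2)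

/-- The `j`-th letter of a block. -/
def letter (x : WArr r n a l) (i : Fin a ⊕ Fin l) (j : ZMod (x.1 i + 1)) : Mu r × Fin n :=
  x.2 ⟨i, (1, Multiplicative.ofAdd j)⟩

/-- The word of a block. -/
def word (x : WArr r n a l) (i : Fin a ⊕ Fin l) : List (Mu r × Fin n) :=
  List.ofFn fun j : Fin (x.1 i + 1) => letter x i ((j : ℕ) : ZMod (x.1 i + 1))

@[simp] theorem length_word (x : WArr r n a l) (i) : (word x i).length = x.1 i + 1 := by
  simp [word]

theorem getElem_word (x : WArr r n a l) (i) (j : ℕ) (hj : j < (word x i).length) :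
    (word x i)[j] = letter x i (j : ZMod (x.1 i + 1)) :=
  List.getElem_ofFn _

/-- Multiply a label. -/
def scale (ξ : Mu r) (x : Mu r × Fin n) : Mu r × Fin n := (ξ * x.1, x.2)

theorem IsEquivariant.apply {x : WArr r n a l} (hx : IsEquivariant x) (i)
    (y : Shape r n (x.1 i)) : x.2 ⟨i, y⟩ = scale y.1 (letter x i y.2.toAdd) := by
  have := hx i y.1 (1, y.2)
  simpa [letter, scale] using this

theorem letter_rot [NeZero r] {x : WArr r n a l} (hx : IsEquivariant x)
    (c : ∀ i, Shape r n (x.1 i)) (i) (j : ZMod (x.1 i + 1)) :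
    letter (x.rot (shapeData r n) c) i j = scale (c i).1 (letter x i ((c i).2.toAdd + j)) := by
  have h : letter (x.rot (shapeData r n) c) i j =
      x.2 ⟨i, ((c i).1 * 1, (c i).2 * Multiplicative.ofAdd j)⟩ := rfl
  rw [h, hx.apply]
  simp

theorem word_rot [NeZero r] {x : WArr r n a l} (hx : IsEquivariant x)
    (c : ∀ i, Shape r n (x.1 i)) (i) :
    word (x.rot (shapeData r n) c) i =
      ((word x i).rotate (ZMod.val (c i).2.toAdd)).map (scale (c i).1) := by
  refine List.ext_getElem (by simp [Arr.rot, Arr.loc]) fun j h1 h2 => ?_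
  rw [getElem_word, List.getElem_map, List.getElem_rotate, getElem_word]
  refine (letter_rot hx c i j).trans ?_
  congr 2
  rw [length_word, ZMod.natCast_mod, Nat.cast_add, ZMod.natCast_zmod_val]
  exact add_comm _ _

theorem word_act (x : WArr r n a l) (σ : Equiv.Perm (Mu r × Fin n)) (i) :
    word (x.act σ) i = (word x i).map σ := by
  simp only [word, List.map_ofFn]
  rfl

theorem isEquivariant_invariant [NeZero r] :
    Invariant (shapeData r n) (IsEquivariant : WArr r n a l → Prop) where
  rot x c hx i ξ := by
    intro (y : Shape r n (x.1 i))
    have h := hx i ξ ((c i).1 * y.1, (c i).2 * y.2)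
    have e : ξ * ((c i).1 * y.1) = (c i).1 * (ξ * y.1) := mul_left_comm _ _ _
    dsimp only at h
    rw [e] at h
    exact h
  mix x π hx i ξ y := hx _ ξ y

theorem IsEquivariant.act {x : WArr r n a l} (hx : IsEquivariant x) (g : W r n) :
    IsEquivariant (x.act (wreathPerm r n g)) := by
  intro i ξ (y : Shape r n (x.1 i))
  have h := congrArg (wreathPerm r n g) (hx i ξ y)
  refine h.trans ?_
  change _ = (ξ * (wreathPerm r n g (x.2 ⟨i, y⟩)).1, (wreathPerm r n g (x.2 ⟨i, y⟩)).2)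
  simp [wreathPerm, mul_left_comm]

theorem shapeData_isFree [NeZero r] : (shapeData r n).IsFree := by
  intro b c y h
  exact mul_eq_right.1 (show c * y = y from h)

/-- The product over the blocks of an arrangement. -/
def arrProd (x : WArr r n a l) : BigForm r n :=
  blockProd (List.ofFn fun i => word x (.inl i)) (List.ofFn fun i => word x (.inr i))

/-! ### Words that partition the points -/

/-- The words partition the points. -/
structure IsPartition (F : Fin a ⊕ Fin l → List (Mu r × Fin n)) : Prop where
  ne_nil : ∀ i, F i ≠ []
  nodup : ∀ i, ((F i).map Prod.snd).Nodup
  eq_of_mem : ∀ i j k, k ∈ (F i).map Prod.snd → k ∈ (F j).map Prod.snd → i = j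
  exists_mem : ∀ k, ∃ i, k ∈ (F i).map Prod.snd

/-- Lists of words suit the inductive construction of spanning sets; families indexed by the blocks
suit group actions and counting. This is the passage between the two. -/
theorem covers_iff (F : Fin a ⊕ Fin l → List (Mu r × Fin n)) :
    Covers n (List.ofFn fun i => F (.inl i)) (List.ofFn fun i => F (.inr i)) ↔ IsPartition F := by
  set O := List.ofFn fun i => F (.inl i) with hO
  set C := List.ofFn fun i => F (.inr i) with hC
  have hmem : ∀ k, k ∈ (O.flatten ++ C.flatten).map Prod.snd ↔ ∃ i, k ∈ (F i).map Prod.snd := by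
    intro k
    simp only [hO, hC, List.map_append, List.mem_append, List.map_flatten, List.mem_flatten,
      List.mem_map, List.mem_ofFn, Sum.exists, exists_exists_and_eq_and]
    simp
  have hnodup : ((O.flatten ++ C.flatten).map Prod.snd).Nodup ↔
      (∀ i, ((F i).map Prod.snd).Nodup) ∧
      ∀ i j k, k ∈ (F i).map Prod.snd → k ∈ (F j).map Prod.snd → i = j := by
    have e : (O.flatten ++ C.flatten).map Prod.snd = ((List.ofFn fun k : Fin (a + l) =>
        (F (finSumFinEquiv.symm k)).map Prod.snd)).flatten := by
      rw [List.ofFn_add]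
      have h1 : ∀ i : Fin a, finSumFinEquiv.symm (Fin.castLE (Nat.le_add_right a l) i) = .inl i :=
        finSumFinEquiv_symm_apply_castAdd
      simp [h1, hO, hC, List.map_flatten, List.map_ofFn, Function.comp_def]
    rw [e, List.nodup_flatten, List.pairwise_ofFn]
    constructor
    · rintro ⟨h1, h2⟩
      refine ⟨fun i => h1 _ (List.mem_ofFn.2 ⟨finSumFinEquiv i, by simp⟩), ?_⟩
      intro i j k hi hj
      by_contra hij
      have hne : finSumFinEquiv i ≠ finSumFinEquiv j := fun h => hij (finSumFinEquiv.injective h)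
      rcases lt_or_gt_of_ne hne with h | h
      · exact h2 h (by simpa using hi) (by simpa using hj)
      · exact h2 h (by simpa using hj) (by simpa using hi)
    · rintro ⟨h1, h2⟩
      refine ⟨fun w hw => ?_, fun i j hij k hi hj => ?_⟩
      · obtain ⟨k, rfl⟩ := List.mem_ofFn.1 hw
        exact h1 _
      · exact hij.ne (finSumFinEquiv.symm.injective (h2 _ _ _ hi hj))
  have hne : ((∀ w ∈ O, w ≠ []) ∧ ∀ w ∈ C, w ≠ []) ↔ ∀ i, F i ≠ [] := by
    simp only [hO, hC, List.forall_mem_ofFn_iff, Sum.forall]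
  constructor
  · intro h
    have hp := h.perm_finRange
    have h1 := hnodup.1 (hp.nodup_iff.2 (List.nodup_finRange n))
    exact ⟨hne.1 ⟨h.2, h.3⟩, h1.1, h1.2, fun k =>
      (hmem k).1 (hp.mem_iff.2 (List.mem_finRange k))⟩
  · rintro ⟨h1, h2, h3, h4⟩
    refine ⟨?_, (hne.2 h1).1, (hne.2 h1).2⟩
    have : ((O.flatten ++ C.flatten).map Prod.snd).Perm (List.finRange n) := by
      rw [List.perm_ext_iff_of_nodup (hnodup.2 ⟨h2, h3⟩) (List.nodup_finRange n)]
      intro k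
      simpa using (hmem k).2 (h4 k)
    have := this.map Fin.val
    simpa [List.map_map, Function.comp_def] using this

/-- Letters above the same point differ by a label, which equivariance carries back into the block;
the arrangement is injective on positions. -/
theorem IsEquivariant.letter_injective {x : WArr r n a l} (hx : IsEquivariant x) {i i'}
    {j : ZMod (x.1 i + 1)} {j' : ZMod (x.1 i' + 1)}
    (h : (letter x i j).2 = (letter x i' j').2) :
    (⟨i, j⟩ : Σ i, ZMod (x.1 i + 1)) = ⟨i', j'⟩ := by
  have h1 : x.2 ⟨i', ((letter x i j).1 * (letter x i' j').1⁻¹, Multiplicative.ofAdd j')⟩ =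
      x.2 ⟨i, (1, Multiplicative.ofAdd j)⟩ := by
    rw [hx.apply]
    exact Prod.ext (by simp [scale, letter]) h.symm
  have h2 := x.2.injective h1
  obtain rfl : i' = i := congrArg Sigma.fst h2
  have h3 := congrArg Prod.snd (eq_of_heq (Sigma.mk.inj h2).2)
  rw [Multiplicative.ofAdd.injective h3]

theorem IsEquivariant.isPartition {x : WArr r n a l} (hx : IsEquivariant x) :
    IsPartition (word x) where
  ne_nil i := by
    rw [← List.length_pos_iff]
    simp
  nodup i := by
    rw [List.nodup_iff_injective_getElem]
    intro j j' h
    simp only [List.getElem_map, getElem_word] at h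
    have h1 := eq_of_heq (Sigma.mk.inj (hx.letter_injective h)).2
    have h2 := congrArg ZMod.val h1
    have hj : (j : ℕ) < x.1 i + 1 := by simpa using j.2
    have hj' : (j' : ℕ) < x.1 i + 1 := by simpa using j'.2
    rw [ZMod.val_natCast_of_lt hj, ZMod.val_natCast_of_lt hj'] at h2
    exact Fin.ext h2
  eq_of_mem i i' k hk hk' := by
    obtain ⟨y, hy, rfl⟩ := List.mem_map.1 hk
    obtain ⟨y', hy', h⟩ := List.mem_map.1 hk'
    obtain ⟨j, hj, rfl⟩ := List.mem_iff_getElem.1 hy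
    obtain ⟨j', hj', rfl⟩ := List.mem_iff_getElem.1 hy'
    rw [getElem_word, getElem_word] at h
    exact (congrArg Sigma.fst (hx.letter_injective h)).symm
  exists_mem k := by
    obtain ⟨⟨i, y⟩, h⟩ := x.2.surjective (1, k)
    refine ⟨i, List.mem_map.2 ⟨letter x i y.2.toAdd, List.mem_iff_getElem.2
      ⟨ZMod.val y.2.toAdd, by
        rw [length_word]; exact ZMod.val_lt y.2.toAdd, ?_⟩, ?_⟩⟩
    · rw [getElem_word]
      simp
    · rw [hx.apply] at h
      exact congrArg Prod.snd h

theorem IsPartition.exists_arr {F : Fin a ⊕ Fin l → List (Mu r × Fin n)} (hF : IsPartition F) :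
    ∃ x : WArr r n a l, IsEquivariant x ∧ word x = F := by
  have hpos : ∀ i, 0 < (F i).length := fun i => List.length_pos_of_ne_nil (hF.ne_nil i)
  have hle : ∀ i, (F i).length ≤ n := fun i => by
    simpa using (hF.nodup i).length_le_card
  -- The shape `b` has `b + 1` rotation positions; a word above distinct points has between 1 and
  -- `n` letters, so its length minus one is an element of `Fin n`.
  let b : Fin a ⊕ Fin l → Fin n := fun i =>
    ⟨(F i).length - 1, by have := hpos i; have := hle i; omega⟩
  have hb : ∀ i, (b i : ℕ) + 1 = (F i).length := fun i => by
    have := hpos i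
    simp only [b]
    omega
  have hv : ∀ i (y : Multiplicative (ZMod (b i + 1))), ZMod.val y.toAdd < (F i).length :=
    fun i y => by rw [← hb i]; exact ZMod.val_lt _
  let u : (Σ i, Shape r n (b i)) → Mu r × Fin n := fun y =>
    scale y.2.1 ((F y.1)[ZMod.val y.2.2.toAdd]'(hv _ _))
  have hsnd : ∀ y, (u y).2 ∈ (F y.1).map Prod.snd := fun y =>
    List.mem_map.2 ⟨_, List.getElem_mem (hv y.1 y.2.2), rfl⟩
  have hu : Function.Bijective u := by
    constructor
    · rintro ⟨i, ξ, κ⟩ ⟨i', ξ', κ'⟩ h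
      have h2 := hsnd ⟨i', ξ', κ'⟩
      rw [← h] at h2
      obtain rfl := hF.eq_of_mem _ _ _ (hsnd ⟨i, ξ, κ⟩) h2
      have h3 : ((F i)[ZMod.val κ.toAdd]'(hv _ _)).2 = ((F i)[ZMod.val κ'.toAdd]'(hv _ _)).2 := by
        have h' := congrArg Prod.snd h
        exact h'
      have h4 := List.nodup_iff_injective_getElem.1 (hF.nodup i)
      have h5 := @h4 ⟨ZMod.val κ.toAdd, by simpa using hv i κ⟩
        ⟨ZMod.val κ'.toAdd, by simpa using hv i κ'⟩ (by simpa using h3)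
      have h6 : ZMod.val κ.toAdd = ZMod.val κ'.toAdd := by
        have h' := Fin.ext_iff.1 h5
        exact h'
      obtain rfl : κ = κ' := Multiplicative.toAdd.injective (ZMod.val_injective _ h6)
      have h7 : ξ * _ = ξ' * _ := congrArg Prod.fst h
      rw [mul_right_cancel h7]
    · rintro ⟨η, k⟩
      obtain ⟨i, hi⟩ := hF.exists_mem k
      obtain ⟨y, hy, rfl⟩ := List.mem_map.1 hi
      obtain ⟨j, hj, rfl⟩ := List.mem_iff_getElem.1 hy
      refine ⟨⟨i, (η * (F i)[j].1⁻¹, Multiplicative.ofAdd (j : ZMod (b i + 1)))⟩, ?_⟩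
      have : ZMod.val (j : ZMod (b i + 1)) = j := ZMod.val_natCast_of_lt (by rw [hb]; exact hj)
      simp [u, scale, this]
  refine ⟨⟨b, Equiv.ofBijective u hu⟩, ?_, ?_⟩
  · intro i ξ y
    simp [u, scale, mul_assoc]
  · funext i
    refine List.ext_getElem (by rw [length_word]; exact hb i) fun j h1 h2 => ?_
    rw [getElem_word]
    have : ZMod.val (j : ZMod (b i + 1)) = j := ZMod.val_natCast_of_lt (by rw [hb]; exact h2)
    simp [letter, u, scale, this]

theorem IsEquivariant.covers {x : WArr r n a l} (hx : IsEquivariant x) :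
    Covers n (List.ofFn fun i => word x (.inl i)) (List.ofFn fun i => word x (.inr i)) :=
  (covers_iff (word x)).2 hx.isPartition

theorem Covers.exists_arr {O C : List (List (Mu r × Fin n))} (h : Covers n O C)
    (hO : O.length = a) (hC : C.length = l) :
    ∃ x : WArr r n a l, IsEquivariant x ∧ (List.ofFn fun i => word x (.inl i)) = O ∧
      (List.ofFn fun i => word x (.inr i)) = C := by
  subst hO hC
  have hF : IsPartition (Sum.elim O.get C.get) := by
    rw [← covers_iff]
    simpa [List.ofFn_getElem] using h
  obtain ⟨x, hx, hw⟩ := hF.exists_arr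
  refine ⟨x, hx, ?_, ?_⟩
  · simp [hw, List.ofFn_getElem]
  · simp [hw, List.ofFn_getElem]

end WreathArr

end WreathOS

end

noncomputable section

namespace WreathOS

/-! ### Products over the blocks of an arrangement -/

section ArrProd

variable {r n a l : ℕ}

theorem link_scale (ξ : Mu r) (x y : Mu r × Fin n) : link (scale ξ x) (scale ξ y) = link x y :=
  Subtype.ext (by rw [link_coe, link_coe, scale, scale, ed_diag])

theorem path_scale (ξ : Mu r) (w : List (Mu r × Fin n)) : ∀ c : Mu r × Fin n,
    path link (scale ξ c) (w.map (scale ξ)) = path link c w := by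
  induction w with
  | nil => intro c; rfl
  | cons x w ih => intro c; rw [List.map_cons, path_cons, path_cons, link_scale, ih]

theorem openWord_scale (ξ : Mu r) (w : List (Mu r × Fin n)) :
    openWord (w.map (scale ξ)) = openWord w := by
  cases w with
  | nil => rfl
  | cons c w =>
    rw [List.map_cons, openWord, path_scale]
    rfl

theorem closedWord_scale (ξ : Mu r) (w : List (Mu r × Fin n)) :
    closedWord (w.map (scale ξ)) = closedWord w := by
  rw [closedWord, closedWord, openWord_scale, omegaSum, omegaSum, List.map_map]
  rfl

theorem bigAct_path (g : W r n) (w : List (Mu r × Fin n)) : ∀ c : Mu r × Fin n,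
    bigAct g (path link c w : Subalgebra.center ℂ (BigForm r n)) =
      (path link (wreathPerm r n g c) (w.map (wreathPerm r n g)) :
        Subalgebra.center ℂ (BigForm r n)) := by
  induction w with
  | nil => intro c; exact map_one _
  | cons x w ih =>
    intro c
    rw [List.map_cons, path_cons, path_cons, Subalgebra.coe_mul, Subalgebra.coe_mul, map_mul, ih,
      link_coe, link_coe, map_mul, bigAct_big, formRep_ed, bigAct_theta]
    rfl

theorem bigAct_openWord (g : W r n) (w : List (Mu r × Fin n)) :
    bigAct g (openWord w) = openWord (w.map (wreathPerm r n g)) := by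
  cases w with
  | nil => exact map_zero _
  | cons c w =>
    rw [List.map_cons, openWord, openWord, map_mul, bigAct_theta, bigAct_path]
    rfl

theorem bigAct_closedWord (g : W r n) (w : List (Mu r × Fin n)) :
    bigAct g (closedWord w) = closedWord (w.map (wreathPerm r n g)) := by
  rw [closedWord, closedWord, map_mul, bigAct_openWord, bigAct_big, omegaSum, omegaSum,
    map_list_sum, List.map_map, List.map_map]
  congr 4
  funext x
  exact formRep_omega g x.2

theorem bigAct_arrProd (g : W r n) (x : WArr r n a l) :
    bigAct g (arrProd x) = arrProd (x.act (wreathPerm r n g)) := by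
  simp only [arrProd, blockProd, map_mul, map_list_prod, List.map_ofFn, word_act]
  congr 1
  · exact congrArg (fun f => (List.ofFn f).prod) (funext fun i => bigAct_openWord g _)
  · exact congrArg (fun f => (List.ofFn f).prod) (funext fun i => bigAct_closedWord g _)

/-- An open word is a single odd variable times an even element, hence odd. -/
theorem openWord_anticomm (w w' : List (Mu r × Fin n)) :
    openWord w * openWord w' = -(openWord w' * openWord w) := by
  cases w with
  | nil => simp [openWord]
  | cons c w =>
    cases w' with
    | nil => simp [openWord]
    | cons c' w' =>
      rw [openWord, openWord]
      generalize path link c w = z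
      generalize path link c' w' = z'
      rw [center_comm z, center_comm z']
      have h1 := center_comm z' (theta r c.2)
      have h2 := center_comm z (theta r c'.2)
      calc (z : BigForm r n) * theta r c.2 * (z' * theta r c'.2)
          = z * (theta r c.2 * z') * theta r c'.2 := by noncomm_ring
        _ = (z * z' : BigForm r n) * (theta r c.2 * theta r c'.2) := by rw [h1]; noncomm_ring
        _ = -((z' * z : BigForm r n) * (theta r c'.2 * theta r c.2)) := by
            rw [(isOdd_theta c.2).mul_swap (isOdd_theta c'.2), center_comm z', mul_neg]
        _ = _ := by
            rw [show (z' : BigForm r n) * theta r c'.2 * (z * theta r c.2) =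
              z' * (theta r c'.2 * z) * theta r c.2 by noncomm_ring, h2]
            noncomm_ring

/-- A product of anticommuting elements changes by the sign when it is permuted. -/
theorem ofFn_prod_perm {A : Type*} [Ring A] [Algebra ℂ A] (f : Fin a → A)
    (hf : ∀ i j, f i * f j = -(f j * f i)) (π : Equiv.Perm (Fin a)) :
    (List.ofFn fun i => f (π i)).prod = signChar a π • (List.ofFn f).prod := by
  -- Anticommutation makes all linear combinations of the `f i` square to zero, so `f` extends to
  -- the exterior algebra on ℂ^a, where the sign rule is known.
  let φ : (Fin a → ℂ) →ₗ[ℂ] A := Fintype.linearCombination ℂ f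
  have hφ : ∀ v, φ v * φ v = 0 := by
    intro v
    have e : φ v * φ v = ∑ i, ∑ j, (v i * v j) • (f i * f j) := by
      simp only [φ, Fintype.linearCombination_apply, Finset.sum_mul_sum, smul_mul_smul_comm]
    have e' : φ v * φ v = -(φ v * φ v) := by
      conv_lhs => rw [e, Finset.sum_comm]
      rw [e, ← Finset.sum_neg_distrib]
      refine Finset.sum_congr rfl fun i _ => ?_
      rw [← Finset.sum_neg_distrib]
      refine Finset.sum_congr rfl fun j _ => ?_
      rw [hf j i, smul_neg, mul_comm]
    have h2 : (2 : ℂ) • (φ v * φ v) = 0 := by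
      rw [two_smul]
      nth_rewrite 2 [e']
      exact add_neg_cancel _
    exact (smul_eq_zero.1 h2).resolve_left two_ne_zero
  have key := congrArg (ExteriorAlgebra.lift ℂ ⟨φ, hφ⟩)
    ((ExteriorAlgebra.ιMulti ℂ a (M := Fin a → ℂ)).map_perm (fun i => Pi.single i 1) π)
  have h1 : ∀ i, φ (Pi.single i 1) = f i := fun i => by
    simp [φ, Fintype.linearCombination_apply_single]
  rw [Function.comp_def, ExteriorAlgebra.ιMulti_apply] at key
  rw [map_list_prod, List.map_ofFn, map_zsmul_unit, ExteriorAlgebra.ιMulti_apply, map_list_prod,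
    List.map_ofFn] at key
  simp only [Function.comp_def, ExteriorAlgebra.lift_ι_apply, h1] at key
  rw [key, Units.smul_def, signChar]
  exact (Int.cast_smul_eq_zsmul ℂ _ _).symm

theorem closedWord_mem_center (w : List (Mu r × Fin n)) :
    closedWord w ∈ Subalgebra.center ℂ (BigForm r n) := by
  cases w with
  | nil => simp [closedWord, openWord]
  | cons c w =>
    rw [closedWord, openWord, ← mul_assoc]
    exact mul_mem ((isOdd_big (isOdd_omegaSum _)).mul_mem_center (isOdd_theta _)) (path link c w).2

/-- Open words are odd and closed words are central; hence the sign of the permutation of the open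
blocks and nothing for the closed ones. -/
theorem arrProd_mix (x : WArr r n a l) (π : BlockPerm a l) :
    arrProd (x.mix π) = mixSign a l π • arrProd x := by
  have h1 : (List.ofFn fun i => openWord (word (x.mix π) (.inl i))).prod =
      mixSign a l π • (List.ofFn fun i => openWord (word x (.inl i))).prod :=
    ofFn_prod_perm (fun i => openWord (word x (.inl i))) (fun i j => openWord_anticomm _ _) π.1
  have h2 : (List.ofFn fun i => closedWord (word (x.mix π) (.inr i))).prod =
      (List.ofFn fun i => closedWord (word x (.inr i))).prod := by
    have hp := Equiv.Perm.ofFn_comp_perm π.2 fun i => closedWord (word x (.inr i))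
    refine hp.prod_eq' (List.pairwise_ofFn.2 fun i j _ => ?_)
    exact Subalgebra.mem_center_iff.1 (closedWord_mem_center _) _
  simp only [arrProd, blockProd, List.map_ofFn, Function.comp_def]
  rw [h1, h2, smul_mul_assoc]

/-- The element attached to a block: open or closed. -/
def blockWord (i : Fin a ⊕ Fin l) (w : List (Mu r × Fin n)) : BigForm r n :=
  Sum.elim (fun _ => openWord w) (fun _ => closedWord w) i

/-- The ordered product, open blocks first, as a multilinear map. -/
def orderedProd (r n a l : ℕ) :
    MultilinearMap ℂ (fun _ : Fin a ⊕ Fin l => BigForm r n) (BigForm r n) :=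
  (MultilinearMap.mkPiAlgebraFin ℂ (a + l) (BigForm r n)).domDomCongr finSumFinEquiv.symm

theorem orderedProd_apply (v : Fin a ⊕ Fin l → BigForm r n) : orderedProd r n a l v =
    (List.ofFn fun i => v (.inl i)).prod * (List.ofFn fun i => v (.inr i)).prod := by
  rw [orderedProd, MultilinearMap.domDomCongr_apply, MultilinearMap.mkPiAlgebraFin_apply,
    List.ofFn_add, List.prod_append]
  have h1 : ∀ i : Fin a, finSumFinEquiv.symm (Fin.castLE (Nat.le_add_right a l) i) = .inl i :=
    finSumFinEquiv_symm_apply_castAdd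
  simp [h1]

theorem arrProd_eq (x : WArr r n a l) :
    arrProd x = orderedProd r n a l fun i => blockWord i (word x i) := by
  rw [orderedProd_apply]
  simp [arrProd, blockProd, List.map_ofFn, blockWord, Function.comp_def]

/-- The labels do not enter the summand, so their sum is the factor |μ_r|; the standard additive
character takes the powers of `zetaRoot` as values. -/
theorem sum_shapeChar_smul (b : Fin n) [NeZero r] (f : ℕ → BigForm r n) :
    ∑ c : Shape r n b, shapeChar r b c • f (ZMod.val c.2.toAdd) =
      (Fintype.card (Mu r) : ℂ) •
        ∑ k ∈ Finset.range (b + 1), zetaRoot (b + 1) ^ k • f k := by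
  have h : ∀ k : ZMod (b + 1), ZMod.stdAddChar k = zetaRoot (b + 1) ^ ZMod.val k := by
    intro k
    have := ZMod.stdAddChar_coe (N := b + 1) (ZMod.val k : ℤ)
    rw [Int.cast_natCast, ZMod.natCast_zmod_val] at this
    rw [this, zetaRoot, ← Complex.exp_nat_mul]
    congr 1
    push_cast
    ring
  rw [Fintype.sum_prod_type]
  have h2 : ∀ ξ : Mu r, ∑ κ : Multiplicative (ZMod (b + 1)),
      shapeChar r b (ξ, κ) • f (ZMod.val κ.toAdd) =
        ∑ k ∈ Finset.range (b + 1), zetaRoot (b + 1) ^ k • f k := by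
    intro ξ
    rw [← Fin.sum_univ_eq_sum_range (fun k => zetaRoot (b + 1) ^ k • f k)]
    refine Fintype.sum_equiv (Multiplicative.toAdd (α := Fin (b + 1))) _ _ fun κ => ?_
    exact congrArg (· • f (ZMod.val (n := b + 1) κ.toAdd)) (h κ.toAdd)
  rw [Finset.sum_congr rfl fun ξ _ => h2 ξ, Finset.sum_const, Finset.card_univ, ← Nat.cast_smul_eq_nsmul ℂ]

/-- The ordered product is multilinear in the blocks, so the sum over the product group factors into
the rotation sums of the single blocks. -/
theorem sum_rot_arrProd [NeZero r] {x : WArr r n a l} (hx : IsEquivariant x) :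
    ∑ c : ∀ i, (shapeData r n).C (x.1 i), (∏ i, (shapeData r n).ψ _ (c i)) •
        arrProd (x.rot (shapeData r n) c) =
      (∏ _i : Fin a ⊕ Fin l, (Fintype.card (Mu r) : ℂ)) •
        rotProd (List.ofFn fun i => word x (.inl i)) (List.ofFn fun i => word x (.inr i)) := by
  have h1 : ∀ c : ∀ i, Shape r n (x.1 i), (∏ i, shapeChar r _ (c i)) •
        arrProd (x.rot (shapeData r n) c) = orderedProd r n a l fun i => shapeChar r _ (c i) •
          blockWord i ((word x i).rotate (ZMod.val (c i).2.toAdd)) := by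
    intro c
    rw [MultilinearMap.map_smul_univ, arrProd_eq]
    congr 2
    funext i
    have hw : word (x.rot (shapeData r n) c) i = _ := word_rot hx c i
    rw [hw]
    cases i with
    | inl i => exact openWord_scale _ _
    | inr i => exact closedWord_scale _ _
  have h2 : ∀ i, ∑ c : Shape r n (x.1 i), shapeChar r _ c •
      blockWord i ((word x i).rotate (ZMod.val c.2.toAdd)) =
        (Fintype.card (Mu r) : ℂ) • Sum.elim (fun i => rotSum (word x (.inl i)))
          (fun i => closedRotSum (word x (.inr i))) i := by
    intro i
    rw [sum_shapeChar_smul (x.1 i) fun k => blockWord i ((word x i).rotate k)]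
    cases i with
    | inl i => simp [rotSum, blockWord]
    | inr i => simp [closedRotSum, blockWord]
  have h3 := MultilinearMap.map_sum (orderedProd r n a l) fun i (c : Shape r n (x.1 i)) =>
    shapeChar r _ c • blockWord i ((word x i).rotate (ZMod.val c.2.toAdd))
  change ∑ c : ∀ i, Shape r n (x.1 i), (∏ i, shapeChar r _ (c i)) •
    arrProd (x.rot (shapeData r n) c) = _
  rw [Finset.sum_congr rfl fun c _ => h1 c, ← h3]
  simp only [h2]
  rw [MultilinearMap.map_smul_univ, orderedProd_apply]
  simp [rotProd, List.map_ofFn, Function.comp_def]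

end ArrProd

end WreathOS

end

noncomputable section

namespace WreathOS

/-! ### Counting increasing forests -/

section Count

variable {r n : ℕ} [NeZero r]

theorem card_mu (r : ℕ) [NeZero r] : Fintype.card (Mu r) = r := by
  rw [← Nat.card_eq_fintype_card]
  exact Complex.card_rootsOfUnity r

-- There are two kinds of root, and `r` labelled edges to each of the `k` smaller vertices.
open scoped Classical in
theorem card_vertex_lt (k : Fin n) :
    Fintype.card {v : Vertex r n // ∀ j η, v = .edge j η → j < k} = 2 + r * k := by
  have h : (Finset.univ.filter fun v : Vertex r n => ∀ j η, v = .edge j η → j < k) =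
      insert .openRoot (insert .closedRoot
        ((((Finset.univ.filter fun j : Fin n => j < k) ×ˢ (Finset.univ : Finset (Mu r)))).image
          fun x => Vertex.edge x.1 x.2)) := by
    ext v
    cases v with
    | openRoot => simp
    | closedRoot => simp
    | edge j η =>
      simp only [Finset.mem_filter, Finset.mem_univ, true_and, Vertex.edge.injEq, and_imp,
        Finset.mem_insert, reduceCtorEq, Finset.mem_image, Finset.mem_product, and_true,
        Prod.exists, false_or]
      constructor
      · intro h
        exact ⟨j, η, h j η rfl rfl, rfl, rfl⟩
      · rintro ⟨j', η', hj, rfl, rfl⟩ j₂ η₂ rfl rfl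
        exact hj
  rw [Fintype.card_subtype, h, Finset.card_insert_of_notMem (by simp),
    Finset.card_insert_of_notMem (by simp), Finset.card_image_of_injective, Finset.card_product,
    Finset.card_univ, card_mu]
  · have : (Finset.univ.filter fun j : Fin n => j < k).card = k := by
      rw [show (Finset.univ.filter fun j : Fin n => j < k) = Finset.Iio k by ext; simp]
      exact Fin.card_Iio k
    rw [this]
    ring
  · rintro ⟨j, η⟩ ⟨j', η'⟩ h
    simpa using h

open scoped Classical in
theorem card_isInc :
    Fintype.card {v : Fin n → Vertex r n // IsInc v} = ∏ k ∈ Finset.range n, (2 + r * k) := by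
  rw [← Fin.prod_univ_eq_prod_range (fun k => 2 + r * k)]
  simp only [← card_vertex_lt (r := r)]
  rw [← Fintype.card_pi]
  exact Fintype.card_congr (Equiv.subtypePiEquivPi 
    (p := fun k (v : Vertex r n) => ∀ j η, v = .edge j η → j < k))

-- The increasing forests are sorted by the number of open roots, `n` minus the number of the other
-- vertices, and the number of closed roots; `p` is the total number of roots.
open scoped Classical in
theorem sum_card_incForest :
    ∑ p ∈ Finset.range (n + 1), ∑ x ∈ Finset.HasAntidiagonal.antidiagonal p,
      Fintype.card (IncForest r n (n - x.1) x.2) = ∏ k ∈ Finset.range n, (2 + r * k) := by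
  have hle : ∀ (f : Vertex r n → Bool) (v : Fin n → Vertex r n), countBefore f v n ≤ n :=
    fun f v => (Finset.card_filter_le _ _).trans (by simp)
  have hcl : ∀ v : Fin n → Vertex r n,
      countBefore Vertex.isClosed v n ≤ countBefore Vertex.isNonOpen v n := by
    intro v
    refine Finset.card_le_card fun k hk => ?_
    simp only [Finset.mem_filter, Finset.mem_univ, true_and] at hk ⊢
    refine ⟨hk.1, ?_⟩
    cases h : v k <;> simp_all [Vertex.isClosed, Vertex.isNonOpen, Vertex.isOpen]
  rw [← card_isInc, Finset.sum_sigma', Fintype.card_subtype,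
    Finset.card_eq_sum_card_fiberwise (f := fun v : Fin n → Vertex r n =>
      (⟨n - countBefore Vertex.isNonOpen v n + countBefore Vertex.isClosed v n,
        (n - countBefore Vertex.isNonOpen v n, countBefore Vertex.isClosed v n)⟩ : Σ _ : ℕ, ℕ × ℕ))
      (t := (Finset.range (n + 1)).sigma fun p => Finset.HasAntidiagonal.antidiagonal p)]
  · refine Finset.sum_congr rfl ?_
    rintro ⟨p, a, l⟩ h
    simp only [Finset.mem_sigma, Finset.mem_range, Finset.HasAntidiagonal.mem_antidiagonal] at h
    rw [Fintype.card_subtype, Finset.filter_filter]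
    congr 1
    ext v
    simp only [Finset.mem_filter, Finset.mem_univ, true_and, Sigma.mk.injEq, heq_eq_eq,
      Prod.mk.injEq]
    have h1 := hle Vertex.isNonOpen v
    have h2 := hcl v
    refine and_congr_right fun _ => ?_
    omega
  · intro v _
    have h1 := hle Vertex.isNonOpen v
    have h2 := hcl v
    simp only [Finset.coe_sigma, Finset.coe_range, Set.mem_sigma_iff, Set.mem_Iio,
      Finset.mem_coe, Finset.HasAntidiagonal.mem_antidiagonal, and_true]
    omega

end Count

/-! ### Coefficients of powers of the logarithmic series -/

section LogSeries

open PowerSeries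

/-- The series `∑ X^s / s`. -/
def logSeries : PowerSeries ℚ := PowerSeries.mk fun s => (s : ℚ)⁻¹

theorem coeff_logSeries_pow_nonneg (m p : ℕ) : 0 ≤ coeff m (logSeries ^ p) := by
  rw [coeff_pow]
  refine Finset.sum_nonneg fun f _ => Finset.prod_nonneg fun i _ => ?_
  rw [logSeries, coeff_mk]
  positivity

theorem derivative_logSeries_mul : derivative ℚ logSeries * (1 - X) = 1 := by
  have : derivative ℚ logSeries = PowerSeries.mk 1 := by
    ext m
    rw [coeff_derivative, logSeries, coeff_mk, coeff_mk, Pi.one_apply, Nat.cast_succ,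
      inv_mul_cancel₀ (by positivity)]
  rw [this]
  exact PowerSeries.mk_one_mul_one_sub_eq_one ℚ

/-- Compare coefficients in (1 - X) (L^p)' = p L^{p-1}, where L = -log(1 - X). For `p = 0` the
truncated exponent does no harm because of the factor `p`. -/
theorem coeff_logSeries_pow_succ (m p : ℕ) :
    (m + 1 : ℚ) * coeff (m + 1) (logSeries ^ p) =
      m * coeff m (logSeries ^ p) + p * coeff m (logSeries ^ (p - 1)) := by
  have h : derivative ℚ (logSeries ^ p) * (1 - X) = (p : ℚ) • logSeries ^ (p - 1) := by
    rw [Derivation.leibniz_pow, smul_mul_assoc, smul_mul_assoc, derivative_logSeries_mul,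
      smul_eq_mul, mul_one, ← Nat.cast_smul_eq_nsmul ℚ]
  have h' := congrArg (coeff m) h
  rw [mul_sub, mul_one, map_sub, coeff_derivative, map_smul, smul_eq_mul] at h'
  cases m with
  | zero =>
    rw [coeff_zero_mul_X] at h'
    push_cast at h' ⊢
    linarith
  | succ m =>
    rw [coeff_succ_mul_X, coeff_derivative] at h'
    push_cast at h' ⊢
    linarith

/-- The number n!/p! [X^n] L^p is the unsigned Stirling number of the first kind, and the sum of
these numbers times 2^p r^{n-p} is the product on the right. The recursion for the coefficients
gives the induction on `n`; as all terms are nonnegative, partial sums and an inequality suffice. -/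
theorem sum_coeff_logSeries_le (r : ℕ) [NeZero r] (n M : ℕ) :
    ∑ p ∈ Finset.range M, (2 : ℚ) ^ p / p.factorial * (r ^ n * (r ^ p : ℚ)⁻¹) *
      (n.factorial * coeff n (logSeries ^ p)) ≤ ∏ k ∈ Finset.range n, (2 + r * k : ℚ) := by
  have hr : (r : ℚ) ≠ 0 := Nat.cast_ne_zero.2 (NeZero.ne r)
  have hterm : ∀ n p : ℕ, 0 ≤ (2 : ℚ) ^ p / p.factorial * (r ^ n * (r ^ p : ℚ)⁻¹) *
      (n.factorial * coeff n (logSeries ^ p)) := fun n p => by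
    have := coeff_logSeries_pow_nonneg n p
    positivity
  induction n generalizing M with
  | zero =>
    cases M with
    | zero => simp
    | succ M =>
      rw [Finset.sum_range_succ']
      -- The constant coefficient of `logSeries` is `(0 : ℚ)⁻¹ = 0`.
      have : ∀ p, coeff 0 (logSeries ^ (p + 1)) = 0 := fun p => by
        simp [logSeries]
      simp [this]
  | succ n ih =>
    rw [Finset.prod_range_succ]
    have h1 : ∀ p : ℕ, (2 : ℚ) ^ p / p.factorial * (r ^ (n + 1) * (r ^ p : ℚ)⁻¹) *
        ((n + 1).factorial * coeff (n + 1) (logSeries ^ p)) =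
        r * n * ((2 : ℚ) ^ p / p.factorial * (r ^ n * (r ^ p : ℚ)⁻¹) *
          (n.factorial * coeff n (logSeries ^ p))) +
        (2 : ℚ) ^ p / p.factorial * (r ^ (n + 1) * (r ^ p : ℚ)⁻¹) *
          (n.factorial * (p * coeff n (logSeries ^ (p - 1)))) := by
      intro p
      rw [Nat.factorial_succ, Nat.cast_mul, Nat.cast_succ, mul_assoc (n + 1 : ℚ),
        mul_left_comm (n + 1 : ℚ), coeff_logSeries_pow_succ]
      ring
    have h2 : ∑ p ∈ Finset.range M, (2 : ℚ) ^ p / p.factorial * (r ^ (n + 1) * (r ^ p : ℚ)⁻¹) *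
          (n.factorial * (p * coeff n (logSeries ^ (p - 1)))) ≤
        2 * ∏ k ∈ Finset.range n, (2 + r * k : ℚ) := by
      cases M with
      | zero =>
        simp only [Finset.range_zero, Finset.sum_empty]
        positivity
      | succ M =>
        rw [Finset.sum_range_succ']
        have h3 : ∀ p : ℕ, (2 : ℚ) ^ (p + 1) / (p + 1).factorial *
            (r ^ (n + 1) * (r ^ (p + 1) : ℚ)⁻¹) *
            (n.factorial * ((p + 1 : ℕ) * coeff n (logSeries ^ (p + 1 - 1)))) =
            2 * ((2 : ℚ) ^ p / p.factorial * (r ^ n * (r ^ p : ℚ)⁻¹) *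
              (n.factorial * coeff n (logSeries ^ p))) := by
          intro p
          rw [Nat.factorial_succ, Nat.add_sub_cancel]
          have : (p.factorial : ℚ) ≠ 0 := by positivity
          push_cast
          field_simp
          try ring
        simp only [h3, ← Finset.mul_sum]
        simpa using ih M
    simp only [h1, Finset.sum_add_distrib, ← Finset.mul_sum]
    have h4 := mul_le_mul_of_nonneg_left (ih M) (show (0 : ℚ) ≤ r * n by positivity)
    nlinarith [h2, h4]

/-- The binomial coefficients add up to 2^p: each of `p` blocks may be declared open or closed. -/
theorem sum_inv_factorial_antidiagonal (p : ℕ) :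
    ∑ x ∈ Finset.HasAntidiagonal.antidiagonal p, ((x.1.factorial * x.2.factorial : ℕ) : ℚ)⁻¹ =
      2 ^ p / p.factorial := by
  rw [eq_div_iff (by positivity), Finset.sum_mul, ← Nat.cast_ofNat, ← Nat.cast_pow, ← Nat.sum_range_choose,
    Nat.cast_sum, ← Finset.Nat.sum_antidiagonal_eq_sum_range_succ_mk
      (fun x : ℕ × ℕ => ((p.choose x.1 : ℕ) : ℚ))]
  refine Finset.sum_congr rfl fun x hx => ?_
  rw [Finset.HasAntidiagonal.mem_antidiagonal] at hx
  subst hx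
  rw [Nat.cast_choose ℚ (Nat.le_add_right _ _), Nat.add_sub_cancel_left]
  push_cast
  ring

end LogSeries

end WreathOS

end

noncomputable section

namespace WreathOS

/-! ### The dimension of the space of equivariant functions -/

section FinrankBlock

variable {r n a l : ℕ} [NeZero r]

instance wArrFintype : Fintype (WArr r n a l) := Fintype.ofFinite _

-- An equivariant arrangement is determined by its letters, that is, by one label for each point and
-- a bijection from the rotation positions to the `n` points.
open scoped Classical in
theorem card_equivariant_le (b : Fin a ⊕ Fin l → Fin n) :
    Fintype.card {u : (Σ i, Shape r n (b i)) ≃ Mu r × Fin n //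
      IsEquivariant (⟨b, u⟩ : WArr r n a l)} ≤
    if ∑ i, ((b i : ℕ) + 1) = n then r ^ n * n.factorial else 0 := by
  let f : {u : (Σ i, Shape r n (b i)) ≃ Mu r × Fin n // IsEquivariant (⟨b, u⟩ : WArr r n a l)} →
      ((Σ i, ZMod ((b i : ℕ) + 1)) → Mu r) × ((Σ i, ZMod ((b i : ℕ) + 1)) ≃ Fin n) := fun u =>
    (fun y => (letter (⟨b, u.1⟩ : WArr r n a l) y.1 y.2).1,
      Equiv.ofBijective (fun y => (letter (⟨b, u.1⟩ : WArr r n a l) y.1 y.2).2)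
        ⟨fun y y' h => u.2.letter_injective h, fun k => by
          obtain ⟨⟨i, y⟩, h⟩ := u.1.surjective (1, k)
          refine ⟨⟨i, y.2.toAdd⟩, ?_⟩
          have := u.2.apply i y
          exact congrArg Prod.snd (this.symm.trans h)⟩)
  have hf : Function.Injective f := by
    rintro ⟨u, hu⟩ ⟨v, hv⟩ h
    refine Subtype.ext (Equiv.ext fun ⟨i, y⟩ => ?_)
    have e1 := hu.apply i y
    have e2 := hv.apply i y
    refine e1.trans (Eq.trans ?_ e2.symm)
    have h1 := congrFun (congrArg Prod.fst h) ⟨i, y.2.toAdd⟩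
    have h2 := congrArg (fun e : (Σ i, ZMod ((b i : ℕ) + 1)) ≃ Fin n => e ⟨i, y.2.toAdd⟩)
      (congrArg Prod.snd h)
    exact congrArg _ (Prod.ext h1 h2)
  have hcard : Fintype.card (Σ i, ZMod ((b i : ℕ) + 1)) = ∑ i, ((b i : ℕ) + 1) := by
    simp [Fintype.card_sigma, ZMod.card]
  refine (Fintype.card_le_of_injective f hf).trans ?_
  split_ifs with h
  · rw [Fintype.card_prod, Fintype.card_fun, hcard, h, card_mu]
    refine Nat.mul_le_mul_left _ ?_
    rcases isEmpty_or_nonempty ((Σ i, ZMod ((b i : ℕ) + 1)) ≃ Fin n) with he | ⟨⟨e⟩⟩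
    · simp
    · rw [Fintype.card_equiv e, hcard, h]
  · have : IsEmpty ((Σ i, ZMod ((b i : ℕ) + 1)) ≃ Fin n) := ⟨fun e => h (by
      rw [← hcard, Fintype.card_congr e, Fintype.card_fin])⟩
    simp

-- Expanding the power of the series gives a sum over all families of block sizes with sum `n`,
-- weighted by the inverses of the sizes; nonnegativity allows terms to be added.
open PowerSeries in
open scoped Classical in
theorem sum_prod_inv_le_coeff :
    ∑ b : Fin a ⊕ Fin l → Fin n, (if ∑ i, ((b i : ℕ) + 1) = n then
      ∏ i, ((b i : ℚ) + 1)⁻¹ else 0) ≤ coeff n (logSeries ^ (a + l)) := by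
  have h1 : logSeries ^ (a + l) = ∏ _i : Fin a ⊕ Fin l, logSeries := by simp
  rw [h1, coeff_prod, ← Finset.sum_filter]
  let g : (Fin a ⊕ Fin l → Fin n) ↪ ((Fin a ⊕ Fin l) →₀ ℕ) :=
    ⟨fun b => Finsupp.equivFunOnFinite.symm fun i => (b i : ℕ) + 1, fun b b' h => by
      have h' := Finsupp.equivFunOnFinite.symm.injective h
      funext i
      have := congrFun h' i
      exact Fin.ext (by simpa using this)⟩
  have hg : ∀ b i, g b i = (b i : ℕ) + 1 := fun _ _ => rfl
  have h2 : ∀ b, ∏ i, ((b i : ℚ) + 1)⁻¹ = ∏ i, coeff (g b i) logSeries := by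
    intro b
    refine Finset.prod_congr rfl fun i _ => ?_
    rw [logSeries, coeff_mk, hg]
    push_cast
    rfl
  rw [Finset.sum_congr rfl fun b _ => h2 b,
    ← Finset.sum_map _ g fun f => ∏ i, coeff (f i) logSeries]
  refine Finset.sum_le_sum_of_subset_of_nonneg ?_ fun f _ _ => Finset.prod_nonneg fun i _ => ?_
  · intro f hf
    obtain ⟨b, hb, rfl⟩ := Finset.mem_map.1 hf
    rw [Finset.mem_finsuppAntidiag]
    refine ⟨?_, by simp⟩
    change ∑ i, g b i = n
    simp only [hg]
    exact (Finset.mem_filter.1 hb).2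
  · rw [logSeries, coeff_mk]
    positivity

-- Start from the trace formula `finrank_blockFun`. The group of a block of size b has order r b:
-- the inverse sizes are coefficients of the logarithmic series, and the factors 1/r collect to
-- r^{-(a+l)}.
open PowerSeries in
theorem finrank_blockFun_le :
    (Module.finrank ℂ (blockFun (shapeData r n) (IsEquivariant : WArr r n a l → Prop)) : ℚ) ≤
      ((a.factorial * l.factorial : ℕ) : ℚ)⁻¹ * (r ^ n * (r ^ (a + l) : ℚ)⁻¹) *
        (n.factorial * coeff n (logSeries ^ (a + l))) := by
  classical
  have h := finrank_blockFun (shapeData_isFree (r := r) (n := n))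
    (isEquivariant_invariant (r := r) (n := n) (a := a) (l := l))
  have h1 : (Module.finrank ℂ
      (blockFun (shapeData r n) (IsEquivariant : WArr r n a l → Prop)) : ℚ) =
      ∑ x : WArr r n a l, if IsEquivariant x then ((a.factorial * l.factorial : ℕ) : ℚ)⁻¹ *
        (∏ i, ((r * ((x.1 i : ℕ) + 1) : ℕ) : ℚ))⁻¹ else 0 := by
    apply Rat.cast_injective (α := ℂ)
    rw [Rat.cast_natCast, h, Rat.cast_sum]
    refine Finset.sum_congr rfl fun x _ => ?_
    split_ifs
    · have e : ∏ i, (Fintype.card ((shapeData r n).C (x.1 i)) : ℂ) =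
          ((∏ i, ((r * ((x.1 i : ℕ) + 1) : ℕ) : ℚ) : ℚ) : ℂ) := by
        rw [Rat.cast_prod]
        refine Finset.prod_congr rfl fun i _ => ?_
        rw [Rat.cast_natCast]
        congr 1
        change Fintype.card (Mu r × Multiplicative (ZMod ((x.1 i : ℕ) + 1))) = _
        rw [Fintype.card_prod, card_mu, Fintype.card_multiplicative, ZMod.card]
      rw [e, Rat.cast_mul, Rat.cast_inv, Rat.cast_inv, Rat.cast_natCast]
    · simp
  have h2 : ∑ x : WArr r n a l, (if IsEquivariant x then
      ((a.factorial * l.factorial : ℕ) : ℚ)⁻¹ *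
        (∏ i, ((r * ((x.1 i : ℕ) + 1) : ℕ) : ℚ))⁻¹ else 0) =
      ∑ b : Fin a ⊕ Fin l → Fin n, (Fintype.card {u : (Σ i, Shape r n (b i)) ≃ Mu r × Fin n //
        IsEquivariant (⟨b, u⟩ : WArr r n a l)} : ℚ) * (((a.factorial * l.factorial : ℕ) : ℚ)⁻¹ *
          (∏ i, ((r * ((b i : ℕ) + 1) : ℕ) : ℚ))⁻¹) := by
    refine Eq.trans (Finset.sum_congr (Finset.ext fun x => by simp) fun x _ => rfl)
      (Fintype.sum_sigma (fun x : (Σ b : Fin a ⊕ Fin l → Fin n, (Σ i, Shape r n (b i)) ≃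
        Mu r × Fin n) => if IsEquivariant (x : WArr r n a l) then
          ((a.factorial * l.factorial : ℕ) : ℚ)⁻¹ *
            (∏ i, ((r * ((x.1 i : ℕ) + 1) : ℕ) : ℚ))⁻¹ else 0)) |>.trans ?_
    refine Finset.sum_congr rfl fun b _ => ?_
    rw [← Finset.sum_filter]
    dsimp only
    rw [Finset.sum_const, nsmul_eq_mul, Fintype.card_subtype]
  rw [h1, h2]
  have h3 : ∀ b : Fin a ⊕ Fin l → Fin n,
      (Fintype.card {u : (Σ i, Shape r n (b i)) ≃ Mu r × Fin n //
        IsEquivariant (⟨b, u⟩ : WArr r n a l)} : ℚ) * (((a.factorial * l.factorial : ℕ) : ℚ)⁻¹ *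
          (∏ i, ((r * ((b i : ℕ) + 1) : ℕ) : ℚ))⁻¹) ≤
      ((a.factorial * l.factorial : ℕ) : ℚ)⁻¹ * (r ^ n * (r ^ (a + l) : ℚ)⁻¹) * n.factorial *
        (if ∑ i, ((b i : ℕ) + 1) = n then ∏ i, ((b i : ℚ) + 1)⁻¹ else 0) := by
    intro b
    have hc : (Fintype.card {u : (Σ i, Shape r n (b i)) ≃ Mu r × Fin n //
        IsEquivariant (⟨b, u⟩ : WArr r n a l)} : ℚ) ≤
        if ∑ i, ((b i : ℕ) + 1) = n then (r : ℚ) ^ n * n.factorial else 0 := by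
      have := (Nat.cast_le (α := ℚ)).2 (card_equivariant_le (r := r) b)
      refine this.trans (le_of_eq ?_)
      split_ifs <;> simp
    refine (mul_le_mul_of_nonneg_right hc (by positivity)).trans (le_of_eq ?_)
    split_ifs
    · have e : (∏ i, ((r * ((b i : ℕ) + 1) : ℕ) : ℚ))⁻¹ =
          (r ^ (a + l) : ℚ)⁻¹ * ∏ i, ((b i : ℚ) + 1)⁻¹ := by
        rw [Finset.prod_inv_distrib, ← mul_inv]
        congr 1
        push_cast
        rw [Finset.prod_mul_distrib]
        simp
      rw [e]
      ring
    · simp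
  refine (Finset.sum_le_sum fun b _ => h3 b).trans ?_
  rw [← Finset.mul_sum]
  exact (mul_le_mul_of_nonneg_left sum_prod_inv_le_coeff (by positivity)).trans
    (le_of_eq (by ring))

open scoped Classical in
theorem sum_finrank_blockFun_le :
    ∑ p ∈ Finset.range (n + 1), ∑ x ∈ Finset.HasAntidiagonal.antidiagonal p,
      Module.finrank ℂ (blockFun (shapeData r n) (IsEquivariant : WArr r n x.1 x.2 → Prop)) ≤
    ∏ k ∈ Finset.range n, (2 + r * k) := by
  have h := sum_coeff_logSeries_le r n (n + 1)
  rw [← Nat.cast_le (α := ℚ)]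
  push_cast
  refine le_trans (Finset.sum_le_sum fun p _ => ?_) h
  rw [← sum_inv_factorial_antidiagonal, Finset.sum_mul, Finset.sum_mul]
  refine Finset.sum_le_sum fun x hx => ?_
  rw [Finset.HasAntidiagonal.mem_antidiagonal] at hx
  subst hx
  exact finrank_blockFun_le

open scoped Classical in
/-- If all graded pieces are quotients of the spaces of equivariant functions, the dimensions are
equal. -/
theorem finrank_blockFun_eq
    (h : ∀ a l, a + l ≤ n → Module.finrank ℂ (Gr r n (n - a - l : ℤ) l) ≤
      Module.finrank ℂ (blockFun (shapeData r n) (IsEquivariant : WArr r n a l → Prop)))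
    {a l : ℕ} (hal : a + l ≤ n) :
    Module.finrank ℂ (Gr r n (n - a - l : ℤ) l) =
      Module.finrank ℂ (blockFun (shapeData r n) (IsEquivariant : WArr r n a l → Prop)) := by
  let A : (Σ _ : ℕ, ℕ × ℕ) → ℕ := fun y => Fintype.card (IncForest r n (n - y.2.1) y.2.2)
  let B : (Σ _ : ℕ, ℕ × ℕ) → ℕ := fun y =>
    Module.finrank ℂ (blockFun (shapeData r n) (IsEquivariant : WArr r n y.2.1 y.2.2 → Prop))
  let s := (Finset.range (n + 1)).sigma fun p => Finset.HasAntidiagonal.antidiagonal p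
  have hmem : ∀ y, y ∈ s ↔ y.2.1 + y.2.2 = y.1 ∧ y.1 < n + 1 := by
    intro y
    simp only [s, Finset.mem_sigma, Finset.mem_range, Finset.HasAntidiagonal.mem_antidiagonal]
    exact and_comm
  have hlow : ∀ y : Σ _ : ℕ, ℕ × ℕ, y.2.1 + y.2.2 ≤ n →
      A y ≤ Module.finrank ℂ (Gr r n (n - y.2.1 - y.2.2 : ℤ) y.2.2) :=
    fun y hy => card_incForest_le_finrank (by omega) rfl
  have hAB : ∀ y ∈ s, A y ≤ B y := fun y hy => by
    have hy' : y.2.1 + y.2.2 ≤ n := by have := (hmem y).1 hy; omega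
    exact (hlow y hy').trans (h _ _ hy')
  have hup : ∑ y ∈ s, B y ≤ ∑ y ∈ s, A y := by
    have h1 := sum_card_incForest (r := r) (n := n)
    have h2 := sum_finrank_blockFun_le (r := r) (n := n)
    rw [Finset.sum_sigma'] at h1 h2
    exact h2.trans h1.ge
  -- The numbers of forests are termwise at most the dimensions of the function spaces, yet their
  -- sum is at least as large; hence equality holds in every term, and the graded piece is squeezed
  -- in between.
  have heq := (Finset.sum_eq_sum_iff_of_le hAB).1 (le_antisymm (Finset.sum_le_sum hAB) hup)
    ⟨a + l, (a, l)⟩ ((hmem _).2 ⟨rfl, by simp only; omega⟩)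
  refine le_antisymm (h a l hal) ?_
  change B ⟨a + l, (a, l)⟩ ≤ _
  rw [← heq]
  exact hlow ⟨a + l, (a, l)⟩ hal

end FinrankBlock

end WreathOS

end

noncomputable section

namespace WreathOS

/-! ### Graded pieces as spaces of equivariant functions -/

section Main

variable {r n a l : ℕ} {k : ℤ}

open scoped Classical in
/-- The form attached to an equivariant arrangement. -/
def arrForm (x : WArr r n a l) : Form r n :=
  if h : ∃ α ∈ incSpan r n n (n - a) l, thetaMul r n α = arrProd x ∧ IsEquivariant x then
    h.choose else 0

theorem IsEquivariant.exists_form (ha : a ≤ n) {x : WArr r n a l} (hx : IsEquivariant x) :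
    ∃ α ∈ incSpan r n n (n - a) l, thetaMul r n α = arrProd x ∧ IsEquivariant x := by
  obtain ⟨α, hα, h⟩ := (hx.covers.blockProd_mem (q := n - a) (by simp; omega)).1
  rw [List.length_ofFn] at hα
  exact ⟨α, hα, h, hx⟩

theorem thetaMul_arrForm (ha : a ≤ n) {x : WArr r n a l} (hx : IsEquivariant x) :
    thetaMul r n (arrForm x) = arrProd x := by
  have h := hx.exists_form ha
  rw [arrForm, dif_pos h]
  exact h.choose_spec.2.1

theorem arrForm_mem (x : WArr r n a l) : arrForm x ∈ incSpan r n n (n - a) l := by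
  rw [arrForm]
  split_ifs with h
  · exact h.choose_spec.1
  · exact zero_mem _

theorem arrForm_of_not {x : WArr r n a l} (hx : ¬ IsEquivariant x) : arrForm x = 0 :=
  dif_neg fun ⟨_, _, _, h⟩ => hx h

theorem signChar_mul_self (σ : Equiv.Perm (Fin n)) : signChar n σ * signChar n σ = 1 := by
  rw [← map_mul]
  rcases Int.units_eq_one_or (Equiv.Perm.sign σ) with h | h <;> simp [signChar, h]

theorem IsEquivariant.act_iff (x : WArr r n a l) (g : W r n) :
    IsEquivariant (x.act (wreathPerm r n g)) ↔ IsEquivariant x := by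
  refine ⟨fun h => ?_, fun h => h.act g⟩
  have := h.act g⁻¹
  rwa [Arr.act_act, ← map_mul, inv_mul_cancel, map_one, Arr.act_one] at this

/-- After multiplication by the θ_i the group just permutes arrangements; the sign is that of the
product of the θ_i. -/
theorem formRep_arrForm (ha : a ≤ n) (g : W r n) (x : WArr r n a l) :
    formRep r n g (arrForm x) =
      signChar n g.right • arrForm (x.act (wreathPerm r n g)) := by
  by_cases hx : IsEquivariant x
  · apply thetaMul_injective
    have h := bigAct_thetaMul g (arrForm x)
    rw [thetaMul_arrForm ha hx, bigAct_arrProd] at h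
    rw [map_smul, thetaMul_arrForm ha (hx.act g), h, smul_smul, signChar_mul_self, one_smul]
  · rw [arrForm_of_not hx, arrForm_of_not (mt (IsEquivariant.act_iff x g).1 hx), map_zero,
      smul_zero]

theorem filt_eq_of (hk : k + l = n - a) (ha : a ≤ n) (m : ℕ) :
    filt r n (k + l) m = incSpan r n n (n - a) m := by
  rw [hk, ← Nat.cast_sub ha, filt_eq_incSpan]
  simp

variable [NeZero r]

theorem arrForm_mix (ha : a ≤ n) (x : WArr r n a l) (π : BlockPerm a l) :
    arrForm (x.mix π) = mixSign a l π • arrForm x := by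
  by_cases hx : IsEquivariant x
  · apply thetaMul_injective
    rw [map_smul, thetaMul_arrForm ha hx, thetaMul_arrForm ha (isEquivariant_invariant.mix x π hx),
      arrProd_mix]
  · rw [arrForm_of_not hx, arrForm_of_not (mt (isEquivariant_invariant.mix_iff x π).1 hx),
      smul_zero]

/-- The form with given coefficients. -/
def sumForm : (WArr r n a l → ℂ) →ₗ[ℂ] Form r n := Fintype.linearCombination ℂ arrForm

theorem sumForm_apply (f : WArr r n a l → ℂ) : sumForm f = ∑ x, f x • arrForm x := rfl

theorem sumForm_mem (f : WArr r n a l → ℂ) : sumForm f ∈ incSpan r n n (n - a) l :=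
  Submodule.sum_mem _ fun x _ => Submodule.smul_mem _ _ (arrForm_mem x)

theorem formRep_sumForm (ha : a ≤ n) (g : W r n) (f : WArr r n a l → ℂ) :
    sumForm (arrRep (Shape r n) _ _ (wreathPerm r n g) f) =
      signChar n g.right • formRep r n g (sumForm f) := by
  let e : WArr r n a l ≃ WArr r n a l :=
    { toFun := fun x => x.act (wreathPerm r n g)
      invFun := fun x => x.act (wreathPerm r n g)⁻¹
      left_inv := fun x => by dsimp only; rw [Arr.act_act, inv_mul_cancel, Arr.act_one]
      right_inv := fun x => by dsimp only; rw [Arr.act_act, mul_inv_cancel, Arr.act_one] }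
  rw [sumForm_apply, sumForm_apply, map_sum, Finset.smul_sum, ← Equiv.sum_comp e]
  refine Finset.sum_congr rfl fun x _ => ?_
  have h1 : arrRep (Shape r n) _ _ (wreathPerm r n g) f (e x) = f x := by
    rw [arrRep_apply]
    exact congrArg f (e.left_inv x)
  rw [h1, map_smul, formRep_arrForm ha, smul_comm, smul_smul _ _ (arrForm _), signChar_mul_self,
    one_smul]
  rfl

theorem mixSign_mul_self (π : BlockPerm a l) : mixSign a l π * mixSign a l π = 1 :=
  signChar_mul_self π.1

theorem mixSign_inv (π : BlockPerm a l) : mixSign a l π⁻¹ = mixSign a l π := by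
  have h := char_mul_inv (mixSign a l) π
  calc mixSign a l π⁻¹ = mixSign a l π * mixSign a l π * mixSign a l π⁻¹ := by
        rw [mixSign_mul_self, one_mul]
    _ = mixSign a l π := by rw [mul_assoc, h, mul_one]

/-- The forms themselves already change by `mixSign`, so antisymmetrizing the coefficients changes
nothing. -/
theorem sumForm_avgMix (ha : a ≤ n) (f : WArr r n a l → ℂ) : sumForm (avgMix f) = sumForm f := by
  have h : ∀ π : BlockPerm a l,
      ∑ x : WArr r n a l, (mixSign a l π⁻¹ * f (x.mix π)) • arrForm x = sumForm f := by
    intro π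
    let e : WArr r n a l ≃ WArr r n a l :=
      { toFun := fun x => x.mix π
        invFun := fun x => x.mix π⁻¹
        left_inv := fun x => by dsimp only; rw [Arr.mix_mix, mul_inv_cancel, Arr.mix_one]
        right_inv := fun x => by dsimp only; rw [Arr.mix_mix, inv_mul_cancel, Arr.mix_one] }
    rw [sumForm_apply]
    refine Eq.trans ?_ (Equiv.sum_comp e fun x => f x • arrForm x)
    refine Finset.sum_congr rfl fun x _ => ?_
    rw [show e x = x.mix π from rfl, arrForm_mix ha, mixSign_inv, smul_smul, mul_comm]
  rw [sumForm_apply]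
  simp only [avgMix_apply, mul_smul, Finset.sum_smul, Finset.smul_sum]
  rw [Finset.sum_comm]
  have h' : ∀ π : BlockPerm a l, ∑ x : WArr r n a l, (Fintype.card (BlockPerm a l) : ℂ)⁻¹ •
      mixSign a l π⁻¹ • f (x.mix π) • arrForm x = (Fintype.card (BlockPerm a l) : ℂ)⁻¹ • sumForm f := by
    intro π
    rw [← Finset.smul_sum, ← h π]
    simp only [mul_smul]
  rw [Finset.sum_congr rfl fun π _ => h' π, Finset.sum_const, Finset.card_univ,
    ← Nat.cast_smul_eq_nsmul ℂ, smul_smul, mul_inv_cancel₀ (Nat.cast_ne_zero.2 Fintype.card_ne_zero),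
    one_smul]

/-- Reverse a rotation of an arrangement. -/
def rotSwap : (Σ x : WArr r n a l, ∀ i, (shapeData r n).C (x.1 i)) ≃
    (Σ x : WArr r n a l, ∀ i, (shapeData r n).C (x.1 i)) :=
  have h : Function.Involutive fun y : (Σ x : WArr r n a l, ∀ i, (shapeData r n).C (x.1 i)) =>
      (⟨y.1.rot (shapeData r n) y.2, (y.2⁻¹ : ∀ i, (shapeData r n).C (y.1.1 i))⟩ :
        Σ x : WArr r n a l, ∀ i, (shapeData r n).C (x.1 i)) := by
    rintro ⟨⟨b, u⟩, c⟩
    have h1 := Arr.rot_rot (shapeData r n) (⟨b, u⟩ : WArr r n a l) c c⁻¹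
    rw [mul_inv_cancel, Arr.rot_one] at h1
    have h2 := eq_of_heq (Sigma.mk.inj h1).2
    have h3 : ∀ (v v' : (Σ i, Shape r n (b i)) ≃ Mu r × Fin n)
        (d d' : ∀ i, (shapeData r n).C (b i)), v = v' → d = d' →
        (⟨⟨b, v⟩, d⟩ : Σ x : WArr r n a l, ∀ i, (shapeData r n).C (x.1 i)) = ⟨⟨b, v'⟩, d'⟩ := by
      rintro v _ d _ rfl rfl
      rfl
    exact h3 _ _ _ _ h2 (inv_inv c)
  h.toPerm _

/-- Averaging is moved from the coefficients to the forms by the substitution of (x rotated by c,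
c⁻¹) for (x, c); the inverse in the character disappears. -/
theorem sumForm_avgRot (f : WArr r n a l → ℂ) : sumForm (avgRot (shapeData r n) f) =
    ∑ x : WArr r n a l, f x • (∏ i, (Fintype.card ((shapeData r n).C (x.1 i)) : ℂ))⁻¹ •
      ∑ c : ∀ i, (shapeData r n).C (x.1 i), (∏ i, (shapeData r n).ψ _ (c i)) •
        arrForm (x.rot (shapeData r n) c) := by
  rw [sumForm_apply]
  simp only [avgRot_apply, mul_smul, Finset.sum_smul, Finset.smul_sum]
  rw [← Fintype.sum_sigma (fun y : (Σ x : WArr r n a l, ∀ i, (shapeData r n).C (x.1 i)) =>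
    (∏ i, (Fintype.card ((shapeData r n).C (y.1.1 i)) : ℂ))⁻¹ •
      (∏ i, (shapeData r n).ψ _ (y.2 i)⁻¹) • f (y.1.rot (shapeData r n) y.2) • arrForm y.1),
    ← Fintype.sum_sigma (fun y : (Σ x : WArr r n a l, ∀ i, (shapeData r n).C (x.1 i)) =>
    f y.1 • (∏ i, (Fintype.card ((shapeData r n).C (y.1.1 i)) : ℂ))⁻¹ •
      (∏ i, (shapeData r n).ψ _ (y.2 i)) • arrForm (y.1.rot (shapeData r n) y.2)),
    ← Equiv.sum_comp rotSwap]
  refine Finset.sum_congr rfl fun y _ => ?_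
  have h1 : ((rotSwap y).1.rot (shapeData r n) (rotSwap y).2) = y.1 :=
    congrArg Sigma.fst (rotSwap.left_inv y)
  rw [h1]
  have h2 : ∏ i, (shapeData r n).ψ _ ((rotSwap y).2 i)⁻¹ = ∏ i, (shapeData r n).ψ _ (y.2 i) :=
    Finset.prod_congr rfl fun i _ => congrArg _ (inv_inv _)
  rw [h2, smul_comm (f y.1), smul_comm (f y.1)]
  rfl

/-- The averaged delta function at `x` produces the symmetrized block product of `x` up to a nonzero
scalar, so these products lie in the image of the equivariant functions. -/
theorem thetaMul_sumForm_avgRot_single (ha : a ≤ n) {x : WArr r n a l} (hx : IsEquivariant x) :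
    ∃ c : ℂ, c ≠ 0 ∧ ∀ [DecidableEq (WArr r n a l)],
      thetaMul r n (sumForm (avgRot (shapeData r n) (Pi.single x 1))) =
      c • rotProd (List.ofFn fun i => word x (.inl i)) (List.ofFn fun i => word x (.inr i)) := by
  refine ⟨(∏ i, (Fintype.card ((shapeData r n).C (x.1 i)) : ℂ))⁻¹ *
    ∏ _i : Fin a ⊕ Fin l, (Fintype.card (Mu r) : ℂ), ?_, ?_⟩
  · refine mul_ne_zero (inv_ne_zero ?_) ?_ <;>
      exact Finset.prod_ne_zero_iff.2 fun i _ => Nat.cast_ne_zero.2 Fintype.card_ne_zero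
  · intro _
    rw [sumForm_avgRot, Finset.sum_eq_single x, Pi.single_eq_same, one_smul, map_smul, map_sum,
      mul_smul, ← sum_rot_arrProd hx]
    · congr 1
      refine Finset.sum_congr rfl fun c _ => ?_
      rw [map_smul, thetaMul_arrForm ha (isEquivariant_invariant.rot x c hx)]
    · intro y _ hy
      rw [Pi.single_eq_of_ne hy, zero_smul]
    · simp

/-- The class in the graded piece of the form with given coefficients. -/
def sumClass (hk : k + l = n - a) (ha : a ≤ n) : (WArr r n a l → ℂ) →ₗ[ℂ] Gr r n k l :=
  Submodule.mkQ _ ∘ₗ LinearMap.codRestrict (filt r n (k + l) l) sumForm fun f => by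
    rw [filt_eq_of hk ha]
    exact sumForm_mem f

theorem sumClass_apply (hk : k + l = n - a) (ha : a ≤ n) (f : WArr r n a l → ℂ) :
    sumClass hk ha f = Submodule.Quotient.mk ⟨sumForm f, by
      rw [filt_eq_of hk ha]
      exact sumForm_mem f⟩ := rfl

/-- Modulo more closed roots, every form is a combination of symmetrized block products
(`thetaMul_mem_span_rotProd`), and each of them comes from an averaged delta function. -/
theorem sumClass_surjective (hk : k + l = n - a) (ha : a ≤ n) (y : Gr r n k l) :
    ∃ f ∈ blockFun (shapeData r n) (IsEquivariant : WArr r n a l → Prop),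
      sumClass hk ha f = y := by
  classical
  obtain ⟨⟨α, hα⟩, rfl⟩ := Submodule.Quotient.mk_surjective _ y
  have hα' : α ∈ incSpan r n n (n - a) l := by rwa [filt_eq_of hk ha] at hα
  let V := (blockFun (shapeData r n) (IsEquivariant : WArr r n a l → Prop)).map
    (thetaMul r n ∘ₗ sumForm)
  have hle : Submodule.span ℂ {x | ∃ O C, Covers n O C ∧ C.length = l ∧
      n - a + O.length = n ∧ x = rotProd O C} ≤ V := by
    rw [Submodule.span_le]
    rintro _ ⟨O, C, hcov, hC, hO, rfl⟩
    obtain ⟨x, hx, rfl, rfl⟩ := hcov.exists_arr (a := a) (by omega) hC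
    obtain ⟨c, hc, h⟩ := thetaMul_sumForm_avgRot_single ha hx
    have hcut : cutOff IsEquivariant (Pi.single x 1 : WArr r n a l → ℂ) = Pi.single x 1 := by
      funext y
      by_cases hy : IsEquivariant y
      · simp [cutOff, hy]
      · have : y ≠ x := fun h => hy (h ▸ hx)
        simp [cutOff, hy, this]
    refine ⟨c⁻¹ • avgMix (avgRot (shapeData r n) (cutOff IsEquivariant (Pi.single x 1))),
      Submodule.smul_mem _ _ (avgMix_mem _ isEquivariant_invariant _), ?_⟩
    rw [LinearMap.comp_apply, map_smul, map_smul, sumForm_avgMix ha, hcut, h, smul_smul,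
      inv_mul_cancel₀ hc, one_smul]
  have h := sup_le_sup_right hle ((incSpan r n n (n - a) (l + 1)).map (thetaMul r n))
    (thetaMul_mem_span_rotProd hα')
  obtain ⟨_, ⟨f, hf, rfl⟩, _, ⟨β, hβ, rfl⟩, hsum⟩ := Submodule.mem_sup.1 h
  refine ⟨f, hf, ?_⟩
  rw [LinearMap.comp_apply, ← map_add] at hsum
  have hα2 := thetaMul_injective hsum
  rw [sumClass_apply, Submodule.Quotient.eq]
  change sumForm f - α ∈ filt r n (k + l) (l + 1)
  have e := filt_eq_of (r := r) hk ha (l + 1)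
  rw [Nat.cast_succ] at e
  rw [e, ← hα2, sub_add_cancel_left]
  exact neg_mem hβ

theorem finrank_gr_le (hk : k + l = n - a) (ha : a ≤ n) : Module.finrank ℂ (Gr r n k l) ≤
    Module.finrank ℂ (blockFun (shapeData r n) (IsEquivariant : WArr r n a l → Prop)) := by
  refine LinearMap.finrank_le_finrank_of_surjective
    (f := (sumClass hk ha).comp (Submodule.subtype _)) fun y => ?_
  obtain ⟨f, hf, h⟩ := sumClass_surjective hk ha y
  exact ⟨⟨f, hf⟩, h⟩

theorem card_shape_le (x : WArr r n a l) : a + l ≤ n := by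
  have h := Fintype.card_congr x.2
  rw [Fintype.card_sigma, Fintype.card_prod, card_mu, Fintype.card_fin] at h
  have h2 : ∑ _i : Fin a ⊕ Fin l, r ≤ r * n := by
    rw [← h]
    refine Finset.sum_le_sum fun i _ => ?_
    rw [Fintype.card_prod, card_mu]
    exact Nat.le_mul_of_pos_right _ Fintype.card_pos
  rw [Finset.sum_const, Finset.card_univ, Fintype.card_sum, Fintype.card_fin, Fintype.card_fin,
    smul_eq_mul, mul_comm] at h2
  exact Nat.le_of_mul_le_mul_left h2 (NeZero.pos r)

/-- The graded piece `A^{k,l}` is, up to the sign character, the representation on equivariant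
functions on arrangements into `a = n - k - l` open and `l` closed blocks. -/
theorem exists_gr_equiv (hk : k + l = n - a) :
    ∃ Φ : blockFun (shapeData r n) (IsEquivariant : WArr r n a l → Prop) ≃ₗ[ℂ] Gr r n k l,
      ∀ g f, Φ (blockRep (shapeData r n) (wreathPerm r n) IsEquivariant
        (fun g _ hx => hx.act g) g f) = signChar n g.right • grRep r n k l g (Φ f) := by
  have hempty : ¬ a + l ≤ n →
      Subsingleton (blockFun (shapeData r n) (IsEquivariant : WArr r n a l → Prop)) := fun h =>
    ⟨fun f g => Subtype.ext (funext fun x => absurd (card_shape_le x) h)⟩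
  by_cases ha : a ≤ n
  · let Φ : blockFun (shapeData r n) (IsEquivariant : WArr r n a l → Prop) →ₗ[ℂ] Gr r n k l :=
      (sumClass hk ha).comp (Submodule.subtype _)
    have hsurj : Function.Surjective Φ := fun y => by
      obtain ⟨f, hf, h⟩ := sumClass_surjective hk ha y
      exact ⟨⟨f, hf⟩, h⟩
    -- No relations are computed: surjectivity in all degrees forces equal dimensions by
    -- `finrank_blockFun_eq`. If `a + l > n` there are no arrangements.
    have hinj : Function.Injective Φ := by
      by_cases hal : a + l ≤ n
      · have h := finrank_blockFun_eq (r := r) (n := n)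
          (fun a l hal => finrank_gr_le (by ring) (by omega)) hal
        obtain rfl : k = n - a - l := by omega
        exact (LinearMap.injective_iff_surjective_of_finrank_eq_finrank h.symm).2 hsurj
      · have := hempty hal
        exact Function.injective_of_subsingleton _
    refine ⟨LinearEquiv.ofBijective Φ ⟨hinj, hsurj⟩, fun g f => ?_⟩
    change sumClass hk ha (arrRep (Shape r n) _ _ (wreathPerm r n g) f.1) =
      signChar n g.right • grRep r n k l g (sumClass hk ha f.1)
    have h := formRep_sumForm ha g f.1
    rw [sumClass_apply, sumClass_apply]
    simp only [h]
    rfl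
  -- For `a > n` the total degree `k + l` is negative and both spaces vanish.
  · have h1 := hempty (by omega)
    by_cases hl : k + l < 0
    · have h2 : Subsingleton (Gr r n k l) := by
        refine ⟨fun x y => ?_⟩
        obtain ⟨⟨x, hx⟩, rfl⟩ := Submodule.Quotient.mk_surjective _ x
        obtain ⟨⟨y, hy⟩, rfl⟩ := Submodule.Quotient.mk_surjective _ y
        rw [filt_of_neg hl, Submodule.mem_bot] at hx hy
        subst hx hy
        rfl
      exact ⟨0, fun g f => Subsingleton.elim _ _⟩
    · omega

end Main

end WreathOS

end

noncomputable section

namespace WreathOS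

/-! ### Idempotents in group algebras -/

section Idempotent

variable {A : Type} [Ring A] [Algebra ℂ A]

theorem finite_linearMap (U M : Type) [AddCommGroup U] [Module A U] [Module ℂ U]
    [IsScalarTower ℂ A U] [FiniteDimensional ℂ U] [AddCommGroup M] [Module A M] [Module ℂ M]
    [IsScalarTower ℂ A M] [FiniteDimensional ℂ M] : FiniteDimensional ℂ (U →ₗ[A] M) :=
  Module.Finite.of_injective (LinearMap.restrictScalarsₗ ℂ A U M ℂ)
    (LinearMap.restrictScalars_injective ℂ)

/-- Semisimple modules are determined by the dimensions of the spaces of maps out of them. -/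
theorem nonempty_linearEquiv_of_finrank_hom [IsSemisimpleRing A] (d : ℕ) (U U' : Type)
    [AddCommGroup U] [Module A U] [Module ℂ U] [IsScalarTower ℂ A U] [FiniteDimensional ℂ U]
    [AddCommGroup U'] [Module A U'] [Module ℂ U'] [IsScalarTower ℂ A U'] [FiniteDimensional ℂ U']
    (hd : Module.finrank ℂ U = d)
    (h : ∀ (M : Type) [AddCommGroup M] [Module A M] [Module ℂ M] [IsScalarTower ℂ A M]
      [FiniteDimensional ℂ M], Module.finrank ℂ (U →ₗ[A] M) = Module.finrank ℂ (U' →ₗ[A] M)) :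
    Nonempty (U ≃ₗ[A] U') := by
  induction d using Nat.strong_induction_on generalizing U U' with
  | _ d ih =>
  have := finite_linearMap (A := A) U' U'
  rcases subsingleton_or_nontrivial U with hU | hU
  · have h0 : Module.finrank ℂ (U' →ₗ[A] U') = 0 := by
      rw [← h U', Module.finrank_zero_of_subsingleton]
    have hs := Module.finrank_zero_iff.1 h0
    have : Subsingleton U' := ⟨fun x y => by
      have e : (LinearMap.id : U' →ₗ[A] U') = 0 := Subsingleton.elim _ _
      have hx := LinearMap.congr_fun e x
      have hy := LinearMap.congr_fun e y
      exact hx.trans hy.symm⟩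
    exact ⟨0⟩
  -- Induction on the dimension: a simple summand `L` of `U` is found in `U'` as well and cancelled.
  · obtain ⟨L, hL⟩ := IsSemisimpleModule.exists_simple_submodule A U
    obtain ⟨Q, hQ⟩ := exists_isCompl L
    have e1 : (L × Q) ≃ₗ[A] U := Submodule.prodEquivOfIsCompl L Q hQ
    have hLfin : FiniteDimensional ℂ L := inferInstanceAs (FiniteDimensional ℂ (L.restrictScalars ℂ))
    have hQfin : FiniteDimensional ℂ Q := inferInstanceAs (FiniteDimensional ℂ (Q.restrictScalars ℂ))
    have hL0 : Nontrivial L := IsSimpleModule.nontrivial A L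
    have f1 := finite_linearMap (A := A) U L
    have f2 := finite_linearMap (A := A) U' L
    -- The projection of `U` to `L` is nonzero, so by hypothesis `U'` has a nonzero map to `L` too.
    -- It is onto because `L` is simple, and it splits.
    have hpos : 0 < Module.finrank ℂ (U' →ₗ[A] L) := by
      rw [← h L, Module.finrank_pos_iff]
      refine ⟨⟨(LinearMap.fst A L Q).comp e1.symm.toLinearMap, 0, fun h0 => ?_⟩⟩
      obtain ⟨x, hx⟩ := exists_ne (0 : L)
      have := LinearMap.congr_fun h0 (e1 (x, 0))
      rw [LinearMap.comp_apply, LinearEquiv.coe_coe, e1.symm_apply_apply] at this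
      exact hx this
    obtain ⟨g, hg⟩ := (Module.finrank_pos_iff_exists_ne_zero).1 hpos
    have hsurj := LinearMap.surjective_of_ne_zero hg
    obtain ⟨L', hL'⟩ := exists_isCompl (LinearMap.ker g)
    have e2 : L' ≃ₗ[A] L := (Submodule.quotientEquivOfIsCompl _ _ hL').symm.trans
      (g.quotKerEquivOfSurjective hsurj)
    have e3 : (L × LinearMap.ker g) ≃ₗ[A] U' :=
      (LinearEquiv.prodComm A _ _).trans (((LinearEquiv.refl A _).prodCongr e2.symm).trans
        (Submodule.prodEquivOfIsCompl _ _ hL'))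
    have hKfin : FiniteDimensional ℂ (LinearMap.ker g) :=
      inferInstanceAs (FiniteDimensional ℂ ((LinearMap.ker g).restrictScalars ℂ))
    have hcut : ∀ (U Q : Type) [AddCommGroup U] [Module A U] [Module ℂ U] [IsScalarTower ℂ A U]
        [FiniteDimensional ℂ U] [AddCommGroup Q] [Module A Q] [Module ℂ Q] [IsScalarTower ℂ A Q]
        [FiniteDimensional ℂ Q] (e : (L × Q) ≃ₗ[A] U) (M : Type) [AddCommGroup M] [Module A M]
        [Module ℂ M] [IsScalarTower ℂ A M] [FiniteDimensional ℂ M],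
        Module.finrank ℂ (U →ₗ[A] M) = Module.finrank ℂ (L →ₗ[A] M) +
          Module.finrank ℂ (Q →ₗ[A] M) := by
      intro U Q _ _ _ _ _ _ _ _ _ _ e M _ _ _ _ _
      have f1 := finite_linearMap (A := A) L M
      have f2 := finite_linearMap (A := A) Q M
      rw [← Module.finrank_prod]
      exact ((LinearMap.coprodEquiv ℂ).trans (LinearEquiv.congrLeft M ℂ e)).finrank_eq.symm
    have hlt : Module.finrank ℂ Q < d := by
      have := (e1.restrictScalars ℂ).finrank_eq
      rw [Module.finrank_prod, hd] at this
      have h0 : 0 < Module.finrank ℂ L := Module.finrank_pos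
      omega
    obtain ⟨φ⟩ := ih _ hlt Q (LinearMap.ker g) rfl fun M _ _ _ _ _ => by
      have h1 := hcut U Q e1 M
      have h2 := hcut U' (LinearMap.ker g) e3 M
      rw [h M, h2] at h1
      omega
    exact ⟨e1.symm.trans (((LinearEquiv.refl A L).prodCongr φ).trans e3)⟩

/-- Maps out of the left ideal generated by an idempotent. -/
def spanHomEquiv {e : A} (he : e * e = e) (M : Type) [AddCommGroup M] [Module A M] [Module ℂ M]
    [IsScalarTower ℂ A M] : (Ideal.span {e} →ₗ[A] M) ≃ₗ[ℂ]
      LinearMap.range (Module.toModuleEnd ℂ (S := A) M e) where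
  toFun f := ⟨f ⟨e, Ideal.subset_span rfl⟩, f ⟨e, Ideal.subset_span rfl⟩, by
    change e • f _ = f _
    rw [← map_smul]
    exact congrArg f (Subtype.ext he)⟩
  map_add' f g := rfl
  map_smul' z f := rfl
  invFun m := (LinearMap.toSpanSingleton A M m.1).comp (Submodule.subtype _)
  left_inv f := by
    refine LinearMap.ext fun ⟨x, hx⟩ => ?_
    obtain ⟨y, rfl⟩ := Ideal.mem_span_singleton'.1 hx
    change (y * e) • f _ = f _
    rw [← map_smul]
    refine congrArg f (Subtype.ext ?_)
    change y * e * e = y * e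
    rw [mul_assoc, he]
  right_inv := by
    rintro ⟨_, m, rfl⟩
    refine Subtype.ext ?_
    change e • e • m = e • m
    rw [smul_smul, he]

/-- Idempotents with the same trace on all modules are equivalent. -/
theorem exists_idempotent_equiv [IsSemisimpleRing A] [FiniteDimensional ℂ A] {e e' : A}
    (he : e * e = e) (he' : e' * e' = e')
    (h : ∀ (M : Type) [AddCommGroup M] [Module A M] [Module ℂ M] [IsScalarTower ℂ A M]
      [FiniteDimensional ℂ M], LinearMap.trace ℂ M (Module.toModuleEnd ℂ (S := A) M e) =
        LinearMap.trace ℂ M (Module.toModuleEnd ℂ (S := A) M e')) :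
    ∃ x y : A, x * y = e ∧ y * x = e' ∧ e * x = x ∧ e' * y = y := by
  have hf : ∀ e : A, FiniteDimensional ℂ (Ideal.span {e} : Ideal A) := fun e =>
    inferInstanceAs (FiniteDimensional ℂ ((Ideal.span {e} : Ideal A).restrictScalars ℂ))
  have htr : ∀ e : A, e * e = e → ∀ (M : Type) [AddCommGroup M] [Module A M] [Module ℂ M]
      [IsScalarTower ℂ A M] [FiniteDimensional ℂ M],
      (Module.finrank ℂ (Ideal.span {e} →ₗ[A] M) : ℂ) =
        LinearMap.trace ℂ M (Module.toModuleEnd ℂ (S := A) M e) := by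
    intro e he M _ _ _ _ _
    -- On `M` the element `e` is a projection, so its trace is the dimension of `e M`, which is the
    -- space of maps from `A e` to `M`.
    have hproj : LinearMap.IsProj (LinearMap.range (Module.toModuleEnd ℂ (S := A) M e))
        (Module.toModuleEnd ℂ (S := A) M e) := by
      refine ⟨fun x => ⟨x, rfl⟩, ?_⟩
      rintro _ ⟨x, rfl⟩
      change e • e • x = e • x
      rw [smul_smul, he]
    rw [hproj.trace, (spanHomEquiv he M).finrank_eq]
  -- Equal traces on all modules therefore make the left ideals `A e` and `A e'` isomorphic.
  obtain ⟨φ⟩ := nonempty_linearEquiv_of_finrank_hom (A := A) _ (Ideal.span {e} : Ideal A)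
    (Ideal.span {e'} : Ideal A) rfl fun M _ _ _ _ _ => by
      have := h M
      rw [← htr e he, ← htr e' he'] at this
      exact_mod_cast this
  let E : (Ideal.span {e} : Ideal A) := ⟨e, Ideal.subset_span rfl⟩
  let E' : (Ideal.span {e'} : Ideal A) := ⟨e', Ideal.subset_span rfl⟩
  have key : ∀ {e : A}, e * e = e → ∀ z : (Ideal.span {e} : Ideal A),
      z = (z : A) • (⟨e, Ideal.subset_span rfl⟩ : (Ideal.span {e} : Ideal A)) := by
    rintro e he ⟨z, hz⟩
    obtain ⟨y, rfl⟩ := Ideal.mem_span_singleton'.1 hz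
    refine Subtype.ext ?_
    change y * e = y * e * e
    rw [mul_assoc, he]
  -- The isomorphism is right multiplication by the image of `e`, its inverse right multiplication
  -- by the image of `e'`.
  refine ⟨φ E, φ.symm E', ?_, ?_, ?_, ?_⟩
  · have h1 := congrArg φ.symm (key he' (φ E))
    rw [map_smul, φ.symm_apply_apply] at h1
    exact (congrArg Subtype.val h1).symm
  · have h1 := congrArg φ (key he (φ.symm E'))
    rw [map_smul, φ.apply_symm_apply] at h1
    exact (congrArg Subtype.val h1).symm
  · have h1 : e • φ E = φ E := by
      rw [← map_smul]
      exact congrArg φ (Subtype.ext he)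
    exact congrArg Subtype.val h1
  · have h1 : e' • φ.symm E' = φ.symm E' := by
      rw [← map_smul]
      exact congrArg φ.symm (Subtype.ext he')
    exact congrArg Subtype.val h1

end Idempotent

end WreathOS

end

noncomputable section

namespace WreathOS

/-! ### Idempotents of groups that act freely -/

section FreeIdempotent

variable {Y : Type}

/-- No power of the permutation other than the identity has a fixed point. -/
def IsSemiregular (σ : Equiv.Perm Y) : Prop := ∀ (k : ℕ) (y : Y), (σ ^ k) y = y → σ ^ k = 1

/-- A power of σ that fixes a point is trivial, so every cycle is as long as the order of σ. Order
and number of points then determine the cycle type, hence the conjugacy class. -/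
theorem IsSemiregular.cycleType [Fintype Y] [DecidableEq Y] {σ : Equiv.Perm Y}
    (h : IsSemiregular σ) (h1 : σ ≠ 1) :
    σ.cycleType = Multiset.replicate (Fintype.card Y / orderOf σ) (orderOf σ) := by
  have hall : ∀ n ∈ σ.cycleType, n = orderOf σ := by
    intro n hn
    refine Nat.dvd_antisymm (Equiv.Perm.dvd_of_mem_cycleType hn) ?_
    rw [Equiv.Perm.cycleType_def, Multiset.mem_map] at hn
    obtain ⟨c, hc, rfl⟩ := hn
    have hcyc := (Equiv.Perm.mem_cycleFactorsFinset_iff.1 hc).1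
    obtain ⟨y, hy⟩ := hcyc.nonempty_support
    have e := Equiv.Perm.cycle_is_cycleOf hy hc
    refine orderOf_dvd_of_pow_eq_one (h _ y ?_)
    rw [← Equiv.Perm.cycleOf_pow_apply_self, ← e]
    have : c ^ c.support.card = 1 := by rw [← hcyc.orderOf, pow_orderOf_eq_one]
    exact Equiv.Perm.congr_fun this y
  have hrep := Multiset.eq_replicate_of_mem hall
  have hsupp : σ.support = Finset.univ := by
    refine Finset.eq_univ_iff_forall.2 fun y => Equiv.Perm.mem_support.2 fun hy => h1 ?_
    simpa using h 1 y (by simpa using hy)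
  have hsum := σ.sum_cycleType
  rw [hsupp, Finset.card_univ, hrep, Multiset.sum_replicate, smul_eq_mul] at hsum
  rw [hrep, ← hsum, Nat.mul_div_cancel _ (orderOf_pos σ)]

theorem IsSemiregular.isConj [Fintype Y] [DecidableEq Y] {σ τ : Equiv.Perm Y}
    (hσ : IsSemiregular σ) (hτ : IsSemiregular τ) (h : orderOf σ = orderOf τ) : IsConj σ τ := by
  rw [Equiv.Perm.isConj_iff_cycleType_eq]
  by_cases h1 : σ = 1
  · have h2 : τ = 1 := by rw [← orderOf_eq_one_iff, ← h, h1, orderOf_one]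
    rw [h1, h2]
  · have h2 : τ ≠ 1 := by
      rintro rfl
      rw [orderOf_one, orderOf_eq_one_iff] at h
      exact h1 h
    rw [hσ.cycleType h1, hτ.cycleType h2, h]

section Sums

open Finset

variable {C C' : Type} [CommGroup C] [Fintype C] [CommGroup C'] [Fintype C']

/-- The character is nontrivial on the elements of order `p`, for every prime divisor `p` of the
order of the group. -/
def IsPrimitiveChar (ψ : C →* ℂ) : Prop :=
  ∀ p : ℕ, p.Prime → p ∣ Fintype.card C → ∃ c, c ^ p = 1 ∧ ψ c ≠ 1

-- If `M` shares a prime with the group order, the `M`-torsion contains an element on which the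
-- character is nontrivial, and the sum over this subgroup vanishes; otherwise the subgroup is
-- trivial. Only `M` and the group order enter the answer.
open scoped Classical in
theorem IsPrimitiveChar.sum_torsion {ψ : C →* ℂ} (h : IsPrimitiveChar ψ) (M : ℕ) :
    ∑ c with c ^ M = 1, ψ c = if M.Coprime (Fintype.card C) then 1 else 0 := by
  split_ifs with hM
  · have : (univ.filter fun c : C => c ^ M = 1) = {1} := by
      ext c
      simp only [mem_filter, mem_univ, true_and, mem_singleton]
      refine ⟨fun hc => ?_, fun hc => by rw [hc, one_pow]⟩
      have := pow_gcd_eq_one.2 ⟨hc, pow_card_eq_one⟩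
      rwa [hM, pow_one] at this
    rw [this, sum_singleton, map_one]
  · obtain ⟨p, hp, h1, h2⟩ := Nat.Prime.not_coprime_iff_dvd.1 hM
    obtain ⟨c0, hc0, hne⟩ := h p hp h2
    have hc0M : c0 ^ M = 1 := by
      obtain ⟨q, rfl⟩ := h1
      rw [pow_mul, hc0, one_pow]
    have key : ∑ c with c ^ M = 1, ψ c = ψ c0 * ∑ c with c ^ M = 1, ψ c := by
      rw [mul_sum]
      refine (sum_equiv (Equiv.mulLeft c0) ?_ fun c _ => ?_).symm
      · intro c
        simp [mul_pow, hc0M]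
      · rw [Equiv.coe_mulLeft, map_mul]
    have h0 : (ψ c0 - 1) * ∑ c with c ^ M = 1, ψ c = 0 := by
      rw [sub_mul, ← key, one_mul, sub_self]
    exact (mul_eq_zero.1 h0).resolve_left (sub_ne_zero.2 hne)

-- The `M`-torsion is the disjoint union of the sets of elements of order `d` over `d ∣ M`, so the
-- sums over exact orders follow from `IsPrimitiveChar.sum_torsion` by Möbius inversion, done here
-- as an induction on `M`.
open scoped Classical in
theorem sum_orderOf_eq {ψ : C →* ℂ} {ψ' : C' →* ℂ} (h : IsPrimitiveChar ψ)
    (h' : IsPrimitiveChar ψ') (hC : Fintype.card C = Fintype.card C') (M : ℕ) :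
    ∑ c with orderOf c = M, ψ c = ∑ c with orderOf c = M, ψ' c := by
  induction M using Nat.strong_induction_on with
  | _ M ih =>
  rcases Nat.eq_zero_or_pos M with rfl | hM
  · rw [filter_false_of_mem fun c _ => (orderOf_pos c).ne',
      filter_false_of_mem fun c _ => (orderOf_pos c).ne', sum_empty, sum_empty]
  · have key : ∀ (C : Type) [CommGroup C] [Fintype C] (ψ : C →* ℂ), ∑ c with c ^ M = 1, ψ c =
        ∑ d ∈ M.properDivisors, ∑ c with orderOf c = d, ψ c + ∑ c with orderOf c = M, ψ c := by
      intro C _ _ ψ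
      rw [add_comm, ← sum_insert (f := fun d => ∑ c with orderOf c = d, ψ c) (by simp),
        Nat.insert_self_properDivisors hM.ne', ← sum_fiberwise_of_maps_to (g := orderOf) (t := M.divisors)]
      · refine sum_congr rfl fun d hd => ?_
        rw [filter_filter]
        refine sum_congr (filter_congr fun c _ => ?_) fun _ _ => rfl
        rw [and_iff_right_iff_imp, ← orderOf_dvd_iff_pow_eq_one]
        rintro rfl
        exact Nat.dvd_of_mem_divisors hd
      · intro c hc
        rw [Nat.mem_divisors]
        exact ⟨orderOf_dvd_of_pow_eq_one (mem_filter.1 hc).2, hM.ne'⟩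
    have h1 := h.sum_torsion M
    have h2 := h'.sum_torsion M
    rw [hC, ← h2, key, key, sum_congr rfl fun d hd => ih d (Nat.mem_properDivisors.1 hd).2] at h1
    exact add_left_cancel h1

theorem sum_char_inv_mul {ψ : C →* ℂ} {ψ' : C' →* ℂ} (h : IsPrimitiveChar ψ)
    (h' : IsPrimitiveChar ψ') (hC : Fintype.card C = Fintype.card C') (F : ℕ → ℂ) :
    ∑ c, ψ c⁻¹ * F (orderOf c) = ∑ c, ψ' c⁻¹ * F (orderOf c) := by
  classical
  have key : ∀ (C : Type) [CommGroup C] [Fintype C] (ψ : C →* ℂ),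
      ∑ c, ψ c⁻¹ * F (orderOf c) = ∑ d ∈ range (Fintype.card C + 1),
        (∑ c with orderOf c = d, ψ c) * F d := by
    intro C _ _ ψ
    rw [← Equiv.sum_comp (Equiv.inv C), ← sum_fiberwise_of_maps_to (g := orderOf)
      (t := range (Fintype.card C + 1))]
    · refine sum_congr rfl fun d _ => ?_
      rw [sum_mul]
      refine sum_congr rfl fun c hc => ?_
      rw [Equiv.inv_apply, inv_inv, orderOf_inv, (mem_filter.1 hc).2]
    · intro c _
      rw [mem_range, Nat.lt_succ_iff]
      exact orderOf_le_card_univ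
  rw [key, key, hC]
  exact sum_congr rfl fun d _ => by rw [sum_orderOf_eq h h' hC]

end Sums

/-- The idempotent of a group of permutations with a character. -/
def rotIdem {C : Type} [Group C] [Fintype C] (ρ : C →* Equiv.Perm Y) (ψ : C →* ℂ) :
    MonoidAlgebra ℂ (Equiv.Perm Y) :=
  (Fintype.card C : ℂ)⁻¹ • ∑ c, MonoidAlgebra.single (ρ c) (ψ c⁻¹)

theorem rotIdem_mul_self {C : Type} [Group C] [Fintype C] (ρ : C →* Equiv.Perm Y) (ψ : C →* ℂ) :
    rotIdem ρ ψ * rotIdem ρ ψ = rotIdem ρ ψ := by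
  have h : ∀ c, MonoidAlgebra.single (ρ c) (ψ c⁻¹) *
      ∑ c', MonoidAlgebra.single (ρ c') (ψ c'⁻¹) = ∑ c', MonoidAlgebra.single (ρ c') (ψ c'⁻¹) := by
    intro c
    rw [Finset.mul_sum, ← Equiv.sum_comp (Equiv.mulLeft c)
      (fun c' => MonoidAlgebra.single (ρ c') (ψ c'⁻¹))]
    refine Finset.sum_congr rfl fun c' _ => ?_
    rw [MonoidAlgebra.single_mul_single, Equiv.coe_mulLeft, map_mul, mul_inv_rev, map_mul,
      mul_comm (ψ c⁻¹)]
  rw [rotIdem, smul_mul_smul_comm, Finset.sum_mul, Finset.sum_congr rfl fun c _ => h c,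
    Finset.sum_const, Finset.card_univ, ← Nat.cast_smul_eq_nsmul ℂ, smul_smul, mul_assoc,
    inv_mul_cancel₀ (Nat.cast_ne_zero.2 Fintype.card_ne_zero), mul_one]

theorem isSemiregular_of_free {C : Type} [Group C] {ρ : C →* Equiv.Perm Y}
    (hρ : ∀ c y, ρ c y = y → c = 1) (c : C) : IsSemiregular (ρ c) := by
  intro k y h
  rw [← map_pow] at h ⊢
  rw [hρ _ y h, map_one]

theorem orderOf_of_free {C : Type} [Group C] [Nonempty Y] {ρ : C →* Equiv.Perm Y}
    (hρ : ∀ c y, ρ c y = y → c = 1) (c : C) : orderOf (ρ c) = orderOf c := by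
  refine orderOf_injective ρ ((injective_iff_map_eq_one ρ).2 fun c hc => ?_) c
  exact hρ c (Classical.arbitrary Y) (by rw [hc]; rfl)

/-- Free actions of two groups of the same order, with characters that are nontrivial on all
subgroups of prime order, have equivalent idempotents. -/
theorem exists_rotIdem_equiv [Fintype Y] [Nonempty Y] {C C' : Type} [CommGroup C] [Fintype C]
    [CommGroup C'] [Fintype C'] {ρ : C →* Equiv.Perm Y} {ρ' : C' →* Equiv.Perm Y} {ψ : C →* ℂ}
    {ψ' : C' →* ℂ} (hρ : ∀ c y, ρ c y = y → c = 1) (hρ' : ∀ c y, ρ' c y = y → c = 1)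
    (h : IsPrimitiveChar ψ) (h' : IsPrimitiveChar ψ')
    (hC : Fintype.card C = Fintype.card C') :
    ∃ x y : MonoidAlgebra ℂ (Equiv.Perm Y), x * y = rotIdem ρ ψ ∧ y * x = rotIdem ρ' ψ' ∧
      rotIdem ρ ψ * x = x ∧ rotIdem ρ' ψ' * y = y := by
  classical
  have hfin : FiniteDimensional ℂ (MonoidAlgebra ℂ (Equiv.Perm Y)) :=
    Module.Finite.equiv (MonoidAlgebra.coeffLinearEquiv ℂ).symm
  refine exists_idempotent_equiv (rotIdem_mul_self ρ ψ) (rotIdem_mul_self ρ' ψ') ?_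
  intro M _ _ _ _ _
  -- The character of `M`. By conjugacy, its value on a semiregular permutation depends only on the
  -- order; this value is `F` below.
  let χ : Equiv.Perm Y → ℂ := fun σ => LinearMap.trace ℂ M
    (Module.toModuleEnd ℂ (S := MonoidAlgebra ℂ (Equiv.Perm Y)) M (MonoidAlgebra.single σ 1))
  have hχ : ∀ σ τ, IsConj σ τ → χ σ = χ τ := by
    intro σ τ hc
    obtain ⟨g, rfl⟩ := isConj_iff.1 hc
    have : (MonoidAlgebra.single (g * σ * g⁻¹) 1 : MonoidAlgebra ℂ (Equiv.Perm Y)) =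
        MonoidAlgebra.single g 1 * (MonoidAlgebra.single σ 1 * MonoidAlgebra.single g⁻¹ 1) := by
      rw [MonoidAlgebra.single_mul_single, MonoidAlgebra.single_mul_single, mul_one, mul_one,
        mul_assoc]
    simp only [χ]
    rw [this, map_mul, LinearMap.trace_mul_comm, ← map_mul, mul_assoc,
      MonoidAlgebra.single_mul_single, inv_mul_cancel, mul_one, ← MonoidAlgebra.one_def, mul_one]
  -- The default `0` for orders of no semiregular permutation is never used.
  let F : ℕ → ℂ := fun d =>
    if hd : ∃ σ : Equiv.Perm Y, IsSemiregular σ ∧ orderOf σ = d then χ hd.choose else 0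
  have hF : ∀ σ, IsSemiregular σ → χ σ = F (orderOf σ) := by
    intro σ hσ
    have hd : ∃ τ : Equiv.Perm Y, IsSemiregular τ ∧ orderOf τ = orderOf σ := ⟨σ, hσ, rfl⟩
    simp only [F, dif_pos hd]
    exact hχ _ _ (hσ.isConj hd.choose_spec.1 hd.choose_spec.2.symm)
  have key : ∀ (C : Type) [CommGroup C] [Fintype C] (ρ : C →* Equiv.Perm Y) (ψ : C →* ℂ),
      (∀ c y, ρ c y = y → c = 1) → LinearMap.trace ℂ M
        (Module.toModuleEnd ℂ (S := MonoidAlgebra ℂ (Equiv.Perm Y)) M (rotIdem ρ ψ)) =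
      (Fintype.card C : ℂ)⁻¹ * ∑ c, ψ c⁻¹ * F (orderOf c) := by
    intro C _ _ ρ ψ hρ
    have hsmul : ∀ (z : ℂ) (a : MonoidAlgebra ℂ (Equiv.Perm Y)),
        Module.toModuleEnd ℂ (S := MonoidAlgebra ℂ (Equiv.Perm Y)) M (z • a) =
          z • Module.toModuleEnd ℂ (S := MonoidAlgebra ℂ (Equiv.Perm Y)) M a := fun z a =>
      LinearMap.ext fun m => smul_assoc z a m
    rw [rotIdem, hsmul, map_smul, map_sum, map_sum, smul_eq_mul]
    congr 1
    refine Finset.sum_congr rfl fun c _ => ?_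
    have h1 : (MonoidAlgebra.single (ρ c) (ψ c⁻¹) : MonoidAlgebra ℂ (Equiv.Perm Y)) =
        ψ c⁻¹ • MonoidAlgebra.single (ρ c) 1 := by
      rw [MonoidAlgebra.smul_single, smul_eq_mul, mul_one]
    rw [h1, hsmul, map_smul, smul_eq_mul, ← orderOf_of_free hρ c,
      ← hF _ (isSemiregular_of_free hρ c)]
  rw [key C ρ ψ hρ, key C' ρ' ψ' hρ', hC, sum_char_inv_mul h h' hC]

end FreeIdempotent

end WreathOS

end

noncomputable section

namespace WreathOS

/-! ### Operators on functions on arrangements given by elements of group algebras -/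

section LocOp

variable {S : Type} {Y : S → Type} {N : Type} {a l : ℕ} [∀ s, Fintype (Y s)]
  [∀ s, DecidableEq (Y s)]

/-- Let elements of the group algebras of the permutation groups of the shapes act. -/
def locOp (X : ∀ s, MonoidAlgebra ℂ (Equiv.Perm (Y s))) :
    (Arr Y (Fin a ⊕ Fin l) N → ℂ) →ₗ[ℂ] (Arr Y (Fin a ⊕ Fin l) N → ℂ) where
  toFun f x := ∑ t : ∀ i, Equiv.Perm (Y (x.1 i)), (∏ i, (X (x.1 i)).coeff (t i)) * f (x.loc t)
  map_add' f g := by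
    funext x
    simp only [Pi.add_apply, mul_add, Finset.sum_add_distrib]
  map_smul' z f := by
    funext x
    simp only [Pi.smul_apply, smul_eq_mul, RingHom.id_apply, Finset.mul_sum]
    exact Finset.sum_congr rfl fun c _ => by ring

theorem locOp_apply (X : ∀ s, MonoidAlgebra ℂ (Equiv.Perm (Y s)))
    (f : Arr Y (Fin a ⊕ Fin l) N → ℂ) (x) : locOp X f x =
      ∑ t : ∀ i, Equiv.Perm (Y (x.1 i)), (∏ i, (X (x.1 i)).coeff (t i)) * f (x.loc t) := rfl

theorem coeff_mul_eq_sum {G : Type} [Group G] [Fintype G] (x y : MonoidAlgebra ℂ G) (g : G) :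
    (x * y).coeff g = ∑ h, x.coeff h * y.coeff (h⁻¹ * g) := by
  rw [MonoidAlgebra.coeff_mul_apply_left, Finsupp.sum_fintype]
  simp

/-- Operators in different blocks commute and in one block they compose as in the group algebra, so
equivalences of idempotents pass to functions on arrangements. -/
theorem locOp_locOp (X X' : ∀ s, MonoidAlgebra ℂ (Equiv.Perm (Y s)))
    (f : Arr Y (Fin a ⊕ Fin l) N → ℂ) :
    locOp X (locOp X' f) = locOp (fun s => X s * X' s) f := by
  funext x
  rw [locOp_apply, locOp_apply]
  have h1 : ∀ t : ∀ i, Equiv.Perm (Y (x.1 i)), (∏ i, (X (x.1 i)).coeff (t i)) *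
      locOp X' f (x.loc t) = ∑ w : ∀ i, Equiv.Perm (Y (x.1 i)),
        (∏ i, (X (x.1 i)).coeff (t i) * (X' (x.1 i)).coeff ((t i)⁻¹ * w i)) * f (x.loc w) := by
    intro t
    rw [locOp_apply, Finset.mul_sum]
    refine Eq.trans ?_ (Equiv.sum_comp (Equiv.mulLeft t) _)
    refine Finset.sum_congr rfl fun w _ => ?_
    rw [Arr.loc_loc, Equiv.coe_mulLeft, Finset.prod_mul_distrib, mul_assoc]
    simp only [Pi.mul_apply, inv_mul_cancel_left]
  rw [Finset.sum_congr rfl fun t _ => h1 t, Finset.sum_comm]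
  refine Finset.sum_congr rfl fun w _ => ?_
  rw [← Finset.sum_mul]
  congr 1
  simp only [coeff_mul_eq_sum]
  rw [Finset.prod_univ_sum, Fintype.piFinset_univ]

theorem locOp_mix (X : ∀ s, MonoidAlgebra ℂ (Equiv.Perm (Y s)))
    (f : Arr Y (Fin a ⊕ Fin l) N → ℂ) (hf : ∀ x π, f (x.mix π) = mixSign a l π * f x) (x)
    (π : BlockPerm a l) : locOp X f (x.mix π) = mixSign a l π * locOp X f x := by
  rw [locOp_apply, locOp_apply, Finset.mul_sum]
  let σ := Equiv.Perm.sumCongrHom (Fin a) (Fin l) π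
  refine Eq.trans (Equiv.sum_comp (Equiv.piCongrLeft (fun i => Equiv.Perm (Y (x.1 i))) σ).symm
    _).symm ?_
  refine Finset.sum_congr rfl fun t _ => ?_
  have h : ((x.mix π).loc fun i => t (σ i)) = (x.loc t).mix π := (Arr.loc_shuf x t σ).symm
  have h2 : ∏ i, (X (x.1 (σ i))).coeff (t (σ i)) = ∏ i, (X (x.1 i)).coeff (t i) :=
    Equiv.prod_comp σ fun i => (X (x.1 i)).coeff (t i)
  refine Eq.trans (b := (∏ i, (X (x.1 (σ i))).coeff (t (σ i))) *
    f ((x.mix π).loc fun i => t (σ i))) rfl ?_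
  rw [h, hf, h2, mul_left_comm]

theorem locOp_act (X : ∀ s, MonoidAlgebra ℂ (Equiv.Perm (Y s)))
    (f : Arr Y (Fin a ⊕ Fin l) N → ℂ) (σ : Equiv.Perm N) :
    locOp X (arrRep Y _ N σ f) = arrRep Y _ N σ (locOp X f) := rfl

variable (D : BlockData Y)

theorem coeff_rotIdem {Z C : Type} [Group C] [Fintype C] [DecidableEq Z]
    (ρ : C →* Equiv.Perm Z) (ψ : C →* ℂ) [DecidableEq (Equiv.Perm Z)] (t : Equiv.Perm Z) :
    (rotIdem ρ ψ).coeff t =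
      ∑ c, (Fintype.card C : ℂ)⁻¹ * ψ c⁻¹ * if ρ c = t then 1 else 0 := by
  rw [rotIdem, MonoidAlgebra.coeff_smul_apply, MonoidAlgebra.coeff_sum, Finsupp.finsetSum_apply,
    Finset.smul_sum]
  refine Finset.sum_congr rfl fun c _ => ?_
  rw [MonoidAlgebra.coeff_single, Finsupp.single_apply, smul_eq_mul, mul_assoc]
  split_ifs <;> simp

/-- Together with `avgRot_of_mem` this describes equivariant functions as those fixed by the
idempotents in all blocks. -/
theorem locOp_rotIdem (f : Arr Y (Fin a ⊕ Fin l) N → ℂ) :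
    locOp (fun s => rotIdem (D.ρ s) (D.ψ s)) f = avgRot D f := by
  classical
  funext x
  rw [locOp_apply, avgRot_apply]
  have h : ∀ t : ∀ i, Equiv.Perm (Y (x.1 i)),
      (∏ i, (rotIdem (D.ρ (x.1 i)) (D.ψ (x.1 i))).coeff (t i)) * f (x.loc t) =
      ∑ c : ∀ i, D.C (x.1 i), if (fun i => D.ρ _ (c i)) = t then
        (∏ i, (Fintype.card (D.C (x.1 i)) : ℂ)⁻¹ * D.ψ _ (c i)⁻¹) * f (x.rot D c) else 0 := by
    intro t
    simp only [coeff_rotIdem]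
    rw [Finset.prod_univ_sum, Fintype.piFinset_univ, Finset.sum_mul]
    refine Finset.sum_congr rfl fun c _ => ?_
    rw [Finset.prod_mul_distrib]
    split_ifs with ht
    · subst ht
      simp
    · obtain ⟨i, hi⟩ := Function.ne_iff.1 ht
      have h0 : ∏ i, (if D.ρ _ (c i) = t i then (1 : ℂ) else 0) = 0 :=
        Finset.prod_eq_zero (Finset.mem_univ i) (if_neg hi)
      rw [h0, mul_zero, zero_mul]
  rw [Finset.sum_congr rfl fun t _ => h t, Finset.sum_comm, Finset.mul_sum]
  refine Finset.sum_congr rfl fun c _ => ?_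
  rw [Finset.sum_ite_eq, if_pos (Finset.mem_univ _), Finset.prod_mul_distrib, Finset.prod_inv_distrib,
    mul_assoc]

variable {D}

/-- The target idempotent fixes `y` from the left, so the image is fixed by averaging for `D'` and
therefore equivariant. -/
theorem locOp_mem {D' : BlockData Y} {y : ∀ s, MonoidAlgebra ℂ (Equiv.Perm (Y s))}
    (hy : ∀ s, rotIdem (D'.ρ s) (D'.ψ s) * y s = y s) {f : Arr Y (Fin a ⊕ Fin l) N → ℂ}
    (hf : f ∈ blockFun D fun _ => True) : locOp y f ∈ blockFun D' fun _ => True := by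
  refine ⟨fun x c => ?_, locOp_mix y f hf.2.1, fun x hx => absurd trivial hx⟩
  have h : avgRot D' (locOp y f) = locOp y f := by
    rw [← locOp_rotIdem, locOp_locOp]
    simp only [hy]
  rw [← h, avgRot_rot]

/-- The representation of all permutations of the points on equivariant functions. -/
abbrev fullRep (D : BlockData Y) (a l : ℕ) (N : Type) : Representation ℂ (Equiv.Perm N)
    (blockFun D fun _ : Arr Y (Fin a ⊕ Fin l) N => True) :=
  blockRep D (MonoidHom.id (Equiv.Perm N)) (fun _ => True) fun _ _ _ => trivial

/-- If the idempotents for the shapes are equivalent, then the representations on equivariant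
functions on arrangements are isomorphic. -/
theorem nonempty_equiv_of_rotIdem {D' : BlockData Y}
    (h : ∀ s, ∃ x y : MonoidAlgebra ℂ (Equiv.Perm (Y s)), x * y = rotIdem (D.ρ s) (D.ψ s) ∧
      y * x = rotIdem (D'.ρ s) (D'.ψ s) ∧ rotIdem (D.ρ s) (D.ψ s) * x = x ∧
      rotIdem (D'.ρ s) (D'.ψ s) * y = y) :
    Nonempty ((fullRep D a l N).Equiv (fullRep D' a l N)) := by
  choose x y hxy hyx hx hy using h
  have hinv : ∀ (D D' : BlockData Y) (x y : ∀ s, MonoidAlgebra ℂ (Equiv.Perm (Y s)))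
      (_ : ∀ s, x s * y s = rotIdem (D.ρ s) (D.ψ s)) (f : Arr Y (Fin a ⊕ Fin l) N → ℂ),
      f ∈ blockFun D (fun _ => True) → locOp x (locOp y f) = f := by
    intro D D' x y hxy f hf
    rw [locOp_locOp]
    simp only [hxy]
    rw [locOp_rotIdem, avgRot_of_mem hf]
  refine ⟨Representation.Equiv.mk (LinearEquiv.ofLinearMap
    ((locOp y).restrict fun f hf => locOp_mem hy hf)
    ((locOp x).restrict fun f hf => locOp_mem hx hf) ?_ ?_) ?_⟩
  · exact LinearMap.ext fun f => Subtype.ext (hinv D' D y x hyx _ f.2)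
  · exact LinearMap.ext fun f => Subtype.ext (hinv D D' x y hxy _ f.2)
  · intro σ
    exact LinearMap.ext fun f => Subtype.ext (locOp_act y _ σ)

end LocOp

end WreathOS

end

noncomputable section

namespace WreathOS

/-! ### Isotypic components of functions on arrangements -/

section Isotypic

variable {r n m a l : ℕ}

/-- The points under labelled points are counted by the positions in the blocks. -/
def IsEquivariant.letterEquiv {x : WArr r n a l} (hx : IsEquivariant x) :
    (Σ i, ZMod (x.1 i + 1)) ≃ Fin n :=
  Equiv.ofBijective (fun p => (letter x p.1 p.2).2) ⟨fun _ _ h => hx.letter_injective h, fun k => by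
    obtain ⟨⟨i, y⟩, h⟩ := x.2.surjective (1, k)
    refine ⟨⟨i, y.2.toAdd⟩, ?_⟩
    rw [hx.apply] at h
    exact congrArg Prod.snd h⟩

theorem IsEquivariant.prod_block {x : WArr r n a l} (hx : IsEquivariant x)
    (G : Fin a ⊕ Fin l → ℂ) :
    ∏ k, G (hx.letterEquiv.symm k).1 = ∏ i, G i ^ ((x.1 i : ℕ) + 1) := by
  rw [← Equiv.prod_comp hx.letterEquiv]
  simp only [Equiv.symm_apply_apply]
  rw [Fintype.prod_sigma]
  refine Finset.prod_congr rfl fun i _ => ?_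
  refine (Finset.prod_const (G i)).trans ?_
  rw [Finset.card_univ, ZMod.card]

theorem wreathPerm_inl (ζ : Fin n → Mu r) (p : Mu r × Fin n) :
    wreathPerm r n (SemidirectProduct.inl ζ) p = (ζ p.2 * p.1, p.2) := rfl

theorem wreathPerm_inr (w : Equiv.Perm (Fin n)) (p : Mu r × Fin n) :
    wreathPerm r n (SemidirectProduct.inr w) p = (p.1, w p.2) := by
  simp [wreathPerm]

/-- Scaling the labels inside the blocks is the same as acting by an element of μ_r^n that is
constant on the blocks; this makes the two kinds of equivariance interact. -/
theorem IsEquivariant.rot_label [NeZero r] {x : WArr r n a l} (hx : IsEquivariant x)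
    (ξ : Fin a ⊕ Fin l → Mu r) :
    x.rot (shapeData r n) (fun i => ((ξ i, 1) : Shape r n (x.1 i))) =
      x.act (wreathPerm r n (SemidirectProduct.inl fun k => ξ (hx.letterEquiv.symm k).1)) := by
  refine Arr.ext_of_fst fun i y => ?_
  change x.2 ⟨i, ((ξ i * y.1, 1 * y.2) : Shape r n (x.1 i))⟩ = wreathPerm r n _ (x.2 ⟨i, y⟩)
  rw [one_mul, hx i (ξ i) y, wreathPerm_inl]
  have h : (x.2 ⟨i, y⟩).2 = hx.letterEquiv ⟨i, y.2.toAdd⟩ := by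
    rw [hx.apply]
    rfl
  rw [h, Equiv.symm_apply_apply]

/-- The character of `μ_r^n` that defines the isotypic component. -/
def labelChar (r n : ℕ) (s : ℤ) : (Fin n → Mu r) →* ℂ where
  toFun ζ := ∏ i, ((ζ i : ℂˣ) : ℂ) ^ (-s)
  map_one' := by simp
  map_mul' ζ ζ' := by simp [mul_zpow, Finset.prod_mul_distrib, mul_comm]

theorem labelChar_block {x : WArr r n a l} (hx : IsEquivariant x) (s : ℤ)
    (ξ : Fin a ⊕ Fin l → Mu r) :
    labelChar r n s (fun k => ξ (hx.letterEquiv.symm k).1) =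
      ∏ i, (((ξ i : ℂˣ) : ℂ) ^ (-s)) ^ ((x.1 i : ℕ) + 1) :=
  hx.prod_block fun i => ((ξ i : ℂˣ) : ℂ) ^ (-s)

/-- The representation of `W(r,n)` on functions on equivariant arrangements. -/
abbrev equivRep (r n a l : ℕ) [NeZero r] : Representation ℂ (W r n)
    (blockFun (shapeData r n) (IsEquivariant : WArr r n a l → Prop)) :=
  blockRep (shapeData r n) (wreathPerm r n) IsEquivariant fun g _ hx => hx.act g

theorem isotypic_act [NeZero r] {s : ℤ}
    {f : blockFun (shapeData r n) (IsEquivariant : WArr r n a l → Prop)}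
    (hf : f ∈ isotypic (equivRep r n a l) s) (ζ : Fin n → Mu r) (x : WArr r n a l) :
    f.1 (x.act (wreathPerm r n (SemidirectProduct.inl ζ))) = labelChar r n s ζ⁻¹ * f.1 x := by
  have h := congrFun (congrArg Subtype.val (hf ζ⁻¹)) x
  rw [blockRep_apply, ← map_inv, ← map_inv, inv_inv] at h
  exact h

theorem exists_mu_zpow_ne_one [NeZero r] {t : ℤ} (ht : ¬ (r : ℤ) ∣ t) :
    ∃ ξ : Mu r, ((ξ : ℂˣ) : ℂ) ^ t ≠ 1 := by
  have hprim := Complex.isPrimitiveRoot_exp r (NeZero.ne r)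
  refine ⟨hprim.toRootsOfUnity, fun h => ht ?_⟩
  rw [← hprim.zpow_eq_one_iff_dvd]
  exact h

/-- Scale block `i` by a label. The function does not change, since labels have trivial character in
`shapeData`, while the isotypic condition multiplies it by the power of the label with exponent `s`
times the block size. For `s` prime to `r` this power can differ from 1 unless `r` divides the block
size. -/
theorem isotypic_apply_eq_zero [NeZero r] {s : ℤ} (hs : Int.gcd s r = 1)
    {f : blockFun (shapeData r n) (IsEquivariant : WArr r n a l → Prop)}
    (hf : f ∈ isotypic (equivRep r n a l) s) {x : WArr r n a l} {i : Fin a ⊕ Fin l}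
    (hi : ¬ r ∣ (x.1 i : ℕ) + 1) : f.1 x = 0 := by
  by_cases hx : IsEquivariant x
  · have hdvd : ¬ (r : ℤ) ∣ s * ((x.1 i : ℕ) + 1) := by
      intro h
      have := Int.dvd_of_dvd_mul_right_of_gcd_one h (by rw [Int.gcd_comm]; exact hs)
      exact hi (by exact_mod_cast this)
    obtain ⟨ξ, hξ⟩ := exists_mu_zpow_ne_one hdvd
    -- Only block `i` is scaled; the inverse compensates the exponent `-s`.
    let ξ' : Fin a ⊕ Fin l → Mu r := Function.update 1 i ξ⁻¹
    have h1 := f.2.1 x (fun j => ((ξ'⁻¹ j, 1) : Shape r n (x.1 j)))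
    rw [hx.rot_label, isotypic_act hf] at h1
    have h2 : labelChar r n s (fun k => ξ'⁻¹ (hx.letterEquiv.symm k).1)⁻¹ =
        ((ξ : ℂˣ) : ℂ) ^ (s * ((x.1 i : ℕ) + 1)) := by
      have : (fun k => ξ'⁻¹ (hx.letterEquiv.symm k).1)⁻¹ =
          fun k => ξ' (hx.letterEquiv.symm k).1 := funext fun k => inv_inv _
      rw [this, labelChar_block, Finset.prod_eq_single i]
      · simp only [ξ', Function.update_self]
        rw [zpow_mul, Subgroup.coe_inv, Units.val_inv_eq_inv_val, inv_zpow', neg_neg]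
        exact_mod_cast rfl
      · intro j _ hj
        simp [ξ', hj]
      · simp
    have h3 : ∏ j, (shapeData r n).ψ _ ((ξ'⁻¹ j, 1) : Shape r n (x.1 j)) = 1 :=
      Finset.prod_eq_one fun j _ => map_one
      (AddChar.toMonoidHom (ZMod.stdAddChar (N := (x.1 j : ℕ) + 1)))
    rw [h2] at h1
    have h4 := h1.trans (congrArg (· * f.1 x) h3)
    have h5 : (((ξ : ℂˣ) : ℂ) ^ (s * ((x.1 i : ℕ) + 1)) - 1) * f.1 x = 0 := by
      rw [sub_mul]
      exact sub_eq_zero.2 h4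
    exact (mul_eq_zero.1 h5).resolve_left (sub_ne_zero.2 hξ)
  · exact f.2.2.2 x hx


/-! ### Blocks of size divisible by r, and labelling of unlabelled arrangements -/

/-- The shape with `r (s + 1)` points. -/
def wideShape (h : r * m = n) [NeZero r] (s : Fin m) : Fin n :=
  ⟨r * (s + 1) - 1, by
    have h1 : r * (s + 1) ≤ r * m := Nat.mul_le_mul_left r s.2
    have h2 : 0 < r * (s + 1) := Nat.mul_pos (NeZero.pos r) (Nat.succ_pos _)
    omega⟩

theorem wideShape_add_one (h : r * m = n) [NeZero r] (s : Fin m) :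
    (wideShape h s : ℕ) + 1 = r * (s + 1) := by
  have h2 : 0 < r * ((s : ℕ) + 1) := Nat.mul_pos (NeZero.pos r) (Nat.succ_pos _)
  simp only [wideShape]
  omega

theorem wideShape_injective (h : r * m = n) [NeZero r] : Function.Injective (wideShape h) := by
  intro s t hst
  have h1 := wideShape_add_one h s
  rw [hst, wideShape_add_one] at h1
  have := Nat.eq_of_mul_eq_mul_left (NeZero.pos r) h1
  exact Fin.ext (by omega)

theorem exists_wideShape (h : r * m = n) [NeZero r] {b : Fin n} (hb : r ∣ (b : ℕ) + 1) :
    ∃ s, wideShape h s = b := by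
  obtain ⟨q, hq⟩ := hb
  have hq0 : q ≠ 0 := by
    rintro rfl
    omega
  have hqm : q ≤ m := by
    refine Nat.le_of_mul_le_mul_left (c := r) ?_ (NeZero.pos r)
    rw [h, ← hq]
    exact b.2
  refine ⟨⟨q - 1, by omega⟩, Fin.ext ?_⟩
  have h1 := wideShape_add_one h ⟨q - 1, by omega⟩
  simp only [Nat.sub_add_cancel (Nat.one_le_iff_ne_zero.2 hq0)] at h1
  omega

theorem card_shape [NeZero r] (s : Fin m) : Fintype.card (Shape r m s) = r * (s + 1) := by
  rw [Fintype.card_prod, card_mu]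
  exact congrArg (r * ·) ((Fintype.card_multiplicative _).trans (ZMod.card _))

/-- Cyclic coordinates on a block. -/
def cycCoord (h : r * m = n) [NeZero r] (s : Fin m) :
    Shape r m s ≃ Multiplicative (ZMod (wideShape h s + 1)) :=
  Fintype.equivOfCardEq (by
    rw [card_shape]
    exact (((Fintype.card_multiplicative _).trans (ZMod.card _)).trans (wideShape_add_one h s)).symm)

/-- Cyclic groups that act simply transitively, with faithful characters. -/
abbrev cycData (h : r * m = n) [NeZero r] : BlockData (Shape r m) where
  C s := Multiplicative (ZMod (wideShape h s + 1))
  ρ s := (cycCoord h s).symm.permCongrHom.toMonoidHom.comp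
    (MulAction.toPermHom (Multiplicative (ZMod (wideShape h s + 1)))
      (Multiplicative (ZMod (wideShape h s + 1))))
  ψ s := AddChar.toMonoidHom (ZMod.stdAddChar (N := wideShape h s + 1))

theorem cycCoord_ρ (h : r * m = n) [NeZero r] (s : Fin m)
    (c κ : Multiplicative (ZMod (wideShape h s + 1))) :
    (cycData h).ρ s c ((cycCoord h s).symm κ) = (cycCoord h s).symm (c * κ) := by
  change (cycCoord h s).symm (c * cycCoord h s ((cycCoord h s).symm κ)) = _
  rw [Equiv.apply_symm_apply]

/-- The equivariant arrangement of labelled points defined by labels and an arrangement of points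
into blocks. -/
def lift (h : r * m = n) [NeZero r] (ζ : Fin n → Mu r)
    (x : Arr (Shape r m) (Fin a ⊕ Fin l) (Fin n)) : WArr r n a l :=
  ⟨fun i => wideShape h (x.1 i),
    { toFun := fun p => (ζ (x.2 ⟨p.1, (cycCoord h _).symm p.2.2⟩) * p.2.1,
        x.2 ⟨p.1, (cycCoord h _).symm p.2.2⟩)
      invFun := fun q => ⟨(x.2.symm q.2).1, ((ζ q.2)⁻¹ * q.1, cycCoord h _ (x.2.symm q.2).2)⟩
      left_inv := by
        rintro ⟨i, ξ, κ⟩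
        have e : x.2.symm (x.2 ⟨i, (cycCoord h _).symm κ⟩) = ⟨i, (cycCoord h _).symm κ⟩ :=
          x.2.symm_apply_apply _
        dsimp only
        rw [e, inv_mul_cancel_left, Equiv.apply_symm_apply]
      right_inv := by
        rintro ⟨η, k⟩
        dsimp only
        rw [Equiv.symm_apply_apply]
        simp }⟩

theorem lift_apply (h : r * m = n) [NeZero r] (ζ : Fin n → Mu r)
    (x : Arr (Shape r m) (Fin a ⊕ Fin l) (Fin n)) (i) (y : Shape r n (wideShape h (x.1 i))) :
    (lift h ζ x).2 ⟨i, y⟩ = (ζ (x.2 ⟨i, (cycCoord h _).symm y.2⟩) * y.1,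
      x.2 ⟨i, (cycCoord h _).symm y.2⟩) := rfl

variable (h : r * m = n) [NeZero r] (ζ : Fin n → Mu r)
  (x : Arr (Shape r m) (Fin a ⊕ Fin l) (Fin n))

theorem lift_act_inl (ζ' : Fin n → Mu r) :
    (lift h ζ x).act (wreathPerm r n (SemidirectProduct.inl ζ')) = lift h (ζ' * ζ) x := by
  refine Arr.ext_of_fst fun i y => ?_
  refine (congrArg (wreathPerm r n (SemidirectProduct.inl ζ')) (lift_apply h ζ x i y)).trans ?_
  rw [wreathPerm_inl, ← mul_assoc]
  rfl

theorem lift_act_inr (w : Equiv.Perm (Fin n)) :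
    (lift h 1 x).act (wreathPerm r n (SemidirectProduct.inr w)) = lift h 1 (x.act w) := by
  refine Arr.ext_of_fst fun i y => ?_
  refine (congrArg (wreathPerm r n (SemidirectProduct.inr w)) (lift_apply h 1 x i y)).trans ?_
  rw [wreathPerm_inr]
  rfl

theorem lift_mix (π : BlockPerm a l) : (lift h ζ x).mix π = lift h ζ (x.mix π) :=
  Arr.ext_of_fst fun _ _ => rfl

theorem lift_rot (κ : ∀ i, (cycData h).C (x.1 i)) :
    (lift h ζ x).rot (shapeData r n) (fun i => ((1, κ i) : Shape r n (wideShape h (x.1 i)))) =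
      lift h ζ (x.rot (cycData h) κ) := by
  refine Arr.ext_of_fst fun i (y : Shape r n (wideShape h (x.1 i))) => ?_
  refine (lift_apply h ζ x i (1 * y.1, (κ i : Multiplicative (ZMod (wideShape h (x.1 i) + 1))) * y.2)).trans ?_
  refine Eq.trans ?_ (lift_apply h ζ (x.rot (cycData h) κ) i y).symm
  have e : (x.rot (cycData h) κ).2 ⟨i, (cycCoord h _).symm y.2⟩ =
      x.2 ⟨i, (cycCoord h _).symm ((κ i : Multiplicative (ZMod (wideShape h (x.1 i) + 1))) * y.2)⟩ :=
    congrArg (fun z => x.2 ⟨i, z⟩) (cycCoord_ρ h _ _ _)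
  rw [e, one_mul]

theorem lift_isEquivariant : IsEquivariant (lift h ζ x) := by
  intro i ξ y
  refine (lift_apply h ζ x i (ξ * y.1, y.2)).trans ?_
  rw [lift_apply h ζ x i y, mul_left_comm]

theorem lift_injective : Function.Injective
    fun p : (Fin n → Mu r) × Arr (Shape r m) (Fin a ⊕ Fin l) (Fin n) => lift h p.1 p.2 := by
  rintro ⟨ζ, b, u⟩ ⟨ζ', b', u'⟩ hp
  obtain rfl : b = b' := funext fun i =>
    wideShape_injective h (congrFun (congrArg Sigma.fst hp) i)
  have h1 := eq_of_heq (Sigma.mk.inj hp).2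
  have h2 : ∀ i (y : Shape r m (b i)), (ζ (u ⟨i, y⟩), u ⟨i, y⟩) = (ζ' (u' ⟨i, y⟩), u' ⟨i, y⟩) := by
    intro i y
    have h3 := Equiv.congr_fun h1 ⟨i, (1, cycCoord h _ y)⟩
    rw [Equiv.coe_fn_mk, Equiv.coe_fn_mk] at h3
    simpa using h3
  obtain rfl : u = u' := Equiv.ext fun ⟨i, y⟩ => congrArg Prod.snd (h2 i y)
  have h4 : ζ = ζ' := by
    funext k
    obtain ⟨⟨i, y⟩, rfl⟩ := u.surjective k
    exact congrArg Prod.fst (h2 i y)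
  rw [h4]

/-- An equivariant arrangement is a labelling of the points together with an arrangement of the
points; the divisibility says that its block shapes are of the form `wideShape h s`. -/
theorem exists_lift_iff (y : WArr r n a l) : (∃ ζ x, lift h ζ x = y) ↔
    IsEquivariant y ∧ ∀ i, r ∣ (y.1 i : ℕ) + 1 := by
  constructor
  · rintro ⟨ζ, x, rfl⟩
    refine ⟨lift_isEquivariant h ζ x, fun i => ?_⟩
    change r ∣ (wideShape h (x.1 i) : ℕ) + 1
    rw [wideShape_add_one]
    exact dvd_mul_right _ _
  · rintro ⟨hy, hdvd⟩
    choose b hb using fun i => exists_wideShape h (hdvd i)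
    obtain ⟨b', v⟩ := y
    obtain rfl : (fun i => wideShape h (b i)) = b' := funext hb
    let u : (Σ i, Shape r m (b i)) ≃ Fin n :=
      (Equiv.sigmaCongrRight fun i => (cycCoord h (b i)).trans Multiplicative.toAdd).trans
        hy.letterEquiv
    refine ⟨fun k => (v ⟨(u.symm k).1, (1, cycCoord h _ (u.symm k).2)⟩).1, ⟨b, u⟩, ?_⟩
    refine Arr.ext_of_fst fun i y => ?_
    have e : u ⟨i, (cycCoord h _).symm y.2⟩ = (v ⟨i, (1, y.2)⟩).2 := by
      change (v ⟨i, (1, (cycCoord h _) ((cycCoord h _).symm y.2))⟩).2 = _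
      rw [Equiv.apply_symm_apply]
    refine Prod.ext ?_ ?_
    · change (v ⟨(u.symm (u ⟨i, (cycCoord h _).symm y.2⟩)).1,
        (1, cycCoord h _ (u.symm (u ⟨i, (cycCoord h _).symm y.2⟩)).2)⟩).1 * y.1 = (v ⟨i, y⟩).1
      rw [Equiv.symm_apply_apply, Equiv.apply_symm_apply]
      have := congrArg Prod.fst (hy.apply i y)
      refine Eq.trans (mul_comm _ _) this.symm
    · refine Eq.trans e ?_
      have := congrArg Prod.snd (hy.apply i y)
      exact this.symm

end Isotypic

end WreathOS

end

noncomputable section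

namespace WreathOS

/-! ### Restriction of isotypic functions to trivial labels -/

section Descend

variable {r n m a l : ℕ} {s : ℤ}

/-- The label of a block contributes a power whose exponent is a multiple of the block size, hence
of `r`. This is the converse of the obstruction in `isotypic_apply_eq_zero`. -/
theorem labelChar_block_eq_one {x : WArr r n a l} (hx : IsEquivariant x)
    (hdvd : ∀ i, r ∣ (x.1 i : ℕ) + 1) (ξ : Fin a ⊕ Fin l → Mu r) :
    labelChar r n s (fun k => ξ (hx.letterEquiv.symm k).1) = 1 := by
  rw [labelChar_block]
  refine Finset.prod_eq_one fun i _ => ?_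
  obtain ⟨q, hq⟩ := hdvd i
  rw [hq, ← zpow_natCast, ← zpow_mul, mul_comm, zpow_mul, zpow_natCast, pow_mul, root_pow, one_pow,
    one_zpow]

variable (h : r * m = n) [NeZero r]

theorem isotypic_apply_lift {f : blockFun (shapeData r n) (IsEquivariant : WArr r n a l → Prop)}
    (hf : f ∈ isotypic (equivRep r n a l) s) (ζ : Fin n → Mu r)
    (x : Arr (Shape r m) (Fin a ⊕ Fin l) (Fin n)) :
    f.1 (lift h ζ x) = labelChar r n s ζ⁻¹ * f.1 (lift h 1 x) := by
  rw [← isotypic_act hf, lift_act_inl, mul_one]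

/-- Restrict a function to arrangements with trivial labels. -/
def descend (s : ℤ) : isotypic (equivRep r n a l) s →ₗ[ℂ]
    blockFun (cycData h) fun _ : Arr (Shape r m) (Fin a ⊕ Fin l) (Fin n) => True where
  toFun f := ⟨fun x => f.1.1 (lift h 1 x), by
    refine ⟨fun x κ => ?_, fun x π => ?_, fun x hx => absurd trivial hx⟩
    · dsimp only
      rw [← lift_rot]
      exact f.1.2.1 _ _
    · dsimp only
      rw [← lift_mix]
      exact f.1.2.2.1 _ _⟩
  map_add' _ _ := rfl
  map_smul' _ _ := rfl

theorem descend_apply (f : isotypic (equivRep r n a l) s) (x) :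
    (descend h s f).1 x = f.1.1 (lift h 1 x) := rfl

/-- An isotypic function vanishes unless `r` divides all block sizes, and elsewhere its values at
all labellings follow from the one with trivial labels. -/
theorem descend_injective (hs : Int.gcd s r = 1) :
    Function.Injective (descend (a := a) (l := l) h s) := by
  refine (injective_iff_map_eq_zero (descend h s)).2 fun f hf => ?_
  refine Subtype.ext (Subtype.ext (funext fun y => ?_))
  by_cases hy : IsEquivariant y
  · by_cases hdvd : ∀ i, r ∣ (y.1 i : ℕ) + 1
    · obtain ⟨ζ, x, rfl⟩ := (exists_lift_iff h y).2 ⟨hy, hdvd⟩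
      rw [isotypic_apply_lift h f.2, ← descend_apply, hf]
      exact mul_zero _
    · obtain ⟨i, hi⟩ := not_forall.1 hdvd
      exact isotypic_apply_eq_zero hs f.2 hi
  · exact f.1.2.2.2 y hy

/-- Extend a function on arrangements of points to labelled points. -/
def ascend (s : ℤ) (g : Arr (Shape r m) (Fin a ⊕ Fin l) (Fin n) → ℂ) :
    WArr r n a l → ℂ :=
  Function.extend (fun p : (Fin n → Mu r) × Arr (Shape r m) (Fin a ⊕ Fin l) (Fin n) =>
    lift h p.1 p.2) (fun p => labelChar r n s p.1⁻¹ * g p.2) 0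

theorem ascend_lift (g : Arr (Shape r m) (Fin a ⊕ Fin l) (Fin n) → ℂ) (ζ : Fin n → Mu r) (x) :
    ascend h s g (lift h ζ x) = labelChar r n s ζ⁻¹ * g x :=
  (lift_injective h).extend_apply _ _ (ζ, x)

theorem ascend_of_not (g : Arr (Shape r m) (Fin a ⊕ Fin l) (Fin n) → ℂ) {y : WArr r n a l}
    (hy : ¬ (IsEquivariant y ∧ ∀ i, r ∣ (y.1 i : ℕ) + 1)) : ascend h s g y = 0 := by
  rw [← exists_lift_iff h] at hy
  exact Function.extend_apply' _ _ _ fun ⟨⟨ζ, x⟩, hx⟩ => hy ⟨ζ, x, hx⟩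

/-- A rotation with labels is a pure rotation followed by the action of a label vector constant on
blocks. The latter contributes nothing by `labelChar_block_eq_one`. -/
theorem ascend_mem {g : Arr (Shape r m) (Fin a ⊕ Fin l) (Fin n) → ℂ}
    (hg : g ∈ blockFun (cycData h) fun _ => True) :
    ascend h s g ∈ blockFun (shapeData r n) (IsEquivariant : WArr r n a l → Prop) := by
  refine ⟨fun y c => ?_, fun y π => ?_, fun y hy => ascend_of_not h g fun hy' => hy hy'.1⟩
  · by_cases hy : IsEquivariant y ∧ ∀ i, r ∣ (y.1 i : ℕ) + 1
    · obtain ⟨ζ, x, rfl⟩ := (exists_lift_iff h y).2 hy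
      let ξ : Fin a ⊕ Fin l → Mu r := fun i => (c i).1
      let κ : ∀ i, (cycData h).C (x.1 i) := fun i => (c i).2
      have hc : c = (fun i => ((1, κ i) : Shape r n (wideShape h (x.1 i)))) *
          fun i => ((ξ i, 1) : Shape r n (wideShape h (x.1 i))) :=
        funext fun i => Prod.ext (one_mul _).symm (mul_one _).symm
      have hrot : (lift h ζ x).rot (shapeData r n) c = lift h
          ((fun k => ξ ((lift_isEquivariant h ζ (x.rot (cycData h) κ)).letterEquiv.symm k).1) * ζ)
          (x.rot (cycData h) κ) := by
        rw [← lift_act_inl, ← IsEquivariant.rot_label, ← lift_rot]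
        exact (congrArg (fun c => (lift h ζ x).rot (shapeData r n) c) hc).trans
          (Arr.rot_rot (shapeData r n) (lift h ζ x) _ _).symm
      rw [hrot, ascend_lift, ascend_lift, mul_inv_rev, map_mul, hg.1]
      have h1 := labelChar_block_eq_one (s := s) (lift_isEquivariant h ζ (x.rot (cycData h) κ))
        (((exists_lift_iff h _).1 ⟨_, _, rfl⟩).2) ξ⁻¹
      have h2 : (fun k => ξ⁻¹ ((lift_isEquivariant h ζ (x.rot (cycData h) κ)).letterEquiv.symm
          k).1) = (fun k => ξ ((lift_isEquivariant h ζ (x.rot (cycData h) κ)).letterEquiv.symm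
          k).1)⁻¹ := rfl
      rw [h2] at h1
      rw [h1, mul_one, mul_left_comm]
      rfl
    · rw [ascend_of_not h g hy, mul_zero, ascend_of_not h g]
      rw [isEquivariant_invariant.rot_iff]
      exact hy
  · by_cases hy : IsEquivariant y ∧ ∀ i, r ∣ (y.1 i : ℕ) + 1
    · obtain ⟨ζ, x, rfl⟩ := (exists_lift_iff h y).2 hy
      rw [lift_mix, ascend_lift, ascend_lift, hg.2.1, mul_left_comm]
    · rw [ascend_of_not h g hy, mul_zero, ascend_of_not h g]
      rw [isEquivariant_invariant.mix_iff]
      refine fun hy' => hy ⟨hy'.1, fun i => ?_⟩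
      have := hy'.2 ((Equiv.Perm.sumCongrHom (Fin a) (Fin l) π)⁻¹ i)
      change r ∣ (y.1 (Equiv.Perm.sumCongrHom (Fin a) (Fin l) π
        ((Equiv.Perm.sumCongrHom (Fin a) (Fin l) π)⁻¹ i)) : ℕ) + 1 at this
      rwa [← Equiv.Perm.mul_apply, mul_inv_cancel] at this

theorem ascend_mem_isotypic {g : Arr (Shape r m) (Fin a ⊕ Fin l) (Fin n) → ℂ}
    (hg : g ∈ blockFun (cycData h) fun _ => True) :
    (⟨ascend h s g, ascend_mem h hg⟩ : blockFun (shapeData r n)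
      (IsEquivariant : WArr r n a l → Prop)) ∈ isotypic (equivRep r n a l) s := by
  refine fun ζ => Subtype.ext (funext fun y => ?_)
  rw [blockRep_apply, ← map_inv, ← map_inv]
  change ascend h s g _ = labelChar r n s ζ * ascend h s g y
  by_cases hy : IsEquivariant y ∧ ∀ i, r ∣ (y.1 i : ℕ) + 1
  · obtain ⟨ζ', x, rfl⟩ := (exists_lift_iff h y).2 hy
    rw [lift_act_inl, ascend_lift, ascend_lift, mul_inv_rev, inv_inv, mul_comm ζ'⁻¹, map_mul,
      mul_assoc]
  · rw [ascend_of_not h g hy, mul_zero, ascend_of_not h g]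
    rw [IsEquivariant.act_iff]
    exact hy

theorem descend_surjective : Function.Surjective (descend (a := a) (l := l) h s) := by
  intro g
  refine ⟨⟨_, ascend_mem_isotypic h g.2⟩, Subtype.ext (funext fun x => ?_)⟩
  rw [descend_apply]
  change ascend h s g.1 _ = _
  rw [ascend_lift, inv_one, map_one, one_mul]

/-- The isotypic component consists of functions on arrangements of points. -/
theorem nonempty_isotypic_equiv (hs : Int.gcd s r = 1) :
    Nonempty ((isotypicRep (equivRep r n a l) s).Equiv (fullRep (cycData h) a l (Fin n))) := by
  refine ⟨Representation.Equiv.mk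
    (LinearEquiv.ofBijective (descend h s) ⟨descend_injective h hs, descend_surjective h⟩) ?_⟩
  intro w
  refine LinearMap.ext fun f => Subtype.ext (funext fun x => ?_)
  change f.1.1 ((lift h 1 x).act (wreathPerm r n (SemidirectProduct.inr w))⁻¹) =
    f.1.1 (lift h 1 (x.act w⁻¹))
  rw [← map_inv, ← map_inv, lift_act_inr]

end Descend

end WreathOS

end

noncomputable section

namespace WreathOS

/-! ### Recognizing induced representations -/

section Induced

open Representation

variable {H G : Type} [Group H] [Group G] (φ : H →* G) {A V : Type}
  [AddCommGroup A] [Module ℂ A] [AddCommGroup V] [Module ℂ V]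
  (ρ : Representation ℂ H A) (τ : Representation ℂ G V)

theorem indV_mk_apply (w : H) (h : G) (x : A) :
    IndV.mk φ ρ (φ w * h) (ρ w x) = IndV.mk φ ρ h x := by
  have h1 := Coinvariants.mk_self_apply (tprod ((leftRegular ℂ G).comp φ) ρ) w
    (TensorProduct.tmul ℂ (MonoidAlgebra.single h 1) x)
  refine Eq.trans ?_ h1
  simp [IndV.mk]

/-- The map from an induced representation given by an equivariant map. -/
def indLift (ι : A →ₗ[ℂ] V) (hι : ∀ w x, ι (ρ w x) = τ (φ w) (ι x)) : IndV φ ρ →ₗ[ℂ] V :=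
  Coinvariants.lift _
    (TensorProduct.lift <| (Finsupp.lift _ _ _ fun h => τ h⁻¹ ∘ₗ ι) ∘ₗ
      (MonoidAlgebra.coeffLinearEquiv ℂ).toLinearMap)
    fun g => by
      ext h x
      simp only [LinearMap.coe_comp, Function.comp_apply, MonoidAlgebra.lsingle_apply]
      simp [ofMulAction_single, mul_inv_rev, hι]

theorem indLift_mk (ι : A →ₗ[ℂ] V) (hι : ∀ w x, ι (ρ w x) = τ (φ w) (ι x)) (h : G) (x : A) :
    indLift φ ρ τ ι hι (IndV.mk φ ρ h x) = τ h⁻¹ (ι x) := by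
  simp [indLift]

/-- A representation of `G` that contains a representation of `H` and is the direct sum of its
translates is induced. -/
theorem nonempty_ind_equiv [Fintype H] [Fintype G] (hφ : Function.Injective φ) (ι : A →ₗ[ℂ] V)
    (p : V →ₗ[ℂ] A) (hι : ∀ w x, ι (ρ w x) = τ (φ w) (ι x)) (hpι : ∀ x, p (ι x) = x)
    (hp : ∀ g, g ∉ Set.range φ → ∀ x, p (τ g (ι x)) = 0)
    (hsum : ∀ v, ∑ g : G, τ g⁻¹ (ι (p (τ g v))) = (Fintype.card H : ℂ) • v) :
    Nonempty ((ind φ ρ).Equiv τ) := by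
  have hH : (Fintype.card H : ℂ) ≠ 0 := Nat.cast_ne_zero.2 Fintype.card_ne_zero
  -- `K` sums over all of `G` and not over cosets of `H`, so `F` and `K` are inverse up to the
  -- factor |H| and no representatives need to be chosen.
  let F := indLift φ ρ τ ι hι
  let K : V →ₗ[ℂ] IndV φ ρ := ∑ g : G, IndV.mk φ ρ g ∘ₗ p ∘ₗ τ g
  have hK : ∀ v, K v = ∑ g : G, IndV.mk φ ρ g (p (τ g v)) := fun v => by
    simp only [K, LinearMap.sum_apply, LinearMap.comp_apply]
  have hFK : ∀ v, F (K v) = (Fintype.card H : ℂ) • v := by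
    intro v
    rw [hK, map_sum, ← hsum v]
    exact Finset.sum_congr rfl fun g _ => indLift_mk φ ρ τ ι hι _ _
  have hKF : K ∘ₗ F = (Fintype.card H : ℂ) • LinearMap.id := by
    refine IndV.hom_ext φ ρ fun h => LinearMap.ext fun x => ?_
    have h1 : F (IndV.mk φ ρ h x) = τ h⁻¹ (ι x) := indLift_mk φ ρ τ ι hι h x
    change K (F (IndV.mk φ ρ h x)) = (Fintype.card H : ℂ) • IndV.mk φ ρ h x
    rw [h1, hK, ← Equiv.sum_comp (Equiv.mulRight h)]
    -- Translates by elements outside the image of `H` are killed by `p`; each element of `H` gives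
    -- the same vector by `indV_mk_apply`.
    have h2 : ∑ w : H, IndV.mk φ ρ h x =
        ∑ g : G, IndV.mk φ ρ (g * h) (p (τ (g * h) (τ h⁻¹ (ι x)))) := by
      refine Fintype.sum_of_injective φ hφ _ _ (fun g hg => ?_) fun w => ?_
      · rw [← Module.End.mul_apply, ← map_mul, mul_inv_cancel_right, hp g hg, map_zero]
      · rw [← Module.End.mul_apply, ← map_mul, mul_inv_cancel_right, ← hι, hpι]
        exact (indV_mk_apply φ ρ w h x).symm
    rw [Finset.sum_const, Finset.card_univ, ← Nat.cast_smul_eq_nsmul ℂ] at h2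
    exact h2.symm
  refine ⟨Representation.Equiv.mk (LinearEquiv.ofLinearMap F ((Fintype.card H : ℂ)⁻¹ • K) ?_ ?_) ?_⟩
  · refine LinearMap.ext fun v => ?_
    rw [LinearMap.comp_apply, LinearMap.smul_apply, map_smul, hFK, smul_smul, inv_mul_cancel₀ hH,
      one_smul]
    rfl
  · rw [LinearMap.smul_comp, hKF, smul_smul, inv_mul_cancel₀ hH, one_smul]
  · intro g
    refine IndV.hom_ext φ ρ fun h => LinearMap.ext fun x => ?_
    change F (ind φ ρ g (IndV.mk φ ρ h x)) = τ g (F (IndV.mk φ ρ h x))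
    rw [ind_mk]
    refine (indLift_mk φ ρ τ ι hι _ _).trans ?_
    have h1 : F (IndV.mk φ ρ h x) = τ h⁻¹ (ι x) := indLift_mk φ ρ τ ι hι h x
    rw [h1, mul_inv_rev, inv_inv, map_mul]
    rfl

end Induced

end WreathOS

end

noncomputable section

namespace WreathOS

/-! ### Functions on arrangements as induced representations -/

section Induction

variable {r n m a l : ℕ}

/-- A permutation between two equivariant arrangements commutes with the scaling of labels, and the
centralizer of the scalings is the wreath product. -/
theorem IsEquivariant.exists_wreathPerm {x : WArr r m a l} (hx : IsEquivariant x)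
    {σ : Equiv.Perm (Mu r × Fin m)} (hσ : IsEquivariant (x.act σ)) :
    ∃ w, wreathPerm r m w = σ := by
  have hcomm : ∀ ξ p, σ (scale ξ p) = scale ξ (σ p) := by
    intro ξ p
    obtain ⟨⟨i, y⟩, rfl⟩ := x.2.surjective p
    exact (congrArg σ (hx i ξ y)).symm.trans (hσ i ξ y)
  have hs : ∀ η k, σ (η, k) = scale η (σ (1, k)) := by
    intro η k
    rw [← hcomm]
    simp [scale]
  have hsurj : Function.Surjective fun k => (σ (1, k)).2 := by
    intro j
    obtain ⟨⟨η, k⟩, h⟩ := σ.surjective (1, j)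
    refine ⟨k, ?_⟩
    rw [hs] at h
    exact congrArg Prod.snd h
  let w : Equiv.Perm (Fin m) := Equiv.ofBijective (fun k => (σ (1, k)).2)
    ⟨Finite.injective_iff_surjective.2 hsurj, hsurj⟩
  refine ⟨⟨fun j => (σ (1, w.symm j)).1, w⟩, Equiv.ext fun ⟨η, k⟩ => ?_⟩
  rw [hs]
  change ((σ (1, w.symm (w k))).1 * η, (σ (1, k)).2) = (η * (σ (1, k)).1, (σ (1, k)).2)
  rw [Equiv.symm_apply_apply, mul_comm]

theorem wreathPerm_injective (r m : ℕ) : Function.Injective (wreathPerm r m) := by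
  intro g h hgh
  have h1 : ∀ k, (g.left (g.right k) * 1, g.right k) = (h.left (h.right k) * 1, h.right k) :=
    fun k => Equiv.congr_fun hgh (1, k)
  have h2 : g.right = h.right := Equiv.ext fun k => congrArg Prod.snd (h1 k)
  refine SemidirectProduct.ext (funext fun k => ?_) h2
  have h3 := congrArg Prod.fst (h1 (g.right⁻¹ k))
  rw [← h2] at h3
  simpa using h3

/-- The inverse of the product of all labels of letters. -/
def labelProd (x : WArr r m a l) : ℂ :=
  ∏ i, ∏ j : ZMod (x.1 i + 1), (((letter x i j).1 : ℂˣ) : ℂ)⁻¹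

theorem labelProd_ne_zero (x : WArr r m a l) : labelProd x ≠ 0 :=
  Finset.prod_ne_zero_iff.2 fun _ _ => Finset.prod_ne_zero_iff.2 fun _ _ =>
    inv_ne_zero (Units.ne_zero _)

theorem labelProd_mix (x : WArr r m a l) (π : BlockPerm a l) :
    labelProd (x.mix π) = labelProd x :=
  Equiv.prod_comp (Equiv.Perm.sumCongrHom (Fin a) (Fin l) π)
    fun i => ∏ j : ZMod (x.1 i + 1), (((letter x i j).1 : ℂˣ) : ℂ)⁻¹

/-- All `b + 1` letters of a block are multiplied by the same label: the origin of the extra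
character in `detData`. -/
theorem labelProd_rot [NeZero r] {x : WArr r m a l} (hx : IsEquivariant x)
    (c : ∀ i, Shape r m (x.1 i)) : labelProd (x.rot (shapeData r m) c) =
      (∏ i, ((((c i).1 : ℂˣ) : ℂ)⁻¹) ^ ((x.1 i : ℕ) + 1)) * labelProd x := by
  rw [labelProd, labelProd, ← Finset.prod_mul_distrib]
  refine Finset.prod_congr rfl fun i _ => ?_
  have h : ∏ j : ZMod (x.1 i + 1), (((letter (x.rot (shapeData r m) c) i j).1 : ℂˣ) : ℂ)⁻¹ =
      ∏ j : ZMod (x.1 i + 1), ((((c i).1 : ℂˣ) : ℂ)⁻¹ *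
        (((letter x i ((c i).2.toAdd + j)).1 : ℂˣ) : ℂ)⁻¹) := by
    refine Finset.prod_congr rfl fun j _ => ?_
    rw [letter_rot hx]
    simp [scale, mul_comm]
  refine h.trans ?_
  rw [Finset.prod_mul_distrib, Finset.prod_const, Finset.card_univ, ZMod.card]
  congr 1
  exact Equiv.prod_comp (Equiv.addLeft (c i).2.toAdd)
    fun j : ZMod (x.1 i + 1) => (((letter x i j).1 : ℂˣ) : ℂ)⁻¹

/-- The letters lie above each point exactly once, so the product of labels changes by the product
of all ζ_k. This realizes the determinant without its sign. -/
theorem labelProd_act {x : WArr r m a l} (hx : IsEquivariant x) (g : W r m) :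
    labelProd (x.act (wreathPerm r m g)) = (∏ k, ((g.left k : ℂˣ) : ℂ))⁻¹ * labelProd x := by
  have h : ∏ k, ((g.left k : ℂˣ) : ℂ) = ∏ i, ∏ j : ZMod (x.1 i + 1),
      ((g.left (g.right (letter x i j).2) : ℂˣ) : ℂ) := by
    rw [← Equiv.prod_comp g.right, ← Equiv.prod_comp hx.letterEquiv, Fintype.prod_sigma]
    rfl
  rw [h, labelProd, labelProd, ← Finset.prod_inv_distrib, ← Finset.prod_mul_distrib]
  refine Finset.prod_congr rfl fun i _ => ?_
  rw [← Finset.prod_inv_distrib, ← Finset.prod_mul_distrib]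
  refine Finset.prod_congr rfl fun j _ => ?_
  have e : (letter (x.act (wreathPerm r m g)) i j).1 =
      g.left (g.right (letter x i j).2) * (letter x i j).1 := rfl
  rw [e, Subgroup.coe_mul, Units.val_mul, mul_inv]

/-- The number of points, divided by `r`, is the number of rotation positions. Any bijection from
these to the `m` underlying points, with labels copied, is equivariant. -/
theorem exists_isEquivariant_act [NeZero r] (x : WArr r m a l) :
    ∃ σ, IsEquivariant (x.act σ) := by
  have hcard : Fintype.card (Σ i, ZMod (x.1 i + 1)) = Fintype.card (Fin m) := by
    have h := Fintype.card_congr x.2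
    rw [Fintype.card_sigma, Fintype.card_prod, card_mu] at h
    simp only [card_shape] at h
    rw [← Finset.mul_sum] at h
    rw [Fintype.card_sigma]
    simp only [ZMod.card]
    exact Nat.eq_of_mul_eq_mul_left (NeZero.pos r) h
  let v := Fintype.equivOfCardEq hcard
  let u : (Σ i, Shape r m (x.1 i)) ≃ Mu r × Fin m :=
    { toFun := fun p => (p.2.1, v ⟨p.1, p.2.2.toAdd⟩)
      invFun := fun q => ⟨(v.symm q.2).1, (q.1, Multiplicative.ofAdd (v.symm q.2).2)⟩
      left_inv := by
        rintro ⟨i, ξ, κ⟩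
        dsimp only
        rw [Equiv.symm_apply_apply]
        rfl
      right_inv := by
        rintro ⟨η, k⟩
        exact Prod.ext rfl (v.apply_symm_apply k) }
  refine ⟨x.2.symm.trans u, fun i ξ y => ?_⟩
  change u (x.2.symm (x.2 ⟨i, (ξ * y.1, y.2)⟩)) =
    (ξ * (u (x.2.symm (x.2 ⟨i, y⟩))).1, (u (x.2.symm (x.2 ⟨i, y⟩))).2)
  rw [Equiv.symm_apply_apply, Equiv.symm_apply_apply]
  rfl

/-! ### The determinant twist and extension of functions by zero -/

/-- Labels and cyclic rotations, with the character that appears in the determinant twist. -/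
abbrev detData (r m : ℕ) [NeZero r] : BlockData (Shape r m) where
  C := Shape r m
  ρ b := MulAction.toPermHom (Shape r m b) (Shape r m b)
  ψ b := (((Units.coeHom ℂ).comp ((rootsOfUnity r ℂ).subtype.comp
    ((powMonoidHom (b + 1)).comp (invMonoidHom.comp (MonoidHom.fst _ _))))) : Shape r m b →* ℂ) *
      shapeChar r b

theorem detData_ψ [NeZero r] (b : Fin m) (c : Shape r m b) : (detData r m).ψ b c =
    (((c.1 : ℂˣ) : ℂ)⁻¹) ^ ((b : ℕ) + 1) * shapeChar r b c := by
  simp [detData]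

variable (e : Mu r × Fin m ≃ Fin n)

/-- Identify the points with labelled points. -/
abbrev Arr.pull {β : Type} (e : Mu r × Fin m ≃ Fin n) (y : Arr (Shape r m) β (Fin n)) :
    Arr (Shape r m) β (Mu r × Fin m) := ⟨y.1, y.2.trans e.symm⟩

/-- Identify labelled points with points. -/
abbrev Arr.push {β : Type} (e : Mu r × Fin m ≃ Fin n) (x : Arr (Shape r m) β (Mu r × Fin m)) :
    Arr (Shape r m) β (Fin n) := ⟨x.1, x.2.trans e⟩

theorem Arr.pull_push (x : WArr r m a l) : (x.push e).pull e = x :=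
  Arr.ext_of_fst fun _ _ => e.symm_apply_apply _

theorem Arr.push_pull (y : Arr (Shape r m) (Fin a ⊕ Fin l) (Fin n)) : (y.pull e).push e = y :=
  Arr.ext_of_fst fun _ _ => e.apply_symm_apply _

theorem Arr.pull_act (y : Arr (Shape r m) (Fin a ⊕ Fin l) (Fin n)) (σ : Equiv.Perm (Fin n)) :
    (y.act σ).pull e = (y.pull e).act (e.permCongrHom.symm σ) :=
  Arr.ext_of_fst fun i z => by
    change e.symm (σ (y.2 ⟨i, z⟩)) = e.symm (σ (e (e.symm (y.2 ⟨i, z⟩))))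
    rw [e.apply_symm_apply]

theorem Arr.pull_act_wreathEmb (y : Arr (Shape r m) (Fin a ⊕ Fin l) (Fin n)) (g : W r m) :
    (y.act (wreathEmb e g)).pull e = (y.pull e).act (wreathPerm r m g) := by
  rw [Arr.pull_act]
  congr 1
  exact e.permCongrHom.symm_apply_apply _

theorem wreathEmb_injective : Function.Injective (wreathEmb e : W r m →* _) :=
  e.permCongrHom.injective.comp (wreathPerm_injective r m)

variable [NeZero r]

/-- Multiply by labels and extend by zero. -/
def indInclusion : blockFun (shapeData r m) (IsEquivariant : WArr r m a l → Prop) →ₗ[ℂ]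
    blockFun (detData r m) fun _ : Arr (Shape r m) (Fin a ⊕ Fin l) (Fin n) => True where
  toFun f := ⟨fun y => labelProd (y.pull e) * f.1 (y.pull e), by
    refine ⟨fun y c => ?_, fun y π => ?_, fun y hy => absurd trivial hy⟩
    · by_cases hy : IsEquivariant (y.pull e)
      · have h1 := labelProd_rot hy c
        have h2 := f.2.1 (y.pull e) c
        have h3 : ∏ i, (detData r m).ψ (y.1 i) (c i) =
            (∏ i, ((((c i).1 : ℂˣ) : ℂ)⁻¹) ^ ((y.1 i : ℕ) + 1)) *
              ∏ i, (shapeData r m).ψ (y.1 i) (c i) := by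
          rw [← Finset.prod_mul_distrib]
          exact Finset.prod_congr rfl fun i _ => detData_ψ _ _
        refine (congrArg₂ (· * ·) h1 h2).trans ?_
        rw [h3]
        dsimp only
        ring
      · have h1 := f.2.2.2 _ hy
        have h2 := f.2.2.2 _ (mt (isEquivariant_invariant.rot_iff (y.pull e) c).1 hy)
        refine (congrArg (_ * ·) h2).trans ?_
        dsimp only
        rw [h1, mul_zero, mul_zero, mul_zero]
    · refine (congrArg₂ (· * ·) (labelProd_mix (y.pull e) π) (f.2.2.1 (y.pull e) π)).trans ?_
      exact mul_left_comm _ _ _⟩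
  map_add' f g := Subtype.ext (funext fun y => mul_add _ _ _)
  map_smul' z f := Subtype.ext (funext fun y => mul_left_comm _ _ _)

open scoped Classical in
/-- Restrict to equivariant arrangements and divide by labels. -/
def indProjection : (blockFun (detData r m) fun _ : Arr (Shape r m) (Fin a ⊕ Fin l) (Fin n) =>
    True) →ₗ[ℂ] blockFun (shapeData r m) (IsEquivariant : WArr r m a l → Prop) where
  toFun f := ⟨fun x => if IsEquivariant x then (labelProd x)⁻¹ * f.1 (x.push e) else 0, by
    refine ⟨fun x c => ?_, fun x π => ?_, fun x hx => if_neg hx⟩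
    · dsimp only
      rw [isEquivariant_invariant.rot_iff]
      split_ifs with hx
      · have h1 := labelProd_rot hx c
        have h2 := f.2.1 (x.push e) c
        have h3 : ∏ i, (detData r m).ψ (x.1 i) (c i) =
            (∏ i, ((((c i).1 : ℂˣ) : ℂ)⁻¹) ^ ((x.1 i : ℕ) + 1)) *
              ∏ i, (shapeData r m).ψ (x.1 i) (c i) := by
          rw [← Finset.prod_mul_distrib]
          exact Finset.prod_congr rfl fun i _ => detData_ψ _ _
        have h4 : ∏ i, ((((c i).1 : ℂˣ) : ℂ)⁻¹) ^ ((x.1 i : ℕ) + 1) ≠ 0 :=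
          Finset.prod_ne_zero_iff.2 fun i _ => pow_ne_zero _ (inv_ne_zero (Units.ne_zero _))
        rw [h1]
        refine (congrArg (_ * ·) (h2.trans (congrArg (· * f.1 (x.push e)) h3))).trans ?_
        have key : ∀ q z z' y : ℂ, q ≠ 0 → (q * z)⁻¹ * (q * z' * y) = z' * (z⁻¹ * y) := by
          intro q z z' y hq
          rw [mul_inv]
          field_simp
        exact key _ _ _ _ h4
      · rw [mul_zero]
    · dsimp only
      rw [isEquivariant_invariant.mix_iff, labelProd_mix]
      split_ifs with hx
      · refine (congrArg (_ * ·) (f.2.2.1 (x.push e) π)).trans ?_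
        exact mul_left_comm _ _ _
      · rw [mul_zero]⟩
  map_add' f g := Subtype.ext (funext fun x => by
    change (if IsEquivariant x then (labelProd x)⁻¹ * (f.1 (x.push e) + g.1 (x.push e)) else 0) =
      (if IsEquivariant x then (labelProd x)⁻¹ * f.1 (x.push e) else 0) +
      (if IsEquivariant x then (labelProd x)⁻¹ * g.1 (x.push e) else 0)
    split_ifs
    · rw [mul_add]
    · rw [add_zero])
  map_smul' z f := Subtype.ext (funext fun x => by
    change (if IsEquivariant x then (labelProd x)⁻¹ * (z * f.1 (x.push e)) else 0) =
      z * (if IsEquivariant x then (labelProd x)⁻¹ * f.1 (x.push e) else 0)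
    split_ifs
    · rw [mul_left_comm]
    · rw [mul_zero])

theorem indInclusion_apply (f : blockFun (shapeData r m) (IsEquivariant : WArr r m a l → Prop))
    (y) : (indInclusion e f).1 y = labelProd (y.pull e) * f.1 (y.pull e) := rfl

open scoped Classical in
theorem indProjection_apply
    (f : blockFun (detData r m) fun _ : Arr (Shape r m) (Fin a ⊕ Fin l) (Fin n) => True) (x) :
    (indProjection e f).1 x =
      if IsEquivariant x then (labelProd x)⁻¹ * f.1 (x.push e) else 0 := rfl

theorem indProjection_indInclusion
    (f : blockFun (shapeData r m) (IsEquivariant : WArr r m a l → Prop)) :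
    indProjection e (indInclusion e f) = f := by
  classical
  refine Subtype.ext (funext fun x => ?_)
  rw [indProjection_apply, indInclusion_apply, Arr.pull_push]
  split_ifs with hx
  · rw [inv_mul_cancel_left₀ (labelProd_ne_zero x)]
  · exact (f.2.2.2 x hx).symm

open scoped Classical in
theorem indInclusion_indProjection
    (f : blockFun (detData r m) fun _ : Arr (Shape r m) (Fin a ⊕ Fin l) (Fin n) => True) (y) :
    (indInclusion e (indProjection e f)).1 y =
      if IsEquivariant (y.pull e) then f.1 y else 0 := by
  rw [indInclusion_apply, indProjection_apply, Arr.push_pull]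
  split_ifs with hx
  · rw [mul_inv_cancel_left₀ (labelProd_ne_zero _)]
  · exact mul_zero _

/-- The factor `labelProd` in the inclusion absorbs the twist by ζ_1 ⋯ ζ_m. -/
theorem indInclusion_equivRep (w : W r m)
    (f : blockFun (shapeData r m) (IsEquivariant : WArr r m a l → Prop)) :
    indInclusion e ((∏ k, ((w.left k : ℂˣ) : ℂ)) • equivRep r m a l w f) =
      fullRep (detData r m) a l (Fin n) (wreathEmb e w) (indInclusion e f) := by
  refine Subtype.ext (funext fun y => ?_)
  refine Eq.trans ?_ (blockRep_apply _ (MonoidHom.id _) _ _ (wreathEmb e w) _ y).symm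
  have h0 : (y.act (wreathEmb e w)⁻¹).pull e = (y.pull e).act (wreathPerm r m w)⁻¹ := by
    rw [← map_inv, ← map_inv, Arr.pull_act_wreathEmb]
  change labelProd (y.pull e) * ((∏ k, ((w.left k : ℂˣ) : ℂ)) *
    f.1 ((y.pull e).act (wreathPerm r m w)⁻¹)) = labelProd ((y.act (wreathEmb e w)⁻¹).pull e) *
      f.1 ((y.act (wreathEmb e w)⁻¹).pull e)
  rw [h0]
  by_cases hy : IsEquivariant ((y.pull e).act (wreathPerm r m w)⁻¹)
  · have h1 := labelProd_act hy w
    rw [Arr.act_act, mul_inv_cancel, Arr.act_one] at h1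
    rw [h1]
    have h2 : ∏ k, ((w.left k : ℂˣ) : ℂ) ≠ 0 :=
      Finset.prod_ne_zero_iff.2 fun k _ => Units.ne_zero _
    field_simp
  · rw [f.2.2.2 _ hy, mul_zero, mul_zero, mul_zero]

/-- If `σ` carried an equivariant arrangement to another one, it would lie in the wreath product.
Translates by other permutations thus have disjoint supports. -/
theorem indProjection_eq_zero {σ : Equiv.Perm (Fin n)} (hσ : σ ∉ Set.range (wreathEmb e))
    (f : blockFun (shapeData r m) (IsEquivariant : WArr r m a l → Prop)) :
    indProjection e (fullRep (detData r m) a l (Fin n) σ (indInclusion e f)) = 0 := by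
  classical
  refine Subtype.ext (funext fun x => ?_)
  rw [indProjection_apply]
  split_ifs with hx
  · refine mul_eq_zero_of_right _ ?_
    change labelProd (((x.push e).act σ⁻¹).pull e) * f.1 (((x.push e).act σ⁻¹).pull e) = 0
    refine mul_eq_zero_of_right _ (f.2.2.2 _ fun hy => hσ ?_)
    rw [Arr.pull_act, Arr.pull_push] at hy
    obtain ⟨w, hw⟩ := hx.exists_wreathPerm hy
    refine ⟨w⁻¹, ?_⟩
    rw [map_inv, inv_eq_iff_eq_inv]
    exact (congrArg e.permCongrHom hw).trans (e.permCongrHom.apply_symm_apply _)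
  · rfl

/-- Each summand cuts `f` off to the arrangements that become equivariant after `σ`. For a given
arrangement such `σ` exist by `exists_isEquivariant_act`, and their number is the order of the
wreath product. -/
theorem sum_indInclusion_indProjection [Fintype (W r m)]
    (f : blockFun (detData r m) fun _ : Arr (Shape r m) (Fin a ⊕ Fin l) (Fin n) => True) :
    ∑ σ, fullRep (detData r m) a l (Fin n) σ⁻¹ (indInclusion e (indProjection e
      (fullRep (detData r m) a l (Fin n) σ f))) = (Fintype.card (W r m) : ℂ) • f := by
  classical
  refine Subtype.ext (funext fun y => ?_)
  have h1 : ∀ σ : Equiv.Perm (Fin n), (fullRep (detData r m) a l (Fin n) σ⁻¹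
      (indInclusion e (indProjection e (fullRep (detData r m) a l (Fin n) σ f)))).1 y =
      if IsEquivariant ((y.act σ).pull e) then f.1 y else 0 := by
    intro σ
    refine (blockRep_apply _ (MonoidHom.id _) _ _ σ⁻¹ _ y).trans ?_
    rw [MonoidHom.id_apply, inv_inv]
    refine (indInclusion_indProjection e _ (y.act σ)).trans ?_
    refine if_congr Iff.rfl ?_ rfl
    refine (blockRep_apply _ (MonoidHom.id _) _ _ σ _ _).trans ?_
    rw [MonoidHom.id_apply, Arr.act_act, inv_mul_cancel, Arr.act_one]
  have h2 : (∑ σ, fullRep (detData r m) a l (Fin n) σ⁻¹ (indInclusion e (indProjection e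
      (fullRep (detData r m) a l (Fin n) σ f)))).1 y =
      ∑ σ : Equiv.Perm (Fin n), if IsEquivariant ((y.act σ).pull e) then f.1 y else 0 := by
    rw [Submodule.coe_sum, Finset.sum_apply]
    exact Finset.sum_congr rfl fun σ _ => h1 σ
  refine h2.trans ?_
  obtain ⟨τ, hτ⟩ := exists_isEquivariant_act (y.pull e)
  let τ' := e.permCongrHom τ
  have hτ' : IsEquivariant ((y.act τ').pull e) := by
    rw [Arr.pull_act]
    have : e.permCongrHom.symm τ' = τ := e.permCongrHom.symm_apply_apply τ
    rwa [this]
  -- The permutations that make `y` equivariant form the coset of the wreath product through `τ'`.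
  have h3 : ∑ _w : W r m, f.1 y =
      ∑ σ : Equiv.Perm (Fin n), if IsEquivariant ((y.act σ).pull e) then f.1 y else 0 := by
    refine Fintype.sum_of_injective (fun w => wreathEmb e w * τ')
      ((mul_left_injective τ').comp (wreathEmb_injective e)) _ _ (fun σ hσ => ?_) fun w => ?_
    · refine if_neg fun h => hσ ?_
      have h4 : y.act σ = (y.act τ').act (σ * τ'⁻¹) := by
        rw [Arr.act_act, inv_mul_cancel_right]
      rw [h4, Arr.pull_act] at h
      obtain ⟨w, hw⟩ := hτ'.exists_wreathPerm h
      refine ⟨w, ?_⟩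
      have : wreathEmb e w = σ * τ'⁻¹ :=
        (congrArg e.permCongrHom hw).trans (e.permCongrHom.apply_symm_apply _)
      change wreathEmb e w * τ' = σ
      rw [this, inv_mul_cancel_right]
    · refine (if_pos ?_).symm
      rw [← Arr.act_act, Arr.pull_act_wreathEmb]
      exact hτ'.act w
  rw [← h3, Finset.sum_const, Finset.card_univ, nsmul_eq_mul]
  rfl

end Induction

end WreathOS

end

noncomputable section

namespace WreathOS

/-! ### Assembly -/

section Assembly

theorem isPrimitiveChar_stdAddChar (N : ℕ) [NeZero N] :
    IsPrimitiveChar (AddChar.toMonoidHom (ZMod.stdAddChar (N := N))) := by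
  intro p hp hdvd
  have := Fact.mk hp
  obtain ⟨c, hc⟩ := exists_prime_orderOf_dvd_card p hdvd
  refine ⟨c, by rw [← hc, pow_orderOf_eq_one], fun h => hp.one_lt.ne' ?_⟩
  rw [← hc, orderOf_eq_one_iff]
  have h1 : ZMod.stdAddChar c.toAdd = ZMod.stdAddChar (0 : ZMod N) := by
    rw [AddChar.map_zero_eq_one]
    exact h
  exact Multiplicative.toAdd.injective (ZMod.injective_stdAddChar h1)

/-- For a prime `p` dividing `b + 1`, rotations of order `p` have nontrivial character. Otherwise
`p` divides `r`, and a label of order `p` is not killed by the exponent `b + 1`. Without the twist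
by the determinant the labels would act trivially and this would fail. -/
theorem isPrimitiveChar_detData (r m : ℕ) [NeZero r] (b : Fin m) :
    IsPrimitiveChar (C := Shape r m b) ((detData r m).ψ b) := by
  intro p hp hdvd
  have := Fact.mk hp
  rw [card_shape, hp.dvd_mul] at hdvd
  by_cases hb : p ∣ (b : ℕ) + 1
  · obtain ⟨κ, hκ, hne⟩ := isPrimitiveChar_stdAddChar ((b : ℕ) + 1) p hp
      (by rwa [Fintype.card_multiplicative, ZMod.card])
    refine ⟨(1, κ), Prod.ext (one_pow p) hκ, fun h => hne ?_⟩
    rw [detData_ψ] at h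
    have h1 : shapeChar r b (1, κ) = 1 := by simpa using h
    exact h1
  · obtain ⟨ξ, hξ⟩ := exists_prime_orderOf_dvd_card (G := Mu r) p
      (by rw [card_mu]; exact hdvd.resolve_right hb)
    refine ⟨(ξ, 1), Prod.ext (by rw [← hξ]; exact pow_orderOf_eq_one ξ) (one_pow p),
      fun h => hb ?_⟩
    rw [detData_ψ] at h
    have h0 : shapeChar r b (ξ, 1) = 1 :=
      map_one (AddChar.toMonoidHom (ZMod.stdAddChar (N := (b : ℕ) + 1)))
    rw [h0, mul_one, inv_pow, inv_eq_one] at h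
    rw [← hξ]
    refine orderOf_dvd_of_pow_eq_one (Subtype.ext (Units.ext ?_))
    exact h

variable {r n m : ℕ}

/-- The heart of the comparison: ℤ/rb and μ_r × ℤ/b act freely on the same r b positions with
primitive characters, so their idempotents are equivalent for every shape. -/
theorem nonempty_cyc_equiv_det [NeZero r] (h : r * m = n) (a l : ℕ) (N : Type) :
    Nonempty ((fullRep (cycData h) a l N).Equiv (fullRep (detData r m) a l N)) := by
  classical
  refine nonempty_equiv_of_rotIdem fun s => ?_
  refine exists_rotIdem_equiv (C := Multiplicative (ZMod (wideShape h s + 1))) (C' := Shape r m s)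
    (fun c y hc => ?_) (fun c y hc => mul_eq_right.1 (show c * y = y from hc))
    (isPrimitiveChar_stdAddChar _) (isPrimitiveChar_detData r m s)
    (Fintype.card_congr (cycCoord h s).symm)
  obtain ⟨κ, rfl⟩ := (cycCoord h s).symm.surjective y
  rw [cycCoord_ρ] at hc
  exact mul_eq_right.1 ((cycCoord h s).symm.injective hc)

/-- Elements of μ_r^n have trivial permutation part, so the isotypic parts correspond without a
sign; the sign is seen only by S_n. -/
theorem nonempty_tprod_isotypic_equiv {V V' : Type} [AddCommGroup V] [Module ℂ V]
    [AddCommGroup V'] [Module ℂ V'] (ρ : Representation ℂ (W r n) V)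
    (ρ' : Representation ℂ (W r n) V') (Φ : V ≃ₗ[ℂ] V')
    (hΦ : ∀ g f, Φ (ρ g f) = signChar n g.right • ρ' g (Φ f)) (s : ℤ) :
    Nonempty (((charRep (signChar n)).tprod (isotypicRep ρ' s)).Equiv (isotypicRep ρ s)) := by
  have hinl : ∀ ζ v, Φ (ρ (SemidirectProduct.inl ζ) v) = ρ' (SemidirectProduct.inl ζ) (Φ v) := by
    intro ζ v
    rw [hΦ, SemidirectProduct.right_inl, map_one, one_smul]
  have hmap : (isotypic ρ s).map (Φ : V →ₗ[ℂ] V') = isotypic ρ' s := by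
    ext v
    constructor
    · rintro ⟨f, hf, rfl⟩ ζ
      refine (hinl ζ f).symm.trans ?_
      rw [hf ζ]
      exact map_smul _ _ _
    · intro hv
      refine ⟨Φ.symm v, fun ζ => Φ.injective ?_, Φ.apply_symm_apply v⟩
      rw [hinl, map_smul, Φ.apply_symm_apply, hv ζ]
  let Ψ : isotypic ρ s ≃ₗ[ℂ] isotypic ρ' s := LinearEquiv.ofSubmodules Φ _ _ hmap
  have hΨ : ∀ w f, Ψ (isotypicRep ρ s w f) = signChar n w • isotypicRep ρ' s w (Ψ f) :=
    fun w f => Subtype.ext ((hΦ (SemidirectProduct.inr w) f.1).trans (by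
      rw [SemidirectProduct.right_inr]
      rfl))
  refine ⟨Representation.Equiv.mk ((TensorProduct.lid ℂ _).trans Ψ.symm) fun w => ?_⟩
  refine TensorProduct.ext' fun z v => Ψ.injective ?_
  change Ψ (Ψ.symm ((signChar n w * z) • isotypicRep ρ' s w v)) =
    Ψ (isotypicRep ρ s w (Ψ.symm (z • v)))
  rw [hΨ, Ψ.apply_symm_apply, Ψ.apply_symm_apply, map_smul, smul_smul]

/-- The sign in `detChar` cancels the sign in the hypothesis on `Φ`, and the product of labels that
remains is absorbed by `indInclusion`. -/
theorem nonempty_ind_det_equiv [NeZero r] (e : Mu r × Fin m ≃ Fin n) {a l : ℕ} {V : Type}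
    [AddCommGroup V] [Module ℂ V] (ρ : Representation ℂ (W r m) V)
    (Φ : blockFun (shapeData r m) (IsEquivariant : WArr r m a l → Prop) ≃ₗ[ℂ] V)
    (hΦ : ∀ g f, Φ (equivRep r m a l g f) = signChar m g.right • ρ g (Φ f)) :
    Nonempty ((Representation.ind (wreathEmb e) ((charRep (detChar r m)).tprod ρ)).Equiv
      (fullRep (detData r m) a l (Fin n))) := by
  classical
  let inst : Fintype (W r m) := Fintype.ofEquiv _ SemidirectProduct.equivProd.symm
  let Θ : TensorProduct ℂ ℂ V ≃ₗ[ℂ]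
      blockFun (shapeData r m) (IsEquivariant : WArr r m a l → Prop) :=
    (TensorProduct.lid ℂ V).trans Φ.symm
  have hΘ : ∀ w, Θ.toLinearMap ∘ₗ (charRep (detChar r m)).tprod ρ w =
      (∏ k, ((w.left k : ℂˣ) : ℂ)) • equivRep r m a l w ∘ₗ Θ.toLinearMap := by
    intro w
    refine TensorProduct.ext' fun z v => Φ.injective ?_
    change Φ (Φ.symm ((signChar m w.right * (∏ k, ((w.left k : ℂˣ) : ℂ)) * z) • ρ w v)) =
      Φ ((∏ k, ((w.left k : ℂˣ) : ℂ)) • equivRep r m a l w (Φ.symm (z • v)))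
    rw [map_smul Φ (∏ k, ((w.left k : ℂˣ) : ℂ)), hΦ, Φ.apply_symm_apply, Φ.apply_symm_apply,
      map_smul, smul_smul, smul_smul]
    congr 1
    ring
  refine nonempty_ind_equiv (wreathEmb e) _ _ (wreathEmb_injective e)
    (indInclusion e ∘ₗ Θ.toLinearMap) (Θ.symm.toLinearMap ∘ₗ indProjection e)
    (fun w x => ?_) (fun x => ?_) (fun g hg x => ?_) fun v => ?_
  · refine (congrArg (indInclusion e) (LinearMap.congr_fun (hΘ w) x)).trans ?_
    exact indInclusion_equivRep e w (Θ x)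
  · change Θ.symm (indProjection e (indInclusion e (Θ x))) = x
    rw [indProjection_indInclusion, Θ.symm_apply_apply]
  · change Θ.symm (indProjection e (fullRep _ a l (Fin n) g (indInclusion e (Θ x)))) = 0
    rw [indProjection_eq_zero e hg, map_zero]
  · rw [← sum_indInclusion_indProjection e v]
    refine Finset.sum_congr rfl fun g _ => ?_
    change fullRep _ a l (Fin n) g⁻¹ (indInclusion e (Θ (Θ.symm _))) = _
    rw [Θ.apply_symm_apply]

theorem gr_subsingleton_of_lt {k l : ℤ} (h : (n : ℤ) < k + l) : Subsingleton (Gr r n k l) := by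
  have : filt r n (k + l) l = ⊥ := by
    rw [filt, Submodule.span_eq_bot]
    rintro _ ⟨F, ⟨h1, -⟩, rfl⟩
    exfalso
    have h2 : F.numEdges + F.numClosed ≤ n := by
      rw [Forest.numEdges, Forest.numClosed, ← Finset.card_union_of_disjoint]
      · exact (Finset.card_le_univ _).trans (by simp)
      · rw [Finset.disjoint_filter]
        intro i _ h
        cases hv : F.vertex i <;> simp_all [Vertex.isEdge, Vertex.isClosed]
    omega
  refine ⟨fun x y => ?_⟩
  obtain ⟨⟨x, hx⟩, rfl⟩ := Submodule.Quotient.mk_surjective _ x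
  obtain ⟨⟨y, hy⟩, rfl⟩ := Submodule.Quotient.mk_surjective _ y
  rw [this, Submodule.mem_bot] at hx hy
  subst hx hy
  rfl

/-- For negative `l` the bounds `l` and `l + 1` on the number of closed roots are both void. -/
theorem gr_subsingleton_of_neg {k l : ℤ} (hl : l < 0) : Subsingleton (Gr r n k l) := by
  have hle : filt r n (k + l) l ≤ filt r n (k + l) (l + 1) :=
    Submodule.span_mono (Set.image_mono fun F h => ⟨h.1, by omega⟩)
  rw [Submodule.Quotient.subsingleton_iff]
  exact Submodule.comap_subtype_eq_top.2 hle

theorem nonempty_equiv_of_subsingleton {G V V' : Type} [Group G] [AddCommGroup V] [Module ℂ V]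
    [AddCommGroup V'] [Module ℂ V'] [Subsingleton V] [Subsingleton V'] (ρ : Representation ℂ G V)
    (ρ' : Representation ℂ G V') : Nonempty (ρ.Equiv ρ') :=
  ⟨Representation.Equiv.mk 0 fun _ => Subsingleton.elim _ _⟩

theorem subsingleton_of_id_eq_zero {V : Type} [AddCommGroup V] [Module ℂ V]
    (h : (LinearMap.id : V →ₗ[ℂ] V) = 0) : Subsingleton V :=
  ⟨fun x y => (LinearMap.congr_fun h x).trans (LinearMap.congr_fun h y).symm⟩

theorem nonempty_tprod_isotypic_equiv_fullRep [NeZero r] (hrm : r * m = n) {s : ℤ}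
    (hs : Int.gcd s r = 1) {k : ℤ} {a l : ℕ} (hk : k + l = n - a) :
    Nonempty (((charRep (signChar n)).tprod (isotypicRep (grRep r n k l) s)).Equiv
      (fullRep (detData r m) a l (Fin n))) := by
  obtain ⟨Φ, hΦ⟩ := exists_gr_equiv (r := r) hk
  obtain ⟨e1⟩ := nonempty_tprod_isotypic_equiv _ (grRep r n k l) Φ hΦ s
  obtain ⟨e2⟩ := nonempty_isotypic_equiv (a := a) (l := l) hrm hs
  obtain ⟨e3⟩ := nonempty_cyc_equiv_det hrm a l (Fin n)
  exact ⟨(e1.trans e2).trans e3⟩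

theorem nonempty_fullRep_equiv_ind [NeZero r] (e : Mu r × Fin m ≃ Fin n) {k : ℤ} {a l : ℕ}
    (hk : k + l = m - a) :
    Nonempty ((fullRep (detData r m) a l (Fin n)).Equiv (Representation.ind (wreathEmb e)
      ((charRep (detChar r m)).tprod (grRep r m k l)))) := by
  obtain ⟨Φ, hΦ⟩ := exists_gr_equiv (r := r) hk
  obtain ⟨e4⟩ := nonempty_ind_det_equiv e (grRep r m k l) Φ hΦ
  exact ⟨e4.symm⟩

theorem subsingleton_tprod_isotypic {k l : ℤ} (h : Subsingleton (Gr r n k l)) (s : ℤ) :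
    Subsingleton (TensorProduct ℂ ℂ (isotypic (grRep r n k l) s)) :=
  (TensorProduct.lid ℂ _).toEquiv.subsingleton

theorem subsingleton_ind {H G A : Type} [Group H] [Group G] [AddCommGroup A] [Module ℂ A]
    [Subsingleton A] (φ : H →* G) (ρ : Representation ℂ H A) :
    Subsingleton (Representation.IndV φ ρ) :=
  subsingleton_of_id_eq_zero (Representation.IndV.hom_ext _ _ fun _ =>
    LinearMap.ext fun x => by rw [Subsingleton.elim x 0, map_zero, map_zero])

theorem subsingleton_ind_tprod {k l : ℤ} (h : Subsingleton (Gr r m k l))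
    (e : Mu r × Fin m ≃ Fin n) : Subsingleton (Representation.IndV (wreathEmb e)
      ((charRep (detChar r m)).tprod (grRep r m k l))) :=
  have : Subsingleton (TensorProduct ℂ ℂ (Gr r m k l)) :=
    (TensorProduct.lid ℂ _).toEquiv.subsingleton
  subsingleton_ind _ _

end Assembly

end WreathOS

end
-- The comparison for all k and l
theorem mainTheorem4 (r n : ℕ) (hr : 0 < r) (hn : 0 < n) (hrn : r ∣ n) (s : ℤ)
    (hs : Int.gcd s r = 1) (e : WreathOS.Mu r × Fin (n / r) ≃ Fin n) (k l : ℤ) :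
    Nonempty
      (((WreathOS.charRep (WreathOS.signChar n)).tprod
          (WreathOS.isotypicRep (WreathOS.grRep r n k l) s)).Equiv
        (Representation.ind (WreathOS.wreathEmb e)
          ((WreathOS.charRep (WreathOS.detChar r (n / r))).tprod
            (WreathOS.grRep r (n / r) (k - n + (n / r : ℕ)) l)))) := by
  have : NeZero r := ⟨hr.ne'⟩
  have hrm : r * (n / r) = n := Nat.mul_div_cancel' hrn
  by_cases h : 0 ≤ l ∧ k + l ≤ n
  · obtain ⟨l, rfl⟩ := Int.eq_ofNat_of_zero_le h.1
    -- The number of open blocks, n - k - l, is also n/r - (k - n + n/r) - l, so one `a` serves both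
    -- sides.
    obtain ⟨a, ha⟩ := Int.eq_ofNat_of_zero_le (sub_nonneg.2 h.2)
    exact ⟨(WreathOS.nonempty_tprod_isotypic_equiv_fullRep hrm hs (by omega)).some.trans
      (WreathOS.nonempty_fullRep_equiv_ind (a := a) e (by omega)).some⟩
  -- Outside this range both graded pieces are zero; the shift of `k` preserves the condition that
  -- the total degree exceeds the number of vertices.
  · have h1 : Subsingleton (WreathOS.Gr r n k l) ∧
        Subsingleton (WreathOS.Gr r (n / r) (k - n + (n / r : ℕ)) l) := by
      rcases not_and_or.1 h with h | h
      · exact ⟨WreathOS.gr_subsingleton_of_neg (not_le.1 h),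
          WreathOS.gr_subsingleton_of_neg (not_le.1 h)⟩
      · exact ⟨WreathOS.gr_subsingleton_of_lt (not_le.1 h),
          WreathOS.gr_subsingleton_of_lt (by linarith)⟩
    have h2 := WreathOS.subsingleton_tprod_isotypic h1.1 s
    have h3 := WreathOS.subsingleton_ind_tprod h1.2 e
    exact WreathOS.nonempty_equiv_of_subsingleton _ _
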